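/- **Setting.** Number the points of $\Gamma=\Gamma_{nm}\subset\mathbb Z^2$ as $\gamma_0=(n,m)$, $\gamma_1=(n+1,m)$, $\gamma_2=(n,m+1)$, $\gamma_3=(n-1,m+1)$, $\gamma_4=(n-1,m)$, $\gamma_5=(n,m-1)$, $\gamma_6=(n+1,m-1)$ (an atom of the triangular lattice and its six nearest neighbours). Consider $$\ddot u_{nm}=F_{nm}\big(t,\{u_{pq}\}_{(p,q)\in\Gamma}\big),\qquad (n,m)\in\mathbb Z^2, \tag{1}$$ where $t$ ranges over a nonempty open interval $I$, the $u_{nm}$ take values in a nonempty open interval $J$, and each $F_{nm}$ is a smooth real function on an open set $\Omega_{nm}\subseteq I\times J^{\Gamma}$ which projects onto $I\times J$ under $(t,u)\mapsto(t,u_{nm})$. A *symmetry* of (1) is a vector field $X=\tau(t,u_{nm})\partial_t+\phi_{nm}(t,u_{nm})\partial_{u_{nm}}$, with smooth coefficients on $I\times J$ and with the same $\tau$ at all sites, such that, at all $(n,m)$, $\mathrm{pr}^{(2)}X\,(\ddot u_{nm}-F_{nm})=0$ whenever $\ddot u_{nm}=F_{nm}$. Here $$\mathrm{pr}^{(2)}X=\tau\partial_t+\sum_{(p,q)\in\Gamma}\phi_{pq}(t,u_{pq})\partial_{u_{pq}}+\phi^{tt}_{nm}\partial_{\ddot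 u_{nm}},\qquad \phi^{tt}_{nm}=D_t^2\phi_{nm}-(D_t^2\tau)\dot u_{nm}-2(D_t\tau)\ddot u_{nm}.$$ The *symmetry algebra* $\mathcal L$ is the set of all symmetries, with the commutator of vector fields taken site by site. The interaction is assumed to be * *nonlinear*: for each $(n,m)$ some $\partial^2F_{nm}/\partial u_{pq}\partial u_{p'q'}$ is not identically zero; * *coupled*: for each $(n,m)$ and all $(p,q)\in\Gamma$, $\partial F_{nm}/\partial u_{pq}$ does not vanish identically on any nonempty open subset of $\Omega_{nm}$; * *isotropic*, in the following sense. For $t\in I$ let $V_t$ be the space of lattice functions $(n,m)\mapsto\lambda_{nm}(t)$ such that $\lambda_{nm}(t)\partial_{u_{nm}}$ is a symmetry. If $\dim V_t=d$ is finite, then at every site an element of $V_t$ that vanishes at the first $\min(d,7)$ of the points $\gamma_0,\gamma_1,\dots,\gamma_6$ is zero; if $V_t$ is infinite-dimensional, the interaction is not isotropic. Moreover, if $(a_{nm}u_{nm}+\lambda_{nm}(t))\partial_{u_{nm}}$ is a symmetry for some $\lambda$ and $a$ vanishes on $\Gamma_{nm}$ for some site $(n,m)$, then $a=0$. An *allowed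 transformation* over an open interval $I'\subseteq I$ is $u_{nm}(t)=\dot\theta(t)^{-1/2}P_{nm}\,\tilde u_{nm}(\theta(t))+Q_{nm}(t)$, $\tilde t=\theta(t)$, with $\theta,Q_{nm}$ smooth on $I'$, $\dot\theta>0$, and constants $P_{nm}\neq0$. It turns (1) into an equation of the same form, with interaction $\tilde F_{nm}$. For functions $f^{(1)},\dots,f^{(N)}$ on the lattice, $\mathcal D[f^{(1)}_{p_1q_1},\dots,f^{(N)}_{p_Nq_N}]=\det\big(f^{(i)}_{p_jq_j}\big)_{i,j=1}^N$. For $\kappa^{(1)},\kappa^{(2)},\kappa^{(3)}:\mathbb Z^2\to\mathbb R$ (independent of $t$) with $$\mathcal D[\kappa^{(1)}_{nm},\kappa^{(2)}_{n+1,m},\kappa^{(3)}_{n,m+1},1_{n-1,m+1}]\neq0\quad\text{for all }(n,m), \tag{2}$$ let $NS_{11,1}(\kappa)$ be the span of $$X_1=\partial_t,\quad X_2=t\partial_t+\tfrac12u_{nm}\partial_{u_{nm}},\quad X_3=t^2\partial_t+tu_{nm}\partial_{u_{nm}},$$ $$\partial_{u_{nm}},\quad t\,\partial_{u_{nm}},\quad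 \kappa^{(i)}_{nm}\partial_{u_{nm}},\quad \kappa^{(i)}_{nm}t\,\partial_{u_{nm}}\quad(i=1,2,3).$$ Say that an interaction $F$ *belongs to the class of* $\kappa$ if for all $(n,m)$, near every point of its domain where $\mathcal D_{nm}:=\mathcal D[u_{nm},\kappa^{(1)}_{n+1,m},\kappa^{(2)}_{n,m+1},\kappa^{(3)}_{n-1,m+1},1_{n-1,m}]\ne0$, $$F_{nm}=\mathcal D_{nm}^{-3}\,f_{nm}(\xi_{n,m-1},\xi_{n+1,m-1}),\qquad \xi_{pq}=\frac{\mathcal D[u_{nm},\kappa^{(1)}_{n+1,m},\kappa^{(2)}_{n,m+1},\kappa^{(3)}_{n-1,m+1},1_{pq}]}{\mathcal D_{nm}},$$ with a smooth function $f_{nm}$ of two variables. **Theorem.** Equation (1) allows an 11-dimensional nonsolvable symmetry algebra for exactly one class of interactions: 1. There is an equation (1) with nonlinear, coupled and isotropic interaction whose symmetry algebra is nonsolvable of dimension $11$. 2. Let the interaction of (1) be nonlinear, coupled and isotropic, and let its symmetry algebra $\mathcal L$ be nonsolvable of dimension $11$. Then for every $t_0\in I$ there are an allowed transformation over an open interval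 $I'\ni t_0$, $I'\subseteq I$, and functions $\kappa^{(1)},\kappa^{(2)},\kappa^{(3)}$ satisfying (2), such that the transformation carries $\mathcal L$ onto $NS_{11,1}(\kappa)$ and the transformed interaction $\tilde F$ belongs to the class of $\kappa$. 3. Conversely, for all $\kappa$ satisfying (2), $NS_{11,1}(\kappa)$ is a nonsolvable Lie algebra of dimension $11$; $X_1,X_2,X_3$ span a subalgebra isomorphic to $\mathrm{sl}(2,\mathbb R)$, and the other eight fields span its radical. If the interaction of (1) belongs to the class of $\kappa$, then all elements of $NS_{11,1}(\kappa)$ are symmetries of (1). -/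

import Mathlib

open Set Filter Topology
open scoped ContDiff

noncomputable section

/-! ### The lattice -/

/-- The sites `(n, m)` of the two-dimensional triangular lattice (skew coordinates). -/
abbrev Site : Type := ℤ × ℤ

/-- The seven points of `Γ`, relative to `(n, m)`, in the order
`(n,m), (n+1,m), (n,m+1), (n-1,m+1), (n-1,m), (n,m-1), (n+1,m-1)`. The points number `1, 2, 3`
are the neighbours of `(n,m)` in the three directions of the lattice. -/
def offset : Fin 7 → Site :=
  ![(0, 0), (1, 0), (0, 1), (-1, 1), (-1, 0), (0, -1), (1, -1)]

/-- The `i`-th point of `Γ` at the site `s`; in particular `nbr 0 s = s`. -/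
def nbr (i : Fin 7) (s : Site) : Site := s + offset i

/-- A point `(t, {u_{pq}})`, `(p,q) ∈ Γ`: a time and the values of `u` at the seven points
of `Γ`. -/
abbrev LocalConf : Type := ℝ × (Fin 7 → ℝ)

/-! ### Lie algebra of sitewise vector fields -/

/-- Families `X = (X_{nm})` of smooth vector fields `X_{nm} = τ_{nm}(t,u) ∂_t + φ_{nm}(t,u) ∂_u` on
the open set `M` of the `(t,u)`-plane. The value of `X_{nm}` at `p = (t,u)` is
`X s p = (τ_{nm}(p), φ_{nm}(p))`; outside `M` it is set to `0`, so that two families are equal if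
and only if they agree on `M`. -/
def LatticeField (M : TopologicalSpace.Opens (ℝ × ℝ)) :
    Submodule ℝ (Site → ℝ × ℝ → ℝ × ℝ) where
  carrier := {X | ∀ s, ContDiffOn ℝ ∞ (X s) M ∧ ∀ p ∉ M, X s p = 0}
  add_mem' := fun {X Y} hX hY s =>
    ⟨(hX s).1.add (hY s).1, fun p hp => by simp [(hX s).2 p hp, (hY s).2 p hp]⟩
  zero_mem' := fun _ => ⟨contDiffOn_const, fun _ _ => rfl⟩
  smul_mem' := fun c X hX s =>
    ⟨(hX s).1.const_smul c, fun p hp => by simp [(hX s).2 p hp]⟩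

namespace LatticeField

variable {M : TopologicalSpace.Opens (ℝ × ℝ)}

theorem prop (X : LatticeField M) (s : Site) :
    ContDiffOn ℝ ∞ (X.1 s) M ∧ ∀ p ∉ M, X.1 s p = 0 :=
  X.2 s

theorem contDiffAt (X : LatticeField M) (s : Site) {p : ℝ × ℝ} (hp : p ∈ M) :
    ContDiffAt ℝ ∞ (X.1 s) p :=
  (prop X s).1.contDiffAt (M.isOpen.mem_nhds hp)

theorem differentiableAt (X : LatticeField M) (s : Site) {p : ℝ × ℝ} (hp : p ∈ M) :
    DifferentiableAt ℝ (X.1 s) p :=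
  (contDiffAt X s hp).differentiableAt (by simp)

open Classical in
/-- The Lie bracket of vector fields, site by site. -/
def bracket (X Y : LatticeField M) : Site → ℝ × ℝ → ℝ × ℝ :=
  fun s p => if p ∈ M then VectorField.lieBracket ℝ (X.1 s) (Y.1 s) p else 0

theorem bracket_mem (X Y : LatticeField M) : bracket X Y ∈ LatticeField M := by
  intro s
  refine ⟨?_, fun p hp => if_neg hp⟩
  have h : ContDiffOn ℝ ∞ (VectorField.lieBracket ℝ (X.1 s) (Y.1 s)) M := fun p hp =>
    ((contDiffAt X s hp).lieBracket_vectorField (contDiffAt Y s hp)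
      (by simp)).contDiffWithinAt
  exact h.congr fun p hp => if_pos hp

instance : Bracket (LatticeField M) (LatticeField M) :=
  ⟨fun X Y => ⟨bracket X Y, bracket_mem X Y⟩⟩

theorem bracket_apply (X Y : LatticeField M) (s : Site) {p : ℝ × ℝ} (hp : p ∈ M) :
    (⁅X, Y⁆ : LatticeField M).1 s p = VectorField.lieBracket ℝ (X.1 s) (Y.1 s) p :=
  if_pos hp

theorem ext_on {X Y : LatticeField M} (h : ∀ s, ∀ p ∈ M, X.1 s p = Y.1 s p) : X = Y := by
  apply Subtype.ext
  funext s p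
  by_cases hp : p ∈ M
  · exact h s p hp
  · rw [(prop X s).2 p hp, (prop Y s).2 p hp]

theorem bracket_eventuallyEq (X Y : LatticeField M) (s : Site) {p : ℝ × ℝ} (hp : p ∈ M) :
    (⁅X, Y⁆ : LatticeField M).1 s =ᶠ[𝓝 p] VectorField.lieBracket ℝ (X.1 s) (Y.1 s) := by
  filter_upwards [M.isOpen.mem_nhds hp] with q hq using bracket_apply X Y s hq

instance : LieRing (LatticeField M) where
  add_lie X Y Z := ext_on fun s p hp => by
    rw [bracket_apply _ _ s hp]
    change VectorField.lieBracket ℝ (X.1 s + Y.1 s) (Z.1 s) p =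
      (⁅X, Z⁆ : LatticeField M).1 s p + (⁅Y, Z⁆ : LatticeField M).1 s p
    rw [bracket_apply _ _ s hp, bracket_apply _ _ s hp,
      VectorField.lieBracket_add_left (differentiableAt X s hp) (differentiableAt Y s hp)]
  lie_add X Y Z := ext_on fun s p hp => by
    rw [bracket_apply _ _ s hp]
    change VectorField.lieBracket ℝ (X.1 s) (Y.1 s + Z.1 s) p =
      (⁅X, Y⁆ : LatticeField M).1 s p + (⁅X, Z⁆ : LatticeField M).1 s p
    rw [bracket_apply _ _ s hp, bracket_apply _ _ s hp,
      VectorField.lieBracket_add_right (differentiableAt Y s hp) (differentiableAt Z s hp)]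
  lie_self X := ext_on fun s p hp => by
    rw [bracket_apply _ _ s hp, VectorField.lieBracket_self]; rfl
  leibniz_lie X Y Z := ext_on fun s p hp => by
    change _ = (⁅⁅X, Y⁆, Z⁆ : LatticeField M).1 s p + (⁅Y, ⁅X, Z⁆⁆ : LatticeField M).1 s p
    rw [bracket_apply _ _ s hp, bracket_apply _ _ s hp, bracket_apply _ _ s hp]
    have e1 := (bracket_eventuallyEq Y Z s hp)
    have e2 := (bracket_eventuallyEq X Y s hp)
    have e3 := (bracket_eventuallyEq X Z s hp)
    have key := VectorField.leibniz_identity_lieBracket (𝕜 := ℝ) (n := ∞)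
      (by
        rw [minSmoothness_of_isRCLikeNormedField]
        exact (WithTop.coe_le_coe.2 le_top : ((2 : ℕ∞) : WithTop ℕ∞) ≤ ((⊤ : ℕ∞) : WithTop ℕ∞)))
      (contDiffAt X s hp) (contDiffAt Y s hp) (contDiffAt Z s hp)
    simp only [VectorField.lieBracket] at key ⊢
    rw [e1.fderiv_eq, e2.fderiv_eq, e3.fderiv_eq, e1.eq_of_nhds, e2.eq_of_nhds, e3.eq_of_nhds]
    exact key

instance : LieAlgebra ℝ (LatticeField M) where
  lie_smul c X Y := ext_on fun s p hp => by
    rw [bracket_apply _ _ s hp]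
    change VectorField.lieBracket ℝ (X.1 s) (c • Y.1 s) p = c • (⁅X, Y⁆ : LatticeField M).1 s p
    rw [bracket_apply _ _ s hp,
      VectorField.lieBracket_const_smul_right (differentiableAt Y s hp)]

end LatticeField

/-! ### The equation and its symmetries -/

/-- An equation `ü_{nm} = F_{nm}(t, {u_{pq}})`, `(p,q) ∈ Γ`, where `t` runs over an open interval
`I`, all the `u_{nm}` take their values in an open interval `J`, and `F_{nm}` is smooth on an open
set `Ω_{nm} ⊆ I × J^Γ` over which every `(t, u_{nm}) ∈ I × J` occurs. -/
structure LatticeEquation where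
  I : Set ℝ
  J : Set ℝ
  isOpen_I : IsOpen I
  isOpen_J : IsOpen J
  ordConnected_I : I.OrdConnected
  ordConnected_J : J.OrdConnected
  nonempty_I : I.Nonempty
  nonempty_J : J.Nonempty
  Ω : Site → Set LocalConf
  isOpen_Ω : ∀ s, IsOpen (Ω s)
  Ω_subset : ∀ s, ∀ p ∈ Ω s, p.1 ∈ I ∧ ∀ i, p.2 i ∈ J
  exists_mem_Ω : ∀ s, ∀ t ∈ I, ∀ x ∈ J, ∃ p ∈ Ω s, p.1 = t ∧ p.2 0 = x
  F : Site → LocalConf → ℝ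
  smooth_F : ∀ s, ContDiffOn ℝ ∞ (F s) (Ω s)

/-- `∂_t` of a function of `(t,u)`. -/
def dt (f : ℝ × ℝ → ℝ) (p : ℝ × ℝ) : ℝ := fderiv ℝ f p (1, 0)

/-- `∂_u` of a function of `(t,u)`. -/
def du (f : ℝ × ℝ → ℝ) (p : ℝ × ℝ) : ℝ := fderiv ℝ f p (0, 1)

/-- The total derivative `D_t f` at a point `p = (t,u)` and `u̇ = v`. -/
def totalDt (f : ℝ × ℝ → ℝ) (p : ℝ × ℝ) (v : ℝ) : ℝ := dt f p + v * du f p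

/-- The second total derivative `D_t² f` at a point `p = (t,u)`, `u̇ = v`, `ü = w`. -/
def totalDt2 (f : ℝ × ℝ → ℝ) (p : ℝ × ℝ) (v w : ℝ) : ℝ :=
  dt (dt f) p + 2 * v * dt (du f) p + v ^ 2 * du (du f) p + w * du f p

/-- The coefficient `φ^{tt} = D_t² φ - (D_t² τ) u̇ - 2 (D_t τ) ü` of the second prolongation of
`τ ∂_t + φ ∂_u`. -/
def prolongCoeff (τ φ : ℝ × ℝ → ℝ) (p : ℝ × ℝ) (v w : ℝ) : ℝ :=
  totalDt2 φ p v w - totalDt2 τ p v w * v - 2 * totalDt τ p v * w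

namespace LatticeEquation

/-- The domain `I × J` of the symmetry fields. -/
def M (E : LatticeEquation) : TopologicalSpace.Opens (ℝ × ℝ) :=
  ⟨E.I ×ˢ E.J, E.isOpen_I.prod E.isOpen_J⟩

/-- `X = τ(t,u_{nm}) ∂_t + φ_{nm}(t,u_{nm}) ∂_{u_{nm}}` (with `τ` the same function at all sites) is
a symmetry field: `pr²X (ü_{nm} - F_{nm}) = 0` whenever `ü_{nm} = F_{nm}`, where
`pr²X = τ ∂_t + ∑_{(p,q) ∈ Γ} φ_{pq}(t,u_{pq}) ∂_{u_{pq}} + φ_{nm}^{tt} ∂_{ü_{nm}}`. -/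
def IsSymmetry (E : LatticeEquation) (X : Site → ℝ × ℝ → ℝ × ℝ) : Prop :=
  (∀ s s', ∀ p ∈ E.M, (X s p).1 = (X s' p).1) ∧
  ∀ s, ∀ p ∈ E.Ω s, ∀ v : ℝ,
    prolongCoeff (fun q => (X s q).1) (fun q => (X s q).2) (p.1, p.2 0) v (E.F s p) =
      fderiv ℝ (E.F s) p
        ((X s (p.1, p.2 0)).1, fun i => (X (nbr i s) (p.1, p.2 i)).2)

/-- `L` is the (full, hence maximal) symmetry algebra of the equation. -/
def IsSymmetryAlgebra (E : LatticeEquation) (L : LieSubalgebra ℝ (LatticeField E.M)) : Prop :=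
  ∀ X : LatticeField E.M, X ∈ L ↔ E.IsSymmetry X.1

/-- `∂F_{nm}/∂u_{pq}`, where `(p,q)` is the `i`-th point of `Γ`. -/
def partialF (E : LatticeEquation) (s : Site) (i : Fin 7) (p : LocalConf) : ℝ :=
  fderiv ℝ (E.F s) p (0, Pi.single i 1)

/-- The interaction is nonlinear: at every site some second derivative
`∂²F_{nm}/∂u_{pq}∂u_{p'q'}` is not the zero function. -/
def IsNonlinear (E : LatticeEquation) : Prop :=
  ∀ s, ∃ i j, ∃ p ∈ E.Ω s, fderiv ℝ (E.partialF s i) p (0, Pi.single j 1) ≠ 0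

/-- The interaction is coupled: at every site and for all `(p,q) ∈ Γ`, the derivative
`∂F_{nm}/∂u_{pq}` is not identically zero on any nonempty open subset of the domain. -/
def IsCoupled (E : LatticeEquation) : Prop :=
  ∀ s i, ∀ U ⊆ E.Ω s, IsOpen U → U.Nonempty → ∃ p ∈ U, E.partialF s i p ≠ 0

/-- The values at the time `t` of the translational symmetries `λ_{nm}(t) ∂_{u_{nm}}`, as a space
of functions on the lattice. -/
def translations (E : LatticeEquation) (t : ℝ) : Submodule ℝ (Site → ℝ) :=
  Submodule.span ℝ {c | ∃ l : Site → ℝ → ℝ, (∀ s, ContDiffOn ℝ ∞ (l s) E.I) ∧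
    E.IsSymmetry (fun s p => (0, l s p.1)) ∧ c = fun s => l s t}

/-- The functions `a_{nm}` for which some field `(a_{nm} u_{nm} + λ_{nm}(t)) ∂_{u_{nm}}` is a
symmetry. -/
def scalings (E : LatticeEquation) : Submodule ℝ (Site → ℝ) :=
  Submodule.span ℝ {a | ∃ l : Site → ℝ → ℝ, (∀ s, ContDiffOn ℝ ∞ (l s) E.I) ∧
    E.IsSymmetry (fun s p => (0, a s * p.2 + l s p.1))}

/-- The interaction is isotropic, in the sense that its symmetries do not degenerate along the
directions of the lattice: at every site, a translational symmetry out of a `d`-dimensional space of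
values is determined by the values at the first `d` points of `Γ` (the determinants
`𝒟[λ⁽¹⁾_{nm}, λ⁽²⁾_{n+1,m}, λ⁽³⁾_{n,m+1}, …]` of `d` independent ones do not vanish), and a
coefficient `a_{nm}` is determined by its values on `Γ`. -/
def IsIsotropic (E : LatticeEquation) : Prop :=
  (∀ t ∈ E.I, ∀ s, ∀ c ∈ E.translations t,
    (∀ i : Fin 7, (i : ℕ) < Module.finrank ℝ (E.translations t) → c (nbr i s) = 0) → c = 0) ∧
  ∀ s, ∀ a ∈ E.scalings, (∀ i, a (nbr i s) = 0) → a = 0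

end LatticeEquation

/-! ### Allowed transformations -/

/-- An allowed transformation `u_{nm}(t) = θ̇(t)^{-1/2} P_{nm} ũ_{nm}(θ(t)) + Q_{nm}(t)`, `t̃ = θ(t)`,
over the open interval `dom`. -/
structure AllowedTransformation where
  dom : Set ℝ
  isOpen_dom : IsOpen dom
  ordConnected_dom : dom.OrdConnected
  θ : ℝ → ℝ
  smooth_θ : ContDiffOn ℝ ∞ θ dom
  deriv_pos : ∀ t ∈ dom, 0 < deriv θ t
  P : Site → ℝ
  P_ne_zero : ∀ s, P s ≠ 0
  Q : Site → ℝ → ℝ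
  smooth_Q : ∀ s, ContDiffOn ℝ ∞ (Q s) dom

namespace AllowedTransformation

/-- The factor `g = θ̇^{-1/2}`. -/
def g (T : AllowedTransformation) (t : ℝ) : ℝ := (Real.sqrt (deriv T.θ t))⁻¹

/-- The map `(t, u_{nm}) ↦ (t̃, ũ_{nm})` at the site `s = (n,m)`. -/
def toMap (T : AllowedTransformation) (s : Site) (p : ℝ × ℝ) : ℝ × ℝ :=
  (T.θ p.1, (p.2 - T.Q s p.1) / (T.g p.1 * T.P s))

/-- The new values `{ũ_{pq}}`, `(p,q) ∈ Γ`, as functions of `(t, {u_{pq}})`. -/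
def newConf (T : AllowedTransformation) (s : Site) (p : LocalConf) : Fin 7 → ℝ :=
  fun i => (T.toMap (nbr i s) (p.1, p.2 i)).2

/-- The transformed interaction `F̃_{nm}(t̃, {ũ_{pq}})`, written as a function of `(t, {u_{pq}})`.
Differentiating `u_{nm} = g P_{nm} ũ_{nm}(θ(t)) + Q_{nm}` twice gives
`ü_{nm} = P_{nm} (g̈ ũ_{nm} + g⁻³ d²ũ_{nm}/dt̃²) + Q̈_{nm}`, and this is solved for
`d²ũ_{nm}/dt̃²`. -/
def newForce (T : AllowedTransformation) (E : LatticeEquation) (s : Site) (p : LocalConf) : ℝ :=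
  T.g p.1 ^ 3 * ((E.F s p - deriv (deriv (T.Q s)) p.1) / T.P s
    - deriv (deriv T.g) p.1 * T.newConf s p 0)

/-- The transformation carries the family of vector fields `X` (in the coordinates `(t,u)`, with
`t ∈ dom` and `u ∈ J`) to the family `X'` (in the coordinates `(t̃,ũ)`). -/
def Carries (T : AllowedTransformation) (J : Set ℝ) (X X' : Site → ℝ × ℝ → ℝ × ℝ) : Prop :=
  ∀ s, ∀ p ∈ T.dom ×ˢ J, X' s (T.toMap s p) = fderiv ℝ (T.toMap s) p (X s p)

end AllowedTransformation

/-! ### The algebra and the interaction of the classification -/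

/-- A smooth family of vector fields on the whole `(t,u)`-plane. -/
def smoothField (X : Site → ℝ × ℝ → ℝ × ℝ) (hX : ∀ s, ContDiff ℝ ∞ (X s)) : LatticeField ⊤ :=
  ⟨X, show ∀ _, _ from fun s =>
    ⟨(hX s).contDiffOn, fun p hp => absurd (TopologicalSpace.Opens.mem_top p) hp⟩⟩

/-- `∂_t`. -/
def fieldX1 : LatticeField ⊤ :=
  smoothField (fun _ _ => (1, 0)) fun _ => by fun_prop

/-- `t ∂_t + (1/2) u_{nm} ∂_{u_{nm}}`. -/
def fieldX2 : LatticeField ⊤ :=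
  smoothField (fun _ p => (p.1, 1 / 2 * p.2)) fun _ => by fun_prop

/-- `t² ∂_t + t u_{nm} ∂_{u_{nm}}`. -/
def fieldX3 : LatticeField ⊤ :=
  smoothField (fun _ p => (p.1 ^ 2, p.1 * p.2)) fun _ => by fun_prop

/-- `c_{nm} ∂_{u_{nm}}`. -/
def fieldY (c : Site → ℝ) : LatticeField ⊤ :=
  smoothField (fun s _ => (0, c s)) fun _s => by fun_prop

/-- `c_{nm} t ∂_{u_{nm}}`. -/
def fieldYt (c : Site → ℝ) : LatticeField ⊤ :=
  smoothField (fun s p => (0, c s * p.1)) fun _s => by fun_prop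

/-- The span of `∂_t`, `t ∂_t + (1/2) u ∂_u`, `t² ∂_t + t u ∂_u`. -/
def sl2Span : Submodule ℝ (LatticeField ⊤) :=
  Submodule.span ℝ {fieldX1, fieldX2, fieldX3}

/-- The span of `∂_u`, `t ∂_u`, `κ⁽ⁱ⁾ ∂_u`, `κ⁽ⁱ⁾ t ∂_u`, `i = 1, 2, 3`. -/
def radicalSpan (κ : Fin 3 → Site → ℝ) : Submodule ℝ (LatticeField ⊤) :=
  Submodule.span ℝ ({fieldY (fun _ => 1), fieldYt (fun _ => 1)} ∪
    (range (fun i => fieldY (κ i)) ∪ range (fun i => fieldYt (κ i))))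

/-- The span of these eleven fields. -/
def nsSpan (κ : Fin 3 → Site → ℝ) : Submodule ℝ (LatticeField ⊤) :=
  sl2Span ⊔ radicalSpan κ

/-- The determinant function `𝒟[f⁽¹⁾_{p₁}, …, f⁽ᴺ⁾_{p_N}]`: row `i` belongs to the function `f⁽ⁱ⁾`,
column `j` to the point `p_j`; here the functions live on `Γ`. -/
def latticeDet {N : ℕ} (f : Fin N → Fin 7 → ℝ) (p : Fin N → Fin 7) : ℝ :=
  (Matrix.of fun i j => f i (p j)).det

/-- A function on the lattice restricted to `Γ` at the site `s`. -/
def onΓ (c : Site → ℝ) (s : Site) : Fin 7 → ℝ := fun i => c (nbr i s)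

/-- `𝒟[u_{nm}, κ⁽¹⁾_{n+1,m}, κ⁽²⁾_{n,m+1}, κ⁽³⁾_{n-1,m+1}, 1_{pq}]`, where `(p,q)` is the `j`-th
point of `Γ`. -/
def detU (κ : Fin 3 → Site → ℝ) (s : Site) (u : Fin 7 → ℝ) (j : Fin 7) : ℝ :=
  latticeDet ![u, onΓ (κ 0) s, onΓ (κ 1) s, onΓ (κ 2) s, fun _ => 1] ![0, 1, 2, 3, j]

/-- `𝒟[κ⁽¹⁾_{nm}, κ⁽²⁾_{n+1,m}, κ⁽³⁾_{n,m+1}, 1_{n-1,m+1}] ≠ 0` at all sites. -/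
def IsNondegenerate (κ : Fin 3 → Site → ℝ) : Prop :=
  ∀ s, latticeDet ![onΓ (κ 0) s, onΓ (κ 1) s, onΓ (κ 2) s, fun _ => 1] ![0, 1, 2, 3] ≠ 0

/-- The invariants `(ξ_{n,m-1}, ξ_{n+1,m-1})`, where
`ξ_{pq} = 𝒟[u_{nm}, κ⁽¹⁾, κ⁽²⁾, κ⁽³⁾, 1_{pq}] / 𝒟[u_{nm}, κ⁽¹⁾, κ⁽²⁾, κ⁽³⁾, 1_{n-1,m}]`. -/
def xi (κ : Fin 3 → Site → ℝ) (s : Site) (u : Fin 7 → ℝ) : ℝ × ℝ :=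
  (detU κ s u 5 / detU κ s u 4, detU κ s u 6 / detU κ s u 4)

/-- Locally on the part of `Ω` where the determinant `𝒟 = 𝒟[u_{nm}, κ⁽¹⁾, κ⁽²⁾, κ⁽³⁾, 1_{n-1,m}]` is
not zero, `G = 𝒟⁻³ f(ξ_{n,m-1}, ξ_{n+1,m-1})` for a smooth function `f` of two variables. Here `U`
expresses the values `{u_{pq}}` through the point of `Ω`. -/
def HasNSForm (κ : Fin 3 → Site → ℝ) (s : Site) (Ω : Set LocalConf)
    (U : LocalConf → Fin 7 → ℝ) (G : LocalConf → ℝ) : Prop :=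
  ∀ p ∈ Ω, detU κ s (U p) 4 ≠ 0 →
    ∃ N ∈ 𝓝 p, ∃ (W : Set (ℝ × ℝ)) (f : ℝ × ℝ → ℝ), IsOpen W ∧ ContDiffOn ℝ ∞ f W ∧
      ∀ q ∈ N, xi κ s (U q) ∈ W ∧ G q = (detU κ s (U q) 4)⁻¹ ^ 3 * f (xi κ s (U q))

end

noncomputable section

/-! ### Linear differential equations with a zero -/

/-! The determining equation is a cubic polynomial in the velocity. For a coupled interaction its
coefficients force every symmetry into the form `τ ∂_t + ((τ'/2 + a) u + λ) ∂_u` with constants `a`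
(`IsSymmetry.exists_affineForm`), so the symmetry algebra `L` becomes an `AffineAction`.

The components `τ` form a finite-dimensional Lie algebra of vector fields on the line, and it is not
solvable when `L` is not. By Lie's classification such an algebra is `sl(2)`. This is proved on
Taylor series (`JetAlgebra.exists_sl2`) and carried over the whole interval by uniqueness for linear
differential equations (`exists_sl2_frame`). The resulting three fields have no common zero, so
around every time there is a coordinate `θ` in which they are `∂_θ, θ ∂_θ, θ² ∂_θ`, up to
translations and a term in `u`.

The translations `λ ∂_u` are densities of weight `-1/2`. In a finite-dimensional `sl(2)`-module of
such densities `e₀` has square zero (`sq_eq_zero_of_lowest_weight`), hence `λ = g (c + θ d)` with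
`g² = τ(e₀)` and `c, d` in a space `V` of lattice functions. This gives `dim L = 3 + dim A + 2 dim
V`, where `A` is the space of the coefficients `a` of symmetries with `τ = 0`. A shift `u - Q`
removes the remaining `λ`-part of the frame (`exists_gauge`); this is a vanishing statement for
cohomology, done by hand.

In this gauge the force, corrected by a linear term, is homogeneous of degree `-3` and invariant
under `V`. In dimension eleven `dim A + 2 dim V = 8`. Isotropy makes `A` a space of multipliers of
`V` with `dim A ≤ dim V`. Homogeneity excludes `1 ∈ A`, so `dim A < dim V`, which leaves `(dim V,
dim A) = (4, 0)` or `(3, 2)`. In the second case there are multipliers concentrated at one site,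
each in `1/4 + A`; three of them add up to `1`, which puts `1` into `A` (`finrank_values`).

So `A = 0` and `V = P · ⟨1, κ⁽¹⁾, κ⁽²⁾, κ⁽³⁾⟩` for a nowhere vanishing `P` (`exists_kappa`). The
determinants of the class are the linear forms on `Γ` that annihilate these shifts. Moving along
orbits to a section of the invariants `ξ` expresses the force by a function of `ξ`
(`hasNSForm_newForce`).

Conversely the form of the class is invariant along the fields of `NS`, and the degenerate points
are reached by continuity. Existence is shown with `κ = (n, m, nm)` and the sum of the inverse cubes
of three linear forms annihilating the shifts. -/

theorem eqOn_zero_of_norm_deriv_le {E : Type*} [NormedAddCommGroup E] [NormedSpace ℝ E]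
    {U : Set ℝ} (hc : U.OrdConnected) {f f' : ℝ → E} {k : ℝ → ℝ}
    (hf : ∀ t ∈ U, HasDerivAt f (f' t) t) (hk : ContinuousOn k U)
    (hle : ∀ t ∈ U, ‖f' t‖ ≤ k t * ‖f t‖) {a : ℝ} (ha : a ∈ U) (h0 : f a = 0) :
    ∀ t ∈ U, f t = 0 := by
  have right : ∀ (f f' : ℝ → E) (k : ℝ → ℝ) (a b : ℝ), a ≤ b →
      (∀ t ∈ Icc a b, HasDerivAt f (f' t) t) → ContinuousOn k (Icc a b) →
      (∀ t ∈ Icc a b, ‖f' t‖ ≤ k t * ‖f t‖) → f a = 0 → f b = 0 := by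
    intro f f' k a b hab hf hk hle h0
    obtain ⟨K, hK⟩ := (isCompact_Icc.image_of_continuousOn hk).bddAbove
    refine eq_zero_of_abs_deriv_le_mul_abs_self_of_eq_zero_right (f' := f') (K := K)
      (fun t ht => (hf t ht).continuousAt.continuousWithinAt)
      (fun t ht => (hf t (Ico_subset_Icc_self ht)).hasDerivWithinAt) h0 (fun t ht => ?_) b
      (right_mem_Icc.2 hab)
    exact (hle t (Ico_subset_Icc_self ht)).trans (mul_le_mul_of_nonneg_right
      (hK (mem_image_of_mem k (Ico_subset_Icc_self ht))) (norm_nonneg _))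
  intro t ht
  rcases le_total a t with hat | hta
  · have hs : Icc a t ⊆ U := hc.out ha ht
    exact right f f' k a t hat (fun x hx => hf x (hs hx)) (hk.mono hs)
      (fun x hx => hle x (hs hx)) h0
  -- To the left of `a` the same estimate is applied to the reflected function.
  · have hs : ∀ x ∈ Icc (-a) (-t), -x ∈ U := fun x hx =>
      hc.out ht ha ⟨by linarith [hx.2], by linarith [hx.1]⟩
    have := right (fun x => f (-x)) (fun x => -f' (-x)) (fun x => k (-x)) (-a) (-t)
      (by linarith)
      (fun x hx => by
        simpa [Function.comp_def] using
          HasDerivAt.scomp x (hf (-x) (hs x hx)) (hasDerivAt_neg x))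
      (hk.comp continuousOn_neg hs)
      (fun x hx => by simpa using hle (-x) (hs x hx)) (by simpa using h0)
    simpa using this

/-- A finite-dimensional space of functions `w X` with `h w' = k w + w ∘ D` that vanish at one point
of an interval on which `h` has no zero. -/
theorem family_eqOn_zero {V : Type*} [AddCommGroup V] [Module ℝ V] [FiniteDimensional ℝ V]
    {U : Set ℝ} (hc : U.OrdConnected) (w : V →ₗ[ℝ] ℝ → ℝ) (D : V →ₗ[ℝ] V)
    {h k : ℝ → ℝ} (hh : ContinuousOn h U) (hk : ContinuousOn k U) (h0 : ∀ t ∈ U, h t ≠ 0)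
    (hw : ∀ X, ∀ t ∈ U, DifferentiableAt ℝ (w X) t)
    (heq : ∀ X, ∀ t ∈ U, h t * deriv (w X) t = k t * w X t + w (D X) t)
    {a : ℝ} (ha : a ∈ U) (hz : ∀ X, w X a = 0) : ∀ X, ∀ t ∈ U, w X t = 0 := by
  let b := Module.finBasis ℝ V
  set n := Module.finrank ℝ V
  let M : Fin n → Fin n → ℝ := fun i j => b.repr (D (b i)) j
  have hD : ∀ i t, w (D (b i)) t = ∑ j, M i j * w (b j) t := by
    intro i t
    have := congrFun (congrArg w (b.sum_repr (D (b i)))) t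
    simpa only [map_sum, map_smul, Finset.sum_apply, Pi.smul_apply, smul_eq_mul] using this.symm
  -- In a basis of `V` the equations become a linear system with matrix `k + M`. `B` dominates all
  -- row sums of `|M|`, so `|h| ‖f'‖ ≤ (|k| + B) ‖f‖` in the sup norm.
  let B : ℝ := ∑ i, ∑ j, |M i j|
  have hB : ∀ i, ∑ j, |M i j| ≤ B := fun i =>
    Finset.single_le_sum (f := fun i => ∑ j, |M i j|)
      (fun i _ => Finset.sum_nonneg fun j _ => abs_nonneg _) (Finset.mem_univ i)
  have hB0 : 0 ≤ B := Finset.sum_nonneg fun i _ => Finset.sum_nonneg fun j _ => abs_nonneg _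
  have key := eqOn_zero_of_norm_deriv_le hc (f := fun t i => w (b i) t)
    (f' := fun t i => deriv (w (b i)) t) (k := fun t => |h t|⁻¹ * (|k t| + B))
    (fun t ht => hasDerivAt_pi.2 fun i => (hw (b i) t ht).hasDerivAt)
    ((hh.abs.inv₀ fun t ht => abs_ne_zero.2 (h0 t ht)).mul (hk.abs.add continuousOn_const))
    (fun t ht => by
      have hp : 0 < |h t| := abs_pos.2 (h0 t ht)
      refine (pi_norm_le_iff_of_nonneg (by positivity)).2 fun i => ?_
      rw [Real.norm_eq_abs]
      have e := heq (b i) t ht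
      rw [hD] at e
      have e1 : |h t| * |deriv (w (b i)) t| ≤ (|k t| + B) * ‖fun i => w (b i) t‖ := by
        rw [← abs_mul, e]
        have hn : ∀ j, |w (b j) t| ≤ ‖fun i => w (b i) t‖ := fun j =>
          norm_le_pi_norm (fun i => w (b i) t) j
        calc |k t * w (b i) t + ∑ j, M i j * w (b j) t|
            ≤ |k t| * |w (b i) t| + ∑ j, |M i j| * |w (b j) t| := by
              refine (abs_add_le _ _).trans (add_le_add (abs_mul _ _).le ?_)
              refine (Finset.abs_sum_le_sum_abs _ _).trans (Finset.sum_le_sum fun j _ => ?_)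
              rw [abs_mul]
          _ ≤ |k t| * ‖fun i => w (b i) t‖ + ∑ j, |M i j| * ‖fun i => w (b i) t‖ := by
              gcongr with j
              · exact hn i
              · exact hn j
          _ ≤ _ := by
              rw [← Finset.sum_mul, ← add_mul]
              gcongr
              exact hB i
      rw [mul_assoc, ← div_eq_inv_mul, le_div_iff₀ hp, mul_comm]
      exact e1)
    ha (funext fun i => hz (b i))
  intro X t ht
  rw [← b.sum_repr X]
  simp only [map_sum, map_smul, Finset.sum_apply, Pi.smul_apply]
  exact Finset.sum_eq_zero fun i _ => by rw [congrFun (key t ht) i]; simp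

/-! ### Three functions with the relations of `sl(2)` -/

/-- The relations `{e₀,e₁} = e₀`, `{e₀,e₂} = 2 e₁`, `{e₁,e₂} = e₂` at the point `t`, where
`{f,g} = f g' - f' g`. -/
def Sl2At (e₀ e₁ e₂ : ℝ → ℝ) (t : ℝ) : Prop :=
  e₀ t * deriv e₁ t - deriv e₀ t * e₁ t = e₀ t ∧
  e₀ t * deriv e₂ t - deriv e₀ t * e₂ t = 2 * e₁ t ∧
  e₁ t * deriv e₂ t - deriv e₁ t * e₂ t = e₂ t

namespace Sl2At

variable {e₀ e₁ e₂ : ℝ → ℝ} {t : ℝ}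

/-- The relations say that the cross product of `(e₀, e₁, e₂)` with its derivative is `(e₂, -2 e₁,
e₀)`. Its orthogonality to `(e₀, e₁, e₂)` is the claim. -/
theorem sq_eq (h : Sl2At e₀ e₁ e₂ t) : e₁ t ^ 2 = e₀ t * e₂ t := by
  obtain ⟨h1, h2, h3⟩ := h
  linear_combination (e₂ t / 2) * h1 - (e₁ t / 2) * h2 + (e₀ t / 2) * h3

/-- Where `e₀ ≠ 0` one has `e = e₀ (1, θ, θ²)` with `θ' = 1 / e₀`, and the left side is `(e₀ θ')²`.
Where `e₀ = 0` also `e₁ = 0`, and the relations with `e₂ ≠ 0` give `e₀' = 0` and `e₁' = -1`. -/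
theorem deriv_sq_eq (h : Sl2At e₀ e₁ e₂ t) (h0 : ¬ (e₀ t = 0 ∧ e₁ t = 0 ∧ e₂ t = 0)) :
    deriv e₁ t ^ 2 - deriv e₀ t * deriv e₂ t = 1 := by
  have hs := h.sq_eq
  obtain ⟨h1, h2, h3⟩ := h
  by_cases h00 : e₀ t = 0
  · have h11 : e₁ t = 0 := by rw [h00] at hs; simpa using hs
    have h22 : e₂ t ≠ 0 := fun h => h0 ⟨h00, h11, h⟩
    simp only [h00, h11] at h1 h2 h3
    have a1 : deriv e₀ t = 0 := by
      have : deriv e₀ t * e₂ t = 0 := by linarith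
      simpa [h22] using this
    have a2 : deriv e₁ t = -1 := by
      have : (deriv e₁ t + 1) * e₂ t = 0 := by linarith
      have := (mul_eq_zero.1 this).resolve_right h22
      linarith
    rw [a1, a2]; norm_num
  · have : e₀ t ^ 2 * (deriv e₁ t ^ 2 - deriv e₀ t * deriv e₂ t - 1) = 0 := by
      linear_combination (e₀ t * deriv e₁ t + deriv e₀ t * e₁ t + e₀ t) * h1
        - deriv e₀ t * e₀ t * h2 + deriv e₀ t ^ 2 * hs
    have := (mul_eq_zero.1 this).resolve_left (pow_ne_zero 2 h00)
    linarith

/-- The three functions have no common zero in the closure of the set where the relations hold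
and they do not all vanish. -/
theorem ne_zero_of_mem_closure {S : Set ℝ} (hS : ∀ t ∈ S, Sl2At e₀ e₁ e₂ t)
    (hS0 : ∀ t ∈ S, ¬ (e₀ t = 0 ∧ e₁ t = 0 ∧ e₂ t = 0)) {b : ℝ} (hb : b ∈ closure S)
    (d₀ : ContDiffAt ℝ 1 e₀ b) (d₁ : ContDiffAt ℝ 1 e₁ b) (d₂ : ContDiffAt ℝ 1 e₂ b) :
    ¬ (e₀ b = 0 ∧ e₁ b = 0 ∧ e₂ b = 0) := by
  intro h0
  have hbS : b ∉ S := fun h => hS0 b h h0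
  have : (𝓝[S] b).NeBot := mem_closure_iff_nhdsWithin_neBot.1 hb
  have hcont : ∀ e : ℝ → ℝ, ContDiffAt ℝ 1 e b → Tendsto (deriv e) (𝓝[S] b) (𝓝 (deriv e b)) :=
    fun e he => by
      have h2 : ContDiffAt ℝ 0 (fderiv ℝ e) b := he.fderiv_right (by norm_num)
      have h3 : ContinuousAt (deriv e) b := by
        have := (h2.continuousAt.clm_apply (continuousAt_const (y := (1 : ℝ))))
        simpa [fderiv_apply_one_eq_deriv] using this
      exact h3.mono_left nhdsWithin_le_nhds
  -- At a common zero `b` the discriminant of the derivatives has two values. The first is the limit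
  -- of the constant `1` on `S`.
  have e1 : deriv e₁ b ^ 2 - deriv e₀ b * deriv e₂ b = 1 := by
    refine tendsto_nhds_unique_of_eventuallyEq
      (((hcont e₁ d₁).pow 2).sub ((hcont e₀ d₀).mul (hcont e₂ d₂))) tendsto_const_nhds ?_
    filter_upwards [self_mem_nhdsWithin] with t ht
    exact (hS t ht).deriv_sq_eq (hS0 t ht)
  have hsl : ∀ e : ℝ → ℝ, ContDiffAt ℝ 1 e b → e b = 0 →
      Tendsto (fun t => e t / (t - b)) (𝓝[S] b) (𝓝 (deriv e b)) := fun e he h => by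
    have := (he.differentiableAt (by norm_num)).hasDerivAt.tendsto_slope
    have h2 : 𝓝[S] b ≤ 𝓝[≠] b := nhdsWithin_mono _ fun t ht h => hbS (h ▸ ht)
    refine (this.mono_left h2).congr fun t => ?_
    simp [slope_def_field, h]
  -- The second is the limit of `(e₁² - e₀ e₂) / (t - b)²`, which is zero on `S` by `sq_eq`.
  have e2 : deriv e₁ b ^ 2 - deriv e₀ b * deriv e₂ b = 0 := by
    refine tendsto_nhds_unique_of_eventuallyEq
      (((hsl e₁ d₁ h0.2.1).pow 2).sub ((hsl e₀ d₀ h0.1).mul (hsl e₂ d₂ h0.2.2)))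
      tendsto_const_nhds ?_
    filter_upwards [self_mem_nhdsWithin] with t ht
    have := (hS t ht).sq_eq
    rw [div_pow, div_mul_div_comm, ← sq, this, sub_self]
  linarith

theorem swap (h : Sl2At e₀ e₁ e₂ t) : Sl2At e₂ (-e₁) e₀ t := by
  obtain ⟨h1, h2, h3⟩ := h
  refine ⟨?_, ?_, ?_⟩ <;> simp only [deriv.neg, Pi.neg_apply] <;> linarith

theorem neg (h : Sl2At e₀ e₁ e₂ t) : Sl2At (-e₀) e₁ (-e₂) t := by
  obtain ⟨h1, h2, h3⟩ := h
  refine ⟨?_, ?_, ?_⟩ <;> simp only [deriv.neg, Pi.neg_apply] <;> linarith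

end Sl2At
end

noncomputable section

/-! ### Formal vector fields on the line -/

namespace JetAlgebra

open PowerSeries

/-- The bracket `f g' - f' g` of formal vector fields. -/
def wr (f g : ℝ⟦X⟧) : ℝ⟦X⟧ := f * d⁄dX ℝ g - d⁄dX ℝ f * g

theorem derivative_wr (f g : ℝ⟦X⟧) :
    d⁄dX ℝ (wr f g) = wr (d⁄dX ℝ f) g + wr f (d⁄dX ℝ g) := by
  simp only [wr, map_sub, Derivation.leibniz, smul_eq_mul]
  ring

variable {L : Type*} [LieRing L] [LieAlgebra ℝ L]

/-- The jet of `X`, whose `k`-th derivative is `ε ((ad h)^k X)`. -/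
def jet (ε : L →ₗ[ℝ] ℝ) (h : L) : L →ₗ[ℝ] ℝ⟦X⟧ where
  toFun Y := PowerSeries.mk fun k => ε ((LieAlgebra.ad ℝ L h ^ k) Y) / (k.factorial : ℝ)
  map_add' Y Z := by ext k; simp [add_div]
  map_smul' c Y := by ext k; simp [mul_div_assoc]

variable {ε : L →ₗ[ℝ] ℝ} {h : L}

theorem coeff_jet (Y : L) (k : ℕ) :
    coeff k (jet ε h Y) = ε ((LieAlgebra.ad ℝ L h ^ k) Y) / (k.factorial : ℝ) := by
  simp [jet]

theorem coeff_zero_jet (Y : L) : coeff 0 (jet ε h Y) = ε Y := by simp [coeff_jet]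

theorem derivative_jet (Y : L) : d⁄dX ℝ (jet ε h Y) = jet ε h ⁅h, Y⁆ := by
  ext k
  rw [coeff_derivative, coeff_jet, coeff_jet, pow_succ, Module.End.mul_apply,
    LieAlgebra.ad_apply, Nat.factorial_succ]
  have : (k.factorial : ℝ) ≠ 0 := by positivity
  push_cast
  field_simp

/-- The hypothesis is the bracket formula at the base point, in the coordinate that straightens `h`.
It gives the constant terms; the higher coefficients follow because the Jacobi identity and
`derivative_wr` say that both sides are differentiated by the same Leibniz rule. -/
theorem jet_lie (hbr : ∀ X Y, ε ⁅X, Y⁆ = ε X * ε ⁅h, Y⁆ - ε ⁅h, X⁆ * ε Y) (Y Z : L) :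
    jet ε h ⁅Y, Z⁆ = wr (jet ε h Y) (jet ε h Z) := by
  ext k
  induction k generalizing Y Z with
  | zero =>
    rw [coeff_zero_jet, hbr]
    have e : ∀ f g : ℝ⟦X⟧, coeff 0 (f * g) = coeff 0 f * coeff 0 g := fun f g => by simp
    simp only [wr, derivative_jet, map_sub, e, coeff_zero_jet]
  | succ k ih =>
    have e : ∀ f : ℝ⟦X⟧, coeff (k + 1) f = coeff k (d⁄dX ℝ f) / (k + 1) := fun f => by
      rw [coeff_derivative]; field_simp
    rw [e, e, derivative_jet, leibniz_lie, map_add, map_add, ih, ih, derivative_wr, map_add,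
      derivative_jet, derivative_jet]

theorem jet_self (hε : ε h = 1) : jet ε h h = 1 := by
  have : d⁄dX ℝ (jet ε h h) = d⁄dX ℝ 1 := by rw [derivative_jet]; simp
  refine PowerSeries.derivative.ext this ?_
  rw [← coeff_zero_eq_constantCoeff_apply, coeff_zero_jet, hε]; simp

/-- The elements whose series vanishes to order `k` form a decreasing chain of subspaces of a
finite-dimensional space. The chain stabilizes, and a series divisible by all powers of `X` is zero.
-/
theorem exists_maximal_order [FiniteDimensional ℝ L] (T : L →ₗ[ℝ] ℝ⟦X⟧) (hT : T ≠ 0) :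
    ∃ N, (∃ Y, X ^ N ∣ T Y ∧ T Y ≠ 0) ∧ ∀ Y, X ^ (N + 1) ∣ T Y → T Y = 0 := by
  let F : ℕ →o (Submodule ℝ L)ᵒᵈ :=
    ⟨fun k => OrderDual.toDual
      { carrier := {Y | X ^ k ∣ T Y}
        add_mem' := fun {a b} ha hb => by
          have : X ^ k ∣ T a + T b := dvd_add ha hb
          simpa using this
        zero_mem' := by simp
        smul_mem' := fun c a ha => by
          have : X ^ k ∣ T a := ha
          simpa [smul_eq_C_mul] using this.mul_left (C c) },
      fun i j hij Y hY => (pow_dvd_pow X hij).trans hY⟩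
  obtain ⟨n, hn⟩ := IsArtinian.monotone_stabilizes F
  have hall : ∀ Y, X ^ n ∣ T Y → T Y = 0 := by
    intro Y hY
    have h2 : ∀ m, n ≤ m → X ^ m ∣ T Y := fun m hm => by
      have : Y ∈ OrderDual.ofDual (F n) := hY
      rw [hn m hm] at this
      exact this
    ext k
    exact X_pow_dvd_iff.1 (h2 (max n (k + 1)) (le_max_left _ _)) k
      (lt_of_lt_of_le (Nat.lt_succ_self k) (le_max_right _ _))
  classical
  have hex : ∃ n, ∀ Y, X ^ n ∣ T Y → T Y = 0 := ⟨n, hall⟩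
  have hpos : Nat.find hex ≠ 0 := by
    intro h0
    apply hT
    ext1 Y
    have := Nat.find_spec hex Y (by rw [h0]; simp)
    simpa using this
  obtain ⟨N, hN⟩ := Nat.exists_eq_succ_of_ne_zero hpos
  refine ⟨N, ?_, fun Y hY => Nat.find_spec hex Y (by rw [hN]; exact hY)⟩
  have := Nat.find_min hex (m := N) (by rw [hN]; exact Nat.lt_succ_self N)
  push Not at this
  exact this

/-- For `f = X^N ψ` the bracket of `f` and `f'` is `f f'' - f'² = X^(2N-2) (-N ψ(0)² + …)`. If `N ≥
3` then `2N - 2 > N`, so by maximality this vanishes, hence `ψ(0) = 0` and `f` has order above `N`.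
-/
theorem order_le_two [FiniteDimensional ℝ L]
    (hbr : ∀ X Y, ε ⁅X, Y⁆ = ε X * ε ⁅h, Y⁆ - ε ⁅h, X⁆ * ε Y) {N : ℕ}
    (h1 : ∃ Y, X ^ N ∣ jet ε h Y ∧ jet ε h Y ≠ 0)
    (h2 : ∀ Y, X ^ (N + 1) ∣ jet ε h Y → jet ε h Y = 0) : N ≤ 2 := by
  by_contra hN
  obtain ⟨n, rfl⟩ : ∃ n, N = n + 3 := ⟨N - 3, by omega⟩
  obtain ⟨Y, ⟨ψ, hψ⟩, hY0⟩ := h1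
  have e : jet ε h ⁅Y, ⁅h, Y⁆⁆ = X ^ (2 * n + 4) *
      (ψ * (((n : ℝ⟦X⟧) + 3) * ((n : ℝ⟦X⟧) + 2) * ψ + 2 * ((n : ℝ⟦X⟧) + 3) * X * d⁄dX ℝ ψ
        + X ^ 2 * d⁄dX ℝ (d⁄dX ℝ ψ)) - (((n : ℝ⟦X⟧) + 3) * ψ + X * d⁄dX ℝ ψ) ^ 2) := by
    rw [jet_lie hbr, ← derivative_jet, hψ, wr]
    have hc : d⁄dX ℝ (n : ℝ⟦X⟧) = 0 := by simp
    have hc3 : d⁄dX ℝ (3 : ℝ⟦X⟧) = 0 := by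
      have := Derivation.map_natCast (d⁄dX ℝ) 3
      simpa using this
    have e1 : d⁄dX ℝ ((X : ℝ⟦X⟧) ^ (n + 3) * ψ) =
        X ^ (n + 2) * (((n : ℝ⟦X⟧) + 3) * ψ + X * d⁄dX ℝ ψ) := by
      simp only [Derivation.leibniz, Derivation.leibniz_pow, smul_eq_mul, derivative_X,
        nsmul_eq_mul]
      push_cast
      ring
    have e2 : d⁄dX ℝ ((X : ℝ⟦X⟧) ^ (n + 2) * (((n : ℝ⟦X⟧) + 3) * ψ + X * d⁄dX ℝ ψ)) =
        X ^ (n + 1) * (((n : ℝ⟦X⟧) + 3) * ((n : ℝ⟦X⟧) + 2) * ψ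
        + 2 * ((n : ℝ⟦X⟧) + 3) * X * d⁄dX ℝ ψ
        + X ^ 2 * d⁄dX ℝ (d⁄dX ℝ ψ)) := by
      simp only [Derivation.leibniz, Derivation.leibniz_pow, smul_eq_mul, derivative_X,
        nsmul_eq_mul, map_add, hc, hc3]
      push_cast
      ring
    rw [e1, e2]
    ring
  have e0 := h2 ⁅Y, ⁅h, Y⁆⁆ (by
    rw [e]
    exact (pow_dvd_pow X (by omega)).mul_right _)
  rw [e] at e0
  have e3 := (mul_eq_zero.1 e0).resolve_left (pow_ne_zero _ X_ne_zero)
  have e4 := congrArg (constantCoeff (R := ℝ)) e3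
  simp only [map_sub, map_mul, map_add, map_pow, constantCoeff_X, map_natCast,
    map_zero, map_ofNat] at e4
  have e5 : ((n : ℝ) + 3) * constantCoeff ψ ^ 2 = 0 := by linear_combination -e4
  have e6 : constantCoeff ψ = 0 := by
    have hn : (n : ℝ) + 3 ≠ 0 := by positivity
    simpa [hn] using e5
  obtain ⟨χ, hχ⟩ := X_dvd_iff.2 e6
  exact hY0 (h2 Y ⟨χ, by rw [hψ, hχ]; ring⟩)

theorem eq_of_coeff {Y : L} (h2 : ∀ Y, X ^ 3 ∣ jet ε h Y → jet ε h Y = 0)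
    (a0 : coeff 0 (jet ε h Y) = 0) (a1 : coeff 1 (jet ε h Y) = 0)
    (a2 : coeff 2 (jet ε h Y) = 0) : jet ε h Y = 0 := by
  refine h2 Y (X_pow_dvd_iff.2 fun m hm => ?_)
  interval_cases m <;> assumption

/-- If the maximal order is at most one, all jets are combinations of `1` and a single `f`. Then the
derived algebra has jets in the line of `f'`, and the second derived algebra has zero jets. -/
theorem two_le_order [FiniteDimensional ℝ L] (hε : ε h = 1)
    (hbr : ∀ X Y, ε ⁅X, Y⁆ = ε X * ε ⁅h, Y⁆ - ε ⁅h, X⁆ * ε Y)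
    (hns : ∃ Y ∈ LieAlgebra.derivedSeries ℝ L 2, ε Y ≠ 0) {N : ℕ}
    (h2 : ∀ Y, X ^ (N + 1) ∣ jet ε h Y → jet ε h Y = 0) : 2 ≤ N := by
  by_contra hN
  have h2' : ∀ Y, X ^ 2 ∣ jet ε h Y → jet ε h Y = 0 := fun Y hY =>
    h2 Y ((pow_dvd_pow X (by omega)).trans hY)
  have step : ∃ f : ℝ⟦X⟧, ∀ Y : L, ∃ a b : ℝ, jet ε h Y = a • (1 : ℝ⟦X⟧) + b • f := by
    by_cases hf : ∃ Y, coeff 0 (jet ε h Y) = 0 ∧ coeff 1 (jet ε h Y) = 1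
    · obtain ⟨Z, hZ0, hZ1⟩ := hf
      refine ⟨jet ε h Z, fun Y =>
        ⟨coeff 0 (jet ε h Y), coeff 1 (jet ε h Y), ?_⟩⟩
      have := h2' (Y - coeff 0 (jet ε h Y) • h - coeff 1 (jet ε h Y) • Z)
        (X_pow_dvd_iff.2 fun m hm => by
          have := jet_self hε
          simp only [map_sub, map_smul, this]
          interval_cases m
          · simp [hZ0]
          · simp [hZ1, coeff_one])
      rw [map_sub, map_sub, map_smul, map_smul, jet_self hε, sub_sub, sub_eq_zero] at this
      exact this
    · refine ⟨0, fun Y => ⟨coeff 0 (jet ε h Y), 0, ?_⟩⟩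
      have := h2' (Y - coeff 0 (jet ε h Y) • h)
        (X_pow_dvd_iff.2 fun m hm => by
          rw [map_sub, map_smul, jet_self hε]
          interval_cases m
          · simp
          · by_contra hne
            refine hf ⟨(coeff 1 (jet ε h Y))⁻¹ • (Y - coeff 0 (jet ε h Y) • h), ?_, ?_⟩
            · simp only [map_smul, map_sub, jet_self hε]; simp
            · simp only [map_sub, map_smul, jet_self hε, coeff_one, smul_eq_mul] at hne ⊢
              simp only [one_ne_zero, if_false, mul_zero, sub_zero] at hne ⊢
              field_simp)
      rw [map_sub, map_smul, jet_self hε, sub_eq_zero] at this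
      simpa using this
  obtain ⟨f, hf⟩ := step
  have hC : ∀ c : ℝ, d⁄dX ℝ (c • (1 : ℝ⟦X⟧)) = 0 := fun c => by simp
  have hs : ∀ (c : ℝ) (f : ℝ⟦X⟧), d⁄dX ℝ (C c * f) = C c * d⁄dX ℝ f := fun c f => by
    simp [Derivation.leibniz]
  have d1 : ∀ Y ∈ LieAlgebra.derivedSeries ℝ L 1, ∃ c : ℝ, jet ε h Y = c • d⁄dX ℝ f := by
    intro Y hY
    rw [LieAlgebra.derivedSeries_def, LieAlgebra.derivedSeriesOfIdeal_succ,
      ← LieSubmodule.mem_toSubmodule,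
      LieSubmodule.lieIdeal_oper_eq_linear_span'] at hY
    induction hY using Submodule.span_induction with
    | mem x hx =>
      obtain ⟨Y, _, Z, _, rfl⟩ := hx
      obtain ⟨a, b, hab⟩ := hf Y
      obtain ⟨c, d, hcd⟩ := hf Z
      refine ⟨a * d - b * c, ?_⟩
      rw [jet_lie hbr, hab, hcd, wr, map_add, map_add, hC, hC]
      simp only [zero_add, smul_eq_C_mul, hs, map_sub, map_mul]
      ring
    | zero => exact ⟨0, by simp⟩
    | add x y _ _ hx hy =>
      obtain ⟨a, ha⟩ := hx
      obtain ⟨b, hb⟩ := hy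
      exact ⟨a + b, by rw [map_add, ha, hb, add_smul]⟩
    | smul c x _ hx =>
      obtain ⟨a, ha⟩ := hx
      exact ⟨c * a, by rw [map_smul, ha, mul_smul]⟩
  obtain ⟨Y, hY, hY0⟩ := hns
  apply hY0
  rw [← coeff_zero_jet (ε := ε) (h := h)]
  suffices jet ε h Y = 0 by simp [this]
  clear hY0
  rw [LieAlgebra.derivedSeries_def, LieAlgebra.derivedSeriesOfIdeal_succ,
    ← LieSubmodule.mem_toSubmodule,
    LieSubmodule.lieIdeal_oper_eq_linear_span'] at hY
  induction hY using Submodule.span_induction with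
  | mem x hx =>
    obtain ⟨Y, hY, Z, hZ, rfl⟩ := hx
    obtain ⟨a, ha⟩ := d1 Y hY
    obtain ⟨b, hb⟩ := d1 Z hZ
    rw [jet_lie hbr, ha, hb, wr]
    simp only [smul_eq_C_mul, hs]
    ring
  | zero => simp
  | add x y _ _ hx hy => rw [map_add, hx, hy, add_zero]
  | smul c x _ hx => rw [map_smul, hx, smul_zero]

/-- A nonsolvable finite-dimensional algebra of formal vector fields on the line is `sl(2)`. -/
theorem exists_sl2 [FiniteDimensional ℝ L] (hε : ε h = 1)
    (hbr : ∀ X Y, ε ⁅X, Y⁆ = ε X * ε ⁅h, Y⁆ - ε ⁅h, X⁆ * ε Y)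
    (hns : ∃ Y ∈ LieAlgebra.derivedSeries ℝ L 2, ε Y ≠ 0) :
    ∃ e₀ e₁ e₂ : L, ε e₀ ≠ 0 ∧ jet ε h (⁅e₀, e₁⁆ - e₀) = 0 ∧
      jet ε h (⁅e₀, e₂⁆ - (2 : ℝ) • e₁) = 0 ∧ jet ε h (⁅e₁, e₂⁆ - e₂) = 0 ∧
      ∀ Y, ∃ a b c : ℝ, jet ε h (Y - (a • e₀ + b • e₁ + c • e₂)) = 0 := by
  have hC2 : (2 : ℝ⟦X⟧) = C (2 : ℝ) := (map_ofNat C 2).symm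
  have hT : jet ε h ≠ 0 := by
    intro h0
    have := congrArg (fun T => T h) h0
    rw [jet_self hε] at this
    simp at this
  obtain ⟨N, h1, h2⟩ := exists_maximal_order (jet ε h) hT
  obtain rfl : N = 2 := le_antisymm (order_le_two hbr h1 h2) (two_le_order hε hbr hns h2)
  obtain ⟨Y', hdvd, hne⟩ := h1
  have hY'0 : coeff 0 (jet ε h Y') = 0 := X_pow_dvd_iff.1 hdvd 0 (by norm_num)
  have hY'1 : coeff 1 (jet ε h Y') = 0 := X_pow_dvd_iff.1 hdvd 1 (by norm_num)
  have hY'2 : coeff 2 (jet ε h Y') ≠ 0 := fun h0 => hne (eq_of_coeff h2 hY'0 hY'1 h0)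
  obtain ⟨y, y0, y1, y2⟩ : ∃ y, coeff 0 (jet ε h y) = 0 ∧ coeff 1 (jet ε h y) = 0 ∧
      coeff 2 (jet ε h y) = 1 :=
    ⟨(coeff 2 (jet ε h Y'))⁻¹ • Y', by simp [hY'0], by simp [hY'1], by simp [hY'2]⟩
  -- With `y = X² + …` the element `z` has the jet `y'/2 = X + …`, so `h, z, y` begin like the
  -- standard basis `1, X, X²`.
  obtain ⟨z, hz⟩ : ∃ z : L, z = (1 / 2 : ℝ) • ⁅h, y⁆ := ⟨_, rfl⟩
  have dY : d⁄dX ℝ (jet ε h y) = 2 * jet ε h z := by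
    rw [derivative_jet, hz, map_smul, smul_eq_C_mul, ← mul_assoc,
      hC2, ← map_mul]
    norm_num
  have zc : ∀ k, coeff k (jet ε h z) = coeff (k + 1) (jet ε h y) * (k + 1) / 2 := fun k => by
    rw [← coeff_derivative, dY, hC2, coeff_C_mul]; ring
  have z0 : coeff 0 (jet ε h z) = 0 := by rw [zc, y1]; simp
  have z1 : coeff 1 (jet ε h z) = 1 := by rw [zc, y2]; norm_num
  -- The jet `2 z² - z' y - y` starts with `(2 - 1 - 1) X²`, hence has order at least three and
  -- vanishes.
  have lieZY : jet ε h (⁅z, y⁆ - y) = 0 := by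
    have e : jet ε h (⁅z, y⁆ - y) =
        2 * jet ε h z * jet ε h z - d⁄dX ℝ (jet ε h z) * jet ε h y - jet ε h y := by
      rw [map_sub, jet_lie hbr, wr, dY]; ring
    have hX : X ∣ jet ε h z := X_dvd_iff.2 (by simpa using z0)
    obtain ⟨ζ, hζ⟩ := hX
    obtain ⟨η, hη⟩ : X ^ 2 ∣ jet ε h y := X_pow_dvd_iff.2 fun m hm => by
      interval_cases m <;> assumption
    have c1 : constantCoeff ζ = 1 := by
      rw [hζ, show (1 : ℕ) = 0 + 1 from rfl, coeff_succ_X_mul] at z1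
      simpa using z1
    have c2 : constantCoeff η = 1 := by
      rw [hη, show (2 : ℕ) = 0 + 2 from rfl, coeff_X_pow_mul] at y2
      simpa using y2
    refine h2 _ ?_
    rw [e, hζ, hη]
    have e3 : 2 * (X * ζ) * (X * ζ) - d⁄dX ℝ (X * ζ) * (X ^ 2 * η) - X ^ 2 * η =
        X ^ 2 * (2 * ζ * ζ - (ζ + X * d⁄dX ℝ ζ) * η - η) := by
      simp only [Derivation.leibniz, smul_eq_mul, derivative_X]
      ring
    rw [e3, pow_succ]
    refine mul_dvd_mul_left _ (X_dvd_iff.2 ?_)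
    simp only [map_sub, map_mul, map_add, constantCoeff_X, c1, c2, map_ofNat]
    norm_num
  have spanL : ∀ Y, ∃ a b c : ℝ, jet ε h (Y - (a • h + b • z + c • y)) = 0 := by
    intro Y
    refine ⟨coeff 0 (jet ε h Y), coeff 1 (jet ε h Y),
      coeff 2 (jet ε h Y) - coeff 1 (jet ε h Y) * coeff 2 (jet ε h z), ?_⟩
    apply eq_of_coeff h2 <;>
    simp only [map_sub, map_add, map_smul, jet_self hε, coeff_one, smul_eq_mul, z0, z1, y0, y1,
      y2] <;> simp
  obtain ⟨α', α, β, hαβ⟩ := spanL ⁅h, z⁆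
  have hα' : α' = 1 := by
    have := congrArg (coeff 0) hαβ
    simp only [map_sub, map_add, map_smul, jet_self hε, ← derivative_jet, coeff_derivative,
      coeff_one, smul_eq_mul, z0, z1, y0, zero_add] at this
    simp at this
    linarith
  subst hα'
  have dZ : d⁄dX ℝ (jet ε h z) = 1 + C α * jet ε h z + C β * jet ε h y := by
    rw [map_sub, sub_eq_zero, ← derivative_jet] at hαβ
    rw [hαβ, map_add, map_add, map_smul, map_smul, map_smul, jet_self hε, one_smul,
      smul_eq_C_mul, smul_eq_C_mul]
  have rel : jet ε h z * (2 * jet ε h z) - d⁄dX ℝ (jet ε h z) * jet ε h y = jet ε h y := by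
    rw [map_sub, sub_eq_zero, jet_lie hbr, wr, dY] at lieZY
    exact lieZY
  -- Write `z' = 1 + α z + β y`. Taking `e₀ = ⁅h, z⁆ - (β / 2) y` is what makes `⁅e₀, z⁆ = e₀` hold
  -- exactly on jets, by `2 z² - z' y = y`.
  obtain ⟨γ, hγ⟩ : ∃ γ : ℝ⟦X⟧, γ = C (β / 2) := ⟨_, rfl⟩
  have hβ : C β = 2 * γ := by
    rw [hγ, hC2, ← map_mul]; congr 1; ring
  have dC : ∀ c : ℝ, d⁄dX ℝ (C c) = 0 := fun c => by simp
  have ddZ : d⁄dX ℝ (d⁄dX ℝ (jet ε h z)) =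
      C α * d⁄dX ℝ (jet ε h z) + C β * (2 * jet ε h z) := by
    conv_lhs => rw [dZ]
    simp only [map_add, Derivation.leibniz, smul_eq_mul, dC, mul_zero, add_zero, dY,
      Derivation.map_one_eq_zero, zero_add]
  have drel : jet ε h z * (2 * d⁄dX ℝ (jet ε h z))
      - d⁄dX ℝ (d⁄dX ℝ (jet ε h z)) * jet ε h y = 2 * jet ε h z := by
    have := congrArg (d⁄dX ℝ) rel
    have d2 : d⁄dX ℝ (2 : ℝ⟦X⟧) = 0 := by
      rw [hC2, dC]
    simp only [map_sub, Derivation.leibniz, smul_eq_mul, dY, d2] at this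
    linear_combination this
  have E0 : jet ε h (⁅h, z⁆ - (β / 2) • y) = d⁄dX ℝ (jet ε h z) - γ * jet ε h y := by
    rw [map_sub, map_smul, smul_eq_C_mul, derivative_jet, hγ]
  have dE0 : d⁄dX ℝ (jet ε h (⁅h, z⁆ - (β / 2) • y)) =
      d⁄dX ℝ (d⁄dX ℝ (jet ε h z)) - γ * (2 * jet ε h z) := by
    rw [E0]
    simp only [map_sub, Derivation.leibniz, smul_eq_mul, dY, hγ, dC]
    ring
  refine ⟨⁅h, z⁆ - (β / 2) • y, z, y, ?_, ?_, ?_, lieZY, ?_⟩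
  · rw [← coeff_zero_jet (ε := ε) (h := h), E0]
    simp only [map_sub, coeff_derivative, hγ, coeff_C_mul, z1, y0]
    norm_num
  · rw [map_sub, jet_lie hbr, wr, dE0, E0, ddZ]
    linear_combination d⁄dX ℝ (jet ε h z) * dZ + (γ - C β) * rel - jet ε h y * hβ
  · rw [map_sub, jet_lie hbr, wr, dE0, E0, dY, map_smul, smul_eq_C_mul,
      ← hC2]
    linear_combination drel
  · intro Y
    obtain ⟨a, b, c, habc⟩ := spanL Y
    refine ⟨a, b - a * α, c - a * β / 2, ?_⟩
    rw [map_sub, sub_eq_zero] at habc ⊢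
    rw [habc]
    simp only [map_add, map_smul, E0, dZ, jet_self hε, smul_eq_C_mul, map_sub, map_mul,
      mul_div_assoc, ← hγ, hβ]
    ring

end JetAlgebra
end

/-! ### Lie algebras acting by affine vector fields, and their copy of `sl(2)` -/

noncomputable section

theorem exists_ball_ne_zero {I : Set ℝ} (hI : IsOpen I) {f : ℝ → ℝ} (hf : ContinuousOn f I)
    {t : ℝ} (ht : t ∈ I) (h0 : f t ≠ 0) :
    ∃ r > 0, Metric.ball t r ⊆ I ∧ ∀ x ∈ Metric.ball t r, f x ≠ 0 := by
  have h1 : ∀ᶠ x in 𝓝 t, x ∈ I ∧ f x ≠ 0 :=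
    (hI.eventually_mem ht).and ((hf.continuousAt (hI.mem_nhds ht)).eventually_ne h0)
  obtain ⟨r, hr, hb⟩ := Metric.eventually_nhds_iff_ball.1 h1
  exact ⟨r, hr, fun x hx => (hb x hx).1, fun x hx => (hb x hx).2⟩

theorem ordConnected_ball (t r : ℝ) : (Metric.ball t r).OrdConnected :=
  (convex_ball t r).ordConnected

/-- A Lie algebra acting by the vector fields `τ ∂_t + ((τ'/2 + a_s) u + λ_s) ∂_u`, `s ∈ S`,
over the open interval `I`. -/
structure AffineAction (I : Set ℝ) (S : Type*) (L : Type*) [LieRing L] [LieAlgebra ℝ L] where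
  tau : L →ₗ[ℝ] ℝ → ℝ
  scal : L →ₗ[ℝ] S → ℝ
  lam : L →ₗ[ℝ] S → ℝ → ℝ
  smooth_tau : ∀ X, ContDiffOn ℝ ∞ (tau X) I
  smooth_lam : ∀ X s, ContDiffOn ℝ ∞ (lam X s) I
  tau_lie : ∀ X Y : L, ∀ t ∈ I,
    tau ⁅X, Y⁆ t = tau X t * deriv (tau Y) t - deriv (tau X) t * tau Y t
  scal_lie : ∀ X Y : L, scal ⁅X, Y⁆ = 0
  lam_lie : ∀ (X Y : L) (s : S), ∀ t ∈ I, lam ⁅X, Y⁆ s t =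
    tau X t * deriv (lam Y s) t + lam X s t * (deriv (tau Y) t / 2 + scal Y s)
      - tau Y t * deriv (lam X s) t - lam Y s t * (deriv (tau X) t / 2 + scal X s)
  ext_zero : ∀ X, (∀ t ∈ I, tau X t = 0) → scal X = 0 → (∀ s, ∀ t ∈ I, lam X s t = 0) → X = 0

namespace AffineAction

variable {I : Set ℝ} {S : Type*} {L : Type*} [LieRing L] [LieAlgebra ℝ L]
  (R : AffineAction I S L)

theorem contDiffAt_tau (hI : IsOpen I) (X : L) {t : ℝ} (ht : t ∈ I) :
    ContDiffAt ℝ ∞ (R.tau X) t := (R.smooth_tau X).contDiffAt (hI.mem_nhds ht)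

theorem contDiffAt_lam (hI : IsOpen I) (X : L) (s : S) {t : ℝ} (ht : t ∈ I) :
    ContDiffAt ℝ ∞ (R.lam X s) t := (R.smooth_lam X s).contDiffAt (hI.mem_nhds ht)

theorem continuousOn_deriv_tau (hI : IsOpen I) (X : L) : ContinuousOn (deriv (R.tau X)) I :=
  (R.smooth_tau X).continuousOn_deriv_of_isOpen hI (by simp)

/-- The bracket formula reads `τ_h τ_X' = τ_h' τ_X + τ_⁅h,X⁆`. Invariance of `W` under `h` closes
this into a linear system, regular where `τ_h ≠ 0`. -/
theorem tau_eqOn_zero [FiniteDimensional ℝ L] (hI : IsOpen I) (W : Submodule ℝ L) {h : L}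
    (hW : ∀ X ∈ W, ⁅h, X⁆ ∈ W) {U : Set ℝ} (hUI : U ⊆ I) (hU : U.OrdConnected)
    (h0 : ∀ t ∈ U, R.tau h t ≠ 0) {a : ℝ} (ha : a ∈ U) (hz : ∀ X ∈ W, R.tau X a = 0) :
    ∀ X ∈ W, ∀ t ∈ U, R.tau X t = 0 := by
  have := family_eqOn_zero (V := W) hU (R.tau ∘ₗ W.subtype)
    ((LieAlgebra.ad ℝ L h).restrict hW) (h := R.tau h) (k := deriv (R.tau h))
    ((R.smooth_tau h).continuousOn.mono hUI) ((R.continuousOn_deriv_tau hI h).mono hUI) h0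
    (fun X t ht => (R.contDiffAt_tau hI X (hUI ht)).differentiableAt (by simp))
    (fun X t ht => by
      have := R.tau_lie h X t (hUI ht)
      change R.tau h t * deriv (R.tau X) t =
        deriv (R.tau h) t * R.tau X t + R.tau ⁅h, (X : L)⁆ t
      linarith) ha (fun X => hz X X.2)
  exact fun X hX t ht => this ⟨X, hX⟩ t ht

/-- The elements whose component along `∂_t` vanishes near `t`. -/
def tauGerm (t : ℝ) : Submodule ℝ L where
  carrier := {X | R.tau X =ᶠ[𝓝 t] 0}
  add_mem' := fun {X Y} hX hY => by
    have : R.tau X + R.tau Y =ᶠ[𝓝 t] 0 + 0 := EventuallyEq.add hX hY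
    simpa using this
  zero_mem' := by simp
  smul_mem' := fun c X hX => by
    have : c • R.tau X =ᶠ[𝓝 t] c • 0 := EventuallyEq.const_smul hX c
    simpa using this

theorem mem_tauGerm {t : ℝ} {X : L} : X ∈ R.tauGerm t ↔ R.tau X =ᶠ[𝓝 t] 0 := Iff.rfl

theorem lie_mem_tauGerm (hI : IsOpen I) {t : ℝ} (ht : t ∈ I) (h : L) {X : L}
    (hX : X ∈ R.tauGerm t) : ⁅h, X⁆ ∈ R.tauGerm t := by
  have hX' : deriv (R.tau X) =ᶠ[𝓝 t] deriv 0 := EventuallyEq.deriv hX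
  rw [mem_tauGerm] at hX
  filter_upwards [hX, hX', hI.mem_nhds ht] with x h1 h2 h3
  rw [R.tau_lie h X x h3, h1, h2]
  simp

/-- The set of `τ` vanishing near a point cannot change along an interval on which one `τ_h` has no
zero. -/
theorem tauGerm_le [FiniteDimensional ℝ L] (hI : IsOpen I) {h : L} {U : Set ℝ} (hUo : IsOpen U)
    (hUI : U ⊆ I) (hU : U.OrdConnected) (h0 : ∀ t ∈ U, R.tau h t ≠ 0) {a b : ℝ} (ha : a ∈ U)
    (hb : b ∈ U) : R.tauGerm a ≤ R.tauGerm b := by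
  intro X hX
  have := R.tau_eqOn_zero hI (R.tauGerm a)
    (fun X hX => R.lie_mem_tauGerm hI (hUI ha) h hX) hUI hU h0 ha
    (fun X hX => hX.self_of_nhds) X hX
  filter_upwards [hUo.mem_nhds hb] with x hx using this x hx

theorem deriv_tau_eq_zero (hI : IsOpen I) {X : L} (hX : ∀ t ∈ I, R.tau X t = 0) :
    ∀ t ∈ I, deriv (R.tau X) t = 0 := fun t ht => by
  have : R.tau X =ᶠ[𝓝 t] fun _ => 0 := by
    filter_upwards [hI.mem_nhds ht] with x hx using hX x hx
  rw [this.deriv_eq, deriv_const]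

/-- The coefficients `a` vanish on brackets. If all `τ` vanished on the second derived algebra as
well, its elements would be translations, which commute, and the third derived algebra would be
zero. The second derived algebra is what `JetAlgebra.exists_sl2` asks for. -/
theorem exists_tau_ne_zero (hI : IsOpen I) (hns : ¬ LieAlgebra.IsSolvable L) :
    ∃ X ∈ LieAlgebra.derivedSeries ℝ L 2, ∃ t ∈ I, R.tau X t ≠ 0 := by
  by_contra hcon
  push Not at hcon
  apply hns
  rw [LieAlgebra.isSolvable_iff ℝ]
  refine ⟨3, ?_⟩
  have hsc : ∀ X ∈ LieAlgebra.derivedSeries ℝ L 2, R.scal X = 0 := by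
    intro X hX
    rw [LieAlgebra.derivedSeries_def, LieAlgebra.derivedSeriesOfIdeal_succ,
      ← LieSubmodule.mem_toSubmodule, LieSubmodule.lieIdeal_oper_eq_linear_span'] at hX
    refine (Submodule.span_le (p := LinearMap.ker R.scal)).2 ?_ hX
    rintro _ ⟨Y, _, Z, _, rfl⟩
    exact R.scal_lie Y Z
  rw [LieAlgebra.derivedSeries_def, LieAlgebra.derivedSeriesOfIdeal_succ,
    LieSubmodule.lie_eq_bot_iff]
  intro X hX Y hY
  have hd : ∀ X ∈ LieAlgebra.derivedSeries ℝ L 2, ∀ t ∈ I, R.tau X t = 0 := hcon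
  apply R.ext_zero _ _ (R.scal_lie X Y)
  · intro s t ht
    rw [R.lam_lie X Y s t ht, hd X hX t ht, hd Y hY t ht, hsc X hX, hsc Y hY,
      R.deriv_tau_eq_zero hI (hd X hX) t ht, R.deriv_tau_eq_zero hI (hd Y hY) t ht]
    simp
  · intro t ht
    rw [R.tau_lie X Y t ht, hd X hX t ht, hd Y hY t ht]
    ring

/-- A nonsolvable algebra contains a copy of `sl(2)` without common zeros, which carries all
the components along `∂_t`. -/
theorem exists_sl2_frame [FiniteDimensional ℝ L] (hI : IsOpen I) (hIc : I.OrdConnected)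
    (hns : ¬ LieAlgebra.IsSolvable L) :
    ∃ e₀ e₁ e₂ : L, (R.scal e₀ = 0 ∧ R.scal e₁ = 0 ∧ R.scal e₂ = 0) ∧
      (∀ t ∈ I, Sl2At (R.tau e₀) (R.tau e₁) (R.tau e₂) t) ∧
      (∀ t ∈ I, ¬ (R.tau e₀ t = 0 ∧ R.tau e₁ t = 0 ∧ R.tau e₂ t = 0)) ∧
      ∀ X, ∃ a b c : ℝ, ∀ t ∈ I,
        R.tau X t = a * R.tau e₀ t + b * R.tau e₁ t + c * R.tau e₂ t := by
  obtain ⟨Y, hY, a, ha, hYa⟩ := R.exists_tau_ne_zero hI hns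
  let ε : L →ₗ[ℝ] ℝ := LinearMap.proj a ∘ₗ R.tau
  have εdef : ∀ X, ε X = R.tau X a := fun X => rfl
  let h : L := (R.tau Y a)⁻¹ • Y
  have hε : ε h = 1 := by simp [εdef, h, hYa]
  have hbr : ∀ X Y : L, ε ⁅X, Y⁆ = ε X * ε ⁅h, Y⁆ - ε ⁅h, X⁆ * ε Y := by
    intro X Y
    have hε' : R.tau h a = 1 := hε
    rw [εdef, εdef, εdef, εdef, εdef, R.tau_lie X Y a ha, R.tau_lie h Y a ha,
      R.tau_lie h X a ha, hε']
    ring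
  obtain ⟨f₀, f₁, f₂, h0, h1, h2, h3, h4⟩ := JetAlgebra.exists_sl2 hε hbr ⟨Y, hY, hYa⟩
  -- The kernel of the jet map is invariant under `h` and its elements vanish at `a`. So a zero jet
  -- means a zero germ: the formal picture is faithful.
  have flat : ∀ X, JetAlgebra.jet ε h X = 0 → X ∈ R.tauGerm a := by
    intro X hX
    let W : Submodule ℝ L := LinearMap.ker (JetAlgebra.jet ε h)
    have hW : ∀ X ∈ W, ⁅h, X⁆ ∈ W := fun X hX => by
      rw [LinearMap.mem_ker] at hX ⊢
      rw [← JetAlgebra.derivative_jet, hX, map_zero]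
    obtain ⟨r, hr, hrI, hr0⟩ := exists_ball_ne_zero hI (R.smooth_tau h).continuousOn ha
      (show R.tau h a ≠ 0 by rw [← εdef, hε]; exact one_ne_zero)
    have := R.tau_eqOn_zero hI W hW hrI (ordConnected_ball a r) hr0 (Metric.mem_ball_self hr)
      (fun X hX => by
        rw [← εdef, ← JetAlgebra.coeff_zero_jet (ε := ε) (h := h), LinearMap.mem_ker.1 hX,
          map_zero]) X hX
    filter_upwards [Metric.ball_mem_nhds a hr] with x hx using this x hx
  -- Replacing the elements by brackets changes the `τ`-germs in nothing and makes the coefficients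
  -- `a` vanish.
  let e₀ : L := ⁅f₀, f₁⁆
  let e₁ : L := (1 / 2 : ℝ) • ⁅f₀, f₂⁆
  let e₂ : L := ⁅f₁, f₂⁆
  have g0 : e₀ - f₀ ∈ R.tauGerm a := flat _ h1
  have g1 : e₁ - f₁ ∈ R.tauGerm a := by
    have := (R.tauGerm a).smul_mem (1 / 2 : ℝ) (flat _ h2)
    rwa [smul_sub, smul_smul, show (1 / 2 * 2 : ℝ) = 1 by norm_num, one_smul] at this
  have g2 : e₂ - f₂ ∈ R.tauGerm a := flat _ h3
  have lie_sub : ∀ {x x' y y' : L}, x - x' ∈ R.tauGerm a → y - y' ∈ R.tauGerm a →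
      ⁅x, y⁆ - ⁅x', y'⁆ ∈ R.tauGerm a := by
    intro x x' y y' hx hy
    have e : ⁅x, y⁆ - ⁅x', y'⁆ = ⁅x', y - y'⁆ - ⁅y, x - x'⁆ := by
      rw [lie_sub, lie_sub, ← lie_skew y x, ← lie_skew y x']; abel
    rw [e]
    exact sub_mem (R.lie_mem_tauGerm hI ha _ hy) (R.lie_mem_tauGerm hI ha _ hx)
  have r0 : ⁅e₀, e₁⁆ - e₀ ∈ R.tauGerm a := by
    have := lie_sub g0 g1
    exact this
  have r1 : ⁅e₀, e₂⁆ - (2 : ℝ) • e₁ ∈ R.tauGerm a := by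
    have := lie_sub g0 g2
    rwa [show (2 : ℝ) • e₁ = ⁅f₀, f₂⁆ by simp [e₁, smul_smul]]
  have r2 : ⁅e₁, e₂⁆ - e₂ ∈ R.tauGerm a := lie_sub g1 g2
  have rs : ∀ X, ∃ b c d : ℝ, X - (b • e₀ + c • e₁ + d • e₂) ∈ R.tauGerm a := by
    intro X
    obtain ⟨b, c, d, hbcd⟩ := h4 X
    refine ⟨b, c, d, ?_⟩
    have e : X - (b • e₀ + c • e₁ + d • e₂) = (X - (b • f₀ + c • f₁ + d • f₂))
        - (b • (e₀ - f₀) + c • (e₁ - f₁) + d • (e₂ - f₂)) := by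
      simp only [smul_sub]; abel
    rw [e]
    exact sub_mem (flat _ hbcd) (add_mem (add_mem ((R.tauGerm a).smul_mem _ g0)
      ((R.tauGerm a).smul_mem _ g1)) ((R.tauGerm a).smul_mem _ g2))
  have rel : ∀ t ∈ I, R.tauGerm a ≤ R.tauGerm t →
      Sl2At (R.tau e₀) (R.tau e₁) (R.tau e₂) t := by
    intro t ht hle
    have k0 := (hle r0).self_of_nhds
    have k1 := (hle r1).self_of_nhds
    have k2 := (hle r2).self_of_nhds
    rw [map_sub, Pi.sub_apply, R.tau_lie _ _ t ht, Pi.zero_apply] at k0 k1 k2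
    rw [map_smul, Pi.smul_apply, smul_eq_mul] at k1
    exact ⟨by linarith, by linarith, by linarith⟩
  -- The relations spread from `a` to all of `I` by connectedness. The good set is open by
  -- uniqueness for differential equations; it is closed in `I` because the three functions cannot
  -- acquire a common zero in the limit.
  let good : Set ℝ := {t | t ∈ I ∧ R.tauGerm a ≤ R.tauGerm t ∧
    ¬ (R.tau e₀ t = 0 ∧ R.tau e₁ t = 0 ∧ R.tau e₂ t = 0)}
  have nbhd : ∀ t ∈ I, ¬ (R.tau e₀ t = 0 ∧ R.tau e₁ t = 0 ∧ R.tau e₂ t = 0) →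
      ∃ r > 0, Metric.ball t r ⊆ I ∧ ∀ x ∈ Metric.ball t r, R.tauGerm t = R.tauGerm x ∧
        ¬ (R.tau e₀ x = 0 ∧ R.tau e₁ x = 0 ∧ R.tau e₂ x = 0) := by
    intro t ht hne
    obtain ⟨e, he, het⟩ : ∃ e, (e = e₀ ∨ e = e₁ ∨ e = e₂) ∧ R.tau e t ≠ 0 := by
      by_contra hcon
      push Not at hcon
      exact hne ⟨hcon e₀ (by simp), hcon e₁ (by simp), hcon e₂ (by simp)⟩
    obtain ⟨r, hr, hrI, hr0⟩ := exists_ball_ne_zero hI (R.smooth_tau e).continuousOn ht het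
    refine ⟨r, hr, hrI, fun x hx => ⟨le_antisymm ?_ ?_, ?_⟩⟩
    · exact R.tauGerm_le hI Metric.isOpen_ball hrI (ordConnected_ball t r) hr0
        (Metric.mem_ball_self hr) hx
    · exact R.tauGerm_le hI Metric.isOpen_ball hrI (ordConnected_ball t r) hr0
        hx (Metric.mem_ball_self hr)
    · rintro ⟨z0, z1, z2⟩
      rcases he with rfl | rfl | rfl
      · exact hr0 x hx z0
      · exact hr0 x hx z1
      · exact hr0 x hx z2
  have hopen : IsOpen good := by
    rw [Metric.isOpen_iff]
    rintro t ⟨ht, hle, hne⟩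
    obtain ⟨r, hr, hrI, hb⟩ := nbhd t ht hne
    exact ⟨r, hr, fun x hx => ⟨hrI hx, (hb x hx).1 ▸ hle, (hb x hx).2⟩⟩
  have haS : a ∈ good := by
    refine ⟨ha, le_rfl, fun hz => h0 ?_⟩
    have := g0.self_of_nhds
    rw [map_sub, Pi.sub_apply, hz.1] at this
    rw [εdef]
    simpa using this
  have hall : I ⊆ good := by
    refine hIc.isPreconnected.subset_of_closure_inter_subset hopen ⟨a, ha, haS⟩ ?_
    rintro b ⟨hbS, hbI⟩
    have hd : ∀ e : L, ContDiffAt ℝ 1 (R.tau e) b := fun e =>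
      (R.contDiffAt_tau hI e hbI).of_le (by simp)
    have hne := Sl2At.ne_zero_of_mem_closure (fun t ht => rel t ht.1 ht.2.1)
      (fun t ht => ht.2.2) hbS (hd e₀) (hd e₁) (hd e₂)
    obtain ⟨r, hr, hrI, hb⟩ := nbhd b hbI hne
    obtain ⟨t, ht, htS⟩ := Metric.mem_closure_iff.1 hbS r hr
    have htb : t ∈ Metric.ball b r := by rwa [Metric.mem_ball, dist_comm]
    exact ⟨hbI, (hb t htb).1 ▸ ht.2.1, hne⟩
  refine ⟨e₀, e₁, e₂, ⟨R.scal_lie _ _, ?_, R.scal_lie _ _⟩,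
    fun t ht => rel t ht (hall ht).2.1, fun t ht => (hall ht).2.2, fun X => ?_⟩
  · rw [map_smul, R.scal_lie, smul_zero]
  · obtain ⟨b, c, d, hbcd⟩ := rs X
    refine ⟨b, c, d, fun t ht => ?_⟩
    have := ((hall ht).2.1 hbcd).self_of_nhds
    simp only [map_sub, map_add, map_smul, Pi.sub_apply, Pi.add_apply, Pi.smul_apply,
      smul_eq_mul, Pi.zero_apply] at this
    linarith

end AffineAction
end

noncomputable section

/-! ### Finite-dimensional representations in which all lowest weights are `-1/2` -/

section Sl2Rep

variable {V : Type*} [AddCommGroup V] [Module ℝ V]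

open Polynomial in
-- On polynomials in `E`, commutation with `H` is the derivation `-E d/dE`.
theorem aeval_commutator {E H : Module.End ℝ V} (h : H * E = E * H - E) (q : ℝ[X]) :
    H * aeval E q = aeval E q * H - E * aeval E (derivative q) := by
  have hpow : ∀ k : ℕ, H * E ^ k = E ^ k * H - (k : ℝ) • E ^ k := by
    intro k
    induction k with
    | zero => simp
    | succ k ih =>
      rw [pow_succ, ← mul_assoc, ih, sub_mul, mul_assoc, h, mul_sub]
      simp only [smul_mul_assoc, ← mul_assoc]
      push_cast
      rw [add_smul, one_smul]
      abel
  induction q using Polynomial.induction_on' with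
  | add p q hp hq =>
    simp only [map_add, mul_add, add_mul, hp, hq]
    abel
  | monomial n a =>
    rw [aeval_monomial, derivative_monomial, aeval_monomial]
    rcases n with _ | n
    · simp [Algebra.commutes]
    · rw [← Algebra.smul_def, mul_smul_comm, hpow, smul_sub, smul_mul_assoc,
        ← Algebra.smul_def, mul_smul_comm, Nat.add_sub_cancel, ← pow_succ', smul_smul]

open Polynomial in
-- For the minimal polynomial `p` the commutator gives `E p'(E) = 0`. Then `(deg p) p - X p'`
-- annihilates `E` and has smaller degree, so it is zero, and `p` is a power of `X`.
theorem pow_natDegree_minpoly_eq_zero [FiniteDimensional ℝ V] {E H : Module.End ℝ V}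
    (h : H * E = E * H - E) : E ^ (minpoly ℝ E).natDegree = 0 := by
  set p := minpoly ℝ E with hp
  have hint : IsIntegral ℝ E := Algebra.IsIntegral.isIntegral E
  have hmon : p.Monic := minpoly.monic hint
  have h0 : aeval E (X * derivative p) = 0 := by
    have := aeval_commutator h p
    rw [hp, minpoly.aeval, mul_zero, zero_mul, zero_sub, eq_comm, neg_eq_zero] at this
    rw [map_mul, aeval_X, hp, this]
  have h1 : aeval E (C (p.natDegree : ℝ) * p - X * derivative p) = 0 := by
    rw [map_sub, map_mul, h0, hp, minpoly.aeval, mul_zero, sub_zero]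
  have hc : ∀ k, (C (p.natDegree : ℝ) * p - X * derivative p).coeff k =
      ((p.natDegree : ℝ) - k) * p.coeff k := by
    intro k
    rcases k with _ | k
    · simp
    · rw [coeff_sub, coeff_C_mul, coeff_X_mul, coeff_derivative]; push_cast; ring
  have h2 : C (p.natDegree : ℝ) * p - X * derivative p = 0 := by
    by_contra hne
    have hdvd : p ∣ C (p.natDegree : ℝ) * p - X * derivative p := minpoly.dvd ℝ E h1
    refine hne (eq_zero_of_dvd_of_degree_lt hdvd ?_)
    rw [degree_eq_natDegree hmon.ne_zero, degree_lt_iff_coeff_zero]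
    intro m hm
    rw [hc]
    rcases hm.lt_or_eq with hlt | rfl
    · rw [coeff_eq_zero_of_natDegree_lt hlt, mul_zero]
    · simp
  have h3 : p = X ^ p.natDegree := by
    ext k
    have := hc k
    rw [h2, coeff_zero, eq_comm, mul_eq_zero] at this
    rw [coeff_X_pow]
    split_ifs with hk
    · rw [hk]; exact hmon
    · refine this.resolve_left fun h => hk ?_
      have : (p.natDegree : ℝ) = k := by linarith
      exact_mod_cast this.symm
  have := minpoly.aeval ℝ E
  rw [← hp, h3, map_pow, aeval_X] at this
  exact this

/-- Let `n` be the least exponent with `E^n = 0` and `w = E^(n-1) v ≠ 0`. Since `E w = 0`, the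
weight of `w` is `-1/2`, so `E^(n-1) H v = (n - 3/2) w`. Applying `F E^n = E^n F - 2n E^(n-1) H +
n(n-1) E^(n-1)` to `v` gives `n (n - 2) w = 0`, impossible for `n ≥ 3`. -/
theorem sq_eq_zero_of_lowest_weight [FiniteDimensional ℝ V] {E H F : Module.End ℝ V}
    (h1 : H * E = E * H - E) (h2 : F * E = E * F - (2 : ℝ) • H)
    (hker : ∀ v, E v = 0 → H v = (-1 / 2 : ℝ) • v) : ∀ v, E (E v) = 0 := by
  classical
  have hnil : ∃ n, E ^ n = 0 := ⟨_, pow_natDegree_minpoly_eq_zero h1⟩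
  set n := Nat.find hnil with hn
  have hEn : E ^ n = 0 := Nat.find_spec hnil
  by_cases hn2 : n ≤ 2
  · intro v
    have : E ^ 2 = 0 := by
      rw [← Nat.sub_add_cancel hn2, pow_add, hEn, mul_zero]
    have := LinearMap.congr_fun this v
    simpa [pow_two] using this
  · exfalso
    obtain ⟨m, hm⟩ : ∃ m, n = m + 3 := ⟨n - 3, by omega⟩
    have hmin : E ^ (m + 2) ≠ 0 := Nat.find_min hnil (by omega)
    have hH : ∀ k : ℕ, H * E ^ k = E ^ k * H - (k : ℝ) • E ^ k := by
      intro k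
      induction k with
      | zero => simp
      | succ k ih =>
        rw [pow_succ, ← mul_assoc, ih, sub_mul, mul_assoc, h1, mul_sub]
        simp only [smul_mul_assoc, ← mul_assoc]
        push_cast
        rw [add_smul, one_smul]
        abel
    have hF : ∀ k : ℕ, F * E ^ (k + 1) = E ^ (k + 1) * F - (2 * (k + 1) : ℝ) • (E ^ k * H)
        + ((k + 1) * k : ℝ) • E ^ k := by
      intro k
      induction k with
      | zero => simp [h2]
      | succ k ih =>
        rw [pow_succ, ← mul_assoc, ih, add_mul, sub_mul, mul_assoc, h2, mul_sub, smul_mul_assoc,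
          mul_assoc, h1, mul_sub, ← mul_assoc, ← mul_assoc, ← pow_succ, ← pow_succ,
          smul_mul_assoc, ← pow_succ, mul_smul_comm]
        push_cast
        module
    have e1 := hF (m + 2)
    rw [show m + 2 + 1 = n by omega, hEn, mul_zero, zero_mul, zero_sub] at e1
    obtain ⟨v, hv⟩ : ∃ v, (E ^ (m + 2)) v ≠ 0 := by
      by_contra hcon
      push Not at hcon
      exact hmin (LinearMap.ext hcon)
    have e2 : E ((E ^ (m + 2)) v) = 0 := by
      have : E ^ (m + 3) = 0 := by rw [← hm]; exact hEn
      rw [← Module.End.mul_apply, ← pow_succ', this, LinearMap.zero_apply]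
    have e3 := hker _ e2
    have e4 := LinearMap.congr_fun (hH (m + 2)) v
    have e5 := LinearMap.congr_fun e1 v
    simp only [Module.End.mul_apply, LinearMap.sub_apply, LinearMap.smul_apply,
      LinearMap.add_apply, LinearMap.neg_apply, LinearMap.zero_apply] at e4 e5
    rw [e3] at e4
    have e6 : ((m + 3 : ℝ) * (m + 1)) • (E ^ (m + 2)) v = 0 := by
      push_cast at e4 e5
      have e7 : (E ^ (m + 2)) (H v) = (-1 / 2 : ℝ) • (E ^ (m + 2)) v
          + (m + 2 : ℝ) • (E ^ (m + 2)) v := by rw [e4]; abel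
      rw [e7] at e5
      have e8 : ((m + 3 : ℝ) * (m + 1)) • (E ^ (m + 2)) v =
          -(-((2 * (m + 2 + 1) : ℝ) • ((-1 / 2 : ℝ) • (E ^ (m + 2)) v
            + (m + 2 : ℝ) • (E ^ (m + 2)) v)) + ((m + 2 + 1) * (m + 2) : ℝ) • (E ^ (m + 2)) v) := by
        module
      rw [e8, ← e5, neg_zero]
    have hm0 : ((m + 3 : ℝ) * (m + 1)) ≠ 0 := by positivity
    exact hv ((smul_eq_zero.1 e6).resolve_left hm0)

end Sl2Rep

/-! ### Translations and frames -/

namespace AffineAction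

variable {I : Set ℝ} {S : Type*} {L : Type*} [LieRing L] [LieAlgebra ℝ L]
  (R : AffineAction I S L)

/-- The elements without component along `∂_t`. -/
def vertical : Submodule ℝ L where
  carrier := {X | ∀ t ∈ I, R.tau X t = 0}
  add_mem' := fun {X Y} hX hY t ht => by simp [hX t ht, hY t ht]
  zero_mem' := fun t _ => by simp
  smul_mem' := fun c X hX t ht => by simp [hX t ht]

/-- The translations `λ_s(t) ∂_u`. -/
def trans : Submodule ℝ L := R.vertical ⊓ LinearMap.ker R.scal

theorem lie_mem_vertical (hI : IsOpen I) (X : L) {Y : L} (hY : Y ∈ R.vertical) :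
    ⁅X, Y⁆ ∈ R.vertical := fun t ht => by
  rw [R.tau_lie X Y t ht, hY t ht, R.deriv_tau_eq_zero hI hY t ht]; ring

theorem lie_mem_trans (hI : IsOpen I) (X : L) {Y : L} (hY : Y ∈ R.vertical) :
    ⁅X, Y⁆ ∈ R.trans :=
  ⟨R.lie_mem_vertical hI X hY, R.scal_lie X Y⟩

/-- The coefficients of translations are acted on as densities of weight `-1/2`. -/
theorem lam_lie_trans (hI : IsOpen I) {X Y : L} (hX : R.scal X = 0) (hY : Y ∈ R.trans) (s : S)
    {t : ℝ} (ht : t ∈ I) : R.lam ⁅X, Y⁆ s t =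
      R.tau X t * deriv (R.lam Y s) t - R.lam Y s t * (deriv (R.tau X) t / 2) := by
  rw [R.lam_lie X Y s t ht, hX, hY.2, hY.1 t ht, R.deriv_tau_eq_zero hI hY.1 t ht]
  simp

theorem lie_trans_trans (hI : IsOpen I) {X Y : L} (hX : X ∈ R.trans) (hY : Y ∈ R.trans) :
    ⁅X, Y⁆ = 0 := by
  apply R.ext_zero _ (R.lie_mem_vertical hI X hY.1) (R.scal_lie X Y)
  intro s t ht
  rw [R.lam_lie_trans hI hX.2 hY s ht, hX.1 t ht, R.deriv_tau_eq_zero hI hX.1 t ht]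
  simp

theorem trans_ext {X : L} (hX : X ∈ R.trans) (h : ∀ s, ∀ t ∈ I, R.lam X s t = 0) : X = 0 :=
  R.ext_zero X hX.1 hX.2 h

/-- A copy of `sl(2)` without common zeros which carries all the components along `∂_t`. -/
structure Frame where
  e₀ : L
  e₁ : L
  e₂ : L
  scal₀ : R.scal e₀ = 0
  scal₁ : R.scal e₁ = 0
  scal₂ : R.scal e₂ = 0
  rel : ∀ t ∈ I, Sl2At (R.tau e₀) (R.tau e₁) (R.tau e₂) t
  ne_zero : ∀ t ∈ I, ¬ (R.tau e₀ t = 0 ∧ R.tau e₁ t = 0 ∧ R.tau e₂ t = 0)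
  span : ∀ X, ∃ a b c : ℝ, ∀ t ∈ I,
    R.tau X t = a * R.tau e₀ t + b * R.tau e₁ t + c * R.tau e₂ t

namespace Frame

variable {R} (f : R.Frame)

/-- In the coordinate `θ = e₁ / e₀` this is the change to `-1/θ`; `neg` is the change to `-θ` and
`shift` the change to `θ - k`. Together they suffice to adapt a frame to a point. -/
def swap : R.Frame where
  e₀ := f.e₂
  e₁ := -f.e₁
  e₂ := f.e₀
  scal₀ := f.scal₂
  scal₁ := by rw [map_neg, f.scal₁, neg_zero]
  scal₂ := f.scal₀
  rel := fun t ht => by rw [map_neg]; exact (f.rel t ht).swap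
  ne_zero := fun t ht h => f.ne_zero t ht ⟨h.2.2, by simpa using h.2.1, h.1⟩
  span := fun X => by
    obtain ⟨a, b, c, h⟩ := f.span X
    exact ⟨c, -b, a, fun t ht => by rw [h t ht, map_neg, Pi.neg_apply]; ring⟩

def neg : R.Frame where
  e₀ := -f.e₀
  e₁ := f.e₁
  e₂ := -f.e₂
  scal₀ := by rw [map_neg, f.scal₀, neg_zero]
  scal₁ := f.scal₁
  scal₂ := by rw [map_neg, f.scal₂, neg_zero]
  rel := fun t ht => by rw [map_neg, map_neg]; exact (f.rel t ht).neg
  ne_zero := fun t ht h => f.ne_zero t ht ⟨by simpa using h.1, h.2.1, by simpa using h.2.2⟩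
  span := fun X => by
    obtain ⟨a, b, c, h⟩ := f.span X
    exact ⟨-a, b, -c, fun t ht => by
      rw [h t ht, map_neg, map_neg, Pi.neg_apply, Pi.neg_apply]; ring⟩

def shift (hI : IsOpen I) (k : ℝ) : R.Frame where
  e₀ := f.e₀
  e₁ := f.e₁ - k • f.e₀
  e₂ := f.e₂ - (2 * k) • f.e₁ + k ^ 2 • f.e₀
  scal₀ := f.scal₀
  scal₁ := by simp [f.scal₀, f.scal₁]
  scal₂ := by simp [f.scal₀, f.scal₁, f.scal₂]
  rel := fun t ht => by
    have hd : ∀ X, HasDerivAt (R.tau X) (deriv (R.tau X) t) t := fun X =>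
      ((R.contDiffAt_tau hI X ht).differentiableAt (by simp)).hasDerivAt
    have d1 : deriv (R.tau (f.e₁ - k • f.e₀)) t =
        deriv (R.tau f.e₁) t - k * deriv (R.tau f.e₀) t := by
      rw [map_sub, map_smul]
      exact ((hd f.e₁).sub ((hd f.e₀).const_smul k)).deriv
    have d2 : deriv (R.tau (f.e₂ - (2 * k) • f.e₁ + k ^ 2 • f.e₀)) t =
        deriv (R.tau f.e₂) t - 2 * k * deriv (R.tau f.e₁) t + k ^ 2 * deriv (R.tau f.e₀) t := by
      rw [map_add, map_sub, map_smul, map_smul]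
      exact (((hd f.e₂).sub ((hd f.e₁).const_smul (2 * k))).add
        ((hd f.e₀).const_smul (k ^ 2))).deriv
    obtain ⟨h1, h2, h3⟩ := f.rel t ht
    simp only [Sl2At, d1, d2]
    simp only [map_add, map_sub, map_smul, Pi.add_apply, Pi.sub_apply, Pi.smul_apply,
      smul_eq_mul]
    refine ⟨?_, ?_, ?_⟩
    · linear_combination h1
    · linear_combination h2 - 2 * k * h1
    · linear_combination h3 - k * h2 + k ^ 2 * h1
  ne_zero := fun t ht h => f.ne_zero t ht (by
    obtain ⟨h1, h2, h3⟩ := h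
    simp only [map_add, map_sub, map_smul, Pi.add_apply, Pi.sub_apply, Pi.smul_apply,
        smul_eq_mul, h1] at h2 h3
    have h4 : R.tau f.e₁ t = 0 := by linarith
    rw [h4] at h3
    exact ⟨h1, h4, by linarith⟩)
  span := fun X => by
    obtain ⟨a, b, c, h⟩ := f.span X
    refine ⟨a + b * k + c * k ^ 2, b + 2 * c * k, c, fun t ht => ?_⟩
    rw [h t ht]
    simp only [map_add, map_sub, map_smul, Pi.add_apply, Pi.sub_apply, Pi.smul_apply,
        smul_eq_mul]
    ring

end Frame
end AffineAction
end

/-! ### Translations as a module over a frame; their unique continuation -/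

noncomputable section

namespace AffineAction

variable {I : Set ℝ} {S : Type*} {L : Type*} [LieRing L] [LieAlgebra ℝ L]
  {R : AffineAction I S L}

theorem exists_frame (R : AffineAction I S L) [FiniteDimensional ℝ L] (hI : IsOpen I)
    (hIc : I.OrdConnected) (hns : ¬ LieAlgebra.IsSolvable L) : Nonempty R.Frame := by
  obtain ⟨e₀, e₁, e₂, ⟨h0, h1, h2⟩, h3, h4, h5⟩ := R.exists_sl2_frame hI hIc hns
  exact ⟨⟨e₀, e₁, e₂, h0, h1, h2, h3, h4, h5⟩⟩

/-- Every frame can be adapted to a given point. -/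
theorem Frame.exists_adapted (f : R.Frame) (hI : IsOpen I) {t : ℝ} (ht : t ∈ I) :
    ∃ f : R.Frame, 0 < R.tau f.e₀ t ∧ R.tau f.e₁ t = 0 := by
  have step1 : ∃ f : R.Frame, R.tau f.e₀ t ≠ 0 := by
    by_cases h : R.tau f.e₀ t = 0
    · refine ⟨f.swap, fun h2 => f.ne_zero t ht ⟨h, ?_, h2⟩⟩
      have := (f.rel t ht).sq_eq
      rw [h, zero_mul] at this
      simpa using this
    · exact ⟨f, h⟩
  obtain ⟨f, hf⟩ := step1
  have step2 : ∃ f : R.Frame, 0 < R.tau f.e₀ t := by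
    rcases hf.lt_or_gt with h | h
    · exact ⟨f.neg, by
        change 0 < R.tau (-f.e₀) t
        rw [map_neg, Pi.neg_apply]; linarith⟩
    · exact ⟨f, h⟩
  obtain ⟨f, hf⟩ := step2
  refine ⟨f.shift hI (R.tau f.e₁ t / R.tau f.e₀ t), hf, ?_⟩
  change R.tau (f.e₁ - (R.tau f.e₁ t / R.tau f.e₀ t) • f.e₀) t = 0
  rw [map_sub, map_smul, Pi.sub_apply, Pi.smul_apply, smul_eq_mul]
  field_simp
  ring

namespace Frame

variable (f : R.Frame)

/-- If `e₀` vanished near `t`, so would `e₁` because `e₁² = e₀ e₂`, and then the third relation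
gives `e₂ = 0` at `t`. -/
theorem mem_closure_ne_zero (hI : IsOpen I) {t : ℝ} (ht : t ∈ I) :
    t ∈ closure {x ∈ I | R.tau f.e₀ x ≠ 0} := by
  by_contra hcon
  have h0 : ∀ᶠ x in 𝓝 t, x ∈ I ∧ R.tau f.e₀ x = 0 := by
    filter_upwards [isClosed_closure.isOpen_compl.mem_nhds hcon, hI.mem_nhds ht] with x hx hxI
    refine ⟨hxI, ?_⟩
    by_contra hne
    exact hx (subset_closure ⟨hxI, hne⟩)
  have h1 : ∀ᶠ x in 𝓝 t, R.tau f.e₁ x = 0 := by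
    filter_upwards [h0] with x hx
    have := (f.rel x hx.1).sq_eq
    rw [hx.2, zero_mul] at this
    simpa using this
  have h2 : R.tau f.e₂ t = 0 := by
    have := (f.rel t ht).2.2
    have hd : R.tau f.e₁ =ᶠ[𝓝 t] fun _ => 0 := h1
    rw [hd.deriv_eq, h1.self_of_nhds, deriv_const] at this
    linarith
  exact f.ne_zero t ht ⟨h0.self_of_nhds.2, h1.self_of_nhds, h2⟩

theorem lie_sub_mem :
    ⁅f.e₀, f.e₁⁆ - f.e₀ ∈ R.trans ∧ ⁅f.e₀, f.e₂⁆ - (2 : ℝ) • f.e₁ ∈ R.trans ∧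
      ⁅f.e₁, f.e₂⁆ - f.e₂ ∈ R.trans := by
  refine ⟨⟨fun t ht => ?_, ?_⟩, ⟨fun t ht => ?_, ?_⟩, ⟨fun t ht => ?_, ?_⟩⟩
  · rw [map_sub, Pi.sub_apply, R.tau_lie _ _ t ht, (f.rel t ht).1, sub_self]
  · change R.scal _ = 0
    rw [map_sub, R.scal_lie, f.scal₀, sub_zero]
  · rw [map_sub, Pi.sub_apply, R.tau_lie _ _ t ht, (f.rel t ht).2.1, map_smul, Pi.smul_apply,
      smul_eq_mul, sub_self]
  · change R.scal _ = 0
    rw [map_sub, R.scal_lie, map_smul, f.scal₁, smul_zero, sub_zero]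
  · rw [map_sub, Pi.sub_apply, R.tau_lie _ _ t ht, (f.rel t ht).2.2, sub_self]
  · change R.scal _ = 0
    rw [map_sub, R.scal_lie, f.scal₂, sub_zero]

/-- A frame closes under the bracket only up to translations. These commute, so on translations the
frame acts as an honest `sl(2)`. -/
theorem lie_lie_of_sub_mem (hI : IsOpen I) {x y z X : L} (h : ⁅x, y⁆ - z ∈ R.trans)
    (hX : X ∈ R.trans) : ⁅x, ⁅y, X⁆⁆ - ⁅y, ⁅x, X⁆⁆ = ⁅z, X⁆ := by
  have := R.lie_trans_trans hI h hX
  rw [sub_lie, sub_eq_zero] at this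
  rw [← this, lie_lie]

/-- A density killed by `e₀` is a constant multiple of the square root of `τ(e₀)`, on which `e₁`
acts by `-1/2`. The identity is checked where `τ(e₀) ≠ 0` and extended by density. -/
theorem lie_e₁_of_lie_e₀ (hI : IsOpen I) {X : L} (hX : X ∈ R.trans) (h : ⁅f.e₀, X⁆ = 0) :
    ⁅f.e₁, X⁆ = (-1 / 2 : ℝ) • X := by
  rw [← sub_eq_zero]
  refine R.trans_ext (sub_mem (R.lie_mem_trans hI f.e₁ hX.1) (R.trans.smul_mem _ hX))
    fun s t ht => ?_
  set Z := ⁅f.e₁, X⁆ - (-1 / 2 : ℝ) • X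
  have hz : ∀ x ∈ {x ∈ I | R.tau f.e₀ x ≠ 0}, R.lam Z s x = 0 := by
    rintro x ⟨hx, hx0⟩
    have h1 : R.lam Z s x = R.lam ⁅f.e₁, X⁆ s x + 1 / 2 * R.lam X s x := by
      simp only [Z, map_sub, map_smul, Pi.sub_apply, Pi.smul_apply, smul_eq_mul]
      ring
    rw [R.lam_lie_trans hI f.scal₁ hX s hx] at h1
    have h2 := R.lam_lie_trans hI f.scal₀ hX s hx
    rw [h, map_zero, Pi.zero_apply, Pi.zero_apply] at h2
    have h3 := (f.rel x hx).1
    have : R.tau f.e₀ x * R.lam Z s x = 0 := by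
      rw [h1]
      linear_combination (-R.tau f.e₁ x) * h2 - R.lam X s x / 2 * h3
    exact (mul_eq_zero.1 this).resolve_left hx0
  have hc : ContinuousWithinAt (R.lam Z s) {x ∈ I | R.tau f.e₀ x ≠ 0} t :=
    (R.contDiffAt_lam hI Z s ht).continuousAt.continuousWithinAt
  have := hc.mem_closure_image (f.mem_closure_ne_zero hI ht)
  have hs : R.lam Z s '' {x ∈ I | R.tau f.e₀ x ≠ 0} ⊆ {0} := by
    rintro _ ⟨x, hx, rfl⟩
    exact hz x hx
  simpa using closure_mono hs this

/-- The preceding lemma supplies the lowest weight `-1/2` in the representation on translations.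
Only copies of the two-dimensional module can then occur. -/
theorem lie_e₀_lie_e₀ [FiniteDimensional ℝ L] (hI : IsOpen I) {X : L} (hX : X ∈ R.trans) :
    ⁅f.e₀, ⁅f.e₀, X⁆⁆ = 0 := by
  let A : L → Module.End ℝ R.trans := fun x =>
    (LieAlgebra.ad ℝ L x).restrict (p := R.trans) (q := R.trans)
      fun X hX => R.lie_mem_trans hI x hX.1
  have hA : ∀ x (X : R.trans), ((A x X : R.trans) : L) = ⁅x, (X : L)⁆ := fun x X => rfl
  obtain ⟨h1, h2, h3⟩ := f.lie_sub_mem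
  have key := sq_eq_zero_of_lowest_weight (E := A f.e₀) (H := A f.e₁) (F := A f.e₂)
    (by
      ext X
      simp only [Module.End.mul_apply, LinearMap.sub_apply, Submodule.coe_sub, hA]
      exact eq_sub_of_add_eq' (sub_eq_iff_eq_add.1 (lie_lie_of_sub_mem hI h1 X.2)).symm)
    (by
      ext X
      simp only [Module.End.mul_apply, LinearMap.sub_apply, LinearMap.smul_apply,
        Submodule.coe_sub, Submodule.coe_smul, hA]
      rw [← smul_lie, ← lie_lie_of_sub_mem hI h2 X.2]; abel)
    (by
      intro X hX
      ext
      rw [hA, Submodule.coe_smul]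
      refine f.lie_e₁_of_lie_e₀ hI X.2 ?_
      rw [← hA, hX, Submodule.coe_zero]) ⟨X, hX⟩
  have := congrArg (fun X : R.trans => (X : L)) key
  simpa [hA] using this

end Frame

/-- The translations that vanish near `t`. -/
def transGerm (R : AffineAction I S L) (t : ℝ) : Submodule ℝ L where
  carrier := {X | X ∈ R.trans ∧ ∀ s, R.lam X s =ᶠ[𝓝 t] 0}
  add_mem' := fun {X Y} hX hY => ⟨add_mem hX.1 hY.1, fun s => by
    have : R.lam X s + R.lam Y s =ᶠ[𝓝 t] 0 + 0 := EventuallyEq.add (hX.2 s) (hY.2 s)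
    simpa using this⟩
  zero_mem' := ⟨zero_mem _, by simp⟩
  smul_mem' := fun c X hX => ⟨R.trans.smul_mem c hX.1, fun s => by
    have : c • R.lam X s =ᶠ[𝓝 t] c • 0 := EventuallyEq.const_smul (hX.2 s) c
    simpa using this⟩

theorem lam_eqOn_zero [FiniteDimensional ℝ L] (hI : IsOpen I) {W : Submodule ℝ L}
    (hWt : W ≤ R.trans) {h : L} (hh : R.scal h = 0) (hW : ∀ X ∈ W, ⁅h, X⁆ ∈ W) {U : Set ℝ}
    (hUI : U ⊆ I) (hU : U.OrdConnected) (h0 : ∀ t ∈ U, R.tau h t ≠ 0) {a : ℝ} (ha : a ∈ U)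
    (hz : ∀ X ∈ W, ∀ s, R.lam X s a = 0) : ∀ X ∈ W, ∀ s, ∀ t ∈ U, R.lam X s t = 0 := by
  intro X hX s
  have := family_eqOn_zero (V := W) hU (LinearMap.proj s ∘ₗ R.lam ∘ₗ W.subtype)
    ((LieAlgebra.ad ℝ L h).restrict hW) (h := R.tau h) (k := fun t => deriv (R.tau h) t / 2)
    ((R.smooth_tau h).continuousOn.mono hUI)
    (((R.continuousOn_deriv_tau hI h).mono hUI).div_const 2) h0
    (fun X t ht => (R.contDiffAt_lam hI X s (hUI ht)).differentiableAt (by simp))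
    (fun X t ht => by
      have := R.lam_lie_trans hI hh (hWt X.2) s (hUI ht)
      change R.tau h t * deriv (R.lam X s) t =
        deriv (R.tau h) t / 2 * R.lam X s t + R.lam ⁅h, (X : L)⁆ s t
      linarith) ha (fun X => hz X X.2 s)
  exact fun t ht => this ⟨X, hX⟩ t ht

theorem lie_mem_transGerm (hI : IsOpen I) {t : ℝ} (ht : t ∈ I) {h : L} (hh : R.scal h = 0)
    {X : L} (hX : X ∈ R.transGerm t) : ⁅h, X⁆ ∈ R.transGerm t := by
  refine ⟨R.lie_mem_trans hI h hX.1.1, fun s => ?_⟩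
  have hX' : deriv (R.lam X s) =ᶠ[𝓝 t] deriv 0 := EventuallyEq.deriv (hX.2 s)
  filter_upwards [hX.2 s, hX', hI.mem_nhds ht] with x h1 h2 h3
  rw [R.lam_lie_trans hI hh hX.1 s h3, h1, h2]
  simp

theorem transGerm_le [FiniteDimensional ℝ L] (hI : IsOpen I) {h : L} (hh : R.scal h = 0)
    {U : Set ℝ} (hUo : IsOpen U) (hUI : U ⊆ I) (hU : U.OrdConnected)
    (h0 : ∀ t ∈ U, R.tau h t ≠ 0) {a b : ℝ} (ha : a ∈ U) (hb : b ∈ U) :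
    R.transGerm a ≤ R.transGerm b := by
  intro X hX
  have := lam_eqOn_zero hI (W := R.transGerm a) (fun X hX => hX.1) hh
    (fun X hX => lie_mem_transGerm hI (hUI ha) hh hX) hUI hU h0 ha
    (fun X hX s => (hX.2 s).self_of_nhds) X hX
  refine ⟨hX.1, fun s => ?_⟩
  filter_upwards [hUo.mem_nhds hb] with x hx using this s x hx

/-- At every time some member of the frame has nonzero `τ`, so the space of translations vanishing
near `t` is locally constant in `t`, hence constant on `I`. -/
theorem Frame.transGerm_eq_bot [FiniteDimensional ℝ L] (f : R.Frame) (hI : IsOpen I)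
    (hIc : I.OrdConnected) {a : ℝ} (ha : a ∈ I) : R.transGerm a = ⊥ := by
  have nbhd : ∀ t ∈ I, ∃ r > 0, Metric.ball t r ⊆ I ∧ ∀ x ∈ Metric.ball t r,
      R.transGerm t = R.transGerm x := by
    intro t ht
    obtain ⟨e, he, hes, het⟩ : ∃ e, (e = f.e₀ ∨ e = f.e₁ ∨ e = f.e₂) ∧ R.scal e = 0 ∧
        R.tau e t ≠ 0 := by
      by_contra hcon
      push Not at hcon
      exact f.ne_zero t ht ⟨hcon f.e₀ (by simp) f.scal₀, hcon f.e₁ (by simp) f.scal₁,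
        hcon f.e₂ (by simp) f.scal₂⟩
    obtain ⟨r, hr, hrI, hr0⟩ := exists_ball_ne_zero hI (R.smooth_tau e).continuousOn ht het
    refine ⟨r, hr, hrI, fun x hx => le_antisymm ?_ ?_⟩
    · exact transGerm_le hI hes Metric.isOpen_ball hrI (ordConnected_ball t r) hr0
        (Metric.mem_ball_self hr) hx
    · exact transGerm_le hI hes Metric.isOpen_ball hrI (ordConnected_ball t r) hr0
        hx (Metric.mem_ball_self hr)
  let good : Set ℝ := {t | t ∈ I ∧ R.transGerm t = R.transGerm a}
  have hopen : IsOpen good := by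
    rw [Metric.isOpen_iff]
    rintro t ⟨ht, hle⟩
    obtain ⟨r, hr, hrI, hb⟩ := nbhd t ht
    exact ⟨r, hr, fun x hx => ⟨hrI hx, (hb x hx).symm.trans hle⟩⟩
  have hall : I ⊆ good := by
    refine hIc.isPreconnected.subset_of_closure_inter_subset hopen ⟨a, ha, ha, rfl⟩ ?_
    rintro b ⟨hbS, hbI⟩
    obtain ⟨r, hr, hrI, hb⟩ := nbhd b hbI
    obtain ⟨t, ht, htS⟩ := Metric.mem_closure_iff.1 hbS r hr
    have htb : t ∈ Metric.ball b r := by rwa [Metric.mem_ball, dist_comm]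
    exact ⟨hbI, (hb t htb).trans ht.2⟩
  rw [Submodule.eq_bot_iff]
  intro X hX
  refine R.trans_ext hX.1 fun s t ht => ?_
  rw [← (hall ht).2] at hX
  exact (hX.2 s).self_of_nhds

/-- A translation is determined by its value and its derivative along `e₀` at one point. -/
theorem Frame.trans_eq_zero [FiniteDimensional ℝ L] (f : R.Frame) (hI : IsOpen I)
    (hIc : I.OrdConnected) {a : ℝ} (ha : a ∈ I) (h0 : R.tau f.e₀ a ≠ 0) {X : L}
    (hX : X ∈ R.trans) (h1 : ∀ s, R.lam X s a = 0) (h2 : ∀ s, R.lam ⁅f.e₀, X⁆ s a = 0) :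
    X = 0 := by
  -- Because `e₀` has square zero on translations, these conditions define a space invariant under
  -- `e₀`, and the differential equation applies to it.
  let W : Submodule ℝ L :=
    { carrier := {X | X ∈ R.trans ∧ ∀ s, R.lam X s a = 0 ∧ R.lam ⁅f.e₀, X⁆ s a = 0}
      add_mem' := fun {X Y} hX hY => ⟨add_mem hX.1 hY.1, fun s => by
        simp [hX.2 s, hY.2 s]⟩
      zero_mem' := ⟨zero_mem _, by simp⟩
      smul_mem' := fun c X hX => ⟨R.trans.smul_mem c hX.1, fun s => by simp [hX.2 s]⟩ }
  obtain ⟨r, hr, hrI, hr0⟩ := exists_ball_ne_zero hI (R.smooth_tau f.e₀).continuousOn ha h0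
  have := lam_eqOn_zero hI (W := W) (fun X hX => hX.1) f.scal₀
    (fun X hX => ⟨R.lie_mem_trans hI _ hX.1.1, fun s => ⟨(hX.2 s).2, by
      rw [f.lie_e₀_lie_e₀ hI hX.1]; simp⟩⟩) hrI (ordConnected_ball a r) hr0
    (Metric.mem_ball_self hr) (fun X hX s => (hX.2 s).1) X ⟨hX, fun s => ⟨h1 s, h2 s⟩⟩
  have hg : X ∈ R.transGerm a := ⟨hX, fun s => by
    filter_upwards [Metric.ball_mem_nhds a hr] with x hx using this s x hx⟩
  rw [f.transGerm_eq_bot hI hIc ha] at hg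
  exact hg

end AffineAction
end

/-! ### Charts, the explicit form of the translations, and the dimension formula -/

noncomputable section

theorem exists_smooth_primitive {t₀ r : ℝ} {h : ℝ → ℝ}
    (hh : ContDiffOn ℝ ∞ h (Metric.ball t₀ r)) :
    ∃ H : ℝ → ℝ, ∀ t ∈ Metric.ball t₀ r, HasDerivAt H (h t) t := by
  refine ⟨fun t => ∫ x in t₀..t, h x, fun t ht => ?_⟩
  have ht₀ : t₀ ∈ Metric.ball t₀ r := Metric.mem_ball_self (dist_nonneg.trans_lt ht)
  have hs : uIcc t₀ t ⊆ Metric.ball t₀ r := (ordConnected_ball t₀ r).uIcc_subset ht₀ ht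
  exact intervalIntegral.integral_hasDerivAt_right
    ((hh.continuousOn.mono hs).intervalIntegrable)
    (hh.continuousOn.stronglyMeasurableAtFilter Metric.isOpen_ball t ht)
    (hh.continuousOn.continuousAt (Metric.isOpen_ball.mem_nhds ht))

theorem contDiffOn_of_hasDerivAt {U : Set ℝ} (hU : IsOpen U) {H h : ℝ → ℝ}
    (hH : ∀ t ∈ U, HasDerivAt H (h t) t) (hh : ContDiffOn ℝ ∞ h U) : ContDiffOn ℝ ∞ H U := by
  rw [contDiffOn_infty_iff_deriv_of_isOpen hU]
  exact ⟨fun t ht => (hH t ht).differentiableAt.differentiableWithinAt,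
    hh.congr fun t ht => (hH t ht).deriv⟩

theorem eq_of_hasDerivAt_zero {t₀ r : ℝ} {f : ℝ → ℝ}
    (hf : ∀ t ∈ Metric.ball t₀ r, HasDerivAt f 0 t) :
    ∀ t ∈ Metric.ball t₀ r, f t = f t₀ := fun t ht =>
  (convex_ball t₀ r).is_const_of_fderivWithin_eq_zero (𝕜 := ℝ)
    (fun x hx => (hf x hx).differentiableAt.differentiableWithinAt)
    (fun x hx => by
      rw [fderivWithin_of_isOpen Metric.isOpen_ball hx]
      ext
      simp [(hf x hx).deriv]) ht
    (Metric.mem_ball_self (dist_nonneg.trans_lt ht))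

namespace AffineAction

variable {I : Set ℝ} {S : Type*} {L : Type*} [LieRing L] [LieAlgebra ℝ L]
  {R : AffineAction I S L}

/-- The values of the functions `λ_s` at the time `t`. -/
def value (R : AffineAction I S L) (t : ℝ) : L →ₗ[ℝ] S → ℝ where
  toFun X s := R.lam X s t
  map_add' X Y := by ext; simp
  map_smul' c X := by ext; simp

@[simp] theorem value_apply (t : ℝ) (X : L) (s : S) : R.value t X s = R.lam X s t := rfl

/-- The values of the translations at the time `t`. -/
def values (R : AffineAction I S L) (t : ℝ) : Submodule ℝ (S → ℝ) := R.trans.map (R.value t)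

/-- The coefficients `a_s` of the elements without component along `∂_t`. -/
def scals (R : AffineAction I S L) : Submodule ℝ (S → ℝ) := R.vertical.map R.scal

instance [FiniteDimensional ℝ L] (t : ℝ) : Module.Finite ℝ (R.values t) := by
  unfold values; infer_instance

instance [FiniteDimensional ℝ L] : Module.Finite ℝ R.scals := by
  unfold scals; infer_instance

/-- A frame with a coordinate `θ = e₁ / e₀` around `t₀`. -/
structure Chart (R : AffineAction I S L) (t₀ : ℝ) extends Frame R where
  mem : t₀ ∈ I
  r : ℝ
  r_pos : 0 < r
  ball_subset : Metric.ball t₀ r ⊆ I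
  pos : ∀ t ∈ Metric.ball t₀ r, 0 < R.tau e₀ t
  zero₁ : R.tau e₁ t₀ = 0

theorem exists_chart (R : AffineAction I S L) [FiniteDimensional ℝ L] (hI : IsOpen I)
    (hIc : I.OrdConnected) (hns : ¬ LieAlgebra.IsSolvable L) {t₀ : ℝ} (ht₀ : t₀ ∈ I) :
    Nonempty (R.Chart t₀) := by
  obtain ⟨f⟩ := R.exists_frame hI hIc hns
  obtain ⟨f, h0, h1⟩ := f.exists_adapted hI ht₀
  have h2 : ∀ᶠ t in 𝓝 t₀, t ∈ I ∧ 0 < R.tau f.e₀ t :=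
    (hI.eventually_mem ht₀).and
      ((R.contDiffAt_tau hI f.e₀ ht₀).continuousAt.eventually_const_lt h0)
  obtain ⟨r, hr, hb⟩ := Metric.eventually_nhds_iff_ball.1 h2
  exact ⟨⟨f, ht₀, r, hr, fun t ht => (hb t ht).1, fun t ht => (hb t ht).2, h1⟩⟩

namespace Chart

variable {t₀ : ℝ} (K : R.Chart t₀)

def dom : Set ℝ := Metric.ball t₀ K.r

def θ (t : ℝ) : ℝ := R.tau K.e₁ t / R.tau K.e₀ t

def g (t : ℝ) : ℝ := √(R.tau K.e₀ t)

theorem isOpen_dom : IsOpen K.dom := Metric.isOpen_ball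

theorem mem_dom : t₀ ∈ K.dom := Metric.mem_ball_self K.r_pos

theorem dom_subset : K.dom ⊆ I := K.ball_subset

variable {t : ℝ}

theorem g_pos (ht : t ∈ K.dom) : 0 < K.g t := Real.sqrt_pos.2 (K.pos t ht)

theorem tau₀ (ht : t ∈ K.dom) : R.tau K.e₀ t = K.g t ^ 2 := (Real.sq_sqrt (K.pos t ht).le).symm

theorem tau₁ (ht : t ∈ K.dom) : R.tau K.e₁ t = K.θ t * K.g t ^ 2 := by
  have := (K.pos t ht).ne'
  rw [← K.tau₀ ht, θ]; field_simp

theorem tau₂ (ht : t ∈ K.dom) : R.tau K.e₂ t = K.θ t ^ 2 * K.g t ^ 2 := by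
  have h0 := (K.pos t ht).ne'
  have := (K.rel t (K.dom_subset ht)).sq_eq
  rw [← K.tau₀ ht, θ]; field_simp; linarith

theorem θ_zero : K.θ t₀ = 0 := by rw [θ, K.zero₁, zero_div]

theorem hasDerivAt_tau (hI : IsOpen I) (X : L) (ht : t ∈ I) :
    HasDerivAt (R.tau X) (deriv (R.tau X) t) t :=
  ((R.contDiffAt_tau hI X ht).differentiableAt (by simp)).hasDerivAt

theorem hasDerivAt_lam (hI : IsOpen I) (X : L) (s : S) (ht : t ∈ I) :
    HasDerivAt (R.lam X s) (deriv (R.lam X s) t) t :=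
  ((R.contDiffAt_lam hI X s ht).differentiableAt (by simp)).hasDerivAt

/-- The numerator of the derivative of `e₁ / e₀` is the bracket `{e₀, e₁} = e₀`. -/
theorem hasDerivAt_θ (hI : IsOpen I) (ht : t ∈ K.dom) :
    HasDerivAt K.θ ((K.g t ^ 2)⁻¹) t := by
  have h0 := (K.pos t ht).ne'
  refine ((hasDerivAt_tau (R := R) hI K.e₁ (K.dom_subset ht)).fun_div
    (hasDerivAt_tau hI K.e₀ (K.dom_subset ht)) h0).congr_deriv ?_
  have h1 := (K.rel t (K.dom_subset ht)).1
  rw [← K.tau₀ ht]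
  field_simp
  linarith

theorem contDiffOn_tau (X : L) : ContDiffOn ℝ ∞ (R.tau X) K.dom :=
  (R.smooth_tau X).mono K.dom_subset

theorem contDiffOn_θ : ContDiffOn ℝ ∞ K.θ K.dom :=
  (K.contDiffOn_tau _).div (K.contDiffOn_tau _) fun t ht => (K.pos t ht).ne'

theorem contDiffOn_g : ContDiffOn ℝ ∞ K.g K.dom :=
  (K.contDiffOn_tau _).sqrt fun t ht => (K.pos t ht).ne'

theorem hasDerivAt_g (ht : t ∈ K.dom) : HasDerivAt K.g (deriv K.g t) t :=
  ((K.contDiffOn_g.contDiffAt (K.isOpen_dom.mem_nhds ht)).differentiableAt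
    (by simp)).hasDerivAt

theorem deriv_tau_of_eqOn {X : L} {φ : ℝ → ℝ} {φ' : ℝ}
    (h : ∀ t ∈ K.dom, R.tau X t = φ t) (ht : t ∈ K.dom) (hd : HasDerivAt φ φ' t) :
    deriv (R.tau X) t = φ' := by
  have : R.tau X =ᶠ[𝓝 t] φ := by
    filter_upwards [K.isOpen_dom.mem_nhds ht] with x hx using h x hx
  rw [this.deriv_eq, hd.deriv]

theorem deriv_tau₀ (ht : t ∈ K.dom) : deriv (R.tau K.e₀) t = 2 * K.g t * deriv K.g t := by
  refine K.deriv_tau_of_eqOn (fun t ht => K.tau₀ ht) ht ?_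
  exact ((K.hasDerivAt_g ht).fun_pow 2).congr_deriv (by norm_num)

theorem deriv_tau₁ (hI : IsOpen I) (ht : t ∈ K.dom) :
    deriv (R.tau K.e₁) t = 1 + K.θ t * (2 * K.g t * deriv K.g t) := by
  refine K.deriv_tau_of_eqOn (fun t ht => K.tau₁ ht) ht ?_
  refine ((K.hasDerivAt_θ hI ht).fun_mul ((K.hasDerivAt_g ht).fun_pow 2)).congr_deriv ?_
  have := (K.g_pos ht).ne'
  norm_num
  field_simp

theorem deriv_tau₂ (hI : IsOpen I) (ht : t ∈ K.dom) :
    deriv (R.tau K.e₂) t = 2 * K.θ t + K.θ t ^ 2 * (2 * K.g t * deriv K.g t) := by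
  refine K.deriv_tau_of_eqOn (fun t ht => K.tau₂ ht) ht ?_
  refine (((K.hasDerivAt_θ hI ht).fun_pow 2).fun_mul
    ((K.hasDerivAt_g ht).fun_pow 2)).congr_deriv ?_
  have := (K.g_pos ht).ne'
  norm_num
  field_simp

theorem eq_zero_of_quadratic (hI : IsOpen I) {a b c : ℝ}
    (h : ∀ t ∈ K.dom, a + b * K.θ t + c * K.θ t ^ 2 = 0) : a = 0 ∧ b = 0 ∧ c = 0 := by
  have diff : ∀ {φ : ℝ → ℝ} {φ' : ℝ} {t : ℝ}, (∀ t ∈ K.dom, φ t = 0) → t ∈ K.dom →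
      HasDerivAt φ φ' t → φ' = 0 := by
    intro φ φ' t h0 ht hd
    have : φ =ᶠ[𝓝 t] fun _ => 0 := by
      filter_upwards [K.isOpen_dom.mem_nhds ht] with x hx using h0 x hx
    exact hd.unique ((hasDerivAt_const t (0 : ℝ)).congr_of_eventuallyEq this)
  have h1 : ∀ t ∈ K.dom, b + 2 * c * K.θ t = 0 := by
    intro t ht
    have hθ := K.hasDerivAt_θ hI ht
    have := diff h ht (((hθ.const_mul b).const_add a).fun_add ((hθ.fun_pow 2).const_mul c))
    have hg : (K.g t ^ 2)⁻¹ ≠ 0 := inv_ne_zero (pow_ne_zero 2 (K.g_pos ht).ne')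
    have e : (K.g t ^ 2)⁻¹ * (b + 2 * c * K.θ t) = 0 := by
      rw [← this]; norm_num; ring
    exact (mul_eq_zero.1 e).resolve_left hg
  have h2 : 2 * c = 0 := by
    have hθ := K.hasDerivAt_θ hI K.mem_dom
    have := diff h1 K.mem_dom ((hθ.const_mul (2 * c)).const_add b)
    have hg : (K.g t₀ ^ 2)⁻¹ ≠ 0 := inv_ne_zero (pow_ne_zero 2 (K.g_pos K.mem_dom).ne')
    exact (mul_eq_zero.1 this).resolve_right hg
  have ha := h t₀ K.mem_dom
  have hb := h1 t₀ K.mem_dom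
  rw [K.θ_zero] at ha hb
  refine ⟨?_, ?_, ?_⟩ <;> linarith

/-- A function whose derivative along `θ` is affine in `θ` is quadratic in `θ`. -/
theorem eq_quadratic (hI : IsOpen I) {m : ℝ → ℝ} {c d : ℝ}
    (hm : ∀ t ∈ K.dom, HasDerivAt m ((c + K.θ t * d) / K.g t ^ 2) t) :
    ∀ t ∈ K.dom, m t = m t₀ + c * K.θ t + d * K.θ t ^ 2 / 2 := by
  intro t ht
  have := eq_of_hasDerivAt_zero (f := fun t => m t - (c * K.θ t + d * K.θ t ^ 2 / 2))
    (t₀ := t₀) (r := K.r) (fun t ht => by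
      have hθ := K.hasDerivAt_θ hI ht
      refine ((hm t ht).fun_sub
        ((hθ.const_mul c).fun_add (((hθ.fun_pow 2).const_mul d).div_const 2))).congr_deriv ?_
      norm_num
      ring) t ht
  simp only [K.θ_zero] at this
  linarith

/-! #### Translations in a chart -/

theorem lam_lie_e₁ (hI : IsOpen I) {X : L} (hX : X ∈ R.trans) (s : S) (ht : t ∈ K.dom) :
    R.lam ⁅K.e₁, X⁆ s t = K.θ t * R.lam ⁅K.e₀, X⁆ s t - R.lam X s t / 2 := by
  rw [R.lam_lie_trans hI K.scal₁ hX s (K.dom_subset ht),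
    R.lam_lie_trans hI K.scal₀ hX s (K.dom_subset ht), K.tau₁ ht, K.tau₀ ht, K.deriv_tau₀ ht,
    K.deriv_tau₁ hI ht]
  ring

theorem lam_lie_e₂ (hI : IsOpen I) {X : L} (hX : X ∈ R.trans) (s : S) (ht : t ∈ K.dom) :
    R.lam ⁅K.e₂, X⁆ s t = K.θ t ^ 2 * R.lam ⁅K.e₀, X⁆ s t - K.θ t * R.lam X s t := by
  rw [R.lam_lie_trans hI K.scal₂ hX s (K.dom_subset ht),
    R.lam_lie_trans hI K.scal₀ hX s (K.dom_subset ht), K.tau₂ ht, K.tau₀ ht, K.deriv_tau₀ ht,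
    K.deriv_tau₂ hI ht]
  ring

/-- The translation with the prescribed value of `λ` at `t₀` and `⁅e₀, λ⁆ = 0`. -/
theorem exists_const [FiniteDimensional ℝ L] (hI : IsOpen I) {c : S → ℝ}
    (hc : c ∈ R.values t₀) : ∃ X ∈ R.trans, ⁅K.e₀, X⁆ = 0 ∧ R.value t₀ X = c := by
  obtain ⟨X, hX, rfl⟩ := hc
  have h2 := R.lie_mem_trans hI K.e₂ hX.1
  -- At `t₀`, where `θ = 0`, brackets with `e₂` vanish and `e₁` acts by `-1/2`. So `⁅e₀, ⁅e₂, X⁆⁆ =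
  -- ⁅e₂, ⁅e₀, X⁆⁆ + 2 ⁅e₁, X⁆` has the value `-c` there.
  refine ⟨-⁅K.e₀, ⁅K.e₂, X⁆⁆, neg_mem (R.lie_mem_trans hI _ h2.1), ?_, ?_⟩
  · rw [lie_neg, K.lie_e₀_lie_e₀ hI h2, neg_zero]
  · ext s
    have e := Frame.lie_lie_of_sub_mem hI K.lie_sub_mem.2.1 hX
    rw [smul_lie, sub_eq_iff_eq_add] at e
    rw [e]
    have h0 := R.lie_mem_trans hI K.e₀ hX.1
    simp only [map_neg, map_add, map_smul, Pi.neg_apply, Pi.add_apply, Pi.smul_apply,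
      value_apply, smul_eq_mul, K.lam_lie_e₁ hI hX s K.mem_dom,
      K.lam_lie_e₂ hI h0 s K.mem_dom, K.θ_zero]
    ring

theorem exists_of_values [FiniteDimensional ℝ L] (hI : IsOpen I) {c d : S → ℝ}
    (hc : c ∈ R.values t₀) (hd : d ∈ R.values t₀) :
    ∃ X ∈ R.trans, R.value t₀ X = c ∧ R.value t₀ ⁅K.e₀, X⁆ = d := by
  obtain ⟨X, hX, hX0, rfl⟩ := K.exists_const hI hc
  obtain ⟨Y, hY, hY0, rfl⟩ := K.exists_const hI hd
  -- The correction vanishes at `t₀`, while `⁅e₀, ⁅e₂, Y⁆⁆ = 2 ⁅e₁, Y⁆` has the value `-d`.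
  refine ⟨X - ⁅K.e₂, Y⁆, sub_mem hX (R.lie_mem_trans hI _ hY.1), ?_, ?_⟩
  · ext s
    rw [map_sub, Pi.sub_apply, value_apply, value_apply, K.lam_lie_e₂ hI hY s K.mem_dom,
      K.θ_zero]
    ring
  · ext s
    have e := Frame.lie_lie_of_sub_mem hI K.lie_sub_mem.2.1 hY
    rw [hY0, lie_zero, sub_zero, smul_lie] at e
    rw [lie_sub, hX0, e, map_sub, map_zero, map_smul, Pi.sub_apply, Pi.smul_apply,
      value_apply, value_apply, K.lam_lie_e₁ hI hY s K.mem_dom, K.θ_zero, smul_eq_mul]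
    simp only [Pi.zero_apply]
    ring

/-- The translations killed by `e₀` are `g(t) c_s ∂_u`. -/
theorem lam_eq_of_lie_eq_zero (hI : IsOpen I) {X : L} (hX : X ∈ R.trans)
    (h : ⁅K.e₀, X⁆ = 0) (s : S) (ht : t ∈ K.dom) :
    R.lam X s t = K.g t * (R.lam X s t₀ / K.g t₀) := by
  have := eq_of_hasDerivAt_zero (f := fun t => R.lam X s t / K.g t) (t₀ := t₀) (r := K.r)
    (fun t ht => by
      have hg := (K.g_pos ht).ne'
      refine ((hasDerivAt_lam hI X s (K.dom_subset ht)).fun_div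
        (K.hasDerivAt_g ht) hg).congr_deriv ?_
      have e := R.lam_lie_trans hI K.scal₀ hX s (K.dom_subset ht)
      rw [h, K.tau₀ ht, K.deriv_tau₀ ht] at e
      simp only [map_zero, Pi.zero_apply] at e
      have e2 : K.g t * (deriv (R.lam X s) t * K.g t - R.lam X s t * deriv K.g t) = 0 := by
        linarith
      rw [(mul_eq_zero.1 e2).resolve_left hg, zero_div]) t ht
  have hg := (K.g_pos ht).ne'
  have hg0 := (K.g_pos K.mem_dom).ne'
  field_simp at this ⊢
  linarith

theorem exists_lam_eq_const [FiniteDimensional ℝ L] (hI : IsOpen I) {c : S → ℝ}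
    (hc : c ∈ R.values t₀) :
    ∃ X ∈ R.trans, ⁅K.e₀, X⁆ = 0 ∧ ∀ s, ∀ t ∈ K.dom, R.lam X s t = K.g t * c s := by
  obtain ⟨X, hX, hX0, hX1⟩ := K.exists_const hI ((R.values t₀).smul_mem (K.g t₀) hc)
  refine ⟨X, hX, hX0, fun s t ht => ?_⟩
  have hg0 := (K.g_pos K.mem_dom).ne'
  have h1 := congrFun hX1 s
  rw [value_apply, Pi.smul_apply, smul_eq_mul] at h1
  rw [K.lam_eq_of_lie_eq_zero hI hX hX0 s ht, h1]
  field_simp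

/-- In a chart the translations are the fields `g(t) (c_s + θ(t) d_s) ∂_u`. -/
theorem exists_lam_eq [FiniteDimensional ℝ L] (hI : IsOpen I) {c d : S → ℝ}
    (hc : c ∈ R.values t₀) (hd : d ∈ R.values t₀) :
    ∃ X ∈ R.trans, ∀ s, ∀ t ∈ K.dom, R.lam X s t = K.g t * (c s + K.θ t * d s) := by
  obtain ⟨X, hX, _, hXc⟩ := K.exists_lam_eq_const hI hc
  obtain ⟨Y, hY, hY0, hYd⟩ := K.exists_lam_eq_const hI hd
  refine ⟨X - ⁅K.e₂, Y⁆, sub_mem hX (R.lie_mem_trans hI _ hY.1), fun s t ht => ?_⟩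
  rw [map_sub, Pi.sub_apply, Pi.sub_apply, K.lam_lie_e₂ hI hY s ht, hY0, hXc s t ht, hYd s t ht]
  simp only [map_zero, Pi.zero_apply]
  ring

theorem lam_eq [FiniteDimensional ℝ L] (hI : IsOpen I) (hIc : I.OrdConnected) {X : L}
    (hX : X ∈ R.trans) : ∃ c ∈ R.values t₀, ∃ d ∈ R.values t₀,
      ∀ s, ∀ t ∈ K.dom, R.lam X s t = K.g t * (c s + K.θ t * d s) := by
  have hg0 := (K.g_pos K.mem_dom).ne'
  have hc : (K.g t₀)⁻¹ • R.value t₀ X ∈ R.values t₀ :=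
    (R.values t₀).smul_mem _ ⟨X, hX, rfl⟩
  have hd : (K.g t₀)⁻¹ • R.value t₀ ⁅K.e₀, X⁆ ∈ R.values t₀ :=
    (R.values t₀).smul_mem _ ⟨_, R.lie_mem_trans hI _ hX.1, rfl⟩
  refine ⟨_, hc, _, hd, ?_⟩
  obtain ⟨Y, hY, hY0, hYc⟩ := K.exists_lam_eq_const hI hc
  obtain ⟨Z, hZ, hZ0, hZd⟩ := K.exists_lam_eq_const hI hd
  have e := Frame.lie_lie_of_sub_mem hI K.lie_sub_mem.2.1 hZ
  rw [hZ0, lie_zero, sub_zero, smul_lie] at e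
  -- Both sides have the same value and the same derivative along `e₀` at `t₀`, which determine a
  -- translation.
  have hX' : X = Y - ⁅K.e₂, Z⁆ := by
    rw [← sub_eq_zero]
    refine K.trans_eq_zero hI hIc K.mem (K.pos t₀ K.mem_dom).ne'
      (sub_mem hX (sub_mem hY (R.lie_mem_trans hI _ hZ.1))) (fun s => ?_) (fun s => ?_)
    · simp only [map_sub, Pi.sub_apply, K.lam_lie_e₂ hI hZ s K.mem_dom, K.θ_zero,
        hYc s t₀ K.mem_dom, Pi.smul_apply, smul_eq_mul, value_apply]
      field_simp
      ring
    · simp only [lie_sub, hY0, e, map_sub, map_zero, map_smul, Pi.sub_apply, Pi.zero_apply,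
        Pi.smul_apply, smul_eq_mul, K.lam_lie_e₁ hI hZ s K.mem_dom, K.θ_zero,
        hZd s t₀ K.mem_dom, value_apply]
      field_simp
      ring
  intro s t ht
  conv_lhs => rw [hX']
  rw [map_sub, Pi.sub_apply, Pi.sub_apply, K.lam_lie_e₂ hI hZ s ht, hZ0, hYc s t ht, hZd s t ht]
  simp only [map_zero, Pi.zero_apply]
  ring

/-! #### Dimensions -/

/-- The value at `t₀` and the value of `⁅e₀, X⁆` at `t₀` are independent coordinates, each ranging
over the whole of `values t₀`. -/
theorem finrank_trans (K : R.Chart t₀) [FiniteDimensional ℝ L] (hI : IsOpen I) (hIc : I.OrdConnected) :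
    Module.finrank ℝ R.trans = 2 * Module.finrank ℝ (R.values t₀) := by
  let Φ : R.trans →ₗ[ℝ] R.values t₀ × R.values t₀ :=
    { toFun := fun X => (⟨R.value t₀ X, X, X.2, rfl⟩,
        ⟨R.value t₀ ⁅K.e₀, (X : L)⁆, _, R.lie_mem_trans hI _ X.2.1, rfl⟩)
      map_add' := fun X Y => by ext <;> simp
      map_smul' := fun c X => by ext <;> simp }
  have hΦ : Function.Bijective Φ := by
    refine ⟨(injective_iff_map_eq_zero Φ).2 fun X hX => ?_, ?_⟩
    · have h1 := congrArg (fun p => (p.1 : S → ℝ)) hX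
      have h2 := congrArg (fun p => (p.2 : S → ℝ)) hX
      exact Subtype.ext (K.trans_eq_zero hI hIc K.mem (K.pos t₀ K.mem_dom).ne' X.2
        (fun s => congrFun h1 s) (fun s => congrFun h2 s))
    · rintro ⟨⟨c, hc⟩, ⟨d, hd⟩⟩
      obtain ⟨X, hX, rfl, rfl⟩ := K.exists_of_values hI hc hd
      exact ⟨⟨X, hX⟩, rfl⟩
  rw [(LinearEquiv.ofBijective Φ hΦ).finrank_eq, Module.finrank_prod]
  ring

theorem finrank_vertical [FiniteDimensional ℝ L] :
    Module.finrank ℝ R.vertical =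
      Module.finrank ℝ R.scals + Module.finrank ℝ R.trans := by
  have h := LinearMap.finrank_range_add_finrank_ker (R.scal ∘ₗ R.vertical.subtype)
  rw [← h]
  congr 1
  · rw [LinearMap.range_comp, Submodule.range_subtype]; rfl
  · rw [LinearMap.ker_comp, ← Submodule.finrank_map_subtype_eq R.vertical,
      Submodule.map_comap_subtype]
    rfl

theorem linearIndependent_tau (hI : IsOpen I) {a b c : ℝ}
    (h : ∀ t ∈ I, a * R.tau K.e₀ t + b * R.tau K.e₁ t + c * R.tau K.e₂ t = 0) :
    a = 0 ∧ b = 0 ∧ c = 0 := by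
  refine K.eq_zero_of_quadratic hI fun t ht => ?_
  have := h t (K.dom_subset ht)
  rw [K.tau₀ ht, K.tau₁ ht, K.tau₂ ht] at this
  have hg : K.g t ^ 2 ≠ 0 := pow_ne_zero 2 (K.g_pos ht).ne'
  have e : K.g t ^ 2 * (a + b * K.θ t + c * K.θ t ^ 2) = 0 := by linarith
  exact (mul_eq_zero.1 e).resolve_left hg

theorem finrank_eq (K : R.Chart t₀) [FiniteDimensional ℝ L] (hI : IsOpen I) :
    Module.finrank ℝ L = 3 + Module.finrank ℝ R.vertical := by
  let ψ : (Fin 3 → ℝ) →ₗ[ℝ] L := Fintype.linearCombination ℝ ![K.e₀, K.e₁, K.e₂]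
  have hψ : ∀ v, ψ v = v 0 • K.e₀ + v 1 • K.e₁ + v 2 • K.e₂ := fun v => by
    simp [ψ, Fintype.linearCombination_apply, Fin.sum_univ_three]
  have hτ : ∀ v, ∀ t ∈ I, R.tau (ψ v) t =
      v 0 * R.tau K.e₀ t + v 1 * R.tau K.e₁ t + v 2 * R.tau K.e₂ t := fun v t _ => by
    rw [hψ]; simp
  have hz : ∀ v, ψ v ∈ R.vertical → v = 0 := fun v hv => by
    obtain ⟨h0, h1, h2⟩ := K.linearIndependent_tau hI fun t ht => by
      rw [← hτ v t ht]; exact hv t ht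
    ext i
    fin_cases i <;> assumption
  have hinj : Function.Injective ψ := (injective_iff_map_eq_zero ψ).2 fun v hv =>
    hz v (by rw [hv]; exact zero_mem _)
  have hc : IsCompl (LinearMap.range ψ) R.vertical := by
    refine ⟨Submodule.disjoint_def.2 ?_, codisjoint_iff.2 (eq_top_iff.2 ?_)⟩
    · rintro _ ⟨v, rfl⟩ hv
      rw [hz v hv, map_zero]
    · intro X _
      obtain ⟨a, b, c, h⟩ := K.span X
      refine Submodule.mem_sup.2 ⟨ψ ![a, b, c], ⟨_, rfl⟩, X - ψ ![a, b, c], fun t ht => ?_,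
        by abel⟩
      rw [map_sub, Pi.sub_apply, hτ _ t ht, h t ht]
      simp
  rw [← Submodule.finrank_add_eq_of_isCompl hc, LinearMap.finrank_range_of_inj hinj]
  simp

/-- The dimension formula. -/
theorem finrank_formula (K : R.Chart t₀) [FiniteDimensional ℝ L] (hI : IsOpen I) (hIc : I.OrdConnected) :
    Module.finrank ℝ L =
      3 + Module.finrank ℝ R.scals + 2 * Module.finrank ℝ (R.values t₀) := by
  rw [K.finrank_eq hI, finrank_vertical, K.finrank_trans hI hIc]
  ring

/-- The coefficients `a` act on the values of the translations. -/
theorem mul_mem_values (K : R.Chart t₀) (hI : IsOpen I) {a c : S → ℝ} (ha : a ∈ R.scals)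
    (hc : c ∈ R.values t₀) : a * c ∈ R.values t₀ := by
  obtain ⟨X, hX, rfl⟩ := ha
  obtain ⟨Y, hY, rfl⟩ := hc
  refine ⟨-⁅X, Y⁆, neg_mem (R.lie_mem_trans hI X hY.1), ?_⟩
  ext s
  rw [map_neg, Pi.neg_apply, value_apply, R.lam_lie X Y s t₀ K.mem, hX t₀ K.mem, hY.2,
    hY.1 t₀ K.mem, R.deriv_tau_eq_zero hI hX t₀ K.mem, R.deriv_tau_eq_zero hI hY.1 t₀ K.mem]
  simp
  ring

end Chart
end AffineAction
end

/-! ### Straightening the frame by a shift of `u` -/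

noncomputable section

namespace AffineAction
namespace Chart

variable {I : Set ℝ} {S : Type*} {L : Type*} [LieRing L] [LieAlgebra ℝ L]
  {R : AffineAction I S L} {t₀ t : ℝ} (K : R.Chart t₀)

/-- A cubic polynomial in `θ` vanishes only if its coefficients do. -/
theorem eq_zero_of_cubic (hI : IsOpen I) {a b c d : ℝ}
    (h : ∀ t ∈ K.dom, a + b * K.θ t + c * K.θ t ^ 2 + d * K.θ t ^ 3 = 0) :
    a = 0 ∧ b = 0 ∧ c = 0 ∧ d = 0 := by
  have h1 : ∀ t ∈ K.dom, b + 2 * c * K.θ t + 3 * d * K.θ t ^ 2 = 0 := by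
    intro t ht
    have hθ := K.hasDerivAt_θ hI ht
    have e : (fun t => a + b * K.θ t + c * K.θ t ^ 2 + d * K.θ t ^ 3) =ᶠ[𝓝 t] fun _ => 0 := by
      filter_upwards [K.isOpen_dom.mem_nhds ht] with x hx using h x hx
    have hd := ((((hθ.const_mul b).const_add a).fun_add ((hθ.fun_pow 2).const_mul c)).fun_add
      ((hθ.fun_pow 3).const_mul d)).unique ((hasDerivAt_const t (0 : ℝ)).congr_of_eventuallyEq e)
    have hg : (K.g t ^ 2)⁻¹ ≠ 0 := inv_ne_zero (pow_ne_zero 2 (K.g_pos ht).ne')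
    refine mul_left_cancel₀ hg ?_
    rw [mul_zero, ← hd]
    norm_num
    ring
  obtain ⟨hb, hc, hd⟩ := K.eq_zero_of_quadratic hI h1
  have ha := h t₀ K.mem_dom
  rw [K.θ_zero] at ha
  refine ⟨?_, ?_, ?_, ?_⟩ <;> linarith

/-- The frame can be straightened: up to translations, the coefficients `λ` of the frame come
from a single function `Q`. -/
theorem exists_gauge_frame [FiniteDimensional ℝ L] (hI : IsOpen I) (hIc : I.OrdConnected) :
    ∃ Q : S → ℝ → ℝ, (∀ s, ContDiffOn ℝ ∞ (Q s) K.dom) ∧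
      ∃ c₀ ∈ R.values t₀, ∃ d₀ ∈ R.values t₀, ∃ c₁ ∈ R.values t₀, ∃ d₁ ∈ R.values t₀,
      ∃ c₂ ∈ R.values t₀, ∃ d₂ ∈ R.values t₀, ∀ s, ∀ t ∈ K.dom,
        R.lam K.e₀ s t = R.tau K.e₀ t * deriv (Q s) t - deriv (R.tau K.e₀) t / 2 * Q s t
          + K.g t * (c₀ s + K.θ t * d₀ s) ∧
        R.lam K.e₁ s t = R.tau K.e₁ t * deriv (Q s) t - deriv (R.tau K.e₁) t / 2 * Q s t
          + K.g t * (c₁ s + K.θ t * d₁ s) ∧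
        R.lam K.e₂ s t = R.tau K.e₂ t * deriv (Q s) t - deriv (R.tau K.e₂) t / 2 * Q s t
          + K.g t * (c₂ s + K.θ t * d₂ s) := by
  obtain ⟨hA, hB, hC⟩ := K.lie_sub_mem
  obtain ⟨c, hc, d, hd, hA⟩ := K.lam_eq hI hIc hA
  obtain ⟨b₀, hb₀, b₁, hb₁, hB⟩ := K.lam_eq hI hIc hB
  obtain ⟨f₀, hf₀, f₁, hf₁, hC⟩ := K.lam_eq hI hIc hC
  have hsm : ∀ s, ContDiffOn ℝ ∞ (fun t => R.lam K.e₀ s t / K.g t ^ 3) K.dom := fun s =>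
    ((R.smooth_lam K.e₀ s).mono K.dom_subset).div (K.contDiffOn_g.pow 3)
      fun t ht => pow_ne_zero 3 (K.g_pos ht).ne'
  -- Since `θ' = g⁻²`, this is the primitive of `λ₀ / g` with respect to `θ`. The trial shift `g P`
  -- accounts for `e₀` completely.
  choose P hP using fun s => exists_smooth_primitive (hsm s)
  have hPs : ∀ s, ContDiffOn ℝ ∞ (P s) K.dom := fun s =>
    contDiffOn_of_hasDerivAt K.isOpen_dom (hP s) (hsm s)
  let n : L → S → ℝ → ℝ := fun X s t => R.lam X s t / K.g t
  have hn : ∀ X s, ∀ t ∈ K.dom, HasDerivAt (n X s)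
      ((deriv (R.lam X s) t * K.g t - R.lam X s t * deriv K.g t) / K.g t ^ 2) t :=
    fun X s t ht => (hasDerivAt_lam hI X s (K.dom_subset ht)).fun_div (K.hasDerivAt_g ht)
      (K.g_pos ht).ne'
  -- `m₁` and `m₂` are what remains of `λ₁ / g` and `λ₂ / g` after the contribution of the trial
  -- shift `g P` is removed. The brackets of the frame prescribe their `θ`-derivatives, so they are
  -- polynomials in `θ`.
  let m₁ : S → ℝ → ℝ := fun s t => n K.e₁ s t - K.θ t * n K.e₀ s t + P s t / 2
  let m₂ : S → ℝ → ℝ := fun s t => n K.e₂ s t - K.θ t ^ 2 * n K.e₀ s t + K.θ t * P s t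
  have hm₁ : ∀ s, ∀ t ∈ K.dom, HasDerivAt (m₁ s) ((c s + K.θ t * d s) / K.g t ^ 2) t := by
    intro s t ht
    have hg := (K.g_pos ht).ne'
    refine (((hn K.e₁ s t ht).fun_sub ((K.hasDerivAt_θ hI ht).fun_mul (hn K.e₀ s t ht))).fun_add
      ((hP s t ht).div_const 2)).congr_deriv ?_
    have e := hA s t ht
    rw [map_sub, Pi.sub_apply, Pi.sub_apply, R.lam_lie _ _ s t (K.dom_subset ht), K.scal₀,
      K.scal₁, K.tau₀ ht, K.tau₁ ht, K.deriv_tau₀ ht, K.deriv_tau₁ hI ht] at e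
    simp only [Pi.zero_apply] at e
    simp only [n]
    field_simp
    linear_combination 2 * e
  have hm₂ : ∀ s, ∀ t ∈ K.dom,
      HasDerivAt (m₂ s) ((b₀ s + K.θ t * b₁ s + 2 * m₁ s t) / K.g t ^ 2) t := by
    intro s t ht
    have hg := (K.g_pos ht).ne'
    refine (((hn K.e₂ s t ht).fun_sub (((K.hasDerivAt_θ hI ht).fun_pow 2).fun_mul
      (hn K.e₀ s t ht))).fun_add ((K.hasDerivAt_θ hI ht).fun_mul (hP s t ht))).congr_deriv ?_
    have e := hB s t ht
    rw [map_sub, Pi.sub_apply, Pi.sub_apply, R.lam_lie _ _ s t (K.dom_subset ht), K.scal₀,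
      K.scal₂, K.tau₀ ht, K.tau₂ ht, K.deriv_tau₀ ht, K.deriv_tau₂ hI ht, map_smul,
      Pi.smul_apply, Pi.smul_apply, smul_eq_mul] at e
    simp only [Pi.zero_apply] at e
    simp only [m₁, n]
    norm_num
    field_simp
    linear_combination e
  -- The bracket of `e₁` and `e₂`, with the derivatives eliminated by the other two brackets, is an
  -- algebraic relation between these polynomials.
  have hm₃ : ∀ s, ∀ t ∈ K.dom, K.θ t * (b₀ s + K.θ t * b₁ s + 2 * m₁ s t) - 3 / 2 * m₂ s t
      - K.θ t ^ 2 * (c s + K.θ t * d s) + K.θ t * m₁ s t = f₀ s + K.θ t * f₁ s := by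
    intro s t ht
    have hg := (K.g_pos ht).ne'
    have eA := hA s t ht
    have eB := hB s t ht
    have eC := hC s t ht
    rw [map_sub, Pi.sub_apply, Pi.sub_apply, R.lam_lie _ _ s t (K.dom_subset ht), K.scal₀,
      K.scal₁, K.tau₀ ht, K.tau₁ ht, K.deriv_tau₀ ht, K.deriv_tau₁ hI ht] at eA
    rw [map_sub, Pi.sub_apply, Pi.sub_apply, R.lam_lie _ _ s t (K.dom_subset ht), K.scal₀,
      K.scal₂, K.tau₀ ht, K.tau₂ ht, K.deriv_tau₀ ht, K.deriv_tau₂ hI ht, map_smul,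
      Pi.smul_apply, Pi.smul_apply, smul_eq_mul] at eB
    rw [map_sub, Pi.sub_apply, Pi.sub_apply, R.lam_lie _ _ s t (K.dom_subset ht), K.scal₁,
      K.scal₂, K.tau₁ ht, K.tau₂ ht, K.deriv_tau₁ hI ht, K.deriv_tau₂ hI ht] at eC
    simp only [Pi.zero_apply] at eA eB eC
    refine mul_left_cancel₀ hg ?_
    rw [← eC]
    have e₀ : K.g t * n K.e₀ s t = R.lam K.e₀ s t := by simp only [n]; field_simp
    have e₁ : K.g t * n K.e₁ s t = R.lam K.e₁ s t := by simp only [n]; field_simp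
    have e₂ : K.g t * n K.e₂ s t = R.lam K.e₂ s t := by simp only [n]; field_simp
    simp only [m₁, m₂]
    linear_combination (-K.θ t) * eB + K.θ t ^ 2 * eA + (- 3 * K.θ t ^ 2 + 3 / 2 * K.θ t ^ 2) * e₀
      + 3 * K.θ t * e₁ - 3 / 2 * e₂
  have q₁ : ∀ s, ∀ t ∈ K.dom,
      m₁ s t = m₁ s t₀ + c s * K.θ t + d s * K.θ t ^ 2 / 2 := fun s => K.eq_quadratic hI (hm₁ s)
  have q₂ : ∀ s, ∀ t ∈ K.dom, m₂ s t = m₂ s t₀ + (b₀ s + 2 * m₁ s t₀) * K.θ t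
      + (b₁ s + 2 * c s) * K.θ t ^ 2 / 2 + d s * K.θ t ^ 3 / 3 := by
    intro s t ht
    have := eq_of_hasDerivAt_zero (f := fun t => m₂ s t - ((b₀ s + 2 * m₁ s t₀) * K.θ t
      + (b₁ s + 2 * c s) * K.θ t ^ 2 / 2 + d s * K.θ t ^ 3 / 3))
      (t₀ := t₀) (r := K.r) (fun t ht => by
        have hθ := K.hasDerivAt_θ hI ht
        refine ((hm₂ s t ht).fun_sub (((hθ.const_mul _).fun_add
          (((hθ.fun_pow 2).const_mul _).div_const 2)).fun_add
          (((hθ.fun_pow 3).const_mul _).div_const 3))).congr_deriv ?_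
        rw [q₁ s t ht]
        norm_num
        ring) t ht
    simp only [K.θ_zero] at this
    linarith
  have q₃ : ∀ s, m₂ s t₀ = -2 / 3 * f₀ s ∧ b₁ s + 2 * c s = 0 := by
    intro s
    have := K.eq_zero_of_cubic hI (a := -3 / 2 * m₂ s t₀ - f₀ s) (b := -b₀ s / 2 - f₁ s)
      (c := (b₁ s + 2 * c s) / 4) (d := 0) fun t ht => by
        have e := hm₃ s t ht
        rw [q₂ s t ht, q₁ s t ht] at e
        linear_combination e
    obtain ⟨h0, -, h2, -⟩ := this
    exact ⟨by linarith, by linarith⟩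
  -- The added term `d θ² / 3 - 2 m₁(t₀)` cancels the constant and quadratic terms of `m₁`. It also
  -- cancels the cubic term of `m₂`; what is left over for each member of the frame is affine in
  -- `θ`, that is, a translation.
  let Rg : S → ℝ → ℝ := fun s t => P s t + d s * K.θ t ^ 2 / 3 - 2 * m₁ s t₀
  have hRg : ∀ s, ∀ t ∈ K.dom, HasDerivAt (Rg s)
      ((n K.e₀ s t + 2 / 3 * d s * K.θ t) / K.g t ^ 2) t := by
    intro s t ht
    have hg := (K.g_pos ht).ne'
    have hθ := K.hasDerivAt_θ hI ht
    refine (((hP s t ht).fun_add (((hθ.fun_pow 2).const_mul (d s)).div_const 3)).sub_const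
      _).congr_deriv ?_
    simp only [n]
    norm_num
    field_simp
  refine ⟨fun s t => K.g t * Rg s t, fun s => K.contDiffOn_g.mul
    (((hPs s).add (((contDiffOn_const (c := d s)).mul (K.contDiffOn_θ.pow 2)).div_const 3)).sub
      contDiffOn_const), 0, zero_mem _, (-2 / 3 : ℝ) • d, Submodule.smul_mem _ _ hd,
    0, zero_mem _, c, hc, (-2 / 3 : ℝ) • f₀, Submodule.smul_mem _ _ hf₀, b₀, hb₀,
    fun s t ht => ?_⟩
  have hg := (K.g_pos ht).ne'
  have hQ := ((K.hasDerivAt_g ht).fun_mul (hRg s t ht)).deriv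
  have e₀ : R.lam K.e₀ s t = K.g t * n K.e₀ s t := by simp only [n]; field_simp
  have e₁ : R.lam K.e₁ s t = K.g t * n K.e₁ s t := by simp only [n]; field_simp
  have e₂ : R.lam K.e₂ s t = K.g t * n K.e₂ s t := by simp only [n]; field_simp
  have r₁ : n K.e₁ s t - K.θ t * n K.e₀ s t + P s t / 2 = _ := q₁ s t ht
  have r₂ : n K.e₂ s t - K.θ t ^ 2 * n K.e₀ s t + K.θ t * P s t = _ := q₂ s t ht
  have hb : b₁ s = -2 * c s := by linarith [(q₃ s).2]
  rw [(q₃ s).1, hb] at r₂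
  rw [hQ, e₀, e₁, e₂, K.tau₀ ht, K.tau₁ ht, K.tau₂ ht, K.deriv_tau₀ ht, K.deriv_tau₁ hI ht,
    K.deriv_tau₂ hI ht]
  simp only [Pi.zero_apply, Pi.smul_apply, smul_eq_mul, Rg]
  refine ⟨?_, ?_, ?_⟩
  · field_simp
    ring
  · field_simp
    linear_combination 6 * r₁
  · field_simp
    linear_combination 3 * r₂

/-- The symmetries in the gauge given by `Q`. -/
structure Gauge where
  Q : S → ℝ → ℝ
  smooth : ∀ s, ContDiffOn ℝ ∞ (Q s) K.dom
  x₀ : L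
  x₁ : L
  x₂ : L
  scal₀ : R.scal x₀ = 0
  scal₁ : R.scal x₁ = 0
  scal₂ : R.scal x₂ = 0
  tau₀ : ∀ t ∈ I, R.tau x₀ t = R.tau K.e₀ t
  tau₁ : ∀ t ∈ I, R.tau x₁ t = R.tau K.e₁ t
  tau₂ : ∀ t ∈ I, R.tau x₂ t = R.tau K.e₂ t
  lam₀ : ∀ s, ∀ t ∈ K.dom, R.lam x₀ s t =
    R.tau K.e₀ t * deriv (Q s) t - deriv (R.tau K.e₀) t / 2 * Q s t
  lam₁ : ∀ s, ∀ t ∈ K.dom, R.lam x₁ s t =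
    R.tau K.e₁ t * deriv (Q s) t - deriv (R.tau K.e₁) t / 2 * Q s t
  lam₂ : ∀ s, ∀ t ∈ K.dom, R.lam x₂ s t =
    R.tau K.e₂ t * deriv (Q s) t - deriv (R.tau K.e₂) t / 2 * Q s t

theorem exists_gauge [FiniteDimensional ℝ L] (hI : IsOpen I) (hIc : I.OrdConnected) :
    Nonempty K.Gauge := by
  obtain ⟨Q, hQ, c₀, hc₀, d₀, hd₀, c₁, hc₁, d₁, hd₁, c₂, hc₂, d₂, hd₂, h⟩ :=
    K.exists_gauge_frame hI hIc
  obtain ⟨Z₀, hZ₀, h₀⟩ := K.exists_lam_eq hI hc₀ hd₀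
  obtain ⟨Z₁, hZ₁, h₁⟩ := K.exists_lam_eq hI hc₁ hd₁
  obtain ⟨Z₂, hZ₂, h₂⟩ := K.exists_lam_eq hI hc₂ hd₂
  have hs : ∀ {e Z : L}, R.scal e = 0 → Z ∈ R.trans → R.scal (e - Z) = 0 := fun he hZ => by
    rw [map_sub, he, hZ.2, sub_zero]
  have ht : ∀ {e Z : L}, Z ∈ R.trans → ∀ t ∈ I, R.tau (e - Z) t = R.tau e t :=
    fun hZ t ht => by rw [map_sub, Pi.sub_apply, hZ.1 t ht, sub_zero]
  exact ⟨⟨Q, hQ, K.e₀ - Z₀, K.e₁ - Z₁, K.e₂ - Z₂, hs K.scal₀ hZ₀, hs K.scal₁ hZ₁,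
    hs K.scal₂ hZ₂, ht hZ₀, ht hZ₁, ht hZ₂,
    fun s t ht => by rw [map_sub, Pi.sub_apply, Pi.sub_apply, (h s t ht).1, h₀ s t ht]; ring,
    fun s t ht => by rw [map_sub, Pi.sub_apply, Pi.sub_apply, (h s t ht).2.1, h₁ s t ht]; ring,
    fun s t ht => by
      rw [map_sub, Pi.sub_apply, Pi.sub_apply, (h s t ht).2.2, h₂ s t ht]; ring⟩⟩

namespace Gauge

variable {K} (G : K.Gauge)

theorem deriv_tau_eq (hI : IsOpen I) {X Y : L} (h : ∀ t ∈ I, R.tau X t = R.tau Y t)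
    (ht : t ∈ I) : deriv (R.tau X) t = deriv (R.tau Y) t := by
  have : R.tau X =ᶠ[𝓝 t] R.tau Y := by
    filter_upwards [hI.mem_nhds ht] with x hx using h x hx
  exact this.deriv_eq

theorem hasDerivAt_Q (s : S) (ht : t ∈ K.dom) : HasDerivAt (G.Q s) (deriv (G.Q s) t) t :=
  (((G.smooth s).contDiffAt (K.isOpen_dom.mem_nhds ht)).differentiableAt (by simp)).hasDerivAt

/-- An element with vanishing component along `∂_t` is, up to a translation, `a (u - Q) ∂_u`. -/
theorem exists_vertical [FiniteDimensional ℝ L] (hI : IsOpen I) (hIc : I.OrdConnected) {k : L}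
    (hk : k ∈ R.vertical) : ∃ k' ∈ R.vertical, R.scal k' = R.scal k ∧
      ∀ s, ∀ t ∈ K.dom, R.lam k' s t = -R.scal k s * G.Q s t := by
  obtain ⟨c, hc, d, hd, h₀⟩ := K.lam_eq hI hIc (R.lie_mem_trans hI G.x₀ hk)
  obtain ⟨c', hc', d', hd', h₁⟩ := K.lam_eq hI hIc (R.lie_mem_trans hI G.x₁ hk)
  -- The deviation of `k` from `a (u - Q) ∂_u`, divided by `g`. That the bracket with `x₀` is a
  -- translation makes `n` quadratic in `θ`; the bracket with `x₁` then gives a relation free of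
  -- derivatives.
  let n : S → ℝ → ℝ := fun s t => (R.lam k s t + R.scal k s * G.Q s t) / K.g t
  have hn : ∀ s, ∀ t ∈ K.dom, HasDerivAt (n s)
      (((deriv (R.lam k s) t + R.scal k s * deriv (G.Q s) t) * K.g t
        - (R.lam k s t + R.scal k s * G.Q s t) * deriv K.g t) / K.g t ^ 2) t :=
    fun s t ht => ((hasDerivAt_lam hI k s (K.dom_subset ht)).fun_add
      ((G.hasDerivAt_Q s ht).const_mul _)).fun_div (K.hasDerivAt_g ht) (K.g_pos ht).ne'
  have hgn : ∀ s, ∀ t ∈ K.dom, R.lam k s t + R.scal k s * G.Q s t = K.g t * n s t := by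
    intro s t ht
    have hg := (K.g_pos ht).ne'
    simp only [n]
    field_simp
  clear_value n
  have e₀ : ∀ s, ∀ t ∈ K.dom, HasDerivAt (n s) ((c s + K.θ t * d s) / K.g t ^ 2) t := by
    intro s t ht
    have hg := (K.g_pos ht).ne'
    refine (hn s t ht).congr_deriv ?_
    have e := h₀ s t ht
    rw [R.lam_lie _ _ s t (K.dom_subset ht), G.tau₀ t (K.dom_subset ht), G.scal₀,
      deriv_tau_eq hI G.tau₀ (K.dom_subset ht), G.lam₀ s t ht, hk t (K.dom_subset ht),
      R.deriv_tau_eq_zero hI hk t (K.dom_subset ht), K.tau₀ ht, K.deriv_tau₀ ht] at e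
    simp only [Pi.zero_apply] at e
    rw [div_left_inj' (pow_ne_zero 2 hg)]
    refine mul_left_cancel₀ hg ?_
    linear_combination e
  have e₁ : ∀ s, ∀ t ∈ K.dom,
      K.θ t * (c s + K.θ t * d s) - n s t / 2 = c' s + K.θ t * d' s := by
    intro s t ht
    have hg := (K.g_pos ht).ne'
    have e := h₁ s t ht
    rw [R.lam_lie _ _ s t (K.dom_subset ht), G.tau₁ t (K.dom_subset ht), G.scal₁,
      deriv_tau_eq hI G.tau₁ (K.dom_subset ht), G.lam₁ s t ht, hk t (K.dom_subset ht),
      R.deriv_tau_eq_zero hI hk t (K.dom_subset ht), K.tau₁ ht, K.deriv_tau₁ hI ht] at e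
    have e0 := (hn s t ht).unique (e₀ s t ht)
    simp only [Pi.zero_apply] at e
    field_simp at e0
    refine mul_left_cancel₀ hg ?_
    linear_combination e - K.θ t * K.g t * e0 + hgn s t ht / 2
  have q : ∀ s, ∀ t ∈ K.dom, n s t = n s t₀ + c s * K.θ t + d s * K.θ t ^ 2 / 2 :=
    fun s => K.eq_quadratic hI (e₀ s)
  -- Comparing coefficients removes the quadratic term and puts the constant term into `values t₀`.
  -- So the deviation is itself a translation and can be subtracted.
  have hz : ∀ s, n s t₀ = -2 * c' s ∧ d s = 0 := by
    intro s
    obtain ⟨h0, -, h2⟩ := K.eq_zero_of_quadratic hI (a := -n s t₀ / 2 - c' s)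
      (b := c s / 2 - d' s) (c := 3 / 4 * d s) fun t ht => by
        have e := e₁ s t ht
        rw [q s t ht] at e
        linear_combination e
    exact ⟨by linarith, by linarith⟩
  obtain ⟨Z, hZ, hZl⟩ := K.exists_lam_eq hI (Submodule.smul_mem _ (-2 : ℝ) hc') hc
  refine ⟨k - Z, sub_mem hk hZ.1, by rw [map_sub, hZ.2, sub_zero], fun s t ht => ?_⟩
  have e := hgn s t ht
  rw [q s t ht, (hz s).1, (hz s).2] at e
  rw [map_sub, Pi.sub_apply, Pi.sub_apply, hZl s t ht, Pi.smul_apply, smul_eq_mul]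
  linear_combination e

end Gauge
end Chart
end AffineAction
end

/-! ### Symmetries of coupled equations are affine in `u` -/

noncomputable section

theorem eq_of_hasDerivAt_zero_on {U : Set ℝ} (hU : IsOpen U) (hc : U.OrdConnected) {f : ℝ → ℝ}
    (hf : ∀ t ∈ U, HasDerivAt f 0 t) {x y : ℝ} (hx : x ∈ U) (hy : y ∈ U) : f x = f y :=
  hc.convex.is_const_of_fderivWithin_eq_zero (𝕜 := ℝ)
    (fun x hx => (hf x hx).differentiableAt.differentiableWithinAt)
    (fun x hx => by
      rw [fderivWithin_of_isOpen hU hx]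
      ext
      simp [(hf x hx).deriv]) hx hy

theorem hasDerivAt_line_fst {f : ℝ × ℝ → ℝ} {t u : ℝ} (hf : DifferentiableAt ℝ f (t, u)) :
    HasDerivAt (fun x => f (x, u)) (dt f (t, u)) t :=
  hf.hasFDerivAt.comp_hasDerivAt t ((hasDerivAt_id t).prodMk (hasDerivAt_const t u))

theorem hasDerivAt_line_snd {f : ℝ × ℝ → ℝ} {t u : ℝ} (hf : DifferentiableAt ℝ f (t, u)) :
    HasDerivAt (fun x => f (t, x)) (du f (t, u)) u :=
  hf.hasFDerivAt.comp_hasDerivAt u ((hasDerivAt_const u t).prodMk (hasDerivAt_id u))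

theorem fderiv_eq_zero_of_line {E : Type*} [NormedAddCommGroup E] [NormedSpace ℝ E] {f : E → ℝ}
    {q v : E} (hf : DifferentiableAt ℝ f q) {k : ℝ} (h : ∀ᶠ y : ℝ in 𝓝 0, f (q + y • v) = k) :
    fderiv ℝ f q v = 0 := by
  have h1 : HasDerivAt (fun y : ℝ => f (q + y • v)) (fderiv ℝ f q v) 0 := by
    have hq : HasFDerivAt f (fderiv ℝ f q) (q + (0 : ℝ) • v) := by
      simpa using hf.hasFDerivAt
    have := hq.comp_hasDerivAt (0 : ℝ) (((hasDerivAt_id (0 : ℝ)).smul_const v).const_add q)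
    simpa [Function.comp_def] using this
  exact h1.unique ((hasDerivAt_const (0 : ℝ) k).congr_of_eventuallyEq h)

theorem ContDiffOn.du {U : Set (ℝ × ℝ)} (hU : IsOpen U) {f : ℝ × ℝ → ℝ}
    (hf : ContDiffOn ℝ ∞ f U) : ContDiffOn ℝ ∞ (du f) U :=
  (hf.fderiv_of_isOpen hU (by simp)).clm_apply contDiffOn_const

theorem ContDiffOn.deriv_smooth {U : Set ℝ} (hU : IsOpen U) {f : ℝ → ℝ}
    (hf : ContDiffOn ℝ ∞ f U) : ContDiffOn ℝ ∞ (deriv f) U :=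
  hf.deriv_of_isOpen hU (by simp)

theorem ContDiffOn.hasDerivAt_deriv {U : Set ℝ} (hU : IsOpen U) {f : ℝ → ℝ}
    (hf : ContDiffOn ℝ ∞ f U) {t : ℝ} (ht : t ∈ U) : HasDerivAt f (deriv f t) t :=
  ((hf.contDiffAt (hU.mem_nhds ht)).differentiableAt (by simp)).hasDerivAt

theorem dt_eq_affine {I J : Set ℝ} (hI : IsOpen I) (hJ : IsOpen J) {f : ℝ × ℝ → ℝ} {A B : ℝ → ℝ}
    (hA : ContDiffOn ℝ ∞ A I) (hB : ContDiffOn ℝ ∞ B I)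
    (h : ∀ p ∈ I ×ˢ J, f p = A p.1 * p.2 + B p.1) :
    (∀ p ∈ I ×ˢ J, dt f p = deriv A p.1 * p.2 + deriv B p.1) ∧
      ∀ p ∈ I ×ˢ J, du f p = A p.1 := by
  have key : ∀ p ∈ I ×ˢ J, HasFDerivAt f
      ((A p.1 • ContinuousLinearMap.snd ℝ ℝ ℝ +
        p.2 • (deriv A p.1 • ContinuousLinearMap.fst ℝ ℝ ℝ)) +
        deriv B p.1 • ContinuousLinearMap.fst ℝ ℝ ℝ) p := by
    intro p hp
    have hA' := (hA.hasDerivAt_deriv hI hp.1).comp_hasFDerivAt p (hasFDerivAt_fst (𝕜 := ℝ))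
    have hB' := (hB.hasDerivAt_deriv hI hp.1).comp_hasFDerivAt p (hasFDerivAt_fst (𝕜 := ℝ))
    refine ((hA'.mul (hasFDerivAt_snd (𝕜 := ℝ))).add hB').congr_of_eventuallyEq ?_
    filter_upwards [(hI.prod hJ).mem_nhds hp] with q hq using h q hq
  refine ⟨fun p hp => ?_, fun p hp => ?_⟩
  · rw [dt, (key p hp).fderiv]
    simp [mul_comm]
  · rw [du, (key p hp).fderiv]
    simp

namespace LatticeEquation

variable {E : LatticeEquation} {X : Site → ℝ × ℝ → ℝ × ℝ}

theorem mem_M_of_mem_Ω {s : Site} {p : LocalConf} (hp : p ∈ E.Ω s) (i : Fin 7) :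
    (p.1, p.2 i) ∈ E.M :=
  ⟨(E.Ω_subset s p hp).1, (E.Ω_subset s p hp).2 i⟩

theorem differentiableAt_F {s : Site} {p : LocalConf} (hp : p ∈ E.Ω s) :
    DifferentiableAt ℝ (E.F s) p :=
  ((E.smooth_F s).contDiffAt ((E.isOpen_Ω s).mem_nhds hp)).differentiableAt (by simp)

/-- `X_s = τ ∂_t + ((τ'/2 + a_s) u + l_s) ∂_u`. -/
structure AffineForm (E : LatticeEquation) (X : Site → ℝ × ℝ → ℝ × ℝ) (τ : ℝ → ℝ) (a : Site → ℝ)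
    (l : Site → ℝ → ℝ) : Prop where
  smooth_τ : ContDiffOn ℝ ∞ τ E.I
  smooth_l : ∀ s, ContDiffOn ℝ ∞ (l s) E.I
  eq : ∀ s, ∀ p ∈ E.M, X s p = (τ p.1, (deriv τ p.1 / 2 + a s) * p.2 + l s p.1)

theorem AffineForm.prolongCoeff_eq {τ : ℝ → ℝ} {a : Site → ℝ} {l : Site → ℝ → ℝ}
    (h : E.AffineForm X τ a l) (s : Site) {p : ℝ × ℝ} (hp : p ∈ E.M) (v w : ℝ) :
    prolongCoeff (fun q => (X s q).1) (fun q => (X s q).2) p v w =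
      deriv (deriv (l s)) p.1 + deriv (deriv (deriv τ)) p.1 / 2 * p.2
        + (a s - 3 / 2 * deriv τ p.1) * w := by
  have hI := E.isOpen_I
  have hJ := E.isOpen_J
  have z : ContDiffOn ℝ ∞ (fun _ : ℝ => (0 : ℝ)) E.I := contDiffOn_const
  have hτ' := h.smooth_τ.deriv_smooth hI
  have hτ'' := hτ'.deriv_smooth hI
  have hl' := (h.smooth_l s).deriv_smooth hI
  have hA : ContDiffOn ℝ ∞ (fun t => deriv τ t / 2 + a s) E.I :=
    (hτ'.div_const 2).add contDiffOn_const
  have hA' : ∀ t ∈ E.I, deriv (fun t => deriv τ t / 2 + a s) t = deriv (deriv τ) t / 2 :=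
    fun t ht => (((hτ'.hasDerivAt_deriv hI ht).div_const 2).add_const _).deriv
  have hA'' : ContDiffOn ℝ ∞ (fun t => deriv (deriv τ) t / 2) E.I := hτ''.div_const 2
  have hA3 : ∀ t ∈ E.I, deriv (fun t => deriv (deriv τ) t / 2) t = deriv (deriv (deriv τ)) t / 2 :=
    fun t ht => ((hτ''.hasDerivAt_deriv hI ht).div_const 2).deriv
  have hz' : ∀ t : ℝ, deriv (fun _ : ℝ => (0 : ℝ)) t = 0 := fun t => deriv_const t _
  obtain ⟨t1, t2⟩ := dt_eq_affine hI hJ (f := fun q => (X s q).1) z h.smooth_τ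
    (fun p hp => by simp [h.eq s p hp])
  obtain ⟨t3, t4⟩ := dt_eq_affine hI hJ (f := dt fun q => (X s q).1) z hτ'
    (fun p hp => by rw [t1 p hp, hz'])
  obtain ⟨t5, t6⟩ := dt_eq_affine hI hJ (f := du fun q => (X s q).1) z z
    (fun p hp => by rw [t2 p hp]; simp)
  obtain ⟨f1, f2⟩ := dt_eq_affine hI hJ (f := fun q => (X s q).2) hA (h.smooth_l s)
    (fun p hp => by simp [h.eq s p hp])
  obtain ⟨f3, f4⟩ := dt_eq_affine hI hJ (f := dt fun q => (X s q).2) hA'' hl'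
    (fun p hp => by rw [f1 p hp, hA' p.1 hp.1])
  obtain ⟨f5, f6⟩ := dt_eq_affine hI hJ (f := du fun q => (X s q).2) z hA
    (fun p hp => by rw [f2 p hp]; simp)
  simp only [prolongCoeff, totalDt2, totalDt]
  rw [t3 p hp, t5 p hp, t6 p hp, t1 p hp, t2 p hp, f3 p hp, f5 p hp, f6 p hp, f2 p hp, hA' _ hp.1,
    hA3 _ hp.1, hz']
  ring

/-- The determining equation of the symmetries. -/
theorem AffineForm.isSymmetry_iff {τ : ℝ → ℝ} {a : Site → ℝ} {l : Site → ℝ → ℝ}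
    (h : E.AffineForm X τ a l) : E.IsSymmetry X ↔ ∀ s, ∀ p ∈ E.Ω s,
      deriv (deriv (l s)) p.1 + deriv (deriv (deriv τ)) p.1 / 2 * p.2 0
        + (a s - 3 / 2 * deriv τ p.1) * E.F s p =
      fderiv ℝ (E.F s) p
        (τ p.1, fun i => (deriv τ p.1 / 2 + a (nbr i s)) * p.2 i + l (nbr i s) p.1) := by
  have e : ∀ s, ∀ p ∈ E.Ω s, ((X s (p.1, p.2 0)).1, fun i => (X (nbr i s) (p.1, p.2 i)).2) =
      (τ p.1, fun i => (deriv τ p.1 / 2 + a (nbr i s)) * p.2 i + l (nbr i s) p.1) := by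
    intro s p hp
    rw [h.eq s _ (mem_M_of_mem_Ω hp 0)]
    congr 1
    ext i
    rw [h.eq _ _ (mem_M_of_mem_Ω hp i)]
  constructor
  · intro hX s p hp
    rw [← e s p hp, ← hX.2 s p hp 0, h.prolongCoeff_eq s (mem_M_of_mem_Ω hp 0)]
  · intro hX
    refine ⟨fun s s' p hp => by rw [h.eq s p hp, h.eq s' p hp], fun s p hp v => ?_⟩
    rw [h.prolongCoeff_eq s (mem_M_of_mem_Ω hp 0), e s p hp, hX s p hp]

theorem coeff_eq_zero_of_cubic {a b c d k : ℝ}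
    (h : ∀ v : ℝ, a + b * v + c * v ^ 2 + d * v ^ 3 = k) : b = 0 ∧ c = 0 := by
  have h0 := h 0
  have h1 := h 1
  have h2 := h (-1)
  have h3 := h 2
  norm_num at h0 h1 h2 h3
  constructor <;> linarith

/-- A coupled interaction is nowhere a function of `(t, u_{nm})` only. -/
theorem IsCoupled.not_local (hc : E.IsCoupled) {s : Site} {U : Set LocalConf} (hU : IsOpen U)
    (hUΩ : U ⊆ E.Ω s) (hne : U.Nonempty) (h : ℝ × ℝ → ℝ)
    (hF : ∀ p ∈ U, E.F s p = h (p.1, p.2 0)) : False := by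
  obtain ⟨p, hp, h0⟩ := hc s 1 U hUΩ hU hne
  refine h0 (fderiv_eq_zero_of_line (differentiableAt_F (hUΩ hp)) (k := E.F s p) ?_)
  have hcont : ContinuousAt (fun y : ℝ => p + y • ((0, Pi.single 1 1) : LocalConf)) 0 := by
    fun_prop
  have := hcont.eventually_mem (s := U) (by simpa using hU.mem_nhds hp)
  filter_upwards [this] with y hy
  rw [hF _ hy, hF p hp]
  simp

/-- For a fixed configuration the determining equation is a cubic identity in the free velocity `v`.
These are its coefficients of `v` and `v²`. -/
theorem IsSymmetry.coeffs (hX : E.IsSymmetry X) {s : Site} {p : LocalConf} (hp : p ∈ E.Ω s) :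
    2 * dt (du fun q => (X s q).2) (p.1, p.2 0) - dt (dt fun q => (X s q).1) (p.1, p.2 0)
        - 3 * E.F s p * du (fun q => (X s q).1) (p.1, p.2 0) = 0 ∧
      du (du fun q => (X s q).2) (p.1, p.2 0) - 2 * dt (du fun q => (X s q).1) (p.1, p.2 0) = 0 := by
  have h := hX.2 s p hp
  simp only [prolongCoeff, totalDt2, totalDt] at h
  exact coeff_eq_zero_of_cubic (a := dt (dt fun q => (X s q).2) (p.1, p.2 0)
      + E.F s p * du (fun q => (X s q).2) (p.1, p.2 0)
      - 2 * dt (fun q => (X s q).1) (p.1, p.2 0) * E.F s p)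
    (d := -du (du fun q => (X s q).1) (p.1, p.2 0)) (fun v => Eq.trans (by ring) (h v))

/-- The symmetries of a coupled equation are affine in `u`. -/
theorem IsSymmetry.exists_affineForm (hc : E.IsCoupled) (hX : E.IsSymmetry X)
    (hs : ∀ s, ContDiffOn ℝ ∞ (X s) E.M) : ∃ τ a l, E.AffineForm X τ a l := by
  have hI := E.isOpen_I
  have hJ := E.isOpen_J
  have hM : IsOpen (E.M : Set (ℝ × ℝ)) := E.M.isOpen
  obtain ⟨t₁, ht₁⟩ := E.nonempty_I
  obtain ⟨x₀, hx₀⟩ := E.nonempty_J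
  have hτ : ∀ s, ContDiffOn ℝ ∞ (fun q => (X s q).1) E.M := fun s => (hs s).fst
  have hφ : ∀ s, ContDiffOn ℝ ∞ (fun q => (X s q).2) E.M := fun s => (hs s).snd
  have diff : ∀ {f : ℝ × ℝ → ℝ}, ContDiffOn ℝ ∞ f E.M → ∀ p ∈ E.M, DifferentiableAt ℝ f p :=
    fun hf p hp => (hf.contDiffAt (hM.mem_nhds hp)).differentiableAt (by simp)
  have fder : ∀ {f h : ℝ × ℝ → ℝ}, (∀ p ∈ E.M, f p = h p) → ∀ p ∈ E.M,
      fderiv ℝ f p = fderiv ℝ h p := fun {f h} hfh p hp => by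
    have : f =ᶠ[𝓝 p] h := by filter_upwards [hM.mem_nhds hp] with q hq using hfh q hq
    exact this.fderiv_eq
  -- Where `τ_u ≠ 0` the coefficient of `v` can be solved for the force, as a function of `t` and
  -- `u_{nm}` only, on an open set. Coupling forbids this.
  have hτu : ∀ s, ∀ p ∈ E.M, du (fun q => (X s q).1) p = 0 := by
    rintro s ⟨t, x⟩ hp
    by_contra hne
    obtain ⟨p, hpΩ, rfl, rfl⟩ := E.exists_mem_Ω s t hp.1 x hp.2
    have hU : IsOpen (E.Ω s ∩ {q | du (fun q => (X s q).1) (q.1, q.2 0) ≠ 0}) := by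
      have hcont : ContinuousOn (fun q : LocalConf => du (fun q => (X s q).1) (q.1, q.2 0))
          (E.Ω s) :=
        ((hτ s).du hM).continuousOn.comp (by fun_prop) fun q hq => mem_M_of_mem_Ω hq 0
      exact hcont.isOpen_inter_preimage (E.isOpen_Ω s) isOpen_ne
    refine hc.not_local hU inter_subset_left ⟨p, hpΩ, hne⟩
      (fun q => (2 * dt (du fun q => (X s q).2) q - dt (dt fun q => (X s q).1) q)
        / (3 * du (fun q => (X s q).1) q)) fun q hq => ?_
    have h := (hX.coeffs hq.1).1
    have h2 : du (fun q => (X s q).1) (q.1, q.2 0) ≠ 0 := hq.2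
    field_simp
    linarith
  have hτtu : ∀ s, ∀ p ∈ E.M, dt (du fun q => (X s q).1) p = 0 := fun s p hp => by
    rw [dt, fder (h := fun _ => 0) (hτu s) p hp]
    simp
  have hφuu : ∀ s, ∀ p ∈ E.M, du (du fun q => (X s q).2) p = 0 := by
    rintro s ⟨t, x⟩ hp
    obtain ⟨p, hpΩ, rfl, rfl⟩ := E.exists_mem_Ω s t hp.1 x hp.2
    have h := (hX.coeffs hpΩ).2
    rw [hτtu s _ hp] at h
    linarith
  have hφtu : ∀ s, ∀ p ∈ E.M,
      dt (du fun q => (X s q).2) p = dt (dt fun q => (X s q).1) p / 2 := by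
    rintro s ⟨t, x⟩ hp
    obtain ⟨p, hpΩ, rfl, rfl⟩ := E.exists_mem_Ω s t hp.1 x hp.2
    have h := (hX.coeffs hpΩ).1
    rw [hτu s _ hp] at h
    linarith
  have const_u : ∀ {f : ℝ × ℝ → ℝ}, ContDiffOn ℝ ∞ f E.M → (∀ p ∈ E.M, du f p = 0) →
      ∀ p ∈ E.M, f p = f (p.1, x₀) := fun {f} hf h p hp =>
    eq_of_hasDerivAt_zero_on hJ E.ordConnected_J (f := fun x => f (p.1, x)) (fun x hx =>
      (hasDerivAt_line_snd (diff hf (p.1, x) ⟨hp.1, hx⟩)).congr_deriv (h (p.1, x) ⟨hp.1, hx⟩))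
      hp.2 hx₀
  have hline : ∀ {f : ℝ × ℝ → ℝ}, ContDiffOn ℝ ∞ f E.M →
      ContDiffOn ℝ ∞ (fun t => f (t, x₀)) E.I := fun hf =>
    hf.comp (by fun_prop) fun t ht => ⟨ht, hx₀⟩
  let s₀ : Site := 0
  let τ : ℝ → ℝ := fun t => (X s₀ (t, x₀)).1
  have hτ_eq : ∀ s, ∀ p ∈ E.M, (X s p).1 = τ p.1 := fun s p hp => by
    rw [hX.1 s s₀ p hp]
    exact const_u (hτ s₀) (hτu s₀) p hp
  have hτs : ContDiffOn ℝ ∞ τ E.I := hline (hτ s₀)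
  have hτt : ∀ s, ∀ p ∈ E.M, dt (fun q => (X s q).1) p = deriv τ p.1 := fun s p hp =>
    (dt_eq_affine hI hJ (A := fun _ => 0) contDiffOn_const hτs
      (fun p hp => by rw [hτ_eq s p hp]; simp)).1 p hp |>.trans (by simp)
  let b : Site → ℝ × ℝ → ℝ := fun s => du fun q => (X s q).2
  have hb : ∀ s, ContDiffOn ℝ ∞ (b s) E.M := fun s => (hφ s).du hM
  -- As `φ_tu = τ_tt / 2`, the difference `φ_u - τ'/2` does not depend on `t`; its value is the
  -- constant `a_s`.
  have hb' : ∀ s, ∀ t ∈ E.I,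
      b s (t, x₀) - deriv τ t / 2 = b s (t₁, x₀) - deriv τ t₁ / 2 := fun s t ht => by
    refine eq_of_hasDerivAt_zero_on hI E.ordConnected_I
      (f := fun t => b s (t, x₀) - deriv τ t / 2) (fun t ht => ?_) ht ht₁
    have h1 := hasDerivAt_line_fst (diff (hb s) (t, x₀) ⟨ht, hx₀⟩)
    have h2 := (hτs.deriv_smooth hI).hasDerivAt_deriv hI ht
    refine (h1.fun_sub (h2.div_const 2)).congr_deriv ?_
    rw [hφtu s (t, x₀) ⟨ht, hx₀⟩]
    have h3 := (dt_eq_affine hI hJ (f := dt fun q => (X s q).1) (A := fun _ => 0)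
      contDiffOn_const (hτs.deriv_smooth hI) (fun p hp => by rw [hτt s p hp]; simp)).1 (t, x₀) ⟨ht, hx₀⟩
    rw [h3]
    simp
  let a : Site → ℝ := fun s => b s (t₁, x₀) - deriv τ t₁ / 2
  have hbeq : ∀ s, ∀ p ∈ E.M, b s p = deriv τ p.1 / 2 + a s := fun s p hp => by
    rw [const_u (hb s) (hφuu s) p hp]
    simp only [a]
    linarith [hb' s p.1 hp.1]
  refine ⟨τ, a, fun s t => (X s (t, x₀)).2 - (deriv τ t / 2 + a s) * x₀, hτs, fun s =>
    (hline (hφ s)).sub ((((hτs.deriv_smooth hI).div_const 2).add contDiffOn_const).mul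
      contDiffOn_const), fun s p hp => Prod.ext (hτ_eq s p hp) ?_⟩
  have := eq_of_hasDerivAt_zero_on hJ E.ordConnected_J
    (f := fun x => (X s (p.1, x)).2 - (deriv τ p.1 / 2 + a s) * x) (fun x hx => by
      refine ((hasDerivAt_line_snd (diff (hφ s) (p.1, x) ⟨hp.1, hx⟩)).fun_sub
        ((hasDerivAt_id x).const_mul _)).congr_deriv ?_
      have := hbeq s (p.1, x) ⟨hp.1, hx⟩
      simp only [b] at this
      rw [this]
      simp) hp.2 hx₀
  simp only at this ⊢
  linarith

theorem exists_ne_mem_J (E : LatticeEquation) : ∃ x ∈ E.J, ∃ y ∈ E.J, x ≠ y := by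
  obtain ⟨x, hx⟩ := E.nonempty_J
  obtain ⟨ε, hε, hb⟩ := Metric.isOpen_iff.1 E.isOpen_J x hx
  refine ⟨x, hx, x + ε / 2, hb ?_, by linarith⟩
  rw [Metric.mem_ball, Real.dist_eq, add_sub_cancel_left, abs_of_pos (by linarith)]
  linarith

theorem smooth_line (E : LatticeEquation) (X : LatticeField E.M) (s : Site) {x : ℝ}
    (hx : x ∈ E.J) : ContDiffOn ℝ ∞ (fun t => X.1 s (t, x)) E.I :=
  (LatticeField.prop X s).1.comp (by fun_prop) fun t ht => ⟨ht, hx⟩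

/-- A point of `I`. -/
def basePoint (E : LatticeEquation) : ℝ := E.nonempty_I.choose

/-- A point of `J`. -/
def baseValue (E : LatticeEquation) : ℝ := E.exists_ne_mem_J.choose

theorem baseValue_mem (E : LatticeEquation) : E.baseValue ∈ E.J :=
  E.exists_ne_mem_J.choose_spec.1

/-- A second point of `J`. -/
def baseValue' (E : LatticeEquation) : ℝ := E.exists_ne_mem_J.choose_spec.2.choose

theorem baseValue'_mem (E : LatticeEquation) : E.baseValue' ∈ E.J :=
  E.exists_ne_mem_J.choose_spec.2.choose_spec.1

theorem baseValue_ne (E : LatticeEquation) : E.baseValue ≠ E.baseValue' :=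
  E.exists_ne_mem_J.choose_spec.2.choose_spec.2

/-- The coefficient `τ` of an affine symmetry. -/
def coordTau (E : LatticeEquation) : LatticeField E.M →ₗ[ℝ] ℝ → ℝ where
  toFun X t := (X.1 0 (t, E.baseValue)).1
  map_add' _ _ := rfl
  map_smul' _ _ := rfl

/-- The coefficient of `u` in an affine symmetry. -/
def coordSlope (E : LatticeEquation) : LatticeField E.M →ₗ[ℝ] Site → ℝ → ℝ where
  toFun X s t := ((X.1 s (t, E.baseValue')).2 - (X.1 s (t, E.baseValue)).2)
    / (E.baseValue' - E.baseValue)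
  map_add' X Y := by
    ext s t
    exact (congrArg (· / (E.baseValue' - E.baseValue)) (add_sub_add_comm _ _ _ _)).trans
      (add_div _ _ _)
  map_smul' c X := by
    ext s t
    exact (congrArg (· / (E.baseValue' - E.baseValue)) (mul_sub _ _ _).symm).trans
      (mul_div_assoc _ _ _)

theorem smooth_coordTau (E : LatticeEquation) (X : LatticeField E.M) :
    ContDiffOn ℝ ∞ (E.coordTau X) E.I := (E.smooth_line X 0 E.baseValue_mem).fst

/-- The coefficient `a_s` of an affine symmetry. -/
def coordScal (E : LatticeEquation) : LatticeField E.M →ₗ[ℝ] Site → ℝ where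
  toFun X s := E.coordSlope X s E.basePoint - deriv (E.coordTau X) E.basePoint / 2
  map_add' X Y := by
    have h : ∀ X, DifferentiableAt ℝ (E.coordTau X) E.basePoint := fun X =>
      ((E.smooth_coordTau X).hasDerivAt_deriv E.isOpen_I E.nonempty_I.choose_spec).differentiableAt
    ext s
    rw [map_add, map_add, deriv_add (h X) (h Y)]
    simp only [Pi.add_apply]
    ring
  map_smul' c X := by
    ext s
    rw [map_smul, map_smul, deriv_const_smul_field]
    simp only [Pi.smul_apply, smul_eq_mul, RingHom.id_apply]
    ring

/-- The coefficient `λ_s` of an affine symmetry. -/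
def coordLam (E : LatticeEquation) : LatticeField E.M →ₗ[ℝ] Site → ℝ → ℝ where
  toFun X s t := (X.1 s (t, E.baseValue)).2 - E.baseValue * E.coordSlope X s t
  map_add' X Y := by
    ext s t
    rw [map_add]
    exact (congrArg (_ - ·) (mul_add _ _ _)).trans (add_sub_add_comm _ _ _ _)
  map_smul' c X := by
    ext s t
    rw [map_smul]
    exact (congrArg (_ - ·) (mul_left_comm _ _ _)).trans (mul_sub _ _ _).symm

theorem AffineForm.coord {X : LatticeField E.M} {τ : ℝ → ℝ} {a : Site → ℝ} {l : Site → ℝ → ℝ}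
    (h : E.AffineForm X.1 τ a l) : (∀ t ∈ E.I, E.coordTau X t = τ t) ∧ E.coordScal X = a ∧
      ∀ s, ∀ t ∈ E.I, E.coordLam X s t = l s t := by
  have h0 : E.baseValue' - E.baseValue ≠ 0 := sub_ne_zero.2 E.baseValue_ne.symm
  have hτ : ∀ t ∈ E.I, E.coordTau X t = τ t := fun t ht => by
    change (X.1 0 (t, E.baseValue)).1 = _
    rw [h.eq 0 _ ⟨ht, E.baseValue_mem⟩]
  have hs : ∀ s, ∀ t ∈ E.I, E.coordSlope X s t = deriv τ t / 2 + a s := fun s t ht => by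
    change ((X.1 s (t, E.baseValue')).2 - (X.1 s (t, E.baseValue)).2) / _ = _
    rw [h.eq s (t, E.baseValue) ⟨ht, E.baseValue_mem⟩,
      h.eq s (t, E.baseValue') ⟨ht, E.baseValue'_mem⟩]
    simp only
    field_simp
    ring
  have hb : E.basePoint ∈ E.I := E.nonempty_I.choose_spec
  refine ⟨hτ, ?_, fun s t ht => ?_⟩
  · ext s
    change E.coordSlope X s E.basePoint - deriv (E.coordTau X) E.basePoint / 2 = _
    have e : E.coordTau X =ᶠ[𝓝 E.basePoint] τ := by
      filter_upwards [E.isOpen_I.mem_nhds hb] with x hx using hτ x hx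
    rw [hs s _ hb, e.deriv_eq]
    ring
  · change (X.1 s (t, E.baseValue)).2 - E.baseValue * E.coordSlope X s t = _
    rw [hs s t ht, h.eq s _ ⟨ht, E.baseValue_mem⟩]
    simp only
    ring

theorem AffineForm.congr {X : Site → ℝ × ℝ → ℝ × ℝ} {τ τ' : ℝ → ℝ} {a : Site → ℝ}
    {l l' : Site → ℝ → ℝ} (h : E.AffineForm X τ a l) (hτ : ∀ t ∈ E.I, τ' t = τ t)
    (hl : ∀ s, ∀ t ∈ E.I, l' s t = l s t) : E.AffineForm X τ' a l' := by
  refine ⟨h.smooth_τ.congr hτ, fun s => (h.smooth_l s).congr (hl s), fun s p hp => ?_⟩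
  have e : τ' =ᶠ[𝓝 p.1] τ := by
    filter_upwards [E.isOpen_I.mem_nhds hp.1] with x hx using hτ x hx
  rw [h.eq s p hp, hτ _ hp.1, hl s _ hp.1, e.deriv_eq]

theorem AffineForm.coordForm {X : LatticeField E.M} {τ : ℝ → ℝ} {a : Site → ℝ}
    {l : Site → ℝ → ℝ} (h : E.AffineForm X.1 τ a l) :
    E.AffineForm X.1 (E.coordTau X) (E.coordScal X) (E.coordLam X) := by
  rw [h.coord.2.1]
  exact h.congr h.coord.1 h.coord.2.2

theorem AffineForm.hasFDerivAt {X : Site → ℝ × ℝ → ℝ × ℝ} {τ : ℝ → ℝ} {a : Site → ℝ}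
    {l : Site → ℝ → ℝ} (h : E.AffineForm X τ a l) (s : Site) {p : ℝ × ℝ} (hp : p ∈ E.M)
    (v : ℝ × ℝ) : fderiv ℝ (X s) p v = (deriv τ p.1 * v.1,
      (deriv (deriv τ) p.1 / 2 * p.2 + deriv (l s) p.1) * v.1
        + (deriv τ p.1 / 2 + a s) * v.2) := by
  have hI := E.isOpen_I
  have f1 := hasFDerivAt_fst (𝕜 := ℝ) (p := p)
  have f2 := hasFDerivAt_snd (𝕜 := ℝ) (p := p)
  have h1 := (h.smooth_τ.hasDerivAt_deriv hI hp.1).comp_hasFDerivAt p f1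
  have h2 := ((((h.smooth_τ.deriv_smooth hI).hasDerivAt_deriv hI hp.1).div_const 2).add_const
    (a s)).comp_hasFDerivAt p f1
  have h3 := ((h.smooth_l s).hasDerivAt_deriv hI hp.1).comp_hasFDerivAt p f1
  have h4 : X s =ᶠ[𝓝 p] fun p => (τ p.1, (deriv τ p.1 / 2 + a s) * p.2 + l s p.1) := by
    filter_upwards [E.M.isOpen.mem_nhds hp] with q hq using h.eq s q hq
  have h5 := ((h1.prodMk ((h2.mul f2).add h3)).congr_of_eventuallyEq h4).fderiv
  rw [h5]
  ext
  · simp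
  · simp
    ring

theorem AffineForm.lie {X Y : LatticeField E.M} {τ τ' : ℝ → ℝ} {a a' : Site → ℝ}
    {l l' : Site → ℝ → ℝ} (hX : E.AffineForm X.1 τ a l) (hY : E.AffineForm Y.1 τ' a' l') :
    E.AffineForm (⁅X, Y⁆ : LatticeField E.M).1 (fun t => τ t * deriv τ' t - deriv τ t * τ' t) 0
      (fun s t => τ t * deriv (l' s) t + l s t * (deriv τ' t / 2 + a' s)
        - τ' t * deriv (l s) t - l' s t * (deriv τ t / 2 + a s)) := by
  have hI := E.isOpen_I
  have d := hX.smooth_τ.deriv_smooth hI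
  have d' := hY.smooth_τ.deriv_smooth hI
  refine ⟨(hX.smooth_τ.mul d').sub (d.mul hY.smooth_τ), fun s => ?_, fun s p hp => ?_⟩
  · have m := (hX.smooth_l s).deriv_smooth hI
    have m' := (hY.smooth_l s).deriv_smooth hI
    exact (((hX.smooth_τ.mul m').add ((hX.smooth_l s).mul
      ((d'.div_const 2).add contDiffOn_const))).sub (hY.smooth_τ.mul m)).sub
      ((hY.smooth_l s).mul ((d.div_const 2).add contDiffOn_const))
  · rw [LatticeField.bracket_apply X Y s hp, VectorField.lieBracket, hX.hasFDerivAt s hp,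
      hY.hasFDerivAt s hp, hX.eq s p hp, hY.eq s p hp]
    have := (((hX.smooth_τ.hasDerivAt_deriv hI hp.1).fun_mul (d'.hasDerivAt_deriv hI hp.1)).fun_sub
      ((d.hasDerivAt_deriv hI hp.1).fun_mul (hY.smooth_τ.hasDerivAt_deriv hI hp.1))).deriv
    rw [this]
    ext
    · simp
      ring
    · simp
      ring

/-- The action of an algebra of symmetries of a coupled equation. -/
def affineAction (L : LieSubalgebra ℝ (LatticeField E.M))
    (hL : ∀ X ∈ L, E.AffineForm X.1 (E.coordTau X) (E.coordScal X) (E.coordLam X)) :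
    AffineAction E.I Site L where
  tau := E.coordTau ∘ₗ L.toSubmodule.subtype
  scal := E.coordScal ∘ₗ L.toSubmodule.subtype
  lam := E.coordLam ∘ₗ L.toSubmodule.subtype
  smooth_tau X := (hL X X.2).smooth_τ
  smooth_lam X s := (hL X X.2).smooth_l s
  tau_lie X Y t ht := ((hL X X.2).lie (hL Y Y.2)).coord.1 t ht
  scal_lie X Y := ((hL X X.2).lie (hL Y Y.2)).coord.2.1
  lam_lie X Y s t ht := ((hL X X.2).lie (hL Y Y.2)).coord.2.2 s t ht
  ext_zero X h1 h2 h3 := by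
    have hX := hL X X.2
    refine Subtype.ext (LatticeField.ext_on fun s p hp => ?_)
    rw [hX.eq s p hp]
    have e : E.coordTau X =ᶠ[𝓝 p.1] fun _ => 0 := by
      filter_upwards [E.isOpen_I.mem_nhds hp.1] with x hx using h1 x hx
    have h1' : E.coordTau X p.1 = 0 := h1 _ hp.1
    have h2' : E.coordScal X = 0 := h2
    have h3' : E.coordLam X s p.1 = 0 := h3 s _ hp.1
    rw [e.deriv_eq, h1', h2', h3']
    simp

end LatticeEquation
end

noncomputable section

/-! ### Spaces of functions on the lattice -/

/-- Functions in `V` are determined by their values at the first `k` points of `Γ`, at any site. -/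
def DeterminedBy (V : Submodule ℝ (Site → ℝ)) (k : ℕ) : Prop :=
  ∀ s, ∀ c ∈ V, (∀ i : Fin 7, (i : ℕ) < k → c (nbr i s) = 0) → c = 0

theorem nbr_zero (s : Site) : nbr 0 s = s := by simp [nbr, offset]

theorem nbr_eq (i : Fin 7) (s : Site) :
    nbr i s = (s.1 + (offset i).1, s.2 + (offset i).2) := rfl

namespace DeterminedBy

variable {V B : Submodule ℝ (Site → ℝ)} {k : ℕ}

/-- The values at the first `k` points of `Γ`. -/
def eval (V : Submodule ℝ (Site → ℝ)) (k : ℕ) (s : Site) : V →ₗ[ℝ] {i : Fin 7 // (i : ℕ) < k} → ℝ where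
  toFun c i := c.1 (nbr i s)
  map_add' _ _ := rfl
  map_smul' _ _ := rfl

theorem eval_injective (h : DeterminedBy V k) (s : Site) : Function.Injective (eval V k s) := by
  refine (injective_iff_map_eq_zero _).2 fun c hc => Subtype.ext (h s c c.2 fun i hi => ?_)
  exact congrFun hc ⟨i, hi⟩

theorem card_index (hk : k ≤ 7) : Fintype.card {i : Fin 7 // (i : ℕ) < k} = k := by
  interval_cases k <;> decide

theorem finrank_le (h : DeterminedBy V k) (hk : k ≤ 7) : Module.finrank ℝ V ≤ k := by
  have := LinearMap.finrank_le_finrank_of_injective (h.eval_injective 0)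
  rwa [Module.finrank_fintype_fun_eq_card, card_index hk] at this

theorem exists_mem [Module.Finite ℝ V] (h : DeterminedBy V k) (hk : k ≤ 7)
    (hV : Module.finrank ℝ V = k) (s : Site) (f : Fin 7 → ℝ) :
    ∃ c ∈ V, ∀ i : Fin 7, (i : ℕ) < k → c (nbr i s) = f i := by
  have hs : Function.Surjective (eval V k s) :=
    (LinearMap.injective_iff_surjective_of_finrank_eq_finrank (by
      rw [hV, Module.finrank_fintype_fun_eq_card, card_index hk])).1 (h.eval_injective s)
  obtain ⟨c, hc⟩ := hs fun i => f i
  exact ⟨c, c.2, fun i hi => congrFun hc ⟨i, hi⟩⟩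

theorem eq_of_eq (h : DeterminedBy V k) (s : Site) {c c' : Site → ℝ} (hc : c ∈ V) (hc' : c' ∈ V)
    (he : ∀ i : Fin 7, (i : ℕ) < k → c (nbr i s) = c' (nbr i s)) : c = c' :=
  sub_eq_zero.1 (h s _ (sub_mem hc hc') fun i hi => by simp [he i hi])

theorem exists_ne_zero [Module.Finite ℝ V] (h : DeterminedBy V k) (hk : k ≤ 7)
    (hV : Module.finrank ℝ V = k) (h0 : 0 < k) (s : Site) : ∃ c ∈ V, c s ≠ 0 := by
  obtain ⟨c, hc, h1⟩ := h.exists_mem hk hV s fun _ => 1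
  refine ⟨c, hc, ?_⟩
  have := h1 0 h0
  rw [nbr_zero] at this
  rw [this]
  exact one_ne_zero

/-- Multipliers of `V` are determined in the same way. -/
theorem multiplier [Module.Finite ℝ V] (h : DeterminedBy V k) (hk : k ≤ 7)
    (hV : Module.finrank ℝ V = k) (h0 : 0 < k) (hB : ∀ b ∈ B, ∀ c ∈ V, b * c ∈ V) :
    DeterminedBy B k := by
  intro s b hb hz
  ext s'
  obtain ⟨c, hc, hc0⟩ := h.exists_ne_zero hk hV h0 s'
  have := congrFun (h s _ (hB b hb c hc) fun i hi => by simp [hz i hi]) s'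
  exact (mul_eq_zero.1 this).resolve_right hc0

/-- When `B` is as large as determinacy permits, it contains a `b` equal to `1` at the test points
of one site. Multiplication by `b` is then the identity on `V`, so `b = 1` at every site. -/
theorem one_mem [Module.Finite ℝ B] (h : DeterminedBy V k) (hk : k ≤ 7)
    (hB : DeterminedBy B k) (hBV : ∀ b ∈ B, ∀ c ∈ V, b * c ∈ V) (hBk : Module.finrank ℝ B = k)
    (hV : ∀ s, ∃ c ∈ V, c s ≠ 0) : (1 : Site → ℝ) ∈ B := by
  obtain ⟨b, hb, hb1⟩ := hB.exists_mem hk hBk 0 fun _ => 1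
  convert hb
  ext s
  obtain ⟨c, hc, hc0⟩ := hV s
  have := congrFun (h.eq_of_eq 0 (hBV b hb c hc) hc fun i hi => by simp [hb1 i hi]) s
  refine mul_right_cancel₀ hc0 ?_
  simpa using this.symm

/-- If `V` is three-dimensional with a three-dimensional space of multipliers, then at each site
there are a multiplier and an element of `V` supported, on `Γ`, at the site itself. -/
theorem exists_local [Module.Finite ℝ V] [Module.Finite ℝ B] (h : DeterminedBy V 3)
    (hV : Module.finrank ℝ V = 3) (hBk : Module.finrank ℝ B = 3)
    (hBV : ∀ b ∈ B, ∀ c ∈ V, b * c ∈ V) (s : Site) :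
    ∃ a ∈ B, ∃ c ∈ V, ∀ i : Fin 7, a (nbr i s) = (Pi.single 0 1 : Fin 7 → ℝ) i ∧
      c (nbr i s) = (Pi.single 0 1 : Fin 7 → ℝ) i := by
  have hB : DeterminedBy B 3 := h.multiplier (by norm_num) hV (by norm_num) hBV
  obtain ⟨a, ha, ha'⟩ := hB.exists_mem (by norm_num) hBk s (Pi.single 0 1)
  obtain ⟨c, hc, hc'⟩ := h.exists_mem (by norm_num) hV s (Pi.single 0 1)
  have a0 : a s = 1 := by simpa [nbr_zero] using ha' 0 (by norm_num)
  -- Let `s` be the `j`-th vertex of the triangle of `s'`, and let `e ∈ V` be one at that vertex and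
  -- zero at the others. Since `a s = 1`, `a * e = e`, so `e` vanishes wherever `a` does; on the
  -- triangle of `s` it agrees with `c`, hence `e = c`. Thus `c` also vanishes at the other vertices
  -- of the triangle of `s'`. Two such triangles supply the points `3, 4, 5, 6` of `Γ`.
  have key : ∀ (s' : Site) (j : Fin 7), (j : ℕ) < 3 → nbr j s' = s →
      ∀ i : Fin 7, (i : ℕ) < 3 → i ≠ j → c (nbr i s') = 0 := by
    intro s' j hj hjs i hi hij
    obtain ⟨e, he, he'⟩ := h.exists_mem (by norm_num) hV s' (Pi.single j 1)
    have e1 : a * e = e := by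
      refine h.eq_of_eq s' (hBV a ha e he) he fun i hi => ?_
      by_cases hij : i = j
      · subst hij
        rw [Pi.mul_apply, hjs, a0, one_mul]
      · rw [Pi.mul_apply, he' i hi]
        simp [hij]
    have es : e s = 1 := by rw [← hjs, he' j hj]; simp
    have e2 : e = c := by
      refine h.eq_of_eq s he hc fun i hi => ?_
      rw [hc' i hi]
      by_cases hi0 : i = 0
      · subst hi0
        simpa [nbr_zero] using es
      · rw [← e1, Pi.mul_apply, ha' i hi]
        simp [hi0]
    rw [← e2, he' i hi]
    simp [hij]
  have c3 : c (nbr 3 s) = 0 := by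
    have := key (s.1 - 1, s.2) 1 (by norm_num) (by simp [nbr_eq, offset]) 2 (by norm_num)
      (by decide)
    convert this using 2
    simp [nbr_eq, offset]
    ring
  have c4 : c (nbr 4 s) = 0 := by
    have := key (s.1 - 1, s.2) 1 (by norm_num) (by simp [nbr_eq, offset]) 0 (by norm_num)
      (by decide)
    convert this using 2
    simp [nbr_eq, offset]
    ring
  have c5 : c (nbr 5 s) = 0 := by
    have := key (s.1, s.2 - 1) 2 (by norm_num) (by simp [nbr_eq, offset]) 0 (by norm_num)
      (by decide)
    convert this using 2
    simp [nbr_eq, offset]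
    ring
  have c6 : c (nbr 6 s) = 0 := by
    have := key (s.1, s.2 - 1) 2 (by norm_num) (by simp [nbr_eq, offset]) 1 (by norm_num)
      (by decide)
    convert this using 2
    simp [nbr_eq, offset]
    ring
  have hcΓ : ∀ i : Fin 7, c (nbr i s) = (Pi.single 0 1 : Fin 7 → ℝ) i := by
    intro i
    by_cases hi : (i : ℕ) < 3
    · exact hc' i hi
    · have : i = 3 ∨ i = 4 ∨ i = 5 ∨ i = 6 := by omega
      rcases this with rfl | rfl | rfl | rfl <;> simp [c3, c4, c5, c6]
  refine ⟨a, ha, c, hc, fun i => ⟨?_, hcΓ i⟩⟩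
  by_cases hi : (i : ℕ) < 3
  · exact ha' i hi
  · obtain ⟨v, hv, hv0⟩ := h.exists_ne_zero (by norm_num) hV (by norm_num) (nbr i s)
    -- Both sides agree on the triangle of `s`. As `v` is not zero at the chosen point, the
    -- vanishing of `c` there passes to `a`.
    have e : a * v = v s • c := by
      refine h.eq_of_eq s (hBV a ha v hv) (V.smul_mem _ hc) fun j hj => ?_
      rw [Pi.mul_apply, ha' j hj, Pi.smul_apply, hc' j hj]
      by_cases hj0 : j = 0
      · subst hj0; simp [nbr_zero]
      · simp [hj0]
    have := congrFun e (nbr i s)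
    have hi0 : i ≠ 0 := fun h => hi (by rw [h]; norm_num)
    rw [Pi.mul_apply, Pi.smul_apply, hcΓ i] at this
    simp only [hi0, ne_eq, not_false_eq_true, Pi.single_eq_of_ne, smul_zero] at this ⊢
    exact (mul_eq_zero.1 this).resolve_right hv0

/-- The multipliers of the previous lemma at the corners of a triangle add up to one. -/
theorem sum_local (hB : DeterminedBy B 3)
    (h1 : (1 : Site → ℝ) ∈ B) {a : Site → Site → ℝ} (ha : ∀ s, a s ∈ B)
    (hΓ : ∀ s (i : Fin 7), a s (nbr i s) = (Pi.single 0 1 : Fin 7 → ℝ) i) :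
    a (0, 0) + a (1, 0) + a (0, 1) = 1 := by
  refine hB.eq_of_eq (0, 0) (add_mem (add_mem (ha _) (ha _)) (ha _)) h1 fun i hi => ?_
  have h0 := hΓ (0, 0)
  have h1 := hΓ (1, 0)
  have h2 := hΓ (0, 1)
  have : i = 0 ∨ i = 1 ∨ i = 2 := by omega
  simp only [Fin.forall_fin_succ, nbr_eq, offset] at h0 h1 h2
  simp at h0 h1 h2
  rcases this with rfl | rfl | rfl <;> simp [nbr_eq, offset, h0, h1, h2]

end DeterminedBy
end

/-! ### The determining equation in a chart -/

noncomputable section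

theorem deriv_eq_of_eqOn {U : Set ℝ} (hU : IsOpen U) {f φ φ' : ℝ → ℝ} (h : ∀ t ∈ U, f t = φ t)
    (hφ : ∀ t ∈ U, HasDerivAt φ (φ' t) t) : ∀ t ∈ U, deriv f t = φ' t := fun t ht => by
  have e : f =ᶠ[𝓝 t] φ := by filter_upwards [hU.mem_nhds ht] with x hx using h x hx
  rw [e.deriv_eq, (hφ t ht).deriv]

namespace AffineAction.Chart

variable {I : Set ℝ} {S : Type*} {L : Type*} [LieRing L] [LieAlgebra ℝ L]
  {R : AffineAction I S L} {t₀ t : ℝ} (K : R.Chart t₀)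

/-- The ratio `g'' / g`. -/
def ψ (t : ℝ) : ℝ := deriv (deriv K.g) t / K.g t

theorem contDiffOn_deriv_g : ContDiffOn ℝ ∞ (deriv K.g) K.dom :=
  K.contDiffOn_g.deriv_smooth K.isOpen_dom

theorem contDiffOn_ψ : ContDiffOn ℝ ∞ K.ψ K.dom :=
  (K.contDiffOn_deriv_g.deriv_smooth K.isOpen_dom).div K.contDiffOn_g fun _ ht => (K.g_pos ht).ne'

theorem hasDerivAt_deriv_g (ht : t ∈ K.dom) :
    HasDerivAt (deriv K.g) (K.ψ t * K.g t) t := by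
  refine (K.contDiffOn_deriv_g.hasDerivAt_deriv K.isOpen_dom ht).congr_deriv ?_
  have := (K.g_pos ht).ne'
  rw [ψ]; field_simp

theorem hasDerivAt_ψ (ht : t ∈ K.dom) : HasDerivAt K.ψ (deriv K.ψ t) t :=
  K.contDiffOn_ψ.hasDerivAt_deriv K.isOpen_dom ht

theorem deriv2_tau₀ (ht : t ∈ K.dom) : deriv (deriv (R.tau K.e₀)) t =
    2 * deriv K.g t ^ 2 + 2 * K.ψ t * K.g t ^ 2 := by
  refine deriv_eq_of_eqOn (φ' := fun t => 2 * deriv K.g t ^ 2 + 2 * K.ψ t * K.g t ^ 2)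
    K.isOpen_dom (fun t ht => K.deriv_tau₀ ht) (fun t ht => ?_) t ht
  refine (((K.hasDerivAt_g ht).const_mul 2).fun_mul (K.hasDerivAt_deriv_g ht)).congr_deriv ?_
  ring

theorem deriv3_tau₀ (ht : t ∈ K.dom) : deriv (deriv (deriv (R.tau K.e₀))) t =
    8 * K.ψ t * K.g t * deriv K.g t + 2 * deriv K.ψ t * K.g t ^ 2 := by
  refine deriv_eq_of_eqOn (φ' := fun t => 8 * K.ψ t * K.g t * deriv K.g t +
    2 * deriv K.ψ t * K.g t ^ 2) K.isOpen_dom (fun t ht => K.deriv2_tau₀ ht) (fun t ht => ?_) t ht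
  refine ((((K.hasDerivAt_deriv_g ht).fun_pow 2).const_mul 2).fun_add
    (((K.hasDerivAt_ψ ht).const_mul 2).fun_mul ((K.hasDerivAt_g ht).fun_pow 2))).congr_deriv ?_
  norm_num
  ring

theorem deriv3_tau₁ (hI : IsOpen I) (ht : t ∈ K.dom) : deriv (deriv (deriv (R.tau K.e₁))) t =
    4 * K.ψ t + K.θ t * (8 * K.ψ t * K.g t * deriv K.g t + 2 * deriv K.ψ t * K.g t ^ 2) := by
  have h2 : ∀ t ∈ K.dom, deriv (deriv (R.tau K.e₁)) t =
      2 * deriv K.g t / K.g t + K.θ t * (2 * deriv K.g t ^ 2 + 2 * K.ψ t * K.g t ^ 2) :=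
    deriv_eq_of_eqOn K.isOpen_dom (fun t ht => K.deriv_tau₁ hI ht) fun t ht => by
      have := (K.g_pos ht).ne'
      refine (((K.hasDerivAt_θ hI ht).fun_mul (((K.hasDerivAt_g ht).const_mul 2).fun_mul
        (K.hasDerivAt_deriv_g ht))).const_add 1).congr_deriv ?_
      field_simp
  refine deriv_eq_of_eqOn (φ' := fun t => 4 * K.ψ t + K.θ t *
    (8 * K.ψ t * K.g t * deriv K.g t + 2 * deriv K.ψ t * K.g t ^ 2)) K.isOpen_dom h2
    (fun t ht => ?_) t ht
  have := (K.g_pos ht).ne'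
  refine ((((K.hasDerivAt_deriv_g ht).const_mul 2).fun_div (K.hasDerivAt_g ht) this).fun_add
    ((K.hasDerivAt_θ hI ht).fun_mul ((((K.hasDerivAt_deriv_g ht).fun_pow 2).const_mul 2).fun_add
    (((K.hasDerivAt_ψ ht).const_mul 2).fun_mul ((K.hasDerivAt_g ht).fun_pow 2))))).congr_deriv ?_
  norm_num
  field_simp
  ring

end AffineAction.Chart

namespace LatticeEquation

variable {E : LatticeEquation} {L : LieSubalgebra ℝ (LatticeField E.M)}

theorem IsSymmetryAlgebra.coordForm (hL : E.IsSymmetryAlgebra L) (hc : E.IsCoupled) :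
    ∀ X ∈ L, E.AffineForm X.1 (E.coordTau X) (E.coordScal X) (E.coordLam X) := fun X hX => by
  obtain ⟨τ, a, l, h⟩ := ((hL X).1 hX).exists_affineForm hc fun s => (LatticeField.prop X s).1
  exact h.coordForm

/-- The action of the symmetry algebra. -/
def IsSymmetryAlgebra.action (hL : E.IsSymmetryAlgebra L) (hc : E.IsCoupled) :
    AffineAction E.I Site L := E.affineAction L (hL.coordForm hc)

theorem AffineForm.contDiffOn {X : Site → ℝ × ℝ → ℝ × ℝ} {τ : ℝ → ℝ} {a : Site → ℝ}
    {l : Site → ℝ → ℝ} (h : E.AffineForm X τ a l) (s : Site) : ContDiffOn ℝ ∞ (X s) E.M := by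
  have h1 : ∀ {f : ℝ → ℝ}, ContDiffOn ℝ ∞ f E.I →
      ContDiffOn ℝ ∞ (fun p : ℝ × ℝ => f p.1) E.M := fun hf =>
    hf.comp contDiffOn_fst fun p hp => hp.1
  refine ContDiffOn.congr ((h1 h.smooth_τ).prodMk
    ((((h1 (h.smooth_τ.deriv_smooth E.isOpen_I)).div_const 2).add contDiffOn_const).mul
      contDiffOn_snd |>.add (h1 (h.smooth_l s)))) fun p hp => h.eq s p hp

section

variable (hL : E.IsSymmetryAlgebra L) (hc : E.IsCoupled)

theorem IsSymmetryAlgebra.affineForm (X : L) : E.AffineForm X.1.1 ((hL.action hc).tau X)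
    ((hL.action hc).scal X) ((hL.action hc).lam X) := hL.coordForm hc X X.2

theorem IsSymmetryAlgebra.exists_mem {X : Site → ℝ × ℝ → ℝ × ℝ} {τ : ℝ → ℝ} {a : Site → ℝ}
    {l : Site → ℝ → ℝ} (h : E.AffineForm X τ a l) (hX : E.IsSymmetry X) :
    ∃ Y : L, (∀ t ∈ E.I, (hL.action hc).tau Y t = τ t) ∧ (hL.action hc).scal Y = a ∧
      ∀ s, ∀ t ∈ E.I, (hL.action hc).lam Y s t = l s t := by
  classical
  -- A symmetry is given as functions on the whole plane; members of `LatticeField` vanish outside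
  -- their domain, so it is cut off there.
  let Y : LatticeField E.M := ⟨fun s p => if p ∈ E.M then X s p else 0, show ∀ _, _ from fun s =>
    ⟨(h.contDiffOn s).congr fun p hp => if_pos hp, fun p hp => if_neg hp⟩⟩
  have hY : E.AffineForm Y.1 τ a l :=
    ⟨h.smooth_τ, h.smooth_l, fun s p hp => (if_pos hp).trans (h.eq s p hp)⟩
  exact ⟨⟨Y, (hL Y).2 (hY.isSymmetry_iff.2 (h.isSymmetry_iff.1 hX))⟩, hY.coord⟩

/-- The determining equation for the elements of the symmetry algebra. -/
theorem IsSymmetryAlgebra.det_eq (X : L) {s : Site} {p : LocalConf} (hp : p ∈ E.Ω s) :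
    deriv (deriv ((hL.action hc).lam X s)) p.1
      + deriv (deriv (deriv ((hL.action hc).tau X))) p.1 / 2 * p.2 0
      + ((hL.action hc).scal X s - 3 / 2 * deriv ((hL.action hc).tau X) p.1) * E.F s p =
    fderiv ℝ (E.F s) p ((hL.action hc).tau X p.1, fun i =>
      (deriv ((hL.action hc).tau X) p.1 / 2 + (hL.action hc).scal X (nbr i s)) * p.2 i
        + (hL.action hc).lam X (nbr i s) p.1) :=
  (hL.affineForm hc X).isSymmetry_iff.1 ((hL X.1).1 X.2) s p hp

theorem deriv_const_on {U : Set ℝ} (hU : IsOpen U) {f : ℝ → ℝ} (h : ∀ t ∈ U, f t = 0) :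
    ∀ t ∈ U, deriv f t = 0 :=
  deriv_eq_of_eqOn hU (φ := fun _ => 0) (φ' := fun _ => 0) h fun t _ => hasDerivAt_const t 0

theorem IsSymmetryAlgebra.isSymmetry_vertical {k : L} (hk : k ∈ (hL.action hc).vertical) :
    E.IsSymmetry fun s p => (0, (hL.action hc).scal k s * p.2 + (hL.action hc).lam k s p.1) := by
  have h := (hL.affineForm hc k).congr (τ' := fun _ => 0) (fun t ht => (hk t ht).symm)
    fun _ _ _ => rfl
  have h' : E.AffineForm
      (fun s p => (0, (hL.action hc).scal k s * p.2 + (hL.action hc).lam k s p.1))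
      (fun _ => 0) ((hL.action hc).scal k) ((hL.action hc).lam k) :=
    ⟨h.smooth_τ, h.smooth_l, fun s p hp => by simp⟩
  exact h'.isSymmetry_iff.2 (h.isSymmetry_iff.1 ((hL k.1).1 k.2))

theorem IsSymmetryAlgebra.exists_vertical {a : Site → ℝ} {l : Site → ℝ → ℝ}
    (hl : ∀ s, ContDiffOn ℝ ∞ (l s) E.I) (h : E.IsSymmetry fun s p => (0, a s * p.2 + l s p.1)) :
    ∃ Y ∈ (hL.action hc).vertical, (hL.action hc).scal Y = a ∧
      ∀ s, ∀ t ∈ E.I, (hL.action hc).lam Y s t = l s t :=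
  hL.exists_mem hc (τ := fun _ => 0) ⟨contDiffOn_const, hl, fun s p _ => by simp⟩ h

/-- This and the next lemma carry the isotropy condition, phrased for the equation, over to the data
of the action. -/
theorem IsSymmetryAlgebra.translations_eq {t : ℝ} (ht : t ∈ E.I) :
    E.translations t = (hL.action hc).values t := by
  apply le_antisymm
  · refine Submodule.span_le.2 ?_
    rintro c ⟨l, hl, h, rfl⟩
    obtain ⟨Y, hY, hYa, hYl⟩ := hL.exists_vertical hc (a := 0) hl (by simpa using h)
    exact ⟨Y, ⟨hY, hYa⟩, funext fun s => hYl s t ht⟩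
  · rintro _ ⟨X, hX, rfl⟩
    have hs : (hL.action hc).scal X = 0 := hX.2
    refine Submodule.subset_span ⟨(hL.action hc).lam X, (hL.action hc).smooth_lam X, ?_, rfl⟩
    have := hL.isSymmetry_vertical hc hX.1
    simpa [hs] using this

theorem IsSymmetryAlgebra.scalings_eq : E.scalings = (hL.action hc).scals := by
  apply le_antisymm
  · refine Submodule.span_le.2 ?_
    rintro a ⟨l, hl, h⟩
    obtain ⟨Y, hY, hYa, -⟩ := hL.exists_vertical hc hl h
    exact ⟨Y, hY, hYa⟩
  · rintro _ ⟨X, hX, rfl⟩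
    exact Submodule.subset_span ⟨_, (hL.action hc).smooth_lam X, hL.isSymmetry_vertical hc hX⟩

end

/-! ### The equation in the gauge -/

open AffineAction

variable {hL : E.IsSymmetryAlgebra L} {hc : E.IsCoupled} {t₀ : ℝ}
  {K : (hL.action hc).Chart t₀} (G : K.Gauge)

/-- The deviation from the gauge. -/
def dev (Q : Site → ℝ → ℝ) (s : Site) (p : LocalConf) : Fin 7 → ℝ :=
  fun i => p.2 i - Q (nbr i s) p.1

/-- The term in `q'` cancels in the second derivative of a density of weight `-1/2`. That is why
only `q''` and `q'''` enter the equations for the force, besides a multiple of `q` that turns `u`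
into `u - q`. -/
theorem deriv2_gauge {U : Set ℝ} (hU : IsOpen U) {e q l : ℝ → ℝ} (he : ContDiffOn ℝ ∞ e U)
    (hq : ContDiffOn ℝ ∞ q U) (hl : ∀ t ∈ U, l t = e t * deriv q t - deriv e t / 2 * q t) :
    ∀ t ∈ U, deriv (deriv l) t = e t * deriv (deriv (deriv q)) t
      + 3 / 2 * deriv e t * deriv (deriv q) t - deriv (deriv (deriv e)) t / 2 * q t := by
  have he1 := he.deriv_smooth hU
  have he2 := he1.deriv_smooth hU
  have hq1 := hq.deriv_smooth hU
  have hq2 := hq1.deriv_smooth hU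
  have h1 : ∀ t ∈ U, deriv l t = e t * deriv (deriv q) t + deriv e t / 2 * deriv q t
      - deriv (deriv e) t / 2 * q t :=
    deriv_eq_of_eqOn hU hl fun t ht => by
      refine (((he.hasDerivAt_deriv hU ht).fun_mul (hq1.hasDerivAt_deriv hU ht)).fun_sub
        (((he1.hasDerivAt_deriv hU ht).div_const 2).fun_mul
          (hq.hasDerivAt_deriv hU ht))).congr_deriv ?_
      ring
  refine deriv_eq_of_eqOn hU h1 fun t ht => ?_
  refine ((((he.hasDerivAt_deriv hU ht).fun_mul (hq2.hasDerivAt_deriv hU ht)).fun_add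
    (((he1.hasDerivAt_deriv hU ht).div_const 2).fun_mul (hq1.hasDerivAt_deriv hU ht))).fun_sub
    (((he2.hasDerivAt_deriv hU ht).div_const 2).fun_mul
      (hq.hasDerivAt_deriv hU ht))).congr_deriv ?_
  ring

/-- The prescribed `λ` makes the field equal to `τ` times the motion along `Q` plus `τ'/2` times the
scaling of `u - Q`. The determining equation splits accordingly. -/
theorem gauge_det_eq {X : L} (hs : (hL.action hc).scal X = 0)
    (hl : ∀ s, ∀ t ∈ K.dom, (hL.action hc).lam X s t = (hL.action hc).tau X t * deriv (G.Q s) t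
      - deriv ((hL.action hc).tau X) t / 2 * G.Q s t) {s : Site} {p : LocalConf}
    (hp : p ∈ E.Ω s) (ht : p.1 ∈ K.dom) :
    (hL.action hc).tau X p.1 * (deriv (deriv (deriv (G.Q s))) p.1
        - fderiv ℝ (E.F s) p (1, fun i => deriv (G.Q (nbr i s)) p.1))
      + deriv ((hL.action hc).tau X) p.1 / 2 * (3 * deriv (deriv (G.Q s)) p.1 - 3 * E.F s p
        - fderiv ℝ (E.F s) p (0, dev G.Q s p))
      + deriv (deriv (deriv ((hL.action hc).tau X))) p.1 / 2 * dev G.Q s p 0 = 0 := by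
  have h := hL.det_eq hc X hp
  rw [hs, deriv2_gauge K.isOpen_dom (K.contDiffOn_tau X) (G.smooth s) (hl s) p.1 ht] at h
  have e : (((hL.action hc).tau X p.1, fun i =>
      (deriv ((hL.action hc).tau X) p.1 / 2 + (0 : Site → ℝ) (nbr i s)) * p.2 i
        + (hL.action hc).lam X (nbr i s) p.1) : LocalConf) =
      (hL.action hc).tau X p.1 • ((1, fun i => deriv (G.Q (nbr i s)) p.1) : LocalConf)
      + (deriv ((hL.action hc).tau X) p.1 / 2) • ((0, dev G.Q s p) : LocalConf) := by
    refine Prod.ext (by simp) (funext fun i => ?_)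
    simp only [hl _ _ ht, dev, Pi.zero_apply, Prod.snd_add, Prod.smul_snd, Pi.add_apply,
      Pi.smul_apply, smul_eq_mul]
    ring
  rw [e, map_add, map_smul, map_smul] at h
  simp only [smul_eq_mul, Pi.zero_apply, dev, nbr_zero] at h ⊢
  linarith

theorem deriv_congr_on {U : Set ℝ} (hU : IsOpen U) {f h : ℝ → ℝ} (e : ∀ t ∈ U, f t = h t) :
    ∀ t ∈ U, deriv f t = deriv h t := fun t ht => by
  have : f =ᶠ[𝓝 t] h := by filter_upwards [hU.mem_nhds ht] with x hx using e x hx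
  exact this.deriv_eq

/-- The time and scaling symmetries of the force in the gauge. -/
theorem force_time_scale {s : Site} {p : LocalConf} (hp : p ∈ E.Ω s) (ht : p.1 ∈ K.dom) :
    fderiv ℝ (E.F s) p (1, fun i => deriv (G.Q (nbr i s)) p.1) =
      deriv (deriv (deriv (G.Q s))) p.1 + deriv K.ψ p.1 * dev G.Q s p 0 ∧
    fderiv ℝ (E.F s) p (0, dev G.Q s p) =
      -3 * (E.F s p - deriv (deriv (G.Q s)) p.1) + 4 * K.ψ p.1 * dev G.Q s p 0 := by
  have hI := E.isOpen_I
  have ht' := K.dom_subset ht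
  have h0 := gauge_det_eq G G.scal₀ (fun s t ht => by
    rw [G.lam₀ s t ht, G.tau₀ t (K.dom_subset ht),
      Chart.Gauge.deriv_tau_eq hI G.tau₀ (K.dom_subset ht)]) hp ht
  have h1 := gauge_det_eq G G.scal₁ (fun s t ht => by
    rw [G.lam₁ s t ht, G.tau₁ t (K.dom_subset ht),
      Chart.Gauge.deriv_tau_eq hI G.tau₁ (K.dom_subset ht)]) hp ht
  rw [G.tau₀ _ ht', deriv_congr_on hI (deriv_congr_on hI (deriv_congr_on hI G.tau₀)) _ ht',
    Chart.Gauge.deriv_tau_eq hI G.tau₀ ht', K.tau₀ ht, K.deriv_tau₀ ht, K.deriv3_tau₀ ht] at h0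
  rw [G.tau₁ _ ht', deriv_congr_on hI (deriv_congr_on hI (deriv_congr_on hI G.tau₁)) _ ht',
    Chart.Gauge.deriv_tau_eq hI G.tau₁ ht', K.tau₁ ht, K.deriv_tau₁ hI ht,
    K.deriv3_tau₁ hI ht] at h1
  -- As `τ₁ = θ τ₀`, subtracting `θ` times the equation of `x₀` from that of `x₁` eliminates the
  -- time derivative and leaves the law of scaling. The equation of `x₂` is not needed.
  have hs : fderiv ℝ (E.F s) p (0, dev G.Q s p) =
      -3 * (E.F s p - deriv (deriv (G.Q s)) p.1) + 4 * K.ψ p.1 * dev G.Q s p 0 := by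
    linear_combination 2 * K.θ p.1 * h0 - 2 * h1
  refine ⟨?_, hs⟩
  rw [hs] at h0
  have hg := pow_ne_zero 2 (K.g_pos ht).ne'
  refine mul_left_cancel₀ hg ?_
  linear_combination -h0

/-- Translations and the force. -/
theorem force_const [FiniteDimensional ℝ L] {c : Site → ℝ} (hcV : c ∈ (hL.action hc).values t₀)
    {s : Site} {p : LocalConf} (hp : p ∈ E.Ω s) (ht : p.1 ∈ K.dom) :
    fderiv ℝ (E.F s) p (0, fun i => c (nbr i s)) = K.ψ p.1 * c s := by
  have hI := E.isOpen_I
  obtain ⟨X, hX, -, hXl⟩ := K.exists_lam_eq_const hI hcV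
  have h := hL.det_eq hc X hp
  have ht' := K.dom_subset ht
  have z1 := deriv_const_on hI hX.1
  have z3 := deriv_const_on hI (deriv_const_on hI z1)
  have hs : (hL.action hc).scal X = 0 := hX.2
  have hl2 := deriv_eq_of_eqOn K.isOpen_dom (deriv_eq_of_eqOn K.isOpen_dom (hXl s)
    fun t ht => (K.hasDerivAt_g ht).mul_const (c s))
    (fun t ht => (K.hasDerivAt_deriv_g ht).mul_const (c s)) p.1 ht
  rw [hs, hX.1 _ ht', z1 _ ht', z3 _ ht', hl2] at h
  have e : ((0, fun i => (0 / 2 + (0 : Site → ℝ) (nbr i s)) * p.2 i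
      + (hL.action hc).lam X (nbr i s) p.1) : LocalConf) =
      K.g p.1 • ((0, fun i => c (nbr i s)) : LocalConf) := by
    refine Prod.ext (by simp) (funext fun i => ?_)
    simp [hXl _ _ ht]
  rw [e, map_smul, smul_eq_mul] at h
  refine mul_left_cancel₀ (K.g_pos ht).ne' ?_
  rw [← h]
  simp
  ring

/-- Multipliers and the force. -/
theorem force_scal [FiniteDimensional ℝ L] {a : Site → ℝ} (ha : a ∈ (hL.action hc).scals)
    {s : Site} {p : LocalConf} (hp : p ∈ E.Ω s) (ht : p.1 ∈ K.dom) :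
    fderiv ℝ (E.F s) p (0, fun i => a (nbr i s) * dev G.Q s p i) =
      a s * (E.F s p - deriv (deriv (G.Q s)) p.1) := by
  have hI := E.isOpen_I
  obtain ⟨k, hk, rfl⟩ := ha
  obtain ⟨X, hX, hXs, hXl⟩ := G.exists_vertical hI E.ordConnected_I hk
  have h := hL.det_eq hc X hp
  have ht' := K.dom_subset ht
  have z1 := deriv_const_on hI hX
  have z3 := deriv_const_on hI (deriv_const_on hI z1)
  have hQ1 := (G.smooth s).deriv_smooth K.isOpen_dom
  have hl2 := deriv_eq_of_eqOn K.isOpen_dom (deriv_eq_of_eqOn K.isOpen_dom (hXl s)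
    fun t ht => (G.hasDerivAt_Q s ht).const_mul _)
    (fun t ht => (hQ1.hasDerivAt_deriv K.isOpen_dom ht).const_mul _) p.1 ht
  rw [hXs, hX _ ht', z1 _ ht', z3 _ ht', hl2] at h
  have e : ((0, fun i => (0 / 2 + (hL.action hc).scal k (nbr i s)) * p.2 i
      + (hL.action hc).lam X (nbr i s) p.1) : LocalConf) =
      (0, fun i => (hL.action hc).scal k (nbr i s) * dev G.Q s p i) := by
    refine Prod.ext rfl (funext fun i => ?_)
    simp only [hXl _ _ ht, dev]
    ring
  rw [e] at h
  rw [← h]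
  ring

end LatticeEquation
end

/-! ### Dimension eleven: four translations and no multipliers -/

noncomputable section

namespace LatticeEquation

open AffineAction

variable {E : LatticeEquation} {L : LieSubalgebra ℝ (LatticeField E.M)}
variable {hL : E.IsSymmetryAlgebra L} {hc : E.IsCoupled} {t₀ : ℝ}
  {K : (hL.action hc).Chart t₀} (G : K.Gauge)

/-- The force in the gauge. -/
def gaugeForce (s : Site) (p : LocalConf) : ℝ :=
  E.F s p - deriv (deriv (G.Q s)) p.1 - K.ψ p.1 * dev G.Q s p 0

theorem isOpen_slab (K : (hL.action hc).Chart t₀) (s : Site) :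
    IsOpen {p ∈ E.Ω s | p.1 ∈ K.dom} :=
  (E.isOpen_Ω s).inter (K.isOpen_dom.preimage continuous_fst)

/-- If the corrected force vanished over the chart, the original one would be a function of `t` and
`u_{nm}` there, against coupling. -/
theorem exists_gaugeForce_ne_zero (s : Site) :
    ∃ p ∈ E.Ω s, p.1 ∈ K.dom ∧ gaugeForce G s p ≠ 0 := by
  by_contra hcon
  push Not at hcon
  obtain ⟨x, hx⟩ := E.nonempty_J
  obtain ⟨p, hp, hpt, -⟩ := E.exists_mem_Ω s t₀ K.mem x hx
  refine hc.not_local (isOpen_slab K s) (fun p hp => hp.1) ⟨p, hp, ?_⟩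
    (fun q => deriv (deriv (G.Q s)) q.1 + K.ψ q.1 * (q.2 - G.Q s q.1)) fun q hq => ?_
  · rw [hpt]; exact K.mem_dom
  · have := hcon q hq.1 hq.2
    rw [gaugeForce, dev, nbr_zero] at this
    linarith

/-- The multiplier `1` would make `F - Q''` of degree one in `u - Q`, while the frame makes the
corrected force of degree `-3`. Together these give four times the corrected force equal to zero. -/
theorem one_notMem_scals (G : K.Gauge) [FiniteDimensional ℝ L] : (1 : Site → ℝ) ∉ (hL.action hc).scals := by
  intro h1
  obtain ⟨p, hp, ht, h0⟩ := exists_gaugeForce_ne_zero G 0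
  have h2 := force_scal G h1 hp ht
  have h3 := (force_time_scale G hp ht).2
  simp only [Pi.one_apply, one_mul] at h2
  rw [show (fun i => dev G.Q (0 : Site) p i) = dev G.Q 0 p from rfl, h3] at h2
  apply h0
  rw [gaugeForce]
  linarith

/-- A multiplier supported, on `Γ`, at the site itself, together with a translation. -/
theorem eq_quarter_of_local (G : K.Gauge) [FiniteDimensional ℝ L] {a c : Site → ℝ} {α : ℝ} {s : Site}
    (ha : a - α • (1 : Site → ℝ) ∈ (hL.action hc).scals) (hcV : c ∈ (hL.action hc).values t₀)
    (h : ∀ i : Fin 7, a (nbr i s) = (Pi.single 0 1 : Fin 7 → ℝ) i ∧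
      c (nbr i s) = (Pi.single 0 1 : Fin 7 → ℝ) i) : α = 1 / 4 := by
  obtain ⟨p, hp, ht, h0⟩ := exists_gaugeForce_ne_zero G s
  have h1 := force_scal G ha hp ht
  have h2 := (force_time_scale G hp ht).2
  have h3 := force_const hcV hp ht
  have as : a s = 1 := by have := (h 0).1; rw [nbr_zero] at this; simpa using this
  have cs : c s = 1 := by have := (h 0).2; rw [nbr_zero] at this; simpa using this
  -- On `Γ` the deviation multiplied by `a` is `dev₀` times the translation `c`, because both are
  -- supported at the site. Its effect on the force is thus known twice, and comparison gives `(1 -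
  -- 4α)` times the corrected force equal to zero.
  have e : ((0, fun i => (a - α • (1 : Site → ℝ)) (nbr i s) * dev G.Q s p i) : LocalConf) =
      dev G.Q s p 0 • ((0, fun i => c (nbr i s)) : LocalConf) - α • (0, dev G.Q s p) := by
    refine Prod.ext (by simp) (funext fun i => ?_)
    simp only [Pi.sub_apply, Pi.smul_apply, Pi.one_apply, (h i).1, (h i).2, Prod.snd_sub,
      Prod.smul_snd, smul_eq_mul]
    by_cases hi : i = 0
    · subst hi; simp; ring
    · simp [hi]
  rw [e, map_sub, map_smul, map_smul, h2, h3, cs] at h1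
  simp only [Pi.sub_apply, as, Pi.smul_apply, Pi.one_apply, smul_eq_mul] at h1
  have : (1 - 4 * α) * gaugeForce G s p = 0 := by
    rw [gaugeForce]; linear_combination -h1
  have := (mul_eq_zero.1 this).resolve_right h0
  linarith

theorem finrank_sup_one {A : Submodule ℝ (Site → ℝ)} [Module.Finite ℝ A]
    (h : (1 : Site → ℝ) ∉ A) :
    Module.finrank ℝ ↥(A ⊔ Submodule.span ℝ {(1 : Site → ℝ)}) = Module.finrank ℝ A + 1 := by
  have h1 := Submodule.finrank_sup_add_finrank_inf_eq A (Submodule.span ℝ {(1 : Site → ℝ)})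
  have h2 : A ⊓ Submodule.span ℝ {(1 : Site → ℝ)} = ⊥ := by
    refine (Submodule.eq_bot_iff _).2 fun x hx => ?_
    obtain ⟨r, rfl⟩ := Submodule.mem_span_singleton.1 hx.2
    by_cases hr : r = 0
    · simp [hr]
    · exact absurd ((A.smul_mem_iff hr).1 hx.1) h
  rw [h2, finrank_bot, finrank_span_singleton one_ne_zero] at h1
  linarith

/-- In dimension eleven there are four translations and no multipliers. -/
theorem finrank_values [FiniteDimensional ℝ L] (G : K.Gauge) (hi : E.IsIsotropic)
    (h11 : Module.finrank ℝ L = 11) :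
    Module.finrank ℝ ((hL.action hc).values t₀) = 4 ∧ Module.finrank ℝ (hL.action hc).scals = 0 := by
  have hI := E.isOpen_I
  have hIc := E.ordConnected_I
  have hf := K.finrank_formula hI hIc
  rw [h11] at hf
  set V := (hL.action hc).values t₀ with hVdef
  set A := (hL.action hc).scals with hAdef
  set d := Module.finrank ℝ V with hd
  have hV : DeterminedBy V d := by
    intro s c hcV
    have := hi.1 t₀ K.mem s c
    rw [hL.translations_eq hc K.mem] at this
    exact this hcV
  have hA7 : Module.finrank ℝ A ≤ 7 := by
    refine DeterminedBy.finrank_le (k := 7) (fun s a ha h => ?_) le_rfl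
    refine hi.2 s a ?_ fun i => h i i.2
    rw [hL.scalings_eq hc]; exact ha
  have hAV : ∀ a ∈ A, ∀ c ∈ V, a * c ∈ V := fun a ha c hcV => K.mul_mem_values hI ha hcV
  have h1 : (1 : Site → ℝ) ∉ A := one_notMem_scals G
  -- The dimension formula reads `dim A + 2 d = 8`; together with `dim A ≤ 7` it also excludes `d =
  -- 0`.
  have hd4 : d ≤ 4 := by omega
  have hd0 : 0 < d := by omega
  have hA : DeterminedBy A d := hV.multiplier (by omega) hd.symm hd0 hAV
  have hAd : Module.finrank ℝ A < d := by
    refine lt_of_le_of_ne (hA.finrank_le (by omega)) fun he => h1 ?_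
    exact hV.one_mem (by omega) hA hAV he fun s => hV.exists_ne_zero (by omega) hd.symm hd0 s
  by_contra hne
  -- With `dim A < d ≤ 4` the only other solution of `dim A + 2 d = 8` is `d = 3`, `dim A = 2`.
  have hd3 : d = 3 := by omega
  have hA2 : Module.finrank ℝ A = 2 := by omega
  set B := A ⊔ Submodule.span ℝ {(1 : Site → ℝ)} with hB
  have hB3 : Module.finrank ℝ B = 3 := by rw [hB, finrank_sup_one h1, hA2]
  have hmemB : ∀ b ∈ B, ∃ α : ℝ, b - α • (1 : Site → ℝ) ∈ A := by
    intro b hb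
    obtain ⟨a, ha, y, hy, rfl⟩ := Submodule.mem_sup.1 hb
    obtain ⟨α, rfl⟩ := Submodule.mem_span_singleton.1 hy
    exact ⟨α, by simpa using ha⟩
  have hBV : ∀ b ∈ B, ∀ c ∈ V, b * c ∈ V := by
    intro b hb c hcV
    obtain ⟨α, hα⟩ := hmemB b hb
    have := add_mem (hAV _ hα c hcV) (V.smul_mem α hcV)
    convert this using 1
    ext s
    simp
    ring
  rw [hd3] at hV
  choose a haB c hcV h using DeterminedBy.exists_local hV (hd.symm.trans hd3) hB3 hBV
  have h14 : ∀ s, a s - (1 / 4 : ℝ) • (1 : Site → ℝ) ∈ A := fun s => by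
    obtain ⟨α, hα⟩ := hmemB _ (haB s)
    have := eq_quarter_of_local G hα (hcV s) (h s)
    rwa [← this]
  have hsum := DeterminedBy.sum_local
    (hV.multiplier (by norm_num) (hd.symm.trans hd3) (by norm_num) hBV)
    (Submodule.mem_sup_right (Submodule.mem_span_singleton_self _)) haB fun s i => (h s i).1
  apply h1
  -- The three local multipliers of a triangle add up to `1`, so `4 ∑ (a_s - 1/4) = 4 (1 - 3/4) = 1`
  -- lies in `A`.
  have := A.smul_mem 4 (add_mem (add_mem (h14 (0, 0)) (h14 (1, 0))) (h14 (0, 1)))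
  convert this using 1
  rw [← hsum]
  ext s
  have := congrFun hsum s
  simp only [Pi.add_apply, Pi.one_apply, Pi.sub_apply, Pi.smul_apply, smul_eq_mul] at this ⊢
  linarith

theorem scals_eq_bot [FiniteDimensional ℝ L] (G : K.Gauge) (hi : E.IsIsotropic)
    (h11 : Module.finrank ℝ L = 11) : (hL.action hc).scals = ⊥ :=
  Submodule.finrank_eq_zero.1 (finrank_values G hi h11).2

end LatticeEquation
end

noncomputable section

/-! ### The determinants -/

/-- The space spanned by `1, κ⁽¹⁾, κ⁽²⁾, κ⁽³⁾`. -/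
def shifts (κ : Fin 3 → Site → ℝ) : Submodule ℝ (Site → ℝ) :=
  Submodule.span ℝ (insert 1 (range κ))

variable {κ : Fin 3 → Site → ℝ}

theorem one_mem_shifts : (1 : Site → ℝ) ∈ shifts κ := Submodule.subset_span (mem_insert _ _)

theorem kappa_mem_shifts (i : Fin 3) : κ i ∈ shifts κ :=
  Submodule.subset_span (mem_insert_of_mem _ (mem_range_self i))

/-- The minors of the determinant `detU` along its first row. -/
def detMinor (κ : Fin 3 → Site → ℝ) (s : Site) (j : Fin 7) (k : Fin 5) : ℝ :=
  latticeDet ![onΓ (κ 0) s, onΓ (κ 1) s, onΓ (κ 2) s, fun _ => 1]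
    (fun i => (![0, 1, 2, 3, j] : Fin 5 → Fin 7) (k.succAbove i))

theorem detU_eq_sum (κ : Fin 3 → Site → ℝ) (s : Site) (u : Fin 7 → ℝ) (j : Fin 7) :
    detU κ s u j = ∑ k : Fin 5, (-1) ^ (k : ℕ) * u ((![0, 1, 2, 3, j] : Fin 5 → Fin 7) k)
      * detMinor κ s j k := by
  rw [detU, latticeDet, Matrix.det_succ_row_zero]
  rfl

theorem detMinor_four (κ : Fin 3 → Site → ℝ) (s : Site) (j : Fin 7) : detMinor κ s j 4 =
    latticeDet ![onΓ (κ 0) s, onΓ (κ 1) s, onΓ (κ 2) s, fun _ => 1] ![0, 1, 2, 3] := by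
  rw [detMinor]
  congr 1
  ext i
  fin_cases i <;> rfl

/-- `detU` as a linear form in `u`. -/
def detForm (κ : Fin 3 → Site → ℝ) (s : Site) (j : Fin 7) : (Fin 7 → ℝ) →L[ℝ] ℝ :=
  ∑ k : Fin 5, ((-1) ^ (k : ℕ) * detMinor κ s j k) •
    ContinuousLinearMap.proj (R := ℝ) (φ := fun _ : Fin 7 => ℝ)
      ((![0, 1, 2, 3, j] : Fin 5 → Fin 7) k)

theorem detForm_apply (κ : Fin 3 → Site → ℝ) (s : Site) (j : Fin 7) (u : Fin 7 → ℝ) :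
    detForm κ s j u = detU κ s u j := by
  rw [detU_eq_sum, detForm]
  simp only [sum_apply, smul_apply,
    ContinuousLinearMap.proj_apply, smul_eq_mul]
  exact Finset.sum_congr rfl fun k _ => by ring

/-- In the expansion along the first row only the last minor survives, with sign `(-1)⁴`; it is the
determinant of the nondegeneracy condition for every `j`. -/
theorem detForm_of_vanish {s : Site} {j : Fin 7} {u : Fin 7 → ℝ} (h0 : u 0 = 0) (h1 : u 1 = 0)
    (h2 : u 2 = 0) (h3 : u 3 = 0) : detForm κ s j u = u j *
      latticeDet ![onΓ (κ 0) s, onΓ (κ 1) s, onΓ (κ 2) s, fun _ => 1] ![0, 1, 2, 3] := by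
  rw [detForm_apply, detU_eq_sum, Fin.sum_univ_five, ← detMinor_four κ s j]
  simp [h0, h1, h2, h3, Even.neg_pow (show Even 4 by decide)]

/-- For a generator of the shifts the first row repeats another one. -/
theorem detForm_shift {c : Site → ℝ} (hc : c ∈ shifts κ) (s : Site) (j : Fin 7) :
    detForm κ s j (onΓ c s) = 0 := by
  induction hc using Submodule.span_induction with
  | mem x hx =>
    rw [detForm_apply, detU, latticeDet]
    rcases hx with rfl | ⟨i, rfl⟩
    · exact Matrix.det_zero_of_row_eq (i := 0) (j := 4) (by decide) rfl
    · fin_cases i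
      · exact Matrix.det_zero_of_row_eq (i := 0) (j := 1) (by decide) rfl
      · exact Matrix.det_zero_of_row_eq (i := 0) (j := 2) (by decide) rfl
      · exact Matrix.det_zero_of_row_eq (i := 0) (j := 3) (by decide) rfl
  | zero => exact map_zero (detForm κ s j)
  | add x y _ _ hx hy => 
    have := map_add (detForm κ s j) (onΓ x s) (onΓ y s)
    rw [hx, hy, add_zero] at this
    exact this
  | smul a x _ hx =>
    have := map_smul (detForm κ s j) a (onΓ x s)
    rw [hx, smul_zero] at this
    exact this

theorem mem_shifts_iff {c : Site → ℝ} :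
    c ∈ shifts κ ↔ ∃ v : Fin 4 → ℝ, c = v 0 • κ 0 + v 1 • κ 1 + v 2 • κ 2 + v 3 • 1 := by
  constructor
  · intro hc
    induction hc using Submodule.span_induction with
    | mem x hx =>
      rcases hx with rfl | ⟨i, rfl⟩
      · exact ⟨![0, 0, 0, 1], by simp⟩
      · fin_cases i
        · exact ⟨![1, 0, 0, 0], by simp⟩
        · exact ⟨![0, 1, 0, 0], by simp⟩
        · exact ⟨![0, 0, 1, 0], by simp⟩
    | zero => exact ⟨0, by simp⟩
    | add x y _ _ hx hy =>
      obtain ⟨v, rfl⟩ := hx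
      obtain ⟨w, rfl⟩ := hy
      exact ⟨v + w, by simp only [Pi.add_apply]; module⟩
    | smul a x _ hx =>
      obtain ⟨v, rfl⟩ := hx
      exact ⟨a • v, by simp only [Pi.smul_apply, smul_eq_mul]; module⟩
  · rintro ⟨v, rfl⟩
    exact add_mem (add_mem (add_mem (Submodule.smul_mem _ _ (kappa_mem_shifts 0))
      (Submodule.smul_mem _ _ (kappa_mem_shifts 1))) (Submodule.smul_mem _ _ (kappa_mem_shifts 2)))
      (Submodule.smul_mem _ _ one_mem_shifts)

theorem vecMul_onΓ (κ : Fin 3 → Site → ℝ) (s : Site) (v : Fin 4 → ℝ) (j : Fin 4) :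
    Matrix.vecMul v (Matrix.of fun i j => (![onΓ (κ 0) s, onΓ (κ 1) s, onΓ (κ 2) s,
      fun _ => 1] : Fin 4 → Fin 7 → ℝ) i ((![0, 1, 2, 3] : Fin 4 → Fin 7) j)) j =
    (v 0 • κ 0 + v 1 • κ 1 + v 2 • κ 2 + v 3 • (1 : Site → ℝ))
      (nbr ((![0, 1, 2, 3] : Fin 4 → Fin 7) j) s) := by
  simp [Matrix.vecMul, dotProduct, Fin.sum_univ_four, onΓ]

/-- Elements of `shifts κ` are determined by their values at the first four points of `Γ`, which
may be prescribed. -/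
theorem IsNondegenerate.coeff_eq_zero (h : IsNondegenerate κ) {s : Site} {v : Fin 4 → ℝ}
    (hv : ∀ j : Fin 4, (v 0 • κ 0 + v 1 • κ 1 + v 2 • κ 2 + v 3 • (1 : Site → ℝ))
      (nbr ((![0, 1, 2, 3] : Fin 4 → Fin 7) j) s) = 0) : v = 0 := by
  by_contra hne
  exact h s (Matrix.exists_vecMul_eq_zero_iff.1 ⟨v, hne, funext fun j => by
    rw [vecMul_onΓ, hv j]; rfl⟩)

theorem IsNondegenerate.exists_shift (h : IsNondegenerate κ) (s : Site) (y : Fin 7 → ℝ) :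
    ∃ c ∈ shifts κ, ∀ j : Fin 4, onΓ c s ((![0, 1, 2, 3] : Fin 4 → Fin 7) j) =
      y ((![0, 1, 2, 3] : Fin 4 → Fin 7) j) := by
  have hu := Matrix.isUnit_iff_isUnit_det _ |>.2 (isUnit_iff_ne_zero.2 (h s))
  obtain ⟨v, hv⟩ := Matrix.vecMul_surjective_iff_isUnit.2 hu
    fun j => y ((![0, 1, 2, 3] : Fin 4 → Fin 7) j)
  exact ⟨_, mem_shifts_iff.2 ⟨v, rfl⟩, fun j => by
    rw [onΓ, ← vecMul_onΓ]; exact congrFun hv j⟩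

/-- The common kernel of the three determinants. -/
theorem IsNondegenerate.exists_eq_shift (h : IsNondegenerate κ) {s : Site} {y : Fin 7 → ℝ}
    (h4 : detForm κ s 4 y = 0) (h5 : detForm κ s 5 y = 0) (h6 : detForm κ s 6 y = 0) :
    ∃ c ∈ shifts κ, y = onΓ c s := by
  obtain ⟨c, hc, hcy⟩ := h.exists_shift s y
  refine ⟨c, hc, ?_⟩
  rw [← sub_eq_zero]
  have z : ∀ j : Fin 4, (y - onΓ c s) ((![0, 1, 2, 3] : Fin 4 → Fin 7) j) = 0 := fun j => by
    rw [Pi.sub_apply, hcy j, sub_self]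
  have z0 : (y - onΓ c s) 0 = 0 := z 0
  have z1 : (y - onΓ c s) 1 = 0 := z 1
  have z2 : (y - onΓ c s) 2 = 0 := z 2
  have z3 : (y - onΓ c s) 3 = 0 := z 3
  have key : ∀ j, detForm κ s j y = 0 → (y - onΓ c s) j = 0 := fun j hj => by
    have := detForm_of_vanish (κ := κ) (s := s) (j := j) z0 z1 z2 z3
    rw [map_sub, hj, detForm_shift hc, sub_self] at this
    exact (mul_eq_zero.1 this.symm).resolve_right (h s)
  have z4 := key 4 h4
  have z5 := key 5 h5
  have z6 := key 6 h6
  ext j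
  fin_cases j <;> assumption

theorem IsNondegenerate.finrank_shifts (h : IsNondegenerate κ) :
    Module.finrank ℝ (shifts κ) = 4 := by
  let Φ : (Fin 4 → ℝ) →ₗ[ℝ] Site → ℝ :=
    { toFun := fun v => v 0 • κ 0 + v 1 • κ 1 + v 2 • κ 2 + v 3 • 1
      map_add' := fun v w => by simp only [Pi.add_apply]; module
      map_smul' := fun a v => by simp only [Pi.smul_apply, smul_eq_mul, RingHom.id_apply]; module }
  have hr : shifts κ = LinearMap.range Φ := by
    ext c
    rw [mem_shifts_iff, LinearMap.mem_range]
    exact exists_congr fun v => eq_comm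
  have hi : Function.Injective Φ := (injective_iff_map_eq_zero Φ).2 fun v hv =>
    h.coeff_eq_zero (s := 0) fun j => congrFun hv _
  rw [hr, LinearMap.finrank_range_of_inj hi]
  simp

/-! ### The algebra `NS` -/

/-- The field with `τ = a₀ + a₁ t + a₂ t²` and `φ = τ' u / 2 + c + d t`. -/
def nsField : (Fin 3 → ℝ) × (Site → ℝ) × (Site → ℝ) →ₗ[ℝ] LatticeField ⊤ where
  toFun x := smoothField (fun s p => (x.1 0 + x.1 1 * p.1 + x.1 2 * p.1 ^ 2,
    (x.1 1 / 2 + x.1 2 * p.1) * p.2 + x.2.1 s + x.2.2 s * p.1)) fun s => by fun_prop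
  map_add' x y := LatticeField.ext_on fun s p _ => by
    ext
    · simp [smoothField]; ring
    · simp [smoothField]; ring
  map_smul' a x := LatticeField.ext_on fun s p _ => by
    ext
    · simp [smoothField]; ring
    · simp [smoothField]; ring

theorem nsField_apply (x : (Fin 3 → ℝ) × (Site → ℝ) × (Site → ℝ)) (s : Site) (p : ℝ × ℝ) :
    (nsField x).1 s p = (x.1 0 + x.1 1 * p.1 + x.1 2 * p.1 ^ 2,
    (x.1 1 / 2 + x.1 2 * p.1) * p.2 + x.2.1 s + x.2.2 s * p.1) := rfl

/-- The coefficients of a field of the form `nsField`. -/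
def nsCoeff : LatticeField ⊤ →ₗ[ℝ] (Fin 3 → ℝ) × (Site → ℝ) × (Site → ℝ) where
  toFun X := (![(X.1 0 (0, 0)).1, 2 * ((X.1 0 (0, 1)).2 - (X.1 0 (0, 0)).2),
    (X.1 0 (1, 0)).1 - (X.1 0 (0, 0)).1 - 2 * ((X.1 0 (0, 1)).2 - (X.1 0 (0, 0)).2)],
    fun s => (X.1 s (0, 0)).2, fun s => (X.1 s (1, 0)).2 - (X.1 s (0, 0)).2)
  map_add' X Y := by
    refine Prod.ext (funext fun i => ?_) (Prod.ext (funext fun s => ?_) (funext fun s => ?_))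
    · fin_cases i <;> simp <;> ring
    · simp
    · simp; ring
  map_smul' a X := by
    refine Prod.ext (funext fun i => ?_) (Prod.ext (funext fun s => ?_) (funext fun s => ?_))
    · fin_cases i <;> simp <;> ring
    · simp
    · simp; ring

theorem nsCoeff_nsField (x : (Fin 3 → ℝ) × (Site → ℝ) × (Site → ℝ)) :
    nsCoeff (nsField x) = x := by
  refine Prod.ext (funext fun i => ?_) (Prod.ext (funext fun s => ?_) (funext fun s => ?_))
  · fin_cases i <;> simp [nsCoeff, nsField_apply] <;> ring
  · simp [nsCoeff, nsField_apply]
  · simp [nsCoeff, nsField_apply]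

theorem nsField_injective : Function.Injective nsField :=
  Function.LeftInverse.injective nsCoeff_nsField

theorem lie_nsField (x y : (Fin 3 → ℝ) × (Site → ℝ) × (Site → ℝ)) :
    ⁅nsField x, nsField y⁆ = nsField (![x.1 0 * y.1 1 - x.1 1 * y.1 0,
      2 * (x.1 0 * y.1 2 - x.1 2 * y.1 0), x.1 1 * y.1 2 - x.1 2 * y.1 1],
      x.1 0 • y.2.2 + (y.1 1 / 2) • x.2.1 - y.1 0 • x.2.2 - (x.1 1 / 2) • y.2.1,
      (x.1 1 / 2) • y.2.2 - (y.1 1 / 2) • x.2.2 + y.1 2 • x.2.1 - x.1 2 • y.2.1) := by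
  have key : ∀ (x : (Fin 3 → ℝ) × (Site → ℝ) × (Site → ℝ)) (s : Site) (p v : ℝ × ℝ),
      fderiv ℝ ((nsField x).1 s) p v = ((x.1 1 + 2 * x.1 2 * p.1) * v.1,
        (x.1 2 * p.2 + x.2.2 s) * v.1 + (x.1 1 / 2 + x.1 2 * p.1) * v.2) := by
    intro x s p v
    have f1 := hasFDerivAt_fst (𝕜 := ℝ) (p := p)
    have f2 := hasFDerivAt_snd (𝕜 := ℝ) (p := p)
    have h := ((((f1.const_mul (x.1 1)).const_add (x.1 0)).add ((f1.pow 2).const_mul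
      (x.1 2))).prodMk (((((f1.const_mul (x.1 2)).const_add (x.1 1 / 2)).mul f2).add_const
      (x.2.1 s)).add (f1.const_mul (x.2.2 s)))).fderiv
    have e : (nsField x).1 s = fun p => (x.1 0 + x.1 1 * p.1 + x.1 2 * p.1 ^ 2,
      (x.1 1 / 2 + x.1 2 * p.1) * p.2 + x.2.1 s + x.2.2 s * p.1) := rfl
    rw [e]
    refine (congrArg (fun A => A v) h).trans ?_
    ext
    · simp; ring
    · simp; ring
  refine LatticeField.ext_on fun s p hp => ?_
  rw [LatticeField.bracket_apply _ _ s hp, VectorField.lieBracket, key, key, nsField_apply,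
    nsField_apply, nsField_apply]
  ext
  · simp; ring
  · simp; ring

/-- The coefficients of the elements of `nsSpan`. -/
def nsDomain (κ : Fin 3 → Site → ℝ) : Submodule ℝ ((Fin 3 → ℝ) × (Site → ℝ) × (Site → ℝ)) :=
  Submodule.prod ⊤ ((shifts κ).prod (shifts κ))

theorem fieldX1_eq : fieldX1 = nsField (![1, 0, 0], 0, 0) :=
  LatticeField.ext_on fun s p _ => by simp [fieldX1, smoothField, nsField_apply]

theorem fieldX2_eq : fieldX2 = nsField (![0, 1, 0], 0, 0) :=
  LatticeField.ext_on fun s p _ => by simp [fieldX2, smoothField, nsField_apply]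

theorem fieldX3_eq : fieldX3 = nsField (![0, 0, 1], 0, 0) :=
  LatticeField.ext_on fun s p _ => by simp [fieldX3, smoothField, nsField_apply]

theorem fieldY_eq (c : Site → ℝ) : fieldY c = nsField (0, c, 0) :=
  LatticeField.ext_on fun s p _ => by simp [fieldY, smoothField, nsField_apply]

theorem fieldYt_eq (c : Site → ℝ) : fieldYt c = nsField (0, 0, c) :=
  LatticeField.ext_on fun s p _ => by simp [fieldYt, smoothField, nsField_apply]

theorem sl2Span_eq : sl2Span = (Submodule.prod ⊤ ⊥).map nsField := by
  apply le_antisymm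
  · refine Submodule.span_le.2 ?_
    rintro X (rfl | rfl | rfl)
    · exact ⟨_, ⟨trivial, zero_mem _⟩, fieldX1_eq.symm⟩
    · exact ⟨_, ⟨trivial, zero_mem _⟩, fieldX2_eq.symm⟩
    · exact ⟨_, ⟨trivial, zero_mem _⟩, fieldX3_eq.symm⟩
  · rintro _ ⟨⟨a, b⟩, ⟨-, hb⟩, rfl⟩
    obtain rfl : b = 0 := hb
    have : nsField (a, 0) = a 0 • fieldX1 + a 1 • fieldX2 + a 2 • fieldX3 := by
      rw [fieldX1_eq, fieldX2_eq, fieldX3_eq, ← map_smul, ← map_smul, ← map_smul, ← map_add,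
        ← map_add]
      congr 1
      refine Prod.ext (funext fun i => ?_) (by simp; rfl)
      fin_cases i <;> simp
    rw [this]
    exact add_mem (add_mem (Submodule.smul_mem _ _ (Submodule.subset_span (by simp)))
      (Submodule.smul_mem _ _ (Submodule.subset_span (by simp))))
      (Submodule.smul_mem _ _ (Submodule.subset_span (by simp)))

theorem radicalSpan_eq (κ : Fin 3 → Site → ℝ) : radicalSpan κ =
    (Submodule.prod ⊥ ((shifts κ).prod (shifts κ))).map nsField := by
  apply le_antisymm
  · refine Submodule.span_le.2 ?_
    rintro X ((rfl | rfl) | (⟨i, rfl⟩ | ⟨i, rfl⟩))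
    · exact ⟨_, ⟨zero_mem _, one_mem_shifts, zero_mem _⟩, (fieldY_eq _).symm⟩
    · exact ⟨_, ⟨zero_mem _, zero_mem _, one_mem_shifts⟩, (fieldYt_eq _).symm⟩
    · exact ⟨_, ⟨zero_mem _, kappa_mem_shifts i, zero_mem _⟩, (fieldY_eq _).symm⟩
    · exact ⟨_, ⟨zero_mem _, zero_mem _, kappa_mem_shifts i⟩, (fieldYt_eq _).symm⟩
  · rintro _ ⟨⟨a, c, d⟩, ⟨ha, hc, hd⟩, rfl⟩
    obtain rfl : a = 0 := ha
    have e : nsField (0, c, d) = nsField (0, c, 0) + nsField (0, 0, d) := by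
      rw [← map_add]; simp
    rw [e]
    have one : (fun _ => 1 : Site → ℝ) = 1 := rfl
    refine add_mem ?_ ?_
    · have : shifts κ ≤ (radicalSpan κ).comap (nsField ∘ₗ LinearMap.inr ℝ _ _ ∘ₗ
          LinearMap.inl ℝ _ _) := by
        refine Submodule.span_le.2 ?_
        rintro x (rfl | ⟨i, rfl⟩)
        · exact Submodule.subset_span (Or.inl (Or.inl (fieldY_eq _).symm))
        · exact Submodule.subset_span (Or.inr (Or.inl ⟨i, fieldY_eq _⟩))
      exact this hc
    · have : shifts κ ≤ (radicalSpan κ).comap (nsField ∘ₗ LinearMap.inr ℝ _ _ ∘ₗ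
          LinearMap.inr ℝ _ _) := by
        refine Submodule.span_le.2 ?_
        rintro x (rfl | ⟨i, rfl⟩)
        · exact Submodule.subset_span (Or.inl (Or.inr (fieldYt_eq _).symm))
        · exact Submodule.subset_span (Or.inr (Or.inr ⟨i, fieldYt_eq _⟩))
      exact this hd

theorem nsSpan_eq (κ : Fin 3 → Site → ℝ) : nsSpan κ = (nsDomain κ).map nsField := by
  rw [nsSpan, sl2Span_eq, radicalSpan_eq, ← Submodule.map_sup]
  congr 1
  rw [nsDomain, Submodule.prod_sup_prod]
  simp

theorem mem_nsSpan {X : LatticeField ⊤} : X ∈ nsSpan κ ↔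
    ∃ a, ∃ c ∈ shifts κ, ∃ d ∈ shifts κ, nsField (a, c, d) = X := by
  rw [nsSpan_eq]
  constructor
  · rintro ⟨⟨a, c, d⟩, ⟨-, hc, hd⟩, rfl⟩
    exact ⟨a, c, hc, d, hd, rfl⟩
  · rintro ⟨a, c, hc, d, hd, rfl⟩
    exact ⟨_, ⟨trivial, hc, hd⟩, rfl⟩
end

noncomputable section

/-! ### Lie algebras over `sl(2)` -/

/-- The bracket of `sl(2)` in the basis `e₀, e₁, e₂`. -/
def sl2Bracket (a b : Fin 3 → ℝ) : Fin 3 → ℝ :=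
  ![a 0 * b 1 - a 1 * b 0, 2 * (a 0 * b 2 - a 2 * b 0), a 1 * b 2 - a 2 * b 1]

section Sl2Quotient

variable {L : Type*} [LieRing L] [LieAlgebra ℝ L] {ν : L →ₗ[ℝ] Fin 3 → ℝ}

theorem eq_top_of_basis {N : Submodule ℝ (Fin 3 → ℝ)} (h0 : ![1, 0, 0] ∈ N) (h1 : ![0, 1, 0] ∈ N)
    (h2 : ![0, 0, 1] ∈ N) : N = ⊤ := by
  refine eq_top_iff.2 fun a _ => ?_
  have := add_mem (add_mem (N.smul_mem (a 0) h0) (N.smul_mem (a 1) h1)) (N.smul_mem (a 2) h2)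
  convert this using 1
  ext i
  fin_cases i <;> simp

/-- `sl(2)` is perfect, so an ideal that projects onto it keeps doing so through its derived series.
-/
theorem map_derivedSeries_eq_top
    (hν : ∀ X Y, ν ⁅X, Y⁆ = sl2Bracket (ν X) (ν Y)) {I : LieIdeal ℝ L} (hI : I.toSubmodule.map ν = ⊤) (k : ℕ) :
    (LieAlgebra.derivedSeriesOfIdeal ℝ L k I).toSubmodule.map ν = ⊤ := by
  induction k with
  | zero => exact hI
  | succ k ih =>
    set J := LieAlgebra.derivedSeriesOfIdeal ℝ L k I
    have hJ : ∀ a, ∃ X ∈ J, ν X = a := fun a => by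
      have : a ∈ J.toSubmodule.map ν := by rw [ih]; trivial
      exact this
    obtain ⟨X, hX, hX'⟩ := hJ ![1, 0, 0]
    obtain ⟨Y, hY, hY'⟩ := hJ ![0, 1, 0]
    obtain ⟨Z, hZ, hZ'⟩ := hJ ![0, 0, 1]
    rw [LieAlgebra.derivedSeriesOfIdeal_succ]
    refine eq_top_of_basis ⟨_, LieSubmodule.lie_mem_lie hX hY, ?_⟩
      ⟨(1 / 2 : ℝ) • ⁅X, Z⁆, ?_, ?_⟩ ⟨_, LieSubmodule.lie_mem_lie hY hZ, ?_⟩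
    · rw [hν, hX', hY']; ext i; fin_cases i <;> simp [sl2Bracket]
    · exact Submodule.smul_mem _ _ (LieSubmodule.lie_mem_lie hX hZ)
    · rw [map_smul, hν, hX', hZ']; ext i; fin_cases i <;> simp [sl2Bracket]
    · rw [hν, hY', hZ']; ext i; fin_cases i <;> simp [sl2Bracket]

theorem not_isSolvable_of_map_eq_top
    (hν : ∀ X Y, ν ⁅X, Y⁆ = sl2Bracket (ν X) (ν Y)) {I : LieIdeal ℝ L} (hI : I.toSubmodule.map ν = ⊤) :
    ¬ LieAlgebra.IsSolvable I := by
  intro h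
  obtain ⟨k, hk⟩ := (LieAlgebra.isSolvable_iff ℝ I).1 h
  rw [LieIdeal.derivedSeries_eq_bot_iff] at hk
  have := map_derivedSeries_eq_top hν hI k
  rw [hk, LieSubmodule.bot_toSubmodule, Submodule.map_bot] at this
  exact bot_ne_top this

theorem not_isSolvable_of_surjective
    (hν : ∀ X Y, ν ⁅X, Y⁆ = sl2Bracket (ν X) (ν Y)) (hs : Function.Surjective ν) : ¬ LieAlgebra.IsSolvable L := by
  intro h
  refine not_isSolvable_of_map_eq_top hν (I := ⊤) ?_ inferInstance
  rw [LieSubmodule.top_toSubmodule, Submodule.map_top]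
  exact LinearMap.range_eq_top.2 hs

/-- `sl(2)` is simple. Bracketing at most twice with `e₀` turns any nonzero element into a multiple
of `e₀`, and brackets with `e₂` then produce the rest of the basis. -/
theorem map_eq_top_of_ne_zero
    (hν : ∀ X Y, ν ⁅X, Y⁆ = sl2Bracket (ν X) (ν Y)) (hs : Function.Surjective ν) {I : LieIdeal ℝ L} {X : L} (hX : X ∈ I)
    (h0 : ν X ≠ 0) : I.toSubmodule.map ν = ⊤ := by
  set N := I.toSubmodule.map ν with hN
  have hbr : ∀ b, ∀ a ∈ N, sl2Bracket b a ∈ N := by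
    rintro b _ ⟨Y, hY, rfl⟩
    obtain ⟨Z, rfl⟩ := hs b
    exact ⟨_, I.lie_mem (x := Z) hY, hν Z Y⟩
  have e0 : ![1, 0, 0] ∈ N := by
    suffices ∃ r : ℝ, r ≠ 0 ∧ ![r, 0, 0] ∈ N by
      obtain ⟨r, hr, h⟩ := this
      convert N.smul_mem r⁻¹ h using 1
      ext i; fin_cases i <;> simp [hr]
    have h1 : ν X ∈ N := ⟨X, hX, rfl⟩
    by_cases h2 : ν X 2 = 0
    · by_cases h3 : ν X 1 = 0
      · refine ⟨ν X 0, fun h4 => h0 ?_, ?_⟩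
        · ext i; fin_cases i <;> assumption
        · convert h1 using 1
          ext i; fin_cases i <;> simp [h2, h3]
      · refine ⟨ν X 1, h3, ?_⟩
        convert hbr ![1, 0, 0] _ h1 using 1
        ext i; fin_cases i <;> simp [sl2Bracket, h2]
    · refine ⟨2 * ν X 2, by simpa using h2, ?_⟩
      convert hbr ![1, 0, 0] _ (hbr ![1, 0, 0] _ h1) using 1
      ext i; fin_cases i <;> simp [sl2Bracket]
  have e1 : ![0, 1, 0] ∈ N := by
    convert N.smul_mem (-1 / 2) (hbr ![0, 0, 1] _ e0) using 1
    ext i; fin_cases i <;> simp [sl2Bracket]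
  refine eq_top_of_basis e0 e1 ?_
  convert N.smul_mem (-1) (hbr ![0, 0, 1] _ e1) using 1
  ext i; fin_cases i <;> simp [sl2Bracket]

/-- The kernel of `ν` is an abelian ideal, hence in the radical. An ideal not contained in it
projects onto `sl(2)` and is not solvable. -/
theorem mem_radical_iff_of_sl2
    (hν : ∀ X Y, ν ⁅X, Y⁆ = sl2Bracket (ν X) (ν Y)) [FiniteDimensional ℝ L] (hs : Function.Surjective ν)
    (hk : ∀ X Y, ν X = 0 → ν Y = 0 → ⁅X, Y⁆ = 0) (X : L) :
    X ∈ LieAlgebra.radical ℝ L ↔ ν X = 0 := by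
  constructor
  · intro hX
    by_contra h0
    exact not_isSolvable_of_map_eq_top hν (map_eq_top_of_ne_zero hν hs hX h0)
      (LieAlgebra.radicalIsSolvable ℝ L)
  · intro hX
    let N : LieIdeal ℝ L :=
      { LinearMap.ker ν with
        lie_mem := fun {x m} hm => by
          have hm' : ν m = 0 := hm
          change ν ⁅x, m⁆ = 0
          rw [hν, hm']
          ext i; fin_cases i <;> simp [sl2Bracket] }
    have : IsLieAbelian N := ⟨fun x y => Subtype.ext (hk x y x.2 y.2)⟩
    have : N ≤ LieAlgebra.radical ℝ L :=
      (LieAlgebra.LieIdeal.solvable_iff_le_radical ℝ L N).1 inferInstance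
    exact this hX

end Sl2Quotient

/-! ### The structure of `NS` -/

variable {κ : Fin 3 → Site → ℝ}

theorem lie_mem_nsSpan {X Y : LatticeField ⊤} (hX : X ∈ nsSpan κ) (hY : Y ∈ nsSpan κ) :
    ⁅X, Y⁆ ∈ nsSpan κ := by
  obtain ⟨a, c, hc, d, hd, rfl⟩ := mem_nsSpan.1 hX
  obtain ⟨a', c', hc', d', hd', rfl⟩ := mem_nsSpan.1 hY
  rw [lie_nsField]
  exact mem_nsSpan.2 ⟨_, _, sub_mem (sub_mem (add_mem (Submodule.smul_mem _ _ hd')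
    (Submodule.smul_mem _ _ hc)) (Submodule.smul_mem _ _ hd)) (Submodule.smul_mem _ _ hc'), _,
    sub_mem (add_mem (sub_mem (Submodule.smul_mem _ _ hd') (Submodule.smul_mem _ _ hd))
      (Submodule.smul_mem _ _ hc)) (Submodule.smul_mem _ _ hc'), rfl⟩

/-- `NS` as a Lie algebra. -/
def nsAlgebra (κ : Fin 3 → Site → ℝ) : LieSubalgebra ℝ (LatticeField ⊤) :=
  { nsSpan κ with lie_mem' := fun hX hY => lie_mem_nsSpan hX hY }

/-- The component along `sl(2)`. -/
def nsProj (κ : Fin 3 → Site → ℝ) : nsAlgebra κ →ₗ[ℝ] Fin 3 → ℝ :=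
  LinearMap.fst ℝ _ _ ∘ₗ nsCoeff ∘ₗ (nsAlgebra κ).toSubmodule.subtype

theorem nsProj_apply {a : Fin 3 → ℝ} {b : (Site → ℝ) × (Site → ℝ)} (h : nsField (a, b) ∈ nsAlgebra κ) :
    nsProj κ ⟨nsField (a, b), h⟩ = a := congrArg Prod.fst (nsCoeff_nsField (a, b))

theorem nsProj_lie (X Y : nsAlgebra κ) :
    nsProj κ ⁅X, Y⁆ = sl2Bracket (nsProj κ X) (nsProj κ Y) := by
  obtain ⟨X, hX⟩ := X
  obtain ⟨Y, hY⟩ := Y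
  obtain ⟨a, c, hc, d, hd, rfl⟩ := mem_nsSpan.1 hX
  obtain ⟨a', c', hc', d', hd', rfl⟩ := mem_nsSpan.1 hY
  rw [nsProj_apply, nsProj_apply]
  change (nsCoeff ⁅nsField (a, c, d), nsField (a', c', d')⁆).1 = _
  rw [lie_nsField, nsCoeff_nsField]
  rfl

theorem nsProj_surjective : Function.Surjective (nsProj κ) := fun a =>
  ⟨⟨nsField (a, 0, 0), mem_nsSpan.2 ⟨a, 0, zero_mem _, 0, zero_mem _, rfl⟩⟩, nsProj_apply _⟩

theorem not_isSolvable_nsAlgebra : ¬ LieAlgebra.IsSolvable (nsAlgebra κ) :=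
  not_isSolvable_of_surjective nsProj_lie nsProj_surjective

instance : Module.Finite ℝ (shifts κ) :=
  Module.Finite.iff_fg.2 (Submodule.fg_span ((finite_range κ).insert 1))

/-- The coefficients of `NS`. -/
def nsEquiv (κ : Fin 3 → Site → ℝ) :
    ((Fin 3 → ℝ) × shifts κ × shifts κ) ≃ₗ[ℝ] nsAlgebra κ :=
  LinearEquiv.ofBijective
    { toFun := fun x => (⟨nsField (x.1, x.2.1, x.2.2), mem_nsSpan.2
        ⟨x.1, _, x.2.1.2, _, x.2.2.2, rfl⟩⟩ : nsAlgebra κ)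
      map_add' := fun x y => Subtype.ext (map_add nsField (x.1, (x.2.1 : Site → ℝ), (x.2.2 : Site → ℝ))
        (y.1, (y.2.1 : Site → ℝ), (y.2.2 : Site → ℝ)))
      map_smul' := fun r x => Subtype.ext (map_smul nsField r
        (x.1, (x.2.1 : Site → ℝ), (x.2.2 : Site → ℝ))) } <| by
    constructor
    · intro x y h
      have h1 := nsField_injective (congrArg Subtype.val h)
      obtain ⟨h2, h3⟩ := Prod.ext_iff.1 h1
      obtain ⟨h4, h5⟩ := Prod.ext_iff.1 h3
      exact Prod.ext h2 (Prod.ext (Subtype.ext h4) (Subtype.ext h5))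
    · rintro ⟨X, hX⟩
      obtain ⟨a, c, hc, d, hd, rfl⟩ := mem_nsSpan.1 hX
      exact ⟨(a, ⟨c, hc⟩, ⟨d, hd⟩), rfl⟩

instance : Module.Finite ℝ (nsAlgebra κ) := Module.Finite.equiv (nsEquiv κ)

theorem IsNondegenerate.finrank_nsAlgebra (h : IsNondegenerate κ) :
    Module.finrank ℝ (nsAlgebra κ) = 11 := by
  rw [← (nsEquiv κ).finrank_eq, Module.finrank_prod, Module.finrank_prod, h.finrank_shifts]
  simp

theorem mem_radical_nsAlgebra (X : nsAlgebra κ) :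
    X ∈ LieAlgebra.radical ℝ (nsAlgebra κ) ↔ (X : LatticeField ⊤) ∈ radicalSpan κ := by
  rw [mem_radical_iff_of_sl2 nsProj_lie nsProj_surjective]
  · obtain ⟨X, hX⟩ := X
    obtain ⟨a, c, hc, d, hd, rfl⟩ := mem_nsSpan.1 hX
    rw [nsProj_apply, radicalSpan_eq]
    constructor
    · rintro rfl
      exact ⟨_, ⟨zero_mem _, hc, hd⟩, rfl⟩
    · rintro ⟨⟨a', c', d'⟩, ⟨ha, -⟩, h⟩
      have := congrArg Prod.fst (nsField_injective h)
      exact this.symm.trans ha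
  · rintro ⟨X, hX⟩ ⟨Y, hY⟩ h1 h2
    obtain ⟨a, c, hc, d, hd, rfl⟩ := mem_nsSpan.1 hX
    obtain ⟨a', c', hc', d', hd', rfl⟩ := mem_nsSpan.1 hY
    rw [nsProj_apply] at h1 h2
    subst h1 h2
    refine Subtype.ext ?_
    change ⁅nsField (0, c, d), nsField (0, c', d')⁆ = 0
    rw [lie_nsField, ← map_zero nsField]
    congr 1
    refine Prod.ext (funext fun i => ?_) (Prod.ext (by simp) (by simp))
    fin_cases i <;> simp

theorem lie_mem_sl2Span {X Y : LatticeField ⊤} (hX : X ∈ sl2Span) (hY : Y ∈ sl2Span) :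
    ⁅X, Y⁆ ∈ sl2Span := by
  rw [sl2Span_eq] at hX hY ⊢
  obtain ⟨⟨a, b⟩, ⟨-, hb⟩, rfl⟩ := hX
  obtain ⟨⟨a', b'⟩, ⟨-, hb'⟩, rfl⟩ := hY
  obtain rfl : b = 0 := hb
  obtain rfl : b' = 0 := hb'
  rw [lie_nsField]
  exact ⟨_, ⟨trivial, by simp⟩, rfl⟩

/-- The span of `X₁, X₂, X₃` as a Lie algebra. -/
def sl2Algebra : LieSubalgebra ℝ (LatticeField ⊤) :=
  { sl2Span with lie_mem' := fun hX hY => lie_mem_sl2Span hX hY }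

theorem mem_sl2Span {X : LatticeField ⊤} : X ∈ sl2Span ↔ ∃ a, nsField (a, 0) = X := by
  rw [sl2Span_eq]
  constructor
  · rintro ⟨⟨a, b⟩, ⟨-, hb⟩, rfl⟩
    obtain rfl : b = 0 := hb
    exact ⟨a, rfl⟩
  · rintro ⟨a, rfl⟩
    exact ⟨_, ⟨trivial, zero_mem _⟩, rfl⟩

/-- The matrix with the coordinates `a` in the basis `e₀ = E`, `e₁ = -H/2`, `e₂ = -F`. -/
def sl2Matrix : (Fin 3 → ℝ) →ₗ[ℝ] Matrix (Fin 2) (Fin 2) ℝ where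
  toFun a := !![-a 1 / 2, a 0; -a 2, a 1 / 2]
  map_add' a b := by ext i j; fin_cases i <;> fin_cases j <;> simp <;> ring
  map_smul' r a := by ext i j; fin_cases i <;> fin_cases j <;> simp <;> ring

theorem sl2Matrix_bracket (a b : Fin 3 → ℝ) : sl2Matrix (sl2Bracket a b) =
    sl2Matrix a * sl2Matrix b - sl2Matrix b * sl2Matrix a := by
  ext i j
  fin_cases i <;> fin_cases j <;>
    simp [sl2Matrix, sl2Bracket] <;> ring

theorem sl2Matrix_mem (a : Fin 3 → ℝ) :
    sl2Matrix a ∈ LieAlgebra.SpecialLinear.sl (Fin 2) ℝ := by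
  change Matrix.trace (sl2Matrix a) = 0
  simp [Matrix.trace_fin_two, sl2Matrix]
  ring

theorem nsCoeff_fst_of_mem_sl2Span {X : LatticeField ⊤} (hX : X ∈ sl2Span) :
    nsField ((nsCoeff X).1, 0) = X := by
  obtain ⟨a, rfl⟩ := mem_sl2Span.1 hX
  rw [nsCoeff_nsField]

/-- `X₁, X₂, X₃` span a copy of `sl(2)`. -/
def sl2Equiv : sl2Algebra ≃ₗ⁅ℝ⁆ LieAlgebra.SpecialLinear.sl (Fin 2) ℝ where
  toFun X := ⟨sl2Matrix (nsCoeff X.1).1, sl2Matrix_mem _⟩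
  map_add' X Y := Subtype.ext (by
    change sl2Matrix (nsCoeff (X.1 + Y.1)).1 = sl2Matrix _ + sl2Matrix _
    rw [map_add, Prod.fst_add, map_add])
  map_smul' r X := Subtype.ext (by
    change sl2Matrix (nsCoeff (r • X.1)).1 = r • sl2Matrix _
    rw [map_smul, Prod.smul_fst, map_smul])
  map_lie' {X Y} := Subtype.ext (by
    obtain ⟨X, hX⟩ := X
    obtain ⟨Y, hY⟩ := Y
    obtain ⟨a, rfl⟩ := mem_sl2Span.1 hX
    obtain ⟨b, rfl⟩ := mem_sl2Span.1 hY
    change sl2Matrix (nsCoeff ⁅nsField (a, 0), nsField (b, 0)⁆).1 =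
      sl2Matrix (nsCoeff (nsField (a, 0))).1 * sl2Matrix (nsCoeff (nsField (b, 0))).1
        - sl2Matrix (nsCoeff (nsField (b, 0))).1 * sl2Matrix (nsCoeff (nsField (a, 0))).1
    rw [lie_nsField, nsCoeff_nsField, nsCoeff_nsField, nsCoeff_nsField, ← sl2Matrix_bracket]
    rfl)
  invFun A := ⟨nsField (![A.1 0 1, 2 * A.1 1 1, -A.1 1 0], 0), mem_sl2Span.2 ⟨_, rfl⟩⟩
  left_inv X := Subtype.ext (by
    conv_rhs => rw [← nsCoeff_fst_of_mem_sl2Span X.2]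
    change nsField (![(sl2Matrix (nsCoeff X.1).1) 0 1, 2 * (sl2Matrix (nsCoeff X.1).1) 1 1,
      -(sl2Matrix (nsCoeff X.1).1) 1 0], 0) = _
    congr 2
    ext i
    fin_cases i <;> simp [sl2Matrix]
    ring)
  right_inv A := Subtype.ext (by
    have h : A.1 0 0 + A.1 1 1 = 0 := by
      have := A.2
      change Matrix.trace A.1 = 0 at this
      rwa [Matrix.trace_fin_two] at this
    change sl2Matrix (nsCoeff (nsField (![A.1 0 1, 2 * A.1 1 1, -A.1 1 0], 0))).1 = A.1
    rw [nsCoeff_nsField]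
    ext i j
    fin_cases i <;> fin_cases j <;> simp [sl2Matrix]
    linarith)

end

noncomputable section

/-! ### The class of `κ` -/

variable {κ : Fin 3 → Site → ℝ}

theorem xi_eq (κ : Fin 3 → Site → ℝ) (s : Site) (u : Fin 7 → ℝ) : xi κ s u =
    (detForm κ s 5 u / detForm κ s 4 u, detForm κ s 6 u / detForm κ s 4 u) := by
  simp only [detForm_apply]
  rfl

theorem xi_eq_of_smul {s : Site} {u u' : Fin 7 → ℝ} {r : ℝ} (hr : r ≠ 0)
    (h : ∀ j, detForm κ s j u' = r * detForm κ s j u) : xi κ s u' = xi κ s u := by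
  rw [xi_eq, xi_eq, h 4, h 5, h 6, mul_div_mul_left _ _ hr, mul_div_mul_left _ _ hr]

theorem detForm_smul_add {c : Site → ℝ} (hc : c ∈ shifts κ) (s : Site) (j : Fin 7) (r x : ℝ)
    (u : Fin 7 → ℝ) : detForm κ s j (r • u + x • onΓ c s) = r * detForm κ s j u := by
  rw [map_add, map_smul, map_smul, detForm_shift hc, smul_zero, add_zero, smul_eq_mul]

theorem detForm_single (κ : Fin 3 → Site → ℝ) (s : Site) : detForm κ s 4 (Pi.single 4 1) =
    latticeDet ![onΓ (κ 0) s, onΓ (κ 1) s, onΓ (κ 2) s, fun _ => 1] ![0, 1, 2, 3] := by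
  rw [detForm_of_vanish] <;> simp

/-- Along a line with this velocity all the determinants are multiplied by the same factor `1 + x
m`. The invariants `ξ` stay fixed and the force is multiplied by `(1 + x m)⁻³`. -/
theorem HasNSForm.fderiv_apply {s : Site} {Ω : Set LocalConf} {F : LocalConf → ℝ}
    (h : HasNSForm κ s Ω (fun p => p.2) F) {p : LocalConf} (hp : p ∈ Ω)
    (hF : DifferentiableAt ℝ F p) (h0 : detForm κ s 4 p.2 ≠ 0) {c : Site → ℝ}
    (hc : c ∈ shifts κ) (b m : ℝ) : fderiv ℝ F p (b, m • p.2 + onΓ c s) = -3 * m * F p := by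
  obtain ⟨N, hN, W, f, -, -, hNF⟩ := h p hp (by rwa [← detForm_apply])
  set v : LocalConf := (b, m • p.2 + onΓ c s) with hv
  have hline : HasDerivAt (fun x : ℝ => F (p + x • v)) (fderiv ℝ F p v) 0 := by
    have hq : HasFDerivAt F (fderiv ℝ F p) (p + (0 : ℝ) • v) := by simpa using hF.hasFDerivAt
    have := hq.comp_hasDerivAt (0 : ℝ) (((hasDerivAt_id (0 : ℝ)).smul_const v).const_add p)
    simpa [Function.comp_def] using this
  have hcont : ContinuousAt (fun x : ℝ => p + x • v) 0 := by fun_prop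
  have hmem : ∀ᶠ x : ℝ in 𝓝 0, p + x • v ∈ N :=
    hcont.preimage_mem_nhds (by simpa using hN)
  have hpos : ∀ᶠ x : ℝ in 𝓝 0, 1 + x * m ≠ 0 := by
    have : ContinuousAt (fun x : ℝ => 1 + x * m) 0 := by fun_prop
    exact this.eventually_ne (by simp)
  have hp0 := (hNF p (mem_of_mem_nhds hN)).2
  have e : (fun x : ℝ => F (p + x • v)) =ᶠ[𝓝 0] fun x => ((1 + x * m)⁻¹) ^ 3 * F p := by
    filter_upwards [hmem, hpos] with x hx h1
    have e2 : (p + x • v).2 = (1 + x * m) • p.2 + x • onΓ c s := by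
      rw [hv, Prod.snd_add, Prod.smul_snd]
      module
    have hd : ∀ j, detForm κ s j (p + x • v).2 = (1 + x * m) * detForm κ s j p.2 := fun j => by
      rw [e2, detForm_smul_add hc]
    rw [(hNF _ hx).2, hp0, xi_eq_of_smul h1 hd, ← detForm_apply, ← detForm_apply, hd 4, mul_inv,
      mul_pow]
    ring
  have hr : HasDerivAt (fun x : ℝ => ((1 + x * m)⁻¹) ^ 3 * F p) (-3 * m * F p) 0 := by
    have h1 : HasDerivAt (fun x : ℝ => 1 + x * m) m 0 := by
      simpa using ((hasDerivAt_id (0 : ℝ)).mul_const m).const_add 1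
    refine (((h1.fun_inv (by simp)).fun_pow 3).mul_const (F p)).congr_deriv ?_
    norm_num
  exact hline.unique (hr.congr_of_eventuallyEq e)

theorem affineForm_nsField (E : LatticeEquation) (a : Fin 3 → ℝ) (c d : Site → ℝ) :
    E.AffineForm (nsField (a, c, d)).1 (fun t => a 0 + a 1 * t + a 2 * t ^ 2) 0
      (fun s t => c s + d s * t) := by
  refine ⟨by fun_prop, fun s => by fun_prop, fun s p _ => ?_⟩
  have : deriv (fun t => a 0 + a 1 * t + a 2 * t ^ 2) p.1 = a 1 + a 2 * (2 * p.1) := by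
    have h := ((((hasDerivAt_id p.1).const_mul (a 1)).const_add (a 0)).fun_add
      (((hasDerivAt_id p.1).fun_pow 2).const_mul (a 2))).deriv
    simpa using h
  rw [this, nsField_apply]
  ext
  · rfl
  · simp; ring

theorem continuousAt_fderiv_F {E : LatticeEquation} {s : Site} {p : LocalConf} (hp : p ∈ E.Ω s) :
    ContinuousAt (fderiv ℝ (E.F s)) p :=
  (((E.smooth_F s).continuousOn_fderiv_of_isOpen (E.isOpen_Ω s) (by simp)).continuousAt
    ((E.isOpen_Ω s).mem_nhds hp))

/-- The elements of `NS` are symmetries of every equation in the class. -/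
theorem isSymmetry_of_mem_nsSpan (hκ : IsNondegenerate κ) {E : LatticeEquation}
    (h : ∀ s, HasNSForm κ s (E.Ω s) (fun p => p.2) (E.F s)) {X : LatticeField ⊤}
    (hX : X ∈ nsSpan κ) : E.IsSymmetry X.1 := by
  obtain ⟨a, c, hc, d, hd, rfl⟩ := mem_nsSpan.1 hX
  refine (affineForm_nsField E a c d).isSymmetry_iff.2 fun s p hp => ?_
  have d1 : deriv (fun t => a 0 + a 1 * t + a 2 * t ^ 2) = fun t => a 1 + a 2 * (2 * t) := by
    funext t
    have h := ((((hasDerivAt_id t).const_mul (a 1)).const_add (a 0)).fun_add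
      (((hasDerivAt_id t).fun_pow 2).const_mul (a 2))).deriv
    simpa using h
  have d2 : deriv (fun t => a 1 + a 2 * (2 * t)) = fun _ => a 2 * 2 := by
    funext t
    simp
  have d3 : deriv (fun t => c s + d s * t) = fun _ => d s := by
    funext t
    simp
  simp only [d1, d2, d3, deriv_const, Pi.zero_apply, add_zero]
  let v : LocalConf → LocalConf := fun q => (a 0 + a 1 * q.1 + a 2 * q.1 ^ 2,
    fun i => (a 1 + a 2 * (2 * q.1)) / 2 * q.2 i + (c (nbr i s) + d (nbr i s) * q.1))
  have hv : ∀ q, v q = (a 0 + a 1 * q.1 + a 2 * q.1 ^ 2,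
      ((a 1 + a 2 * (2 * q.1)) / 2) • q.2 + onΓ (c + q.1 • d) s) := fun q => by
    refine Prod.ext rfl (funext fun i => ?_)
    simp [v, onΓ, mul_comm]
  have key : ∀ q ∈ E.Ω s, detForm κ s 4 q.2 ≠ 0 →
      -(3 / 2 * (a 1 + a 2 * (2 * q.1))) * E.F s q - fderiv ℝ (E.F s) q (v q) = 0 := by
    intro q hq h0
    rw [hv, (h s).fderiv_apply hq (LatticeEquation.differentiableAt_F hq) h0
      (add_mem hc (Submodule.smul_mem _ _ hd))]
    ring
  suffices -(3 / 2 * (a 1 + a 2 * (2 * p.1))) * E.F s p - fderiv ℝ (E.F s) p (v p) = 0 by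
    have e : fderiv ℝ (E.F s) p (v p) = fderiv ℝ (E.F s) p (a 0 + a 1 * p.1 + a 2 * p.1 ^ 2,
      fun i => (a 1 + a 2 * (2 * p.1)) / 2 * p.2 i + (c (nbr i s) + d (nbr i s) * p.1)) := rfl
    rw [← e]
    linear_combination this
  by_cases h0 : detForm κ s 4 p.2 ≠ 0
  · exact key p hp h0
  · rw [not_not] at h0
    -- A point with `𝒟 = 0` is a limit of points with `𝒟 ≠ 0`: moving the value at `(n-1,m)` changes
    -- `𝒟` at the rate of the nondegeneracy determinant. The determining equation is continuous and
    -- passes to the limit.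
    let l : ℝ → LocalConf := fun y => p + y • (0, Pi.single 4 1)
    have hl0 : l 0 = p := by simp [l]
    have hl : ContinuousAt l 0 := by simp only [l]; fun_prop
    have hcont : ContinuousAt (fun q : LocalConf => -(3 / 2 * (a 1 + a 2 * (2 * q.1))) * E.F s q
        - fderiv ℝ (E.F s) q (v q)) (l 0) := by
      rw [hl0]
      refine ContinuousAt.sub (ContinuousAt.mul (by fun_prop)
        (LatticeEquation.differentiableAt_F hp).continuousAt) ?_
      refine (continuousAt_fderiv_F hp).clm_apply ?_
      simp only [v]
      fun_prop
    have hlim := (hcont.comp hl).tendsto.mono_left (nhdsWithin_le_nhds (s := {0}ᶜ))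
    have hmem : ∀ᶠ y in 𝓝[≠] (0 : ℝ), l y ∈ E.Ω s :=
      Eventually.filter_mono nhdsWithin_le_nhds
        (hl.preimage_mem_nhds ((E.isOpen_Ω s).mem_nhds (by rwa [hl0])))
    have hz : ∀ᶠ y in 𝓝[≠] (0 : ℝ), ((fun q : LocalConf =>
        -(3 / 2 * (a 1 + a 2 * (2 * q.1))) * E.F s q - fderiv ℝ (E.F s) q (v q)) ∘ l) y = 0 := by
      filter_upwards [hmem, self_mem_nhdsWithin] with y hy hy0
      refine key _ hy ?_
      have e : (l y).2 = p.2 + y • Pi.single 4 1 := rfl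
      rw [e, map_add, map_smul, h0, detForm_single, zero_add, smul_eq_mul]
      exact mul_ne_zero hy0 (hκ s)
    have := tendsto_nhds_unique (hlim.congr' hz) tendsto_const_nhds
    simpa [hl0] using this

end

/-! ### The functions `κ` and the transformation to the gauge -/

noncomputable section

/-- A finite-dimensional space of functions on a countable set without common zeros contains a
function without zeros. -/
theorem exists_forall_ne_zero {S : Type*} [Countable S] (V : Submodule ℝ (S → ℝ))
    [Module.Finite ℝ V] (h : ∀ s, ∃ c ∈ V, c s ≠ 0) : ∃ c ∈ V, ∀ s, c s ≠ 0 := by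
  let b := Module.finBasis ℝ V
  -- The value at `s` of `∑ xⁱ bᵢ`, as a polynomial in `x`. None of these countably many polynomials
  -- is zero, so some `x` is a root of none of them.
  let p : S → Polynomial ℝ := fun s => ∑ i : Fin (Module.finrank ℝ V),
    Polynomial.C ((b i : S → ℝ) s) * Polynomial.X ^ (i : ℕ)
  have hp : ∀ s, p s ≠ 0 := by
    intro s h0
    obtain ⟨c, hc, hcs⟩ := h s
    apply hcs
    have hb : ∀ i, (b i : S → ℝ) s = 0 := by
      intro i
      have := congrArg (fun q => Polynomial.coeff q (i : ℕ)) h0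
      simp only [p, Polynomial.finsetSum_coeff, Polynomial.coeff_C_mul, Polynomial.coeff_X_pow,
        Polynomial.coeff_zero] at this
      rw [Finset.sum_eq_single i (fun j _ hj => by
        rw [if_neg fun h => hj (Fin.ext h.symm), mul_zero]) (by simp)] at this
      simpa using this
    have e := congrArg (fun v : V => (v : S → ℝ) s) (b.sum_repr ⟨c, hc⟩)
    simp only [AddSubmonoidClass.coe_finsetSum, Finset.sum_apply, Submodule.coe_smul,
      Pi.smul_apply, hb, smul_zero, Finset.sum_const_zero] at e
    exact e.symm
  have hbad : (⋃ s, {x | (p s).IsRoot x}).Countable :=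
    countable_iUnion fun s => (Polynomial.finite_setOfPred_isRoot (hp s)).countable
  obtain ⟨x, hx⟩ : ∃ x, x ∉ ⋃ s, {x | (p s).IsRoot x} := by
    by_contra hcon
    push Not at hcon
    exact not_countable_univ (hbad.mono fun x _ => hcon x)
  refine ⟨_, (∑ i : Fin (Module.finrank ℝ V), (x ^ (i : ℕ)) • b i : V).2, fun s hs => hx ?_⟩
  refine mem_iUnion.2 ⟨s, ?_⟩
  simp only [AddSubmonoidClass.coe_finsetSum, Finset.sum_apply, Submodule.coe_smul,
    Pi.smul_apply, smul_eq_mul] at hs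
  simp only [mem_ofPred_eq, Polynomial.IsRoot, p, Polynomial.eval_finsetSum, Polynomial.eval_mul,
    Polynomial.eval_C, Polynomial.eval_pow, Polynomial.eval_X]
  rw [← hs]
  exact Finset.sum_congr rfl fun i _ => mul_comm _ _

/-- A space of dimension four determined by the first four points of `Γ` is, up to a factor, the
space of shifts of some `κ`. -/
theorem DeterminedBy.exists_kappa {V : Submodule ℝ (Site → ℝ)} [Module.Finite ℝ V]
    (h : DeterminedBy V 4) (hV : Module.finrank ℝ V = 4) :
    ∃ (P : Site → ℝ) (κ : Fin 3 → Site → ℝ), (∀ s, P s ≠ 0) ∧ IsNondegenerate κ ∧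
      ∀ w, w ∈ shifts κ ↔ P * w ∈ V := by
  obtain ⟨P, hPV, hP⟩ := exists_forall_ne_zero V
    (h.exists_ne_zero (by norm_num) hV (by norm_num))
  -- For `j < 4` these are dual to the first four points of `Γ` at the site `0`. In the basis `P`
  -- takes the place of `v 0`, which is possible because `P` is not zero there; division by `P`
  -- turns it into `1`.
  choose v hvV hv using fun j : Fin 7 => h.exists_mem (by norm_num) hV 0 (Pi.single j 1)
  let κ : Fin 3 → Site → ℝ := ![v 1 / P, v 2 / P, v 3 / P]
  have hmul : ∀ f : Site → ℝ, P * (f / P) = f := fun f => by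
    ext s; simp [mul_div_cancel₀ _ (hP s)]
  have hcomb : ∀ y : Fin 4 → ℝ, P * (y 0 • κ 0 + y 1 • κ 1 + y 2 • κ 2 + y 3 • 1) =
      y 0 • v 1 + y 1 • v 2 + y 2 • v 3 + y 3 • P := fun y => by
    have e0 : P * κ 0 = v 1 := hmul _
    have e1 : P * κ 1 = v 2 := hmul _
    have e2 : P * κ 2 = v 3 := hmul _
    rw [mul_add, mul_add, mul_add, mul_smul_comm, mul_smul_comm, mul_smul_comm, mul_smul_comm,
      e0, e1, e2, mul_one]
  have hmem : ∀ y : Fin 4 → ℝ, y 0 • v 1 + y 1 • v 2 + y 2 • v 3 + y 3 • P ∈ V := fun y =>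
    add_mem (add_mem (add_mem (V.smul_mem _ (hvV _)) (V.smul_mem _ (hvV _)))
      (V.smul_mem _ (hvV _))) (V.smul_mem _ hPV)
  refine ⟨P, κ, hP, fun s h0 => ?_, fun w => ⟨fun hw => ?_, fun hw => ?_⟩⟩
  -- A zero determinant at one site gives a combination vanishing at the first four points there,
  -- hence everywhere. Evaluation at the site `0` shows that its coefficients are zero.
  · obtain ⟨y, hy, hy0⟩ := Matrix.exists_vecMul_eq_zero_iff.2 h0
    have hz : y 0 • v 1 + y 1 • v 2 + y 2 • v 3 + y 3 • P = 0 := by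
      refine h s _ (hmem y) fun i hi => ?_
      rw [← hcomb, Pi.mul_apply]
      have hj : (![0, 1, 2, 3] : Fin 4 → Fin 7) ⟨i, hi⟩ = i := by
        have : i = 0 ∨ i = 1 ∨ i = 2 ∨ i = 3 := by omega
        rcases this with rfl | rfl | rfl | rfl <;> rfl
      have := congrFun hy0 ⟨i, hi⟩
      rw [vecMul_onΓ, hj] at this
      rw [this]
      simp
    have hzi := fun i : Fin 7 => congrFun hz (nbr i 0)
    have v1 := hv 1
    have v2 := hv 2
    have v3 := hv 3
    have h0 := hzi 0
    have h1 := hzi 1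
    have h2 := hzi 2
    have h3 := hzi 3
    simp only [Pi.add_apply, Pi.smul_apply, smul_eq_mul, Pi.zero_apply] at h0 h1 h2 h3
    rw [v1 0 (by norm_num), v2 0 (by norm_num), v3 0 (by norm_num)] at h0
    rw [v1 1 (by norm_num), v2 1 (by norm_num), v3 1 (by norm_num)] at h1
    rw [v1 2 (by norm_num), v2 2 (by norm_num), v3 2 (by norm_num)] at h2
    rw [v1 3 (by norm_num), v2 3 (by norm_num), v3 3 (by norm_num)] at h3
    simp [hP] at h0
    simp [h0] at h1 h2 h3
    exact hy (funext fun i => by fin_cases i <;> assumption)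
  · obtain ⟨y, rfl⟩ := mem_shifts_iff.1 hw
    rw [hcomb]
    exact hmem y
  · let α : ℝ := (P * w) (nbr 0 0) / P (nbr 0 0)
    let y : Fin 4 → ℝ := ![(P * w) (nbr 1 0) - α * P (nbr 1 0), (P * w) (nbr 2 0) - α * P (nbr 2 0),
      (P * w) (nbr 3 0) - α * P (nbr 3 0), α]
    have e : P * w = y 0 • v 1 + y 1 • v 2 + y 2 • v 3 + y 3 • P := by
      refine h.eq_of_eq 0 hw (hmem y) fun i hi => ?_
      simp only [Pi.add_apply, Pi.smul_apply, smul_eq_mul, hv _ i hi]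
      have : i = 0 ∨ i = 1 ∨ i = 2 ∨ i = 3 := by omega
      rcases this with rfl | rfl | rfl | rfl
      · simp [y, α, div_mul_cancel₀ _ (hP _)]
      all_goals simp [y]
    rw [← hcomb] at e
    refine mem_shifts_iff.2 ⟨y, funext fun s => mul_left_cancel₀ (hP s) (congrFun e s)⟩

namespace LatticeEquation

open AffineAction

variable {E : LatticeEquation} {L : LieSubalgebra ℝ (LatticeField E.M)}
variable {hL : E.IsSymmetryAlgebra L} {hc : E.IsCoupled} {t₀ : ℝ}
  {K : (hL.action hc).Chart t₀} (G : K.Gauge) {P : Site → ℝ} (hP : ∀ s, P s ≠ 0)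

/-- The transformation to the gauge. -/
def gaugeTransformation : AllowedTransformation where
  dom := K.dom
  isOpen_dom := K.isOpen_dom
  ordConnected_dom := ordConnected_ball _ _
  θ := K.θ
  smooth_θ := K.contDiffOn_θ
  deriv_pos t ht := by
    rw [(K.hasDerivAt_θ E.isOpen_I ht).deriv]
    have := K.g_pos ht
    positivity
  P := P
  P_ne_zero := hP
  Q := G.Q
  smooth_Q := G.smooth

theorem gaugeTransformation_g {t : ℝ} (ht : t ∈ K.dom) :
    (gaugeTransformation G hP).g t = K.g t := by
  have := K.g_pos ht
  change (√(deriv K.θ t))⁻¹ = _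
  rw [(K.hasDerivAt_θ E.isOpen_I ht).deriv, Real.sqrt_inv, Real.sqrt_sq this.le, inv_inv]

theorem fderiv_toMap {s : Site} {p : ℝ × ℝ} (hp : p.1 ∈ K.dom) (v : ℝ × ℝ) :
    fderiv ℝ ((gaugeTransformation G hP).toMap s) p v = (v.1 / K.g p.1 ^ 2,
      (v.2 - v.1 * deriv (G.Q s) p.1) / (K.g p.1 * P s)
        - v.1 * deriv K.g p.1 * (p.2 - G.Q s p.1) / (K.g p.1 ^ 2 * P s)) := by
  have hg := (K.g_pos hp).ne'
  have hPs := hP s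
  have f1 := hasFDerivAt_fst (𝕜 := ℝ) (p := p)
  have f2 := hasFDerivAt_snd (𝕜 := ℝ) (p := p)
  have h1 := (K.hasDerivAt_θ E.isOpen_I hp).comp_hasFDerivAt p f1
  have h2 := (G.hasDerivAt_Q s hp).comp_hasFDerivAt p f1
  have h3 := (((K.hasDerivAt_g hp).mul_const (P s)).fun_inv
    (mul_ne_zero hg hPs)).comp_hasFDerivAt p f1
  have e : (gaugeTransformation G hP).toMap s =ᶠ[𝓝 p] fun p =>
      (K.θ p.1, (p.2 - G.Q s p.1) * (K.g p.1 * P s)⁻¹) := by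
    filter_upwards [(K.isOpen_dom.preimage continuous_fst).mem_nhds hp] with q hq
    rw [← div_eq_mul_inv, ← gaugeTransformation_g G hP hq]
    rfl
  have h4 := ((h1.prodMk ((f2.sub h2).mul h3)).congr_of_eventuallyEq e).fderiv
  refine (congrArg (fun A => A v) h4).trans ?_
  ext
  · simp
    field_simp
  · simp
    field_simp
    ring

/-- A symmetry is carried to an element of `NS`. -/
theorem carries_nsField {X : L} {a : Fin 3 → ℝ} {c d : Site → ℝ}
    (hs : (hL.action hc).scal X = 0)
    (hτ : ∀ t ∈ K.dom, (hL.action hc).tau X t =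
      a 0 * K.g t ^ 2 + a 1 * (K.θ t * K.g t ^ 2) + a 2 * (K.θ t ^ 2 * K.g t ^ 2))
    (hl : ∀ s, ∀ t ∈ K.dom, (hL.action hc).lam X s t =
      (hL.action hc).tau X t * deriv (G.Q s) t - deriv ((hL.action hc).tau X) t / 2 * G.Q s t
        + K.g t * (P s * (c s + K.θ t * d s))) :
    (gaugeTransformation G hP).Carries E.J X.1.1 (nsField (a, c, d)).1 := by
  intro s p hp
  have hpt : p.1 ∈ K.dom := hp.1
  have hg := (K.g_pos hpt).ne'
  have hPs := hP s
  rw [fderiv_toMap G hP hpt, (hL.affineForm hc X).eq s p ⟨K.dom_subset hpt, hp.2⟩, hs,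
    hl s _ hpt, nsField_apply]
  have e : (gaugeTransformation G hP).toMap s p =
      (K.θ p.1, (p.2 - G.Q s p.1) / (K.g p.1 * P s)) := by
    rw [← gaugeTransformation_g G hP hpt]; rfl
  have hd : deriv ((hL.action hc).tau X) p.1 = a 0 * (2 * K.g p.1 * deriv K.g p.1)
      + a 1 * (1 + K.θ p.1 * (2 * K.g p.1 * deriv K.g p.1))
      + a 2 * (2 * K.θ p.1 + K.θ p.1 ^ 2 * (2 * K.g p.1 * deriv K.g p.1)) := by
    refine K.deriv_tau_of_eqOn hτ hpt ?_
    have h1 := (K.hasDerivAt_g hpt).fun_pow 2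
    have h2 := K.hasDerivAt_θ E.isOpen_I hpt
    refine (((h1.const_mul (a 0)).fun_add ((h2.fun_mul h1).const_mul (a 1))).fun_add
      (((h2.fun_pow 2).fun_mul h1).const_mul (a 2))).congr_deriv ?_
    norm_num
    field_simp
  rw [e, hd, hτ _ hpt]
  ext
  · simp
    field_simp
  · simp
    field_simp
    ring

theorem tau_combination (a : Fin 3 → ℝ) {Z : L} (hZ : Z ∈ (hL.action hc).trans) {t : ℝ}
    (ht : t ∈ K.dom) : (hL.action hc).tau (a 0 • G.x₀ + a 1 • G.x₁ + a 2 • G.x₂ + Z) t =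
      a 0 * K.g t ^ 2 + a 1 * (K.θ t * K.g t ^ 2) + a 2 * (K.θ t ^ 2 * K.g t ^ 2) := by
  have ht' := K.dom_subset ht
  simp only [map_add, map_smul, Pi.add_apply, Pi.smul_apply, smul_eq_mul, hZ.1 t ht',
    G.tau₀ t ht', G.tau₁ t ht', G.tau₂ t ht', K.tau₀ ht, K.tau₁ ht, K.tau₂ ht, add_zero]

theorem lam_combination (a : Fin 3 → ℝ) {Z : L} (hZ : Z ∈ (hL.action hc).trans) (s : Site) {t : ℝ}
    (ht : t ∈ K.dom) : (hL.action hc).lam (a 0 • G.x₀ + a 1 • G.x₁ + a 2 • G.x₂ + Z) s t =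
      (hL.action hc).tau (a 0 • G.x₀ + a 1 • G.x₁ + a 2 • G.x₂ + Z) t * deriv (G.Q s) t
      - deriv ((hL.action hc).tau (a 0 • G.x₀ + a 1 • G.x₁ + a 2 • G.x₂ + Z)) t / 2 * G.Q s t
      + (hL.action hc).lam Z s t := by
  have hI := E.isOpen_I
  have ht' := K.dom_subset ht
  have hd := ((((Chart.hasDerivAt_tau (R := hL.action hc) hI K.e₀ ht').const_mul (a 0)).fun_add
    ((Chart.hasDerivAt_tau (R := hL.action hc) hI K.e₁ ht').const_mul (a 1))).fun_add
    ((Chart.hasDerivAt_tau (R := hL.action hc) hI K.e₂ ht').const_mul (a 2)))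
  have e := K.deriv_tau_of_eqOn (X := a 0 • G.x₀ + a 1 • G.x₁ + a 2 • G.x₂ + Z)
    (fun t ht => by
      have ht' := K.dom_subset ht
      simp only [map_add, map_smul, Pi.add_apply, Pi.smul_apply, smul_eq_mul, hZ.1 t ht',
        G.tau₀ t ht', G.tau₁ t ht', G.tau₂ t ht', add_zero]) ht hd
  rw [e]
  simp only [map_add, map_smul, Pi.add_apply, Pi.smul_apply, smul_eq_mul, hZ.1 t ht',
    G.tau₀ t ht', G.tau₁ t ht', G.tau₂ t ht', G.lam₀ s t ht, G.lam₁ s t ht, G.lam₂ s t ht]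
  ring

theorem scal_combination (a : Fin 3 → ℝ) {Z : L} (hZ : Z ∈ (hL.action hc).trans) :
    (hL.action hc).scal (a 0 • G.x₀ + a 1 • G.x₁ + a 2 • G.x₂ + Z) = 0 := by
  simp only [map_add, map_smul, G.scal₀, G.scal₁, G.scal₂, smul_zero, zero_add]
  exact hZ.2

/-- After subtraction of a combination of the straightened frame no `τ` remains. The coefficient `a`
is zero because there are no multipliers, so the rest is a translation. -/
theorem exists_carries [FiniteDimensional ℝ L] (hscal : (hL.action hc).scals = ⊥)
    {κ : Fin 3 → Site → ℝ} (hκ : ∀ w, w ∈ shifts κ ↔ P * w ∈ (hL.action hc).values t₀) (X : L) :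
    ∃ X' ∈ nsSpan κ, (gaugeTransformation G hP).Carries E.J X.1.1 X'.1 := by
  obtain ⟨a, b, c, habc⟩ := K.span X
  let y : Fin 3 → ℝ := ![a, b, c]
  let Z := X - (y 0 • G.x₀ + y 1 • G.x₁ + y 2 • G.x₂)
  have hZv : Z ∈ (hL.action hc).vertical := fun t ht => by
    simp only [Z, y, map_sub, map_add, map_smul, Pi.sub_apply, Pi.add_apply, Pi.smul_apply,
      smul_eq_mul, habc t ht, G.tau₀ t ht, G.tau₁ t ht, G.tau₂ t ht]
    simp
  have hZs : (hL.action hc).scal Z ∈ (hL.action hc).scals := ⟨Z, hZv, rfl⟩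
  rw [hscal] at hZs
  have hZ : Z ∈ (hL.action hc).trans := ⟨hZv, hZs⟩
  have hX : X = y 0 • G.x₀ + y 1 • G.x₁ + y 2 • G.x₂ + Z := by simp only [Z]; abel
  obtain ⟨c, hcV, d, hdV, hcd⟩ := K.lam_eq E.isOpen_I E.ordConnected_I hZ
  have hmul : ∀ f : Site → ℝ, P * (f / P) = f := fun f => by
    ext s; simp [mul_div_cancel₀ _ (hP s)]
  refine ⟨nsField (y, c / P, d / P), mem_nsSpan.2 ⟨_, _, (hκ _).2 (by rwa [hmul]), _,
    (hκ _).2 (by rwa [hmul]), rfl⟩, ?_⟩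
  rw [hX]
  refine carries_nsField G hP (scal_combination G y hZ) (fun t ht => tau_combination G y hZ ht)
    fun s t ht => ?_
  rw [lam_combination G y hZ s ht, hcd s t ht]
  have hPs := hP s
  simp only [Pi.div_apply]
  field_simp

theorem exists_carries_of_mem [FiniteDimensional ℝ L] {κ : Fin 3 → Site → ℝ}
    (hκ : ∀ w, w ∈ shifts κ ↔ P * w ∈ (hL.action hc).values t₀) {X' : LatticeField ⊤} (hX' : X' ∈ nsSpan κ) :
    ∃ X : L, (gaugeTransformation G hP).Carries E.J X.1.1 X'.1 := by
  obtain ⟨y, c, hcs, d, hds, rfl⟩ := mem_nsSpan.1 hX'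
  obtain ⟨Z, hZ, hZl⟩ := K.exists_lam_eq E.isOpen_I ((hκ c).1 hcs) ((hκ d).1 hds)
  refine ⟨y 0 • G.x₀ + y 1 • G.x₁ + y 2 • G.x₂ + Z, carries_nsField G hP
    (scal_combination G y hZ) (fun t ht => tau_combination G y hZ ht) fun s t ht => ?_⟩
  rw [lam_combination G y hZ s ht, hZl s t ht, Pi.mul_apply, Pi.mul_apply]
  ring

end LatticeEquation
end

/-! ### The force along the orbits of the symmetries -/

noncomputable section

namespace LatticeEquation

open AffineAction

variable {E : LatticeEquation} {L : LieSubalgebra ℝ (LatticeField E.M)}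
variable {hL : E.IsSymmetryAlgebra L} {hc : E.IsCoupled} {t₀ : ℝ}
  {K : (hL.action hc).Chart t₀} (G : K.Gauge) {P : Site → ℝ}

/-- The configuration with the transformed values `y` at the time `t`. -/
def gaugeConf (P : Site → ℝ) (s : Site) (t : ℝ) (y : Fin 7 → ℝ) : LocalConf :=
  (t, fun i => G.Q (nbr i s) t + K.g t * (P (nbr i s) * y i))

theorem dev_gaugeConf (s : Site) (t : ℝ) (y : Fin 7 → ℝ) (i : Fin 7) :
    dev G.Q s (gaugeConf G P s t y) i = K.g t * (P (nbr i s) * y i) := by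
  simp [dev, gaugeConf]

/-- A path of configurations along the orbits of the symmetries. -/
def orbitPath (P : Site → ℝ) (s : Site) (t₁ δ ρ : ℝ) (y : Fin 7 → ℝ) (c : Site → ℝ) (x : ℝ) :
    LocalConf :=
  gaugeConf G P s (t₁ + x * δ) ((1 + x * ρ) • y + x • onΓ c s)

/-- The velocity of the path is a combination of the motion in time along `Q`, the scaling of the
deviation, and a translation. The derivative of the force is known in all three directions, and the
`ψ`-terms cancel in the corrected force. -/
theorem hasDerivAt_gaugeForce_orbitPath [FiniteDimensional ℝ L] {s : Site} {t₁ δ ρ : ℝ}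
    {y : Fin 7 → ℝ} {c : Site → ℝ} (hcV : P * c ∈ (hL.action hc).values t₀) {x : ℝ}
    (hx : orbitPath G P s t₁ δ ρ y c x ∈ E.Ω s) (ht : t₁ + x * δ ∈ K.dom) (hr : 1 + x * ρ ≠ 0) :
    HasDerivAt (fun x => gaugeForce G s (orbitPath G P s t₁ δ ρ y c x))
      (-3 * (δ * deriv K.g (t₁ + x * δ) / K.g (t₁ + x * δ) + ρ / (1 + x * ρ)) *
        gaugeForce G s (orbitPath G P s t₁ δ ρ y c x)) x := by
  set t := t₁ + x * δ with htdef
  set p := orbitPath G P s t₁ δ ρ y c x with hp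
  have hg := (K.g_pos ht).ne'
  have dt : HasDerivAt (fun x : ℝ => t₁ + x * δ) δ x := by
    simpa using ((hasDerivAt_id x).mul_const δ).const_add t₁
  have dr : HasDerivAt (fun x : ℝ => 1 + x * ρ) ρ x := by
    simpa using ((hasDerivAt_id x).mul_const ρ).const_add 1
  have dg : HasDerivAt (fun x : ℝ => K.g (t₁ + x * δ)) (deriv K.g t * δ) x :=
    HasDerivAt.comp (h₂ := K.g) x (K.hasDerivAt_g ht) dt
  have dQ : ∀ s', HasDerivAt (fun x : ℝ => G.Q s' (t₁ + x * δ)) (deriv (G.Q s') t * δ) x :=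
    fun s' => (G.hasDerivAt_Q s' ht).comp x dt
  have dy : ∀ i : Fin 7, HasDerivAt (fun x : ℝ => (1 + x * ρ) * y i + x * c (nbr i s))
      (ρ * y i + c (nbr i s)) x := fun i => by
    simpa using (dr.mul_const (y i)).fun_add ((hasDerivAt_id x).mul_const (c (nbr i s)))
  have dw : ∀ i : Fin 7, HasDerivAt (fun x : ℝ => K.g (t₁ + x * δ) *
      (P (nbr i s) * ((1 + x * ρ) * y i + x * c (nbr i s))))
      (deriv K.g t * δ * (P (nbr i s) * ((1 + x * ρ) * y i + x * c (nbr i s))) +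
        K.g t * (P (nbr i s) * (ρ * y i + c (nbr i s)))) x := fun i =>
    dg.fun_mul ((dy i).const_mul _)
  have dp : HasDerivAt (orbitPath G P s t₁ δ ρ y c)
      (δ, fun i => deriv (G.Q (nbr i s)) t * δ + (deriv K.g t * δ *
        (P (nbr i s) * ((1 + x * ρ) * y i + x * c (nbr i s))) +
        K.g t * (P (nbr i s) * (ρ * y i + c (nbr i s))))) x :=
    dt.prodMk (hasDerivAt_pi.2 fun i => (dQ _).add (dw i))
  have hdev : ∀ i, dev G.Q s p i =
      K.g t * (P (nbr i s) * ((1 + x * ρ) * y i + x * c (nbr i s))) := fun i => by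
    rw [hp, orbitPath, dev_gaugeConf]; rfl
  set A := δ * deriv K.g t / K.g t + ρ / (1 + x * ρ) with hA
  set B := K.g t * (1 - x * ρ / (1 + x * ρ)) with hB
  have hsum : ∀ i, deriv K.g t * δ * (P (nbr i s) * ((1 + x * ρ) * y i + x * c (nbr i s))) +
        K.g t * (P (nbr i s) * (ρ * y i + c (nbr i s))) =
      A * dev G.Q s p i + B * (P * c) (nbr i s) := fun i => by
    rw [hdev, hA, hB, Pi.mul_apply]
    field_simp
    ring
  have hv : ((δ, fun i => deriv (G.Q (nbr i s)) t * δ + (deriv K.g t * δ *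
        (P (nbr i s) * ((1 + x * ρ) * y i + x * c (nbr i s))) +
        K.g t * (P (nbr i s) * (ρ * y i + c (nbr i s))))) : LocalConf) =
      δ • ((1, fun i => deriv (G.Q (nbr i s)) t) : LocalConf) + A • (0, dev G.Q s p)
        + B • (0, fun i => (P * c) (nbr i s)) := by
    refine Prod.ext (by simp) (funext fun i => ?_)
    refine (congrArg (fun y => deriv (G.Q (nbr i s)) t * δ + y) (hsum i)).trans ?_
    simp only [Prod.snd_add, Prod.smul_snd, Pi.add_apply, Pi.smul_apply, smul_eq_mul]
    ring
  have hpt : p.1 = t := rfl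
  have hts := force_time_scale G hx (hpt ▸ ht)
  have hcn := force_const (hL := hL) (hc := hc) (K := K) hcV hx (hpt ▸ ht)
  rw [hpt] at hts hcn
  have dF := (differentiableAt_F hx).hasFDerivAt.comp_hasDerivAt x dp
  rw [hv, map_add, map_add, map_smul, map_smul, map_smul, hts.1, hts.2, hcn] at dF
  have hQ2 := ((G.smooth s).deriv_smooth K.isOpen_dom).deriv_smooth K.isOpen_dom
  have dQ2 : HasDerivAt (fun x : ℝ => deriv (deriv (G.Q s)) (t₁ + x * δ))
      (deriv (deriv (deriv (G.Q s))) t * δ) x :=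
    HasDerivAt.comp (h₂ := deriv (deriv (G.Q s))) x (hQ2.hasDerivAt_deriv K.isOpen_dom ht) dt
  have dψ : HasDerivAt (fun x : ℝ => K.ψ (t₁ + x * δ)) (deriv K.ψ t * δ) x :=
    HasDerivAt.comp (h₂ := K.ψ) x (K.hasDerivAt_ψ ht) dt
  have d0 := dw 0
  rw [hsum 0, nbr_zero] at d0
  have e : (fun x => gaugeForce G s (orbitPath G P s t₁ δ ρ y c x)) = fun x =>
      (E.F s ∘ orbitPath G P s t₁ δ ρ y c) x - deriv (deriv (G.Q s)) (t₁ + x * δ)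
      - K.ψ (t₁ + x * δ) * (K.g (t₁ + x * δ) * (P s * ((1 + x * ρ) * y 0 + x * c s))) := by
    funext x
    rw [gaugeForce, orbitPath, dev_gaugeConf, nbr_zero]
    simp only [Function.comp, orbitPath, Pi.add_apply, Pi.smul_apply, smul_eq_mul, onΓ, nbr_zero]
    rfl
  rw [e]
  refine ((dF.sub dQ2).sub (dψ.fun_mul d0)).congr_deriv ?_
  have h0 := hdev 0
  rw [nbr_zero] at h0
  simp only [smul_eq_mul]
  rw [gaugeForce, ← h0, hpt, ← htdef]
  ring

/-- The invariance of the force along the orbits. -/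
theorem gaugeForce_orbitPath [FiniteDimensional ℝ L] {s : Site} {t₁ δ ρ : ℝ}
    {y : Fin 7 → ℝ} {c : Site → ℝ} (hcV : P * c ∈ (hL.action hc).values t₀)
    (h : ∀ x ∈ Icc (0 : ℝ) 1, orbitPath G P s t₁ δ ρ y c x ∈ E.Ω s ∧ t₁ + x * δ ∈ K.dom ∧
      1 + x * ρ ≠ 0) :
    ((1 + ρ) * K.g (t₁ + δ)) ^ 3 * gaugeForce G s (orbitPath G P s t₁ δ ρ y c 1) =
      K.g t₁ ^ 3 * gaugeForce G s (orbitPath G P s t₁ δ ρ y c 0) := by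
  let f : ℝ → ℝ := fun x => ((1 + x * ρ) * K.g (t₁ + x * δ)) ^ 3 *
    gaugeForce G s (orbitPath G P s t₁ δ ρ y c x)
  have hf : ∀ x ∈ Icc (0 : ℝ) 1, HasDerivAt f 0 x := by
    intro x hx
    obtain ⟨h1, h2, h3⟩ := h x hx
    have hg := (K.g_pos h2).ne'
    have dt : HasDerivAt (fun x : ℝ => t₁ + x * δ) δ x := by
      simpa using ((hasDerivAt_id x).mul_const δ).const_add t₁
    have dr : HasDerivAt (fun x : ℝ => 1 + x * ρ) ρ x := by
      simpa using ((hasDerivAt_id x).mul_const ρ).const_add 1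
    have dg : HasDerivAt (fun x : ℝ => K.g (t₁ + x * δ)) (deriv K.g (t₁ + x * δ) * δ) x :=
      HasDerivAt.comp (h₂ := K.g) x (K.hasDerivAt_g h2) dt
    refine (((dr.fun_mul dg).fun_pow 3).fun_mul
      (hasDerivAt_gaugeForce_orbitPath G hcV h1 h2 h3)).congr_deriv ?_
    field_simp
    ring
  have := constant_of_derivWithin_zero (f := f) (a := 0) (b := 1)
    (fun x hx => (hf x hx).differentiableAt.differentiableWithinAt)
    (fun x hx => ((hf x (Ico_subset_Icc_self hx)).hasDerivWithinAt.derivWithin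
      (uniqueDiffOn_Icc zero_lt_one x (Ico_subset_Icc_self hx)))) 1 (right_mem_Icc.2 zero_le_one)
  simpa [f] using this

/-- Since `g'' = ψ g`, the term `-g'' ũ` of the transformed force is the linear correction in
`gaugeForce`. -/
theorem newForce_eq (hP : ∀ s, P s ≠ 0) {s : Site} {p : LocalConf} (ht : p.1 ∈ K.dom) :
    (gaugeTransformation G hP).newForce E s p = K.g p.1 ^ 3 / P s * gaugeForce G s p := by
  have hg := (K.g_pos ht).ne'
  have hPs := hP s
  have e1 : deriv (deriv (gaugeTransformation G hP).g) p.1 = K.ψ p.1 * K.g p.1 := by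
    refine deriv_eq_of_eqOn K.isOpen_dom (φ' := fun t => K.ψ t * K.g t)
      (deriv_eq_of_eqOn K.isOpen_dom (φ := K.g) (φ' := deriv K.g)
      (fun t ht => gaugeTransformation_g G hP ht) fun t ht => K.hasDerivAt_g ht)
      (fun t ht => K.hasDerivAt_deriv_g ht) p.1 ht
  have e2 : (gaugeTransformation G hP).newConf s p 0 = dev G.Q s p 0 / (K.g p.1 * P s) := by
    rw [← gaugeTransformation_g G hP ht, dev, nbr_zero]
    change (p.2 0 - G.Q (nbr 0 s) p.1) / (_ * P (nbr 0 s)) = _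
    rw [nbr_zero]
  rw [AllowedTransformation.newForce, e1, e2, gaugeTransformation_g G hP ht, gaugeForce]
  change K.g p.1 ^ 3 * ((E.F s p - deriv (deriv (G.Q s)) p.1) / P s - _) = _
  field_simp

end LatticeEquation
end

/-! ### The local form of the force as a function of the invariants -/

noncomputable section

variable {κ : Fin 3 → Site → ℝ}

/-- The minor of the nondegeneracy condition. -/
def shiftDet (κ : Fin 3 → Site → ℝ) (s : Site) : ℝ :=
  latticeDet ![onΓ (κ 0) s, onΓ (κ 1) s, onΓ (κ 2) s, fun _ => 1] ![0, 1, 2, 3]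

/-- A section of the invariants through `y`. -/
def xiSection (κ : Fin 3 → Site → ℝ) (s : Site) (y : Fin 7 → ℝ) (ξ : ℝ × ℝ) : Fin 7 → ℝ :=
  y + (((ξ.1 - (xi κ s y).1) * detForm κ s 4 y / shiftDet κ s) • (Pi.single 5 1 : Fin 7 → ℝ)
    + ((ξ.2 - (xi κ s y).2) * detForm κ s 4 y / shiftDet κ s) • (Pi.single 6 1 : Fin 7 → ℝ))

theorem xiSection_self (κ : Fin 3 → Site → ℝ) (s : Site) (y : Fin 7 → ℝ) :
    xiSection κ s y (xi κ s y) = y := by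
  simp [xiSection]

theorem contDiff_xiSection (κ : Fin 3 → Site → ℝ) (s : Site) (y : Fin 7 → ℝ) :
    ContDiff ℝ ∞ (xiSection κ s y) := by
  unfold xiSection
  fun_prop

theorem detForm_single_five (κ : Fin 3 → Site → ℝ) (s : Site) (j : Fin 7) :
    detForm κ s j (Pi.single 5 1) = (Pi.single 5 1 : Fin 7 → ℝ) j * shiftDet κ s := by
  rw [detForm_of_vanish, shiftDet] <;> simp

theorem detForm_single_six (κ : Fin 3 → Site → ℝ) (s : Site) (j : Fin 7) :
    detForm κ s j (Pi.single 6 1) = (Pi.single 6 1 : Fin 7 → ℝ) j * shiftDet κ s := by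
  rw [detForm_of_vanish, shiftDet] <;> simp

/-- Moving only the last two coordinates of `Γ` keeps `𝒟` constant and gives the invariants any
prescribed values. -/
theorem IsNondegenerate.detForm_xiSection (h : IsNondegenerate κ) (s : Site) {y : Fin 7 → ℝ}
    (hy : detForm κ s 4 y ≠ 0) (ξ : ℝ × ℝ) :
    detForm κ s 4 (xiSection κ s y ξ) = detForm κ s 4 y ∧
      detForm κ s 5 (xiSection κ s y ξ) = ξ.1 * detForm κ s 4 y ∧
      detForm κ s 6 (xiSection κ s y ξ) = ξ.2 * detForm κ s 4 y := by
  have hΔ : shiftDet κ s ≠ 0 := h s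
  simp only [xiSection, map_add, map_smul, detForm_single_five, detForm_single_six, xi_eq]
  refine ⟨by simp, ?_, ?_⟩
  · simp
    field_simp
    ring
  · simp
    field_simp
    ring

/-- Every `z` is a multiple of a point of the section plus a shift. -/
theorem IsNondegenerate.exists_sub_eq_shift (h : IsNondegenerate κ) {s : Site} {y z : Fin 7 → ℝ}
    (hy : detForm κ s 4 y ≠ 0) (hz : detForm κ s 4 z ≠ 0) : ∃ c ∈ shifts κ,
      z - (detForm κ s 4 z / detForm κ s 4 y) • xiSection κ s y (xi κ s z) = onΓ c s := by
  obtain ⟨h4, h5, h6⟩ := h.detForm_xiSection s hy (xi κ s z)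
  refine h.exists_eq_shift ?_ ?_ ?_
  · rw [map_sub, map_smul, h4, smul_eq_mul, div_mul_cancel₀ _ hy, sub_self]
  · rw [map_sub, map_smul, h5, xi_eq, smul_eq_mul]
    field_simp
    ring
  · rw [map_sub, map_smul, h6, xi_eq, smul_eq_mul]
    field_simp
    ring

theorem continuousAt_xi {s : Site} {y : Fin 7 → ℝ} (hy : detForm κ s 4 y ≠ 0) :
    ContinuousAt (xi κ s) y := by
  have : xi κ s = fun u => (detForm κ s 5 u / detForm κ s 4 u,
      detForm κ s 6 u / detForm κ s 4 u) := funext fun u => xi_eq κ s u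
  rw [this]
  exact ((detForm κ s 5).continuous.continuousAt.div (detForm κ s 4).continuous.continuousAt
    hy).prodMk ((detForm κ s 6).continuous.continuousAt.div
    (detForm κ s 4).continuous.continuousAt hy)

namespace LatticeEquation

open AffineAction

variable {E : LatticeEquation} {L : LieSubalgebra ℝ (LatticeField E.M)}
variable {hL : E.IsSymmetryAlgebra L} {hc : E.IsCoupled} {t₀ : ℝ}
  {K : (hL.action hc).Chart t₀} (G : K.Gauge) {P : Site → ℝ} (hP : ∀ s, P s ≠ 0)

theorem newConf_apply {s : Site} {q : LocalConf} (hq : q.1 ∈ K.dom) (i : Fin 7) :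
    (gaugeTransformation G hP).newConf s q i =
      (q.2 i - G.Q (nbr i s) q.1) / (K.g q.1 * P (nbr i s)) := by
  rw [← gaugeTransformation_g G hP hq]
  rfl

theorem gaugeConf_newConf {s : Site} {q : LocalConf} (hq : q.1 ∈ K.dom) :
    gaugeConf G P s q.1 ((gaugeTransformation G hP).newConf s q) = q := by
  have hg := (K.g_pos hq).ne'
  refine Prod.ext rfl (funext fun i => ?_)
  have hPs := hP (nbr i s)
  simp only [gaugeConf, newConf_apply G hP hq]
  field_simp
  ring

theorem continuousAt_newConf {s : Site} {p : LocalConf} (hp : p.1 ∈ K.dom) :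
    ContinuousAt ((gaugeTransformation G hP).newConf s) p := by
  have e : (gaugeTransformation G hP).newConf s =ᶠ[𝓝 p] fun q i =>
      (q.2 i - G.Q (nbr i s) q.1) / (K.g q.1 * P (nbr i s)) := by
    filter_upwards [(K.isOpen_dom.preimage continuous_fst).mem_nhds hp] with q hq
    exact funext fun i => newConf_apply G hP hq i
  refine ContinuousAt.congr ?_ e.symm
  refine continuousAt_pi.2 fun i => ?_
  have h1 : ContinuousAt (fun q : LocalConf => G.Q (nbr i s) q.1) p :=
    ContinuousAt.comp (f := fun q : LocalConf => q.1) (g := G.Q (nbr i s))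
      (G.hasDerivAt_Q (nbr i s) hp).continuousAt continuousAt_fst
  have h2 : ContinuousAt (fun q : LocalConf => K.g q.1) p :=
    ContinuousAt.comp (f := fun q : LocalConf => q.1) (g := K.g)
      (K.hasDerivAt_g hp).continuousAt continuousAt_fst
  exact ContinuousAt.div (ContinuousAt.sub (by fun_prop) h1) (h2.mul continuousAt_const)
    (mul_ne_zero (K.g_pos hp).ne' (hP _))

theorem continuousAt_gaugeConf (P : Site → ℝ) (s : Site) {z : ℝ × (Fin 7 → ℝ)} (hz : z.1 ∈ K.dom) :
    ContinuousAt (fun z : ℝ × (Fin 7 → ℝ) => gaugeConf G P s z.1 z.2) z := by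
  refine continuousAt_fst.prodMk (continuousAt_pi.2 fun i => ?_)
  have h1 : ContinuousAt (fun q : LocalConf => G.Q (nbr i s) q.1) z :=
    ContinuousAt.comp (f := fun q : LocalConf => q.1) (g := G.Q (nbr i s))
      (G.hasDerivAt_Q (nbr i s) hz).continuousAt continuousAt_fst
  have h2 : ContinuousAt (fun q : LocalConf => K.g q.1) z :=
    ContinuousAt.comp (f := fun q : LocalConf => q.1) (g := K.g)
      (K.hasDerivAt_g hz).continuousAt continuousAt_fst
  exact h1.add (h2.mul (by fun_prop))

theorem contDiff_gaugeConf (P : Site → ℝ) (s : Site) (t : ℝ) :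
    ContDiff ℝ ∞ (gaugeConf G P s t) := by
  unfold gaugeConf
  fun_prop

theorem contDiffOn_gaugeForce_gaugeConf (P : Site → ℝ) (s : Site) (t : ℝ) :
    ContDiffOn ℝ ∞ (fun y => gaugeForce G s (gaugeConf G P s t y))
      {y | gaugeConf G P s t y ∈ E.Ω s} := by
  have h := (E.smooth_F s).comp (contDiff_gaugeConf G P s t).contDiffOn
    (s := {y | gaugeConf G P s t y ∈ E.Ω s}) fun y hy => hy
  have e : (fun y => gaugeForce G s (gaugeConf G P s t y)) = fun y =>
      (E.F s ∘ gaugeConf G P s t) y - deriv (deriv (G.Q s)) t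
        - K.ψ t * (K.g t * (P (nbr 0 s) * y 0)) := by
    funext y
    rw [gaugeForce, dev_gaugeConf]
    rfl
  rw [e]
  exact (h.sub contDiffOn_const).sub (by fun_prop)

theorem hasNSForm_newForce [FiniteDimensional ℝ L] (hκ : IsNondegenerate κ)
    (hV : ∀ w, w ∈ shifts κ ↔ P * w ∈ (hL.action hc).values t₀) (s : Site) :
    HasNSForm κ s {p ∈ E.Ω s | p.1 ∈ K.dom} ((gaugeTransformation G hP).newConf s)
      ((gaugeTransformation G hP).newForce E s) := by
  rintro p ⟨hp, hpt⟩ hD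
  rw [← detForm_apply] at hD
  set w := (gaugeTransformation G hP).newConf s with hw
  set y := w p with hy
  set D := detForm κ s 4 y with hDdef
  let σ := xiSection κ s y
  have hσ := contDiff_xiSection κ s y
  let ρ : LocalConf → ℝ := fun q => detForm κ s 4 (w q) / D
  -- For fixed `q`, the path from the section point over `ξ(w q)` at time `p.1` to `w q` at time
  -- `q.1`, linear in both time and values. It is an orbit path once the last bracket is recognized
  -- as a shift.
  let Φ : LocalConf × ℝ → ℝ × (Fin 7 → ℝ) := fun z =>
    (p.1 + z.2 * (z.1.1 - p.1), (1 + z.2 * (ρ z.1 - 1)) • σ (xi κ s (w z.1))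
      + z.2 • (w z.1 - ρ z.1 • σ (xi κ s (w z.1))))
  have hwc : ContinuousAt w p := continuousAt_newConf G hP hpt
  have hρ : ContinuousAt ρ p :=
    ((detForm κ s 4).continuous.continuousAt.comp hwc).div_const D
  have hξ : ContinuousAt (fun q => xi κ s (w q)) p :=
    ContinuousAt.comp (g := xi κ s) (continuousAt_xi hD) hwc
  have hσξ : ContinuousAt (fun q => σ (xi κ s (w q))) p :=
    ContinuousAt.comp (g := σ) hσ.continuous.continuousAt hξ
  have hΦ : ∀ x, ContinuousAt Φ (p, x) := fun x => by
    have c1 : ContinuousAt (fun z : LocalConf × ℝ => ρ z.1) (p, x) :=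
      ContinuousAt.comp (f := Prod.fst) (g := ρ) hρ continuousAt_fst
    have c2 : ContinuousAt (fun z : LocalConf × ℝ => σ (xi κ s (w z.1))) (p, x) :=
      ContinuousAt.comp (f := Prod.fst) (g := fun q => σ (xi κ s (w q))) hσξ continuousAt_fst
    have c3 : ContinuousAt (fun z : LocalConf × ℝ => w z.1) (p, x) :=
      ContinuousAt.comp (f := Prod.fst) (g := w) hwc continuousAt_fst
    have c4 : ContinuousAt (fun z : LocalConf × ℝ => z.2) (p, x) := continuousAt_snd
    refine ContinuousAt.prodMk (by fun_prop) (ContinuousAt.add ?_ ?_)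
    · exact (continuousAt_const.add (c4.mul (c1.sub continuousAt_const))).smul c2
    · exact c4.smul (c3.sub (c1.smul c2))
  have hρp : ρ p = 1 := div_self hD
  have hΦp : ∀ x, Φ (p, x) = (p.1, y) := fun x => by
    simp only [Φ, hρp, σ, ← hy, xiSection_self]
    simp
  -- At `q = p` the path is constant. By compactness of `[0, 1]` the whole path stays in the domain
  -- for all `q` near `p`.
  have hev : ∀ᶠ q in 𝓝 p, ∀ x ∈ Icc (0 : ℝ) 1,
      gaugeConf G P s (Φ (q, x)).1 (Φ (q, x)).2 ∈ E.Ω s ∧ (Φ (q, x)).1 ∈ K.dom ∧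
        1 + x * (ρ q - 1) ≠ 0 := by
    refine isCompact_Icc.eventually_forall_of_forall_eventually fun x _ => ?_
    have k1 : ContinuousAt (fun z => gaugeConf G P s (Φ z).1 (Φ z).2) (p, x) :=
      ContinuousAt.comp (f := Φ) (g := fun z => gaugeConf G P s z.1 z.2)
        (continuousAt_gaugeConf G P s (by rw [hΦp]; exact hpt)) (hΦ x)
    have k2 : ContinuousAt (fun z : LocalConf × ℝ => 1 + z.2 * (ρ z.1 - 1)) (p, x) := by
      have c1 : ContinuousAt (fun z : LocalConf × ℝ => ρ z.1) (p, x) :=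
        ContinuousAt.comp (f := Prod.fst) (g := ρ) hρ continuousAt_fst
      fun_prop
    refine (k1.eventually_mem ((E.isOpen_Ω s).mem_nhds ?_)).and
      (((continuous_fst.continuousAt.comp (hΦ x)).eventually_mem
        (K.isOpen_dom.mem_nhds ?_)).and (k2.eventually_ne ?_))
    · rw [hΦp, hy, hw, gaugeConf_newConf G hP hpt]
      exact hp
    · simp only [Function.comp, hΦp]
      exact hpt
    · simp [hρp]
  have hD' : ∀ᶠ q in 𝓝 p, detForm κ s 4 (w q) ≠ 0 :=
    ((detForm κ s 4).continuous.continuousAt.comp hwc).eventually_ne hD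
  -- The function `f` is the corrected force on the section at the fixed time `p.1`; the factor `D³`
  -- compensates for `𝒟⁻³`, as `𝒟 = D` on the section.
  refine ⟨_, hev.and hD', {ξ | gaugeConf G P s p.1 (σ ξ) ∈ E.Ω s}, fun ξ =>
    D ^ 3 * (K.g p.1 ^ 3 / P s) * gaugeForce G s (gaugeConf G P s p.1 (σ ξ)),
    (E.isOpen_Ω s).preimage ((contDiff_gaugeConf G P s p.1).continuous.comp hσ.continuous),
    contDiffOn_const.mul ((contDiffOn_gaugeForce_gaugeConf G P s p.1).comp hσ.contDiffOn
      fun ξ hξ => hξ), ?_⟩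
  rintro q ⟨hq, hDq⟩
  obtain ⟨c, hcs, hcq⟩ := hκ.exists_sub_eq_shift hD hDq
  have hpath : ∀ x, orbitPath G P s p.1 (q.1 - p.1) (ρ q - 1) (σ (xi κ s (w q))) c x =
      gaugeConf G P s (Φ (q, x)).1 (Φ (q, x)).2 := fun x => by
    simp only [orbitPath, Φ, ← hcq]
    rfl
  have h0 : gaugeConf G P s (Φ (q, 0)).1 (Φ (q, 0)).2 =
      gaugeConf G P s p.1 (σ (xi κ s (w q))) := by simp [Φ]
  have hq0 := hq 0 (left_mem_Icc.2 zero_le_one)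
  have hq1 := hq 1 (right_mem_Icc.2 zero_le_one)
  have hqt : q.1 ∈ K.dom := by simpa [Φ] using hq1.2.1
  have h1 : gaugeConf G P s (Φ (q, 1)).1 (Φ (q, 1)).2 = q := by
    simp only [Φ, one_mul, add_sub_cancel, one_smul]
    exact gaugeConf_newConf G hP hqt
  rw [h0] at hq0
  refine ⟨hq0.1, ?_⟩
  have key := gaugeForce_orbitPath G ((hV c).1 hcs) (t₁ := p.1) (δ := q.1 - p.1) (ρ := ρ q - 1)
    (y := σ (xi κ s (w q))) fun x hx => by rw [hpath x]; exact hq x hx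
  rw [hpath, hpath, h0, h1, add_sub_cancel, add_sub_cancel] at key
  rw [newForce_eq G hP hqt, ← detForm_apply]
  have hρq : ρ q = detForm κ s 4 (w q) / D := rfl
  rw [hρq] at key
  have hPs := hP s
  field_simp at key ⊢
  linear_combination key

end LatticeEquation

theorem exists_transformation {E : LatticeEquation} {L : LieSubalgebra ℝ (LatticeField E.M)}
    (hc : E.IsCoupled) (hi : E.IsIsotropic) (hL : E.IsSymmetryAlgebra L)
    (h11 : Module.finrank ℝ L = 11) (hns : ¬ LieAlgebra.IsSolvable L) {t₀ : ℝ} (ht₀ : t₀ ∈ E.I) :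
    ∃ (T : AllowedTransformation) (κ : Fin 3 → Site → ℝ),
      t₀ ∈ T.dom ∧ T.dom ⊆ E.I ∧ IsNondegenerate κ ∧
      (∀ X ∈ L, ∃ X' ∈ nsSpan κ, T.Carries E.J X.1 X'.1) ∧
      (∀ X' ∈ nsSpan κ, ∃ X ∈ L, T.Carries E.J X.1 X'.1) ∧
      ∀ s, HasNSForm κ s {p ∈ E.Ω s | p.1 ∈ T.dom} (T.newConf s) (T.newForce E s) := by
  have : FiniteDimensional ℝ L := FiniteDimensional.of_finrank_pos (by omega)
  obtain ⟨K⟩ := AffineAction.exists_chart (hL.action hc) E.isOpen_I E.ordConnected_I hns ht₀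
  obtain ⟨G⟩ := K.exists_gauge E.isOpen_I E.ordConnected_I
  have h4 := (LatticeEquation.finrank_values G hi h11).1
  have hV : DeterminedBy ((hL.action hc).values t₀) 4 := by
    intro s c hcV
    have := hi.1 t₀ ht₀ s c
    rw [hL.translations_eq hc ht₀, h4] at this
    exact this hcV
  obtain ⟨P, κ, hP, hκ, hPκ⟩ := hV.exists_kappa h4
  refine ⟨LatticeEquation.gaugeTransformation G hP, κ, K.mem_dom, K.dom_subset, hκ,
    fun X hX => LatticeEquation.exists_carries G hP (LatticeEquation.scals_eq_bot G hi h11) hPκ ⟨X, hX⟩, fun X' hX' => ?_,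
    LatticeEquation.hasNSForm_newForce G hP hκ hPκ⟩
  obtain ⟨X, hX⟩ := LatticeEquation.exists_carries_of_mem G hP hPκ hX'
  exact ⟨X, X.2, hX⟩
end

noncomputable section

/-! ### An interaction of the class -/

/-- The functions `n`, `m`, `n m`. -/
def modelKappa : Fin 3 → Site → ℝ :=
  ![fun s => s.1, fun s => s.2, fun s => s.1 * s.2]

theorem isNondegenerate_modelKappa : IsNondegenerate modelKappa := by
  intro s
  simp [latticeDet, Matrix.det_succ_row_zero, Fin.sum_univ_succ, Fin.succAbove, onΓ, nbr_eq,
    modelKappa, offset]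
  intro h
  ring_nf at h
  norm_num at h

/-- The value at a point of `Γ`. -/
def siteValue (i : Fin 7) : (Fin 7 → ℝ) →L[ℝ] ℝ :=
  ContinuousLinearMap.proj (R := ℝ) (φ := fun _ : Fin 7 => ℝ) i

/-- The second difference in the first direction. -/
def diffN : (Fin 7 → ℝ) →L[ℝ] ℝ :=
  siteValue 1 + siteValue 4 - (2 : ℝ) • siteValue 0

/-- The second difference in the second direction. -/
def diffM : (Fin 7 → ℝ) →L[ℝ] ℝ :=
  siteValue 2 + siteValue 5 - (2 : ℝ) • siteValue 0

/-- The third relation between the values of an affine-bilinear function on `Γ`. -/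
def diffX : (Fin 7 → ℝ) →L[ℝ] ℝ :=
  siteValue 6 - siteValue 3 - (2 : ℝ) • siteValue 1
    + (2 : ℝ) • siteValue 2

theorem diffN_apply (u : Fin 7 → ℝ) : diffN u = u 1 + u 4 - 2 * u 0 := rfl

theorem diffM_apply (u : Fin 7 → ℝ) : diffM u = u 2 + u 5 - 2 * u 0 := rfl

theorem diffX_apply (u : Fin 7 → ℝ) : diffX u = u 6 - u 3 - 2 * u 1 + 2 * u 2 := rfl

theorem eq_add_mul_of_diff_eq_zero {f : ℤ → ℝ} (h : ∀ n, f (n + 1) + f (n - 1) - 2 * f n = 0)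
    (n : ℤ) : f n = f 0 + n * (f 1 - f 0) := by
  suffices f n = f 0 + n * (f 1 - f 0) ∧ f (n + 1) = f 0 + (n + 1) * (f 1 - f 0) from this.1
  induction n using Int.induction_on with
  | zero => simp
  | succ k ih =>
    have := h (k + 1)
    rw [show (k + 1 - 1 : ℤ) = k by ring] at this
    push_cast at ih ⊢
    exact ⟨ih.2, by linear_combination this - ih.1 + 2 * ih.2⟩
  | pred k ih =>
    have := h (-k)
    rw [show (-k - 1 + 1 : ℤ) = -k by ring]
    push_cast at ih ⊢
    refine ⟨by linear_combination this - ih.2 + 2 * ih.1, by linear_combination ih.1⟩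

/-- Vanishing second differences in `n` and in `m` make a function affine in each variable, hence a
combination of `1, n, m, nm`. The third relation completes the annihilator of these functions on the
seven points of `Γ`. -/
theorem mem_shifts_modelKappa {c : Site → ℝ} : c ∈ shifts modelKappa ↔
    ∀ s, diffN (onΓ c s) = 0 ∧ diffM (onΓ c s) = 0 ∧ diffX (onΓ c s) = 0 := by
  rw [mem_shifts_iff]
  constructor
  · rintro ⟨v, rfl⟩ s
    simp only [diffN_apply, diffM_apply, diffX_apply, onΓ, nbr_eq, offset, modelKappa]
    simp
    refine ⟨?_, ?_, ?_⟩ <;> ring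
  · intro h
    have hn : ∀ n m : ℤ, c (n, m) = c (0, m) + n * (c (1, m) - c (0, m)) := fun n m =>
      eq_add_mul_of_diff_eq_zero (f := fun n => c (n, m)) (fun n => by
        have := (h (n, m)).1
        simpa [diffN_apply, onΓ, nbr_eq, offset, ← sub_eq_add_neg] using this) n
    have hm : ∀ n m : ℤ, c (n, m) = c (n, 0) + m * (c (n, 1) - c (n, 0)) := fun n m =>
      eq_add_mul_of_diff_eq_zero (f := fun m => c (n, m)) (fun m => by
        have := (h (n, m)).2.1
        simpa [diffM_apply, onΓ, nbr_eq, offset, ← sub_eq_add_neg] using this) m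
    refine ⟨![c (1, 0) - c (0, 0), c (0, 1) - c (0, 0),
      c (1, 1) - c (0, 1) - c (1, 0) + c (0, 0), c (0, 0)], funext fun s => ?_⟩
    obtain ⟨n, m⟩ := s
    rw [hn n m, hm 0 m, hm 1 m]
    simp [modelKappa]
    ring

/-- The domain of the interaction. -/
def modelCone : Set (Fin 7 → ℝ) := {u | 0 < diffN u ∧ 0 < diffM u ∧ 2 * diffN u < diffX u}

theorem isOpen_modelCone : IsOpen modelCone :=
  (isOpen_lt continuous_const diffN.continuous).inter
    ((isOpen_lt continuous_const diffM.continuous).inter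
      (isOpen_lt (continuous_const.mul diffN.continuous) diffX.continuous))

theorem diffX_pos {u : Fin 7 → ℝ} (hu : u ∈ modelCone) : 0 < diffX u := by
  have := hu.1
  have := hu.2.2
  linarith

theorem smul_mem_modelCone {u : Fin 7 → ℝ} (hu : u ∈ modelCone) {r : ℝ} (hr : 0 < r) :
    r • u ∈ modelCone := by
  obtain ⟨h1, h2, h3⟩ := hu
  refine ⟨?_, ?_, ?_⟩
  · rw [map_smul]; exact mul_pos hr h1
  · rw [map_smul]; exact mul_pos hr h2
  · simp only [map_smul, smul_eq_mul]
    nlinarith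

/-- The interaction. -/
def modelForce (u : Fin 7 → ℝ) : ℝ :=
  (diffN u)⁻¹ ^ 3 + (diffM u)⁻¹ ^ 3 + (diffX u)⁻¹ ^ 3

/-- Minus its derivative. -/
def modelSlope (u : Fin 7 → ℝ) : (Fin 7 → ℝ) →L[ℝ] ℝ :=
  (3 * (diffN u)⁻¹ ^ 4) • diffN + (3 * (diffM u)⁻¹ ^ 4) • diffM + (3 * (diffX u)⁻¹ ^ 4) • diffX

theorem modelSlope_apply (u v : Fin 7 → ℝ) : modelSlope u v = 3 * (diffN u)⁻¹ ^ 4 * diffN v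
    + 3 * (diffM u)⁻¹ ^ 4 * diffM v + 3 * (diffX u)⁻¹ ^ 4 * diffX v := rfl

theorem hasFDerivAt_modelForce {u : Fin 7 → ℝ} (hu : u ∈ modelCone) :
    HasFDerivAt modelForce (-modelSlope u) u := by
  have key : ∀ (y : (Fin 7 → ℝ) →L[ℝ] ℝ), 0 < y u →
      HasFDerivAt (fun u => (y u)⁻¹ ^ 3) ((-(3 * (y u)⁻¹ ^ 4)) • y) u := fun y hy => by
    have h : HasDerivAt (fun x : ℝ => x⁻¹ ^ 3) (-(3 * (y u)⁻¹ ^ 4)) (y u) := by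
      refine ((hasDerivAt_inv hy.ne').fun_pow 3).congr_deriv ?_
      norm_num
      field_simp
    exact h.comp_hasFDerivAt u y.hasFDerivAt
  refine (((key diffN hu.1).add (key diffM hu.2.1)).add (key diffX (diffX_pos hu))).congr_fderiv ?_
  ext v
  simp only [modelSlope, add_apply, smul_apply, neg_apply, smul_eq_mul]
  ring

theorem modelSlope_self {u : Fin 7 → ℝ} (hu : u ∈ modelCone) :
    modelSlope u u = 3 * modelForce u := by
  have h1 := hu.1.ne'
  have h2 := hu.2.1.ne'
  have h3 := (diffX_pos hu).ne'
  rw [modelSlope_apply, modelForce]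
  field_simp

theorem modelForce_smul (r : ℝ) (u : Fin 7 → ℝ) : modelForce (r • u) = r⁻¹ ^ 3 * modelForce u := by
  simp only [modelForce, map_smul, smul_eq_mul, mul_inv]
  ring

theorem modelSlope_smul (r : ℝ) (u v : Fin 7 → ℝ) :
    modelSlope (r • u) v = r⁻¹ ^ 4 * modelSlope u v := by
  simp only [modelSlope_apply, map_smul, smul_eq_mul, mul_inv]
  ring

theorem modelForce_pos {u : Fin 7 → ℝ} (hu : u ∈ modelCone) : 0 < modelForce u := by
  have h1 := hu.1
  have h2 := hu.2.1
  have h3 := diffX_pos hu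
  unfold modelForce
  positivity

/-- A point with prescribed differences. -/
def modelPoint (x α β γ : ℝ) : Fin 7 → ℝ := ![x, x, x, x, x + α, x + β, x + γ]

theorem diff_modelPoint (x α β γ : ℝ) : diffN (modelPoint x α β γ) = α ∧
    diffM (modelPoint x α β γ) = β ∧ diffX (modelPoint x α β γ) = γ := by
  refine ⟨?_, ?_, ?_⟩
  · simp [diffN_apply, modelPoint]
    ring
  · simp [diffM_apply, modelPoint]
    ring
  · simp [diffX_apply, modelPoint]

theorem modelPoint_mem {x α β γ : ℝ} (hα : 0 < α) (hβ : 0 < β) (hγ : 2 * α < γ) :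
    modelPoint x α β γ ∈ modelCone := by
  obtain ⟨h1, h2, h3⟩ := diff_modelPoint x α β γ
  exact ⟨by rwa [h1], by rwa [h2], by rwa [h1, h3]⟩

theorem diff_eq_zero_of_modelSlope {v : Fin 7 → ℝ}
    (h : ∀ α β γ : ℝ, 0 < α → 0 < β → 2 * α < γ → modelSlope (modelPoint 0 α β γ) v = 0) :
    diffN v = 0 ∧ diffM v = 0 ∧ diffX v = 0 := by
  -- The vectors of inverse fourth powers of these three triples are linearly independent.
  have h1 := h 1 1 3 (by norm_num) (by norm_num) (by norm_num)
  have h2 := h 1 2 3 (by norm_num) (by norm_num) (by norm_num)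
  have h3 := h 1 1 4 (by norm_num) (by norm_num) (by norm_num)
  simp only [modelSlope_apply, diff_modelPoint] at h1 h2 h3
  norm_num at h1 h2 h3
  refine ⟨?_, ?_, ?_⟩ <;> linarith

/-- The equation `ü = modelForce u`. -/
def modelEquation : LatticeEquation where
  I := univ
  J := univ
  isOpen_I := isOpen_univ
  isOpen_J := isOpen_univ
  ordConnected_I := ordConnected_univ
  ordConnected_J := ordConnected_univ
  nonempty_I := univ_nonempty
  nonempty_J := univ_nonempty
  Ω _ := {p | p.2 ∈ modelCone}
  isOpen_Ω _ := isOpen_modelCone.preimage continuous_snd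
  Ω_subset _ _ _ := ⟨mem_univ _, fun _ => mem_univ _⟩
  exists_mem_Ω _ t _ x _ := ⟨(t, modelPoint x 1 1 3),
    modelPoint_mem one_pos one_pos (by norm_num), rfl, rfl⟩
  F _ p := modelForce p.2
  smooth_F _ := by
    have h : ∀ p ∈ {p : LocalConf | p.2 ∈ modelCone}, diffN p.2 ≠ 0 ∧ diffM p.2 ≠ 0 ∧
      diffX p.2 ≠ 0 := fun p hp => ⟨hp.1.ne', hp.2.1.ne', (diffX_pos hp).ne'⟩
    unfold modelForce
    refine ContDiffOn.add (ContDiffOn.add ?_ ?_) ?_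
    · exact (ContDiffOn.inv (by fun_prop) fun p hp => (h p hp).1).pow 3
    · exact (ContDiffOn.inv (by fun_prop) fun p hp => (h p hp).2.1).pow 3
    · exact (ContDiffOn.inv (by fun_prop) fun p hp => (h p hp).2.2).pow 3

namespace modelEquation

theorem mem_M (p : ℝ × ℝ) : p ∈ modelEquation.M := ⟨mem_univ _, mem_univ _⟩

theorem fderiv_F {s : Site} {p : LocalConf} (hp : p.2 ∈ modelCone) (v : LocalConf) :
    fderiv ℝ (modelEquation.F s) p v = -modelSlope p.2 v.2 := by
  have h : HasFDerivAt (modelEquation.F s) _ p :=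
    (hasFDerivAt_modelForce hp).comp p (hasFDerivAt_snd (𝕜 := ℝ) (p := p))
  rw [h.fderiv]
  rfl

theorem isNonlinear : modelEquation.IsNonlinear := by
  intro s
  refine ⟨4, 4, (0, modelPoint 0 1 1 3), modelPoint_mem one_pos one_pos (by norm_num), ?_⟩
  set p : LocalConf := (0, modelPoint 0 1 1 3) with hp
  have hpc : p.2 ∈ modelCone := modelPoint_mem one_pos one_pos (by norm_num)
  have e : modelEquation.partialF s 4 =ᶠ[𝓝 p] fun q => -(3 * (diffN q.2)⁻¹ ^ 4) := by
    filter_upwards [(isOpen_modelCone.preimage continuous_snd).mem_nhds hpc] with q hq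
    rw [LatticeEquation.partialF, fderiv_F hq, modelSlope_apply]
    simp [diffN_apply, diffM_apply, diffX_apply]
  have h1 : diffN p.2 = 1 := (diff_modelPoint 0 1 1 3).1
  have h : HasDerivAt (fun x : ℝ => -(3 * x⁻¹ ^ 4)) 12 (diffN p.2) := by
    rw [h1]
    refine (((hasDerivAt_inv one_ne_zero).fun_pow 4).const_mul 3).fun_neg.congr_deriv ?_
    norm_num
  have h2 := h.comp_hasFDerivAt p ((diffN.comp (ContinuousLinearMap.snd ℝ ℝ _)).hasFDerivAt)
  rw [e.fderiv_eq]
  have h3 : fderiv ℝ (fun q : LocalConf => -(3 * (diffN q.2)⁻¹ ^ 4)) p =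
    (12 : ℝ) • (diffN.comp (ContinuousLinearMap.snd ℝ ℝ _)) := h2.fderiv
  rw [h3]
  simp [diffN_apply]

theorem isCoupled : modelEquation.IsCoupled := by
  rintro s i U hU - ⟨p, hp⟩
  refine ⟨p, hp, ?_⟩
  have hpc : p.2 ∈ modelCone := hU hp
  rw [LatticeEquation.partialF, fderiv_F hpc, modelSlope_apply]
  have h1 := hpc.1
  have h2 := hpc.2.1
  have h3 := diffX_pos hpc
  have hA : 0 < (diffN p.2)⁻¹ ^ 4 := by positivity
  have hB : 0 < (diffM p.2)⁻¹ ^ 4 := by positivity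
  have hC : 0 < (diffX p.2)⁻¹ ^ 4 := by positivity
  -- The value at `(n+1,m)` enters both `diffN` and `diffX`, with opposite signs. The inequality `2
  -- diffN < diffX` of the cone keeps the two contributions from cancelling.
  have hAC : (diffX p.2)⁻¹ ^ 4 < (2 * diffN p.2)⁻¹ ^ 4 := by
    refine pow_lt_pow_left₀ ?_ (by positivity) (by norm_num)
    exact inv_strictAnti₀ (by positivity) hpc.2.2
  rw [mul_inv, mul_pow] at hAC
  generalize (diffN p.2)⁻¹ ^ 4 = A at *
  generalize (diffM p.2)⁻¹ ^ 4 = B at *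
  generalize (diffX p.2)⁻¹ ^ 4 = C at *
  norm_num at hAC
  refine neg_ne_zero.2 ?_
  fin_cases i <;> simp [diffN_apply, diffM_apply, diffX_apply] <;>
    first | positivity | (intro h; linarith)

theorem coeff_eq_zero {A B C D : ℝ}
    (h : ∀ r : ℝ, 0 < r → A + B * r + C * r⁻¹ ^ 3 + D * r⁻¹ ^ 4 = 0) :
    A = 0 ∧ B = 0 ∧ C = 0 ∧ D = 0 := by
  have h1 := h 1 (by norm_num)
  have h2 := h 2 (by norm_num)
  have h3 := h 3 (by norm_num)
  have h4 := h 4 (by norm_num)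
  norm_num at h1 h2 h3 h4
  refine ⟨?_, ?_, ?_, ?_⟩ <;> linarith

theorem eq_zero_of_multiplier {a : Site → ℝ}
    (h : ∀ s, ∀ u ∈ modelCone, a s * modelForce u + modelSlope u (fun i => a (nbr i s) * u i) = 0) :
    a = 0 := by
  -- A vector with all three differences zero: adding it to `u` changes neither the force nor its
  -- slope. The difference of the two conditions shows that `a` agrees at `(n,m)`, `(n-1,m)` and
  -- `(n,m-1)`, so `a` is constant, and homogeneity of degree `-3` excludes a nonzero constant.
  let k : Fin 7 → ℝ := ![1, 0, 0, 0, 2, 2, 0]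
  have hk : diffN k = 0 ∧ diffM k = 0 ∧ diffX k = 0 := by
    simp [diffN_apply, diffM_apply, diffX_apply, k]
  have hloc : ∀ s, a (nbr 4 s) = a s ∧ a (nbr 5 s) = a s := by
    intro s
    have := diff_eq_zero_of_modelSlope (v := fun i => a (nbr i s) * k i) fun α β γ hα hβ hγ => by
      have hm := modelPoint_mem (x := 0) hα hβ hγ
      set u := modelPoint 0 α β γ
      have eN : diffN (u + k) = diffN u := by rw [map_add, hk.1, add_zero]
      have eM : diffM (u + k) = diffM u := by rw [map_add, hk.2.1, add_zero]
      have eX : diffX (u + k) = diffX u := by rw [map_add, hk.2.2, add_zero]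
      have hm' : u + k ∈ modelCone := by
        refine ⟨?_, ?_, ?_⟩
        · rw [eN]; exact hm.1
        · rw [eM]; exact hm.2.1
        · rw [eN, eX]; exact hm.2.2
      have h1 := h s u hm
      have h2 := h s (u + k) hm'
      have eF : modelForce (u + k) = modelForce u := by simp only [modelForce, eN, eM, eX]
      have eS : modelSlope (u + k) = modelSlope u := by simp only [modelSlope, eN, eM, eX]
      have ev : (fun i => a (nbr i s) * (u + k) i) =
          (fun i => a (nbr i s) * u i) + fun i => a (nbr i s) * k i := by
        funext i; simp only [Pi.add_apply]; ring
      rw [eF, eS, ev, map_add] at h2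
      linarith
    simp [diffN_apply, diffM_apply, k, nbr_zero] at this
    constructor <;> linarith [this.1, this.2.1]
  have h1 : ∀ n m : ℤ, a (n - 1, m) = a (n, m) := fun n m => by
    simpa [nbr_eq, offset, ← sub_eq_add_neg] using (hloc (n, m)).1
  have h2 : ∀ n m : ℤ, a (n, m - 1) = a (n, m) := fun n m => by
    simpa [nbr_eq, offset, ← sub_eq_add_neg] using (hloc (n, m)).2
  have per : ∀ f : ℤ → ℝ, (∀ n, f (n - 1) = f n) → ∀ n, f n = f 0 := by
    intro f hf n
    induction n using Int.induction_on with
    | zero => rfl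
    | succ k ih => rw [← ih, ← hf (k + 1), add_sub_cancel_right]
    | pred k ih => rw [hf, ih]
  have hconst : ∀ s, a s = a 0 := fun s => by
    rw [show s = (s.1, s.2) from rfl, per (fun n => a (n, s.2)) (fun n => h1 n s.2) s.1]
    exact per (fun m => a (0, m)) (fun m => h2 0 m) s.2
  have hm := modelPoint_mem (x := 0) (α := 1) (β := 1) (γ := 3) one_pos one_pos (by norm_num)
  have h0 := h 0 _ hm
  have ev : (fun i => a (nbr i 0) * modelPoint 0 1 1 3 i) = a 0 • modelPoint 0 1 1 3 := by
    funext i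
    rw [hconst]
    rfl
  rw [ev, map_smul, modelSlope_self hm, smul_eq_mul] at h0
  have hF := modelForce_pos hm
  have : a 0 = 0 := by
    have : a 0 * (4 * modelForce (modelPoint 0 1 1 3)) = 0 := by linear_combination h0
    exact (mul_eq_zero.1 this).resolve_right (by positivity)
  funext s
  rw [hconst, this]
  rfl

theorem isSymmetry_iff {X : Site → ℝ × ℝ → ℝ × ℝ} {τ : ℝ → ℝ} {a : Site → ℝ}
    {l : Site → ℝ → ℝ} (h : modelEquation.AffineForm X τ a l) : modelEquation.IsSymmetry X ↔
      a = 0 ∧ (∀ t, deriv (deriv (deriv τ)) t = 0) ∧ (∀ s t, deriv (deriv (l s)) t = 0) ∧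
      ∀ t, (fun s => l s t) ∈ shifts modelKappa := by
  have e : modelEquation.IsSymmetry X ↔ ∀ s t, ∀ u ∈ modelCone,
      deriv (deriv (l s)) t + deriv (deriv (deriv τ)) t / 2 * u 0 + (a s * modelForce u +
        modelSlope u (fun i => a (nbr i s) * u i)) + modelSlope u (onΓ (fun s => l s t) s) = 0 := by
    rw [h.isSymmetry_iff]
    have key : ∀ s t, ∀ u ∈ modelCone, (deriv (deriv (l s)) t
        + deriv (deriv (deriv τ)) t / 2 * u 0 + (a s - 3 / 2 * deriv τ t) * modelForce u =
        -modelSlope u (fun i => (deriv τ t / 2 + a (nbr i s)) * u i + l (nbr i s) t)) ↔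
        deriv (deriv (l s)) t + deriv (deriv (deriv τ)) t / 2 * u 0 + (a s * modelForce u +
        modelSlope u (fun i => a (nbr i s) * u i)) + modelSlope u (onΓ (fun s => l s t) s) = 0 := by
      intro s t u hu
      have ev : (fun i => (deriv τ t / 2 + a (nbr i s)) * u i + l (nbr i s) t) =
          (deriv τ t / 2) • u + (fun i => a (nbr i s) * u i) + onΓ (fun s => l s t) s := by
        funext i
        simp [onΓ]
        ring
      rw [ev, map_add, map_add, map_smul, modelSlope_self hu, smul_eq_mul]
      constructor <;> intro h <;> linear_combination h
    constructor
    · intro H s t u hu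
      refine (key s t u hu).1 ?_
      have := H s (t, u) hu
      rwa [fderiv_F hu] at this
    · intro H s p hp
      rw [fderiv_F hp]
      exact (key s p.1 p.2 hp).2 (H s p.1 p.2 hp)
  rw [e]
  constructor
  · intro H
    -- The cone is stable under positive scalings, and the four terms are homogeneous of degrees
    -- `0`, `1`, `-3` and `-4`. So they vanish separately.
    have H' : ∀ s t, ∀ u ∈ modelCone, deriv (deriv (l s)) t = 0 ∧
        deriv (deriv (deriv τ)) t / 2 * u 0 = 0 ∧ (a s * modelForce u +
        modelSlope u (fun i => a (nbr i s) * u i)) = 0 ∧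
        modelSlope u (onΓ (fun s => l s t) s) = 0 := by
      intro s t u hu
      refine coeff_eq_zero fun r hr => ?_
      have := H s t (r • u) (smul_mem_modelCone hu hr)
      have ev : (fun i => a (nbr i s) * (r • u) i) = r • fun i => a (nbr i s) * u i := by
        funext i
        simp only [Pi.smul_apply, smul_eq_mul]
        ring
      rw [modelForce_smul, modelSlope_smul, modelSlope_smul, ev, map_smul, Pi.smul_apply,
        smul_eq_mul, smul_eq_mul] at this
      have hr' := hr.ne'
      have e4 : r⁻¹ ^ 4 * r = r⁻¹ ^ 3 := by field_simp
      linear_combination this - modelSlope u (fun i => a (nbr i s) * u i) * e4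
    refine ⟨eq_zero_of_multiplier fun s u hu => (H' s 0 u hu).2.2.1, fun t => ?_, fun s t =>
      (H' s t _ (modelPoint_mem (x := 0) one_pos one_pos (show (2 : ℝ) * 1 < 3 by norm_num))).1,
      fun t => mem_shifts_modelKappa.2 fun s => diff_eq_zero_of_modelSlope fun α β γ hα hβ hγ =>
        (H' s t _ (modelPoint_mem hα hβ hγ)).2.2.2⟩
    -- A point with `u_{nm} = 1`, to read off the third derivative of `τ`.
    have := (H' 0 t _ (modelPoint_mem (x := 1) one_pos one_pos
      (show (2 : ℝ) * 1 < 3 by norm_num))).2.1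
    simpa [modelPoint] using this
  · rintro ⟨rfl, hτ, hl, hs⟩ s t u hu
    have := mem_shifts_modelKappa.1 (hs t) s
    have ez : (fun i => (0 : Site → ℝ) (nbr i s) * u i) = 0 := by
      funext i; simp
    rw [modelSlope_apply u (onΓ _ s), this.1, this.2.1, this.2.2, hτ, hl, ez, map_zero]
    simp

theorem affineForm_of_scaling {a : Site → ℝ} {l : Site → ℝ → ℝ}
    (hl : ∀ s, ContDiffOn ℝ ∞ (l s) modelEquation.I) :
    modelEquation.AffineForm (fun s p => (0, a s * p.2 + l s p.1)) (fun _ => 0) a l :=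
  ⟨contDiffOn_const, hl, fun s p _ => by simp⟩

theorem translations_eq (t : ℝ) : modelEquation.translations t = shifts modelKappa := by
  have key : ∀ l : Site → ℝ → ℝ, (∀ s, ContDiffOn ℝ ∞ (l s) modelEquation.I) →
      modelEquation.AffineForm (fun s p => (0, l s p.1)) (fun _ => 0) 0 l := fun l hl =>
    ⟨contDiffOn_const, hl, fun s p _ => by simp⟩
  refine le_antisymm (Submodule.span_le.2 ?_) fun c hc => Submodule.subset_span ?_
  · rintro _ ⟨l, hl, hs, rfl⟩
    exact ((isSymmetry_iff (key l hl)).1 hs).2.2.2 t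
  · have hl : ∀ s, ContDiffOn ℝ ∞ ((fun (s : Site) (_ : ℝ) => c s) s) modelEquation.I :=
      fun s => contDiffOn_const
    exact ⟨fun s _ => c s, hl, (isSymmetry_iff (key _ hl)).2
      ⟨rfl, fun t => by simp, fun s t => by simp, fun _ => hc⟩, rfl⟩

theorem scalings_eq : modelEquation.scalings = ⊥ := by
  refine (Submodule.span_eq_bot).2 ?_
  rintro a ⟨l, hl, hs⟩
  exact ((isSymmetry_iff (affineForm_of_scaling hl)).1 hs).1

theorem isIsotropic : modelEquation.IsIsotropic := by
  refine ⟨fun t _ s c hc h => ?_, fun s a ha _ => ?_⟩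
  · rw [translations_eq] at hc h
    rw [isNondegenerate_modelKappa.finrank_shifts] at h
    obtain ⟨v, rfl⟩ := mem_shifts_iff.1 hc
    have : v = 0 := isNondegenerate_modelKappa.coeff_eq_zero (s := s) fun j =>
      h _ (by fin_cases j <;> decide)
    simp [this]
  · rw [scalings_eq] at ha
    exact ha

end modelEquation

theorem eq_add_mul_of_deriv2_eq_zero {f : ℝ → ℝ} (hf : ContDiff ℝ ∞ f)
    (h : ∀ t, deriv (deriv f) t = 0) (t : ℝ) : f t = f 0 + (f 1 - f 0) * t := by
  have hf' : ContDiff ℝ ∞ (deriv f) := by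
    have := (contDiffOn_univ.2 hf).deriv_smooth isOpen_univ
    exact contDiffOn_univ.1 this
  have h1 : ∀ t, deriv f t = deriv f 0 := fun t =>
    is_const_of_deriv_eq_zero (hf'.differentiable (by simp)) h t 0
  have h2 : ∀ t, f t - deriv f 0 * t = f 0 - deriv f 0 * 0 := fun t => by
    refine is_const_of_deriv_eq_zero (f := fun t => f t - deriv f 0 * t) ?_ (fun t => ?_) t 0
    · exact (hf.differentiable (by simp)).sub (by fun_prop)
    · have := ((hf.differentiable (by simp) t).hasDerivAt.fun_sub
        ((hasDerivAt_id t).const_mul (deriv f 0))).deriv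
      simp only [id] at this
      rw [this, h1]
      simp
  have e1 := h2 1
  have et := h2 t
  linear_combination et - t * e1

theorem eq_quadratic_of_deriv3_eq_zero {f : ℝ → ℝ} (hf : ContDiff ℝ ∞ f)
    (h : ∀ t, deriv (deriv (deriv f)) t = 0) :
    ∃ a b c : ℝ, ∀ t, f t = a + b * t + c * t ^ 2 := by
  have hf' : ContDiff ℝ ∞ (deriv f) := by
    have := (contDiffOn_univ.2 hf).deriv_smooth isOpen_univ
    exact contDiffOn_univ.1 this
  have h1 := eq_add_mul_of_deriv2_eq_zero hf' h
  refine ⟨f 0, deriv f 0, (deriv f 1 - deriv f 0) / 2, fun t => ?_⟩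
  have h2 := is_const_of_deriv_eq_zero
    (f := fun t => f t - (deriv f 0 * t + (deriv f 1 - deriv f 0) / 2 * t ^ 2)) ?_ (fun t => ?_) t 0
  · linear_combination h2
  · exact (hf.differentiable (by simp)).sub (by fun_prop)
  · have := ((hf.differentiable (by simp) t).hasDerivAt.fun_sub
      (((hasDerivAt_id t).const_mul (deriv f 0)).fun_add
        (((hasDerivAt_id t).fun_pow 2).const_mul ((deriv f 1 - deriv f 0) / 2)))).deriv
    simp only [id] at this
    rw [this, h1 t]
    simp
    ring

theorem modelEquation.isSymmetry_iff_mem {X : LatticeField modelEquation.M} :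
    modelEquation.IsSymmetry X.1 ↔ ∃ X' ∈ nsSpan modelKappa, X.1 = X'.1 := by
  constructor
  · intro hX
    obtain ⟨τ, a, l, h⟩ := hX.exists_affineForm modelEquation.isCoupled fun s =>
      (LatticeField.prop X s).1
    obtain ⟨rfl, hτ, hl, hs⟩ := (modelEquation.isSymmetry_iff h).1 hX
    have hτs : ContDiff ℝ ∞ τ := contDiffOn_univ.1 h.smooth_τ
    have hls : ∀ s, ContDiff ℝ ∞ (l s) := fun s => contDiffOn_univ.1 (h.smooth_l s)
    obtain ⟨x, y, z, hxyz⟩ := eq_quadratic_of_deriv3_eq_zero hτs hτ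
    refine ⟨nsField (![x, y, z], fun s => l s 0, fun s => l s 1 - l s 0),
      mem_nsSpan.2 ⟨_, _, hs 0, _, sub_mem (hs 1) (hs 0), rfl⟩, funext fun s => funext fun p => ?_⟩
    rw [h.eq s p (modelEquation.mem_M p), nsField_apply,
      eq_add_mul_of_deriv2_eq_zero (hls s) (hl s) p.1]
    have hτe : τ = fun t => x + y * t + z * t ^ 2 := funext hxyz
    have hd : deriv τ p.1 = y + 2 * z * p.1 := by
      rw [hτe]
      have := ((((hasDerivAt_id p.1).const_mul y).const_add x).fun_add
        (((hasDerivAt_id p.1).fun_pow 2).const_mul z)).deriv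
      simp only [id] at this
      rw [this]
      simp
      ring
    rw [hd, hxyz]
    ext
    · simp
    · simp
      ring
  · rintro ⟨_, hX', e⟩
    obtain ⟨a, c, hc, d, hd, rfl⟩ := mem_nsSpan.1 hX'
    rw [e]
    refine (modelEquation.isSymmetry_iff (affineForm_nsField modelEquation a c d)).2
      ⟨rfl, fun t => ?_, fun s t => ?_, fun t => ?_⟩
    · have d1 : deriv (fun t => a 0 + a 1 * t + a 2 * t ^ 2) = fun t => a 1 + a 2 * (2 * t) := by
        funext t
        have h := ((((hasDerivAt_id t).const_mul (a 1)).const_add (a 0)).fun_add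
          (((hasDerivAt_id t).fun_pow 2).const_mul (a 2))).deriv
        simpa using h
      have d2 : deriv (fun t => a 1 + a 2 * (2 * t)) = fun _ => a 2 * 2 := by
        funext t
        simp
      rw [d1, d2, deriv_const]
    · have d3 : deriv (fun t => c s + d s * t) = fun _ => d s := by
        funext t
        simp
      rw [d3, deriv_const]
    · have : (fun s => c s + d s * t) = c + t • d := by
        funext s
        simp [mul_comm]
      rw [this]
      exact add_mem hc (Submodule.smul_mem _ _ hd)

/-- The domain of the model is the whole plane but not literally `⊤`; the equality is a hypothesis
so that it can be substituted in the type of the algebra. -/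
theorem IsNondegenerate.exists_lieSubalgebra {κ : Fin 3 → Site → ℝ} (hκ : IsNondegenerate κ)
    {M : TopologicalSpace.Opens (ℝ × ℝ)} (hM : M = ⊤) :
    ∃ L : LieSubalgebra ℝ (LatticeField M), (∀ X : LatticeField M, X ∈ L ↔
      ∃ X' ∈ nsSpan κ, X.1 = X'.1) ∧ Module.finrank ℝ L = 11 ∧ ¬ LieAlgebra.IsSolvable L := by
  subst hM
  refine ⟨nsAlgebra κ, fun X => ⟨fun hX => ⟨X, hX, rfl⟩, ?_⟩, hκ.finrank_nsAlgebra,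
    not_isSolvable_nsAlgebra⟩
  rintro ⟨X', hX', e⟩
  rw [Subtype.ext e]
  exact hX'

end

theorem mainTheorem6 :
    -- such equations exist
    (∃ (E : LatticeEquation) (L : LieSubalgebra ℝ (LatticeField E.M)),
      E.IsNonlinear ∧ E.IsCoupled ∧ E.IsIsotropic ∧ E.IsSymmetryAlgebra L ∧
      Module.finrank ℝ L = 11 ∧ ¬ LieAlgebra.IsSolvable L) ∧
    -- up to allowed transformations they form one class
    (∀ (E : LatticeEquation) (L : LieSubalgebra ℝ (LatticeField E.M)),
      E.IsNonlinear → E.IsCoupled → E.IsIsotropic → E.IsSymmetryAlgebra L →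
      Module.finrank ℝ L = 11 → ¬ LieAlgebra.IsSolvable L →
      ∀ t₀ ∈ E.I, ∃ (T : AllowedTransformation) (κ : Fin 3 → Site → ℝ),
        t₀ ∈ T.dom ∧ T.dom ⊆ E.I ∧ IsNondegenerate κ ∧
        (∀ X ∈ L, ∃ X' ∈ nsSpan κ, T.Carries E.J X.1 X'.1) ∧
        (∀ X' ∈ nsSpan κ, ∃ X ∈ L, T.Carries E.J X.1 X'.1) ∧
        ∀ s, HasNSForm κ s {p ∈ E.Ω s | p.1 ∈ T.dom} (T.newConf s) (T.newForce E s)) ∧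
    -- the algebra of the class, and its action on every interaction of the class
    (∀ κ : Fin 3 → Site → ℝ, IsNondegenerate κ →
      (∃ A S : LieSubalgebra ℝ (LatticeField ⊤),
        A.toSubmodule = nsSpan κ ∧ Module.finrank ℝ A = 11 ∧ ¬ LieAlgebra.IsSolvable A ∧
        (∀ X : A, X ∈ LieAlgebra.radical ℝ A ↔ (X : LatticeField ⊤) ∈ radicalSpan κ) ∧
        S.toSubmodule = sl2Span ∧
        Nonempty (S ≃ₗ⁅ℝ⁆ LieAlgebra.SpecialLinear.sl (Fin 2) ℝ)) ∧
      ∀ E : LatticeEquation, (∀ s, HasNSForm κ s (E.Ω s) (fun p => p.2) (E.F s)) →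
        ∀ X ∈ nsSpan κ, E.IsSymmetry X.1) := by
  refine ⟨?_, fun E L _ hc hi hL h11 hns t₀ ht₀ => exists_transformation hc hi hL h11 hns ht₀,
    fun κ hκ => ⟨⟨nsAlgebra κ, sl2Algebra, rfl, hκ.finrank_nsAlgebra, not_isSolvable_nsAlgebra,
      mem_radical_nsAlgebra, rfl, ⟨sl2Equiv⟩⟩, fun E h X hX => isSymmetry_of_mem_nsSpan hκ h hX⟩⟩
  obtain ⟨L, hL, h11, hns⟩ := isNondegenerate_modelKappa.exists_lieSubalgebra
    (M := modelEquation.M) (eq_top_iff.2 fun p _ => modelEquation.mem_M p)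
  exact ⟨modelEquation, L, modelEquation.isNonlinear, modelEquation.isCoupled,
    modelEquation.isIsotropic, fun X => (hL X).trans modelEquation.isSymmetry_iff_mem.symm, h11,
    hns⟩
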